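/- **Setting.** Let $m\ge 3$, $n=2m$, and let $(\mathfrak V,g)$ be an $n$-dimensional complex vector space with a non-degenerate symmetric bilinear form. Let $\mathfrak g=\mathfrak{so}(\mathfrak V,g)$, and let $\mathcal S$ be a module of dimension $2^m$ over the Clifford algebra of $(\mathfrak V,g)$ with $v\cdot v=-g(v,v)$ (the spinor space), on which $\mathfrak g$ acts by the spin representation. Let $\xi\in\mathcal S$ be a pure spinor: $\xi\neq0$ and $\mathfrak V^{1/2}:=\{v: v\cdot\xi=0\}$ has dimension $m$. Let $\mathfrak p\subset\mathfrak g$ be the stabiliser of the line $\langle\xi\rangle$. Let $\mathfrak A$ be the $\mathfrak g$-module of tensors with Cotton–York symmetries, $$\mathfrak A=\{A_{abc}: A_{abc}=A_{a[bc]},\ A_{[abc]}=0,\ A^a{}_{ac}=0\}.$$ **Maps.** Indices are raised and lowered with $g$, $(\,)$ and $[\,]$ denote (anti)symmetrisation with weight one, $e_a\cdot$ is Clifford multiplication. Put $\xi_a=e_a\cdot\xi\in\mathcal S$ and $\xi_{bc}=\tfrac12\bigl(e_c\cdot(e_b\cdot\xi)-e_b\cdot(e_c\cdot\xi)\bigr)\in\mathcal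 S$; write $\xi_a{}^{A}$, $\xi_{bc}{}^{D'}$ to indicate their spinor index and $\gamma_{aD'}{}^{A}\sigma^{D'}=(e_a\cdot\sigma)^A$. For $A\in\mathfrak A$ let $$\Pi^0_{-3/2}(A)=\xi^{aA}\xi^{bB}\xi^{cC}A_{abc},\qquad \Pi^0_{-1/2}(A)=\xi^{aA}A_{abc}\xi^{bcC'},$$ $$\Pi^1_{-1/2}(A)=\xi^{bB}\xi^{cC}A_{abc}+\tfrac1{n-2}\gamma_{aD'}{}^{[B}\xi^{dC]}\xi^{bcD'}A_{dbc},$$ $$\Pi^2_{-1/2}(A)=\xi^{a(A}\xi^{bB)}A_{abc}+\tfrac3{2(n+2)}\gamma_{cD'}{}^{(A}\xi^{dB)}\xi^{baD'}A_{dba},$$ $$\Pi^0_{1/2}(A)=A_{abc}\xi^{bcA'},\qquad \Pi^1_{1/2}(A)=\xi^{cA}A_{cab}-\tfrac1{n-2}\gamma_{[a|D'}{}^{A}A_{|b]cd}\xi^{cdD'},$$ $$\Pi^2_{1/2}(A)=A_{(ab)c}\xi^{cA}-\tfrac3{2(n+2)}\gamma_{(a|D'}{}^{A}A_{|b)cd}\xi^{cdD'}.$$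 **Statement.** (1) $\mathfrak A$ admits a filtration by $\mathfrak p$-submodules, with strict inclusions, $$\{0\}=:\mathfrak A^{5/2}\subset\mathfrak A^{3/2}\subset\mathfrak A^{1/2}\subset\mathfrak A^{-1/2}\subset\mathfrak A^{-3/2}=\mathfrak A,$$ where $\mathfrak A^i=\{A\in\mathfrak A:\Pi^k_{i-1}(A)=0\text{ for all }k\}$ for $i=-\tfrac12,\tfrac12,\tfrac32$. (2) For $\mathrm{gr}_i(\mathfrak A)=\mathfrak A^i/\mathfrak A^{i+1}$ there are internal direct sum decompositions into $\mathfrak p$-modules $$\mathrm{gr}_{\pm3/2}(\mathfrak A)=\mathfrak A^0_{\pm3/2},\qquad \mathrm{gr}_{\pm1/2}(\mathfrak A)=\mathfrak A^0_{\pm1/2}\oplus\mathfrak A^1_{\pm1/2}\oplus\mathfrak A^2_{\pm1/2},$$ where for $|i|=\tfrac12$, $\mathfrak A_i^j=\{A\in\mathfrak A^i:\Pi_i^k(A)=0\text{ for all }k\ne j\}/\mathfrak A^{i+1}$. These eight $\mathfrak p$-modules are irreducible, with $$\dim\mathfrak A^0_{\pm3/2}=\tfrac13m(m^2-1),\quad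 \dim\mathfrak A^0_{\pm1/2}=m,\quad \dim\mathfrak A^1_{\pm1/2}=\tfrac12m(m-2)(m+1),\quad \dim\mathfrak A^2_{\pm1/2}=\tfrac12m(m+2)(m-1).$$ (3) Let $\mathfrak V=\mathfrak V_{1/2}\oplus\mathfrak V_{-1/2}$ be any splitting with $\mathfrak V_{1/2}=\mathfrak V^{1/2}$ and $\mathfrak V_{-1/2}$ totally null. Let $\mathfrak g_0\subset\mathfrak p$ be the subalgebra preserving both summands, $\mathfrak z_0$ its centre, $\mathfrak{sl}_0=[\mathfrak g_0,\mathfrak g_0]$, and let $\mathfrak g_{1}$, $\mathfrak g_{-1}$ be the $\mathfrak g_0$-modules of elements of $\mathfrak g$ annihilating $\mathfrak V_{1/2}$, respectively $\mathfrak V_{-1/2}$. Then: * the element of $\mathfrak g_0$ acting as $\pm\tfrac12$ on $\mathfrak V_{\pm1/2}$ acts as the scalar $i$ on $\mathrm{gr}_i(\mathfrak A)$; * the $\mathfrak A_i^j$ are irreducible over $\mathfrak g_0$, and as $\mathfrak g_0$-modules $$\mathfrak A^0_{\pm3/2}\cong\mathfrak V_{\pm1/2}\circledcirc\mathfrak g_{\pm1},\quad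 \mathfrak A^0_{\pm1/2}\cong\mathfrak V_{\pm1/2}\circledcirc\mathfrak z_0,\quad \mathfrak A^1_{\pm1/2}\cong\mathfrak V_{\mp1/2}\circledcirc\mathfrak g_{\pm1},\quad \mathfrak A^2_{\pm1/2}\cong\mathfrak V_{\pm1/2}\circledcirc\mathfrak{sl}_0,$$ where $\circledcirc$ is the Cartan product (the submodule of the tensor product generated by the tensor product of highest weight vectors); * $\mathrm{gr}(\mathfrak A)$ is described by the directed graph with these eight vertices and the twelve arrows $$\mathfrak A^0_{3/2}\to\mathfrak A^0_{1/2},\mathfrak A^1_{1/2},\mathfrak A^2_{1/2};\quad \mathfrak A^2_{1/2}\to\mathfrak A^2_{-1/2},\mathfrak A^1_{-1/2};\quad \mathfrak A^1_{1/2}\to\mathfrak A^2_{-1/2},\mathfrak A^0_{-1/2};\quad \mathfrak A^0_{1/2}\to\mathfrak A^1_{-1/2},\mathfrak A^0_{-1/2};$$ $$\mathfrak A^0_{-1/2},\mathfrak A^1_{-1/2},\mathfrak A^2_{-1/2}\to\mathfrak A^0_{-3/2}$$ in the following sense: each $\mathfrak A_i^j$ is isomorphic to some $\mathfrak g_0$-submodule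 of $\mathfrak A$, and an arrow from $\mathfrak A_i^j$ to $\mathfrak A_{i-1}^k$ implies $\breve{\mathfrak A}_i^j\subset\mathfrak g_1\cdot\breve{\mathfrak A}_{i-1}^k$ for any $\mathfrak g_0$-submodules $\breve{\mathfrak A}_i^j,\breve{\mathfrak A}_{i-1}^k$ of $\mathfrak A$ isomorphic to $\mathfrak A_i^j$ and $\mathfrak A_{i-1}^k$ respectively, where $\mathfrak g_1\cdot M$ is the linear span of all $X\cdot A$ with $X\in\mathfrak g_1$, $A\in M$. -/

import Mathlib

open Module TensorProduct

attribute [local instance 100] LieRing.ofAssociativeRing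

noncomputable section

namespace PureSpinor

/-! ### Metric contractions and the orthogonal Lie algebra -/

section Metric

variable {V : Type*} [AddCommGroup V] [Module ℂ V]

/-- The complex orthogonal Lie algebra `𝔤 = 𝔰𝔬(V, g)` of skew-adjoint endomorphisms. It acts on
`V`, on multilinear forms on `V` and on itself in the usual way. -/
def so (g : LinearMap.BilinForm ℂ V) : Type _ := ↥(skewAdjointLieSubalgebra g)

instance (g : LinearMap.BilinForm ℂ V) : LieRing (so g) :=
  inferInstanceAs (LieRing ↥(skewAdjointLieSubalgebra g))

instance (g : LinearMap.BilinForm ℂ V) : LieAlgebra ℂ (so g) :=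
  inferInstanceAs (LieAlgebra ℂ ↥(skewAdjointLieSubalgebra g))

instance (g : LinearMap.BilinForm ℂ V) : LieRingModule (so g) V :=
  inferInstanceAs (LieRingModule ↥(skewAdjointLieSubalgebra g) V)

instance (g : LinearMap.BilinForm ℂ V) : LieModule ℂ (so g) V :=
  inferInstanceAs (LieModule ℂ ↥(skewAdjointLieSubalgebra g) V)

theorem so_apply (g : LinearMap.BilinForm ℂ V) (X : so g) (u v : V) :
    g ⁅X, u⁆ v = - g u ⁅X, v⁆ := by
  have h := (show ↥(skewAdjointLieSubalgebra g) from X).2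
  change (show ↥(skewAdjointLieSubalgebra g) from X).1 ∈ g.skewAdjointSubmodule at h
  rw [LinearMap.mem_skewAdjointSubmodule] at h
  have h' := h u v
  change g ⁅X, u⁆ v = g u (-⁅X, v⁆) at h'
  rw [h', map_neg]

variable [FiniteDimensional ℂ V]

/-- A basis `e_i` of `V`, used to write contractions of indices as sums. -/
def frame (V : Type*) [AddCommGroup V] [Module ℂ V] [FiniteDimensional ℂ V] :
    Basis (Fin (finrank ℂ V)) ℂ V :=
  finBasis ℂ V

/-- The dual basis `e^i` of `V` with respect to the metric, `g(e^i, e_j) = δ^i_j`, so that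
`∑ i, e_i ⊗ e^i` is the inverse metric `g^{ab}`. -/
def coframe (g : LinearMap.BilinForm ℂ V) (hg : g.Nondegenerate) :
    Basis (Fin (finrank ℂ V)) ℂ V :=
  g.dualBasis hg (frame V)

theorem coframe_apply (g : LinearMap.BilinForm ℂ V) (hg : g.Nondegenerate)
    (j : Fin (finrank ℂ V)) (w : V) : g (coframe g hg j) w = (frame V).repr w j := by
  rw [coframe, LinearMap.BilinForm.dualBasis, Basis.map_apply, Basis.coe_dualBasis,
    ← LinearMap.BilinForm.toDual_def hg, LinearEquiv.apply_symm_apply, Basis.coord_apply]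

/-- The inverse metric is annihilated by `𝔰𝔬(V, g)`. -/
theorem contract_skew (g : LinearMap.BilinForm ℂ V) (hg : g.Nondegenerate) (X : so g)
    {M : Type*} [AddCommGroup M] [Module ℂ M] (B : V →ₗ[ℂ] V →ₗ[ℂ] M) :
    ∑ i, (B ⁅X, frame V i⁆ (coframe g hg i) + B (frame V i) ⁅X, coframe g hg i⁆) = 0 := by
  have h1 : ∀ i, ⁅X, frame V i⁆ =
      ∑ j, g (coframe g hg j) ⁅X, frame V i⁆ • frame V j := by
    intro i
    conv_lhs => rw [← (frame V).sum_repr ⁅X, frame V i⁆]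
    refine Finset.sum_congr rfl fun j _ => ?_
    rw [coframe_apply]
  have h2 : ∀ i, ⁅X, coframe g hg i⁆ =
      ∑ j, g ⁅X, coframe g hg i⁆ (frame V j) • coframe g hg j := by
    intro i
    conv_lhs => rw [← (coframe g hg).sum_repr ⁅X, coframe g hg i⁆]
    refine Finset.sum_congr rfl fun j _ => ?_
    congr 1
    exact LinearMap.BilinForm.dualBasis_repr_apply hg (frame V) _ _
  rw [Finset.sum_add_distrib]
  have e1 : ∑ i, B ⁅X, frame V i⁆ (coframe g hg i) =
      ∑ i, ∑ j, g (coframe g hg j) ⁅X, frame V i⁆ • B (frame V j) (coframe g hg i) := by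
    refine Finset.sum_congr rfl fun i _ => ?_
    conv_lhs => rw [h1 i]
    simp
  have e2 : ∑ i, B (frame V i) ⁅X, coframe g hg i⁆ =
      ∑ i, ∑ j, g ⁅X, coframe g hg i⁆ (frame V j) • B (frame V i) (coframe g hg j) := by
    refine Finset.sum_congr rfl fun i _ => ?_
    conv_lhs => rw [h2 i]
    simp
  rw [e1, e2, Finset.sum_comm, ← Finset.sum_add_distrib]
  refine Finset.sum_eq_zero fun i _ => ?_
  rw [← Finset.sum_add_distrib]
  refine Finset.sum_eq_zero fun j _ => ?_
  rw [so_apply, neg_smul, add_neg_cancel]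

/-- The tensors with Cotton–York symmetries, as an `𝔰𝔬(V, g)`-module of trilinear
forms: `A_{abc} = A_{a[bc]}`, `A_{[abc]} = 0`, `A^a_{ac} = 0`. -/
def cottonYork (g : LinearMap.BilinForm ℂ V) (hg : g.Nondegenerate) :
    LieSubmodule ℂ (so g) (V →ₗ[ℂ] V →ₗ[ℂ] V →ₗ[ℂ] ℂ) where
  carrier := {A | (∀ a b c, A a b c = - A a c b) ∧ (∀ a b c, A a b c + A b c a + A c a b = 0) ∧
    ∀ c, ∑ i, A (frame V i) (coframe g hg i) c = 0}
  add_mem' := by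
    rintro A B ⟨a1, a2, a3⟩ ⟨b1, b2, b3⟩
    refine ⟨fun a b c => ?_, fun a b c => ?_, fun c => ?_⟩
    · simp only [LinearMap.add_apply]; linear_combination a1 a b c + b1 a b c
    · simp only [LinearMap.add_apply]; linear_combination a2 a b c + b2 a b c
    · simp only [LinearMap.add_apply, Finset.sum_add_distrib, a3, b3, add_zero]
  zero_mem' := by simp
  smul_mem' := by
    rintro t A ⟨a1, a2, a3⟩
    refine ⟨fun a b c => ?_, fun a b c => ?_, fun c => ?_⟩
    · simp only [LinearMap.smul_apply, smul_eq_mul]; linear_combination t * a1 a b c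
    · simp only [LinearMap.smul_apply, smul_eq_mul]; linear_combination t * a2 a b c
    · simp only [LinearMap.smul_apply, smul_eq_mul, ← Finset.mul_sum, a3, mul_zero]
  lie_mem := by
    rintro X A ⟨a1, a2, a3⟩
    have key : ∀ a b c, (⁅X, A⁆ : V →ₗ[ℂ] V →ₗ[ℂ] V →ₗ[ℂ] ℂ) a b c =
        - A ⁅X, a⁆ b c - A a ⁅X, b⁆ c - A a b ⁅X, c⁆ := by
      intro a b c
      have : (⁅X, A⁆ : V →ₗ[ℂ] V →ₗ[ℂ] V →ₗ[ℂ] ℂ) a b c =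
        - A a b ⁅X, c⁆ - A a ⁅X, b⁆ c - A ⁅X, a⁆ b c := by
        simp [LieHom.lie_apply]
      rw [this]; ring
    refine ⟨fun a b c => ?_, fun a b c => ?_, fun c => ?_⟩
    · rw [key, key]
      linear_combination - a1 ⁅X, a⁆ b c - a1 a ⁅X, b⁆ c - a1 a b ⁅X, c⁆
    · rw [key, key, key]
      linear_combination - a2 ⁅X, a⁆ b c - a2 a ⁅X, b⁆ c - a2 a b ⁅X, c⁆
    · have h := contract_skew g hg X (A.compr₂ (LinearMap.applyₗ c))
      simp only [LinearMap.compr₂_apply, LinearMap.applyₗ_apply_apply] at h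
      have h3 := a3 ⁅X, c⁆
      simp only [key, Finset.sum_sub_distrib, Finset.sum_neg_distrib, h3]
      rw [Finset.sum_add_distrib] at h
      linear_combination - h

/-- The space `𝔄` of tensors with Cotton–York symmetries. -/
def CottonYork (g : LinearMap.BilinForm ℂ V) (hg : g.Nondegenerate) : Type _ :=
  ↥(cottonYork g hg)

instance (g : LinearMap.BilinForm ℂ V) (hg : g.Nondegenerate) :
    AddCommGroup (CottonYork g hg) :=
  inferInstanceAs (AddCommGroup ↥(cottonYork g hg))

instance (g : LinearMap.BilinForm ℂ V) (hg : g.Nondegenerate) :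
    Module ℂ (CottonYork g hg) :=
  inferInstanceAs (Module ℂ ↥(cottonYork g hg))

instance (g : LinearMap.BilinForm ℂ V) (hg : g.Nondegenerate) :
    LieRingModule (so g) (CottonYork g hg) :=
  inferInstanceAs (LieRingModule (so g) ↥(cottonYork g hg))

instance (g : LinearMap.BilinForm ℂ V) (hg : g.Nondegenerate) :
    LieModule ℂ (so g) (CottonYork g hg) :=
  inferInstanceAs (LieModule ℂ (so g) ↥(cottonYork g hg))

/-- The underlying trilinear form of a tensor with Cotton–York symmetries. -/
def CottonYork.form {g : LinearMap.BilinForm ℂ V} {hg : g.Nondegenerate} (A : CottonYork g hg) :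
    V →ₗ[ℂ] V →ₗ[ℂ] V →ₗ[ℂ] ℂ :=
  (show ↥(cottonYork g hg) from A).1

/-- The action of `𝔰𝔬(V, g)` is the usual one. -/
theorem CottonYork.form_lie {g : LinearMap.BilinForm ℂ V} {hg : g.Nondegenerate} (X : so g)
    (A : CottonYork g hg) (a b c : V) :
    (⁅X, A⁆ : CottonYork g hg).form a b c =
      - A.form ⁅X, a⁆ b c - A.form a ⁅X, b⁆ c - A.form a b ⁅X, c⁆ := by
  have : (⁅X, A⁆ : CottonYork g hg).form a b c =
      - A.form a b ⁅X, c⁆ - A.form a ⁅X, b⁆ c - A.form ⁅X, a⁆ b c := by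
    change (⁅X, A.form⁆ : V →ₗ[ℂ] V →ₗ[ℂ] V →ₗ[ℂ] ℂ) a b c = _
    simp [LieHom.lie_apply]
  rw [this]; ring

end Metric

/-! ### Spinors -/

section Spinors

variable {V : Type*} [AddCommGroup V] [Module ℂ V]

/-- The quadratic form of the Clifford algebra `Cl(V, g)`, in which `v · v = - g(v, v)`. -/
abbrev cliffordForm (g : LinearMap.BilinForm ℂ V) : QuadraticForm ℂ V :=
  LinearMap.BilinMap.toQuadraticMap (-g)

variable {S : Type*} [AddCommGroup S] [Module ℂ S]

/-- Clifford multiplication `v ↦ v · ` of vectors on a module over the Clifford algebra (the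
`γ`-matrices). -/
def gamma (S : Type*) [AddCommGroup S] [Module ℂ S] (g : LinearMap.BilinForm ℂ V)
    [Module (CliffordAlgebra (cliffordForm g)) S]
    [IsScalarTower ℂ (CliffordAlgebra (cliffordForm g)) S] : V →ₗ[ℂ] Module.End ℂ S :=
  (Algebra.lsmul ℂ ℂ S).toLinearMap ∘ₗ CliffordAlgebra.ι (cliffordForm g)

variable (g : LinearMap.BilinForm ℂ V) [Module (CliffordAlgebra (cliffordForm g)) S]
  [IsScalarTower ℂ (CliffordAlgebra (cliffordForm g)) S]

theorem gamma_apply (v : V) (s : S) :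
    gamma S g v s = CliffordAlgebra.ι (cliffordForm g) v • s := rfl

theorem gamma_anticomm (hs : g.IsSymm) (u v : V) :
    gamma S g u * gamma S g v + gamma S g v * gamma S g u =
      (-2 * g u v) • (1 : Module.End ℂ S) := by
  ext s
  have h := CliffordAlgebra.ι_mul_ι_add_swap (Q := cliffordForm g) u v
  have h' := congrArg (fun x => x • s) h
  simp only [add_smul, mul_smul, algebraMap_smul] at h'
  simp only [LinearMap.add_apply, Module.End.mul_apply, gamma_apply, LinearMap.smul_apply,
    Module.End.one_apply]
  rw [h']
  congr 1
  simp only [QuadraticMap.polar, LinearMap.BilinMap.toQuadraticMap_apply, LinearMap.neg_apply,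
    map_add, LinearMap.add_apply]
  have := hs.eq u v
  linear_combination this

/-- The null space of a spinor: the kernel of `v ↦ v · ξ`, i.e. of `ξ_a^A`. This is
`𝔙^{1/2}` when `ξ` is pure. -/
def nullPlane (ξ : S) : Submodule ℂ V := LinearMap.ker ((gamma S g).flip ξ)

/-- A non-zero spinor is pure if the kernel of `v ↦ v · ξ` has dimension `m`, where
`dim V = 2 m`. -/
def IsPure (ξ : S) : Prop := ξ ≠ 0 ∧ 2 * finrank ℂ (nullPlane g ξ) = finrank ℂ V

variable [FiniteDimensional ℂ V]

/-- The spin action of `X ∈ 𝔰𝔬(V, g)` on spinors, `-(1/4) ∑ i, (X e_i) · e^i`. -/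
def spin (hg : g.Nondegenerate) (X : so g) : Module.End ℂ S :=
  (-(1 / 4) : ℂ) • ∑ i, gamma S g ⁅X, frame V i⁆ * gamma S g (coframe g hg i)

theorem spin_gamma (hs : g.IsSymm) (hg : g.Nondegenerate) (X : so g) (v : V) :
    spin (S := S) g hg X * gamma S g v - gamma S g v * spin g hg X = gamma S g ⁅X, v⁆ := by
  have h1 : ∀ a b : V, gamma S g a * gamma S g b * gamma S g v -
      gamma S g v * (gamma S g a * gamma S g b) =
      (-2 * g b v) • gamma S g a - (-2 * g a v) • gamma S g b := by
    intro a b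
    have e1 := gamma_anticomm (S := S) g hs b v
    have e2 := gamma_anticomm (S := S) g hs a v
    calc _ = gamma S g a * (gamma S g b * gamma S g v + gamma S g v * gamma S g b) -
        (gamma S g a * gamma S g v + gamma S g v * gamma S g a) * gamma S g b := by noncomm_ring
      _ = _ := by rw [e1, e2]; simp
  have hv : ∀ w : V, ∑ i, g (coframe g hg i) w • frame V i = w := by
    intro w
    conv_rhs => rw [← (frame V).sum_repr w]
    refine Finset.sum_congr rfl fun j _ => ?_
    rw [coframe_apply]
  have hw : ∀ w : V, ∑ i, g w (frame V i) • coframe g hg i = w := by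
    intro w
    conv_rhs => rw [← (coframe g hg).sum_repr w]
    refine Finset.sum_congr rfl fun j _ => ?_
    congr 1
    exact (LinearMap.BilinForm.dualBasis_repr_apply hg (frame V) _ _).symm
  have s1 : ∑ i, (-2 * g (coframe g hg i) v) • gamma S g ⁅X, frame V i⁆ =
      (-2 : ℂ) • gamma S g ⁅X, v⁆ := by
    have h := congrArg (fun w => (-2 : ℂ) • gamma S g ⁅X, w⁆) (hv v)
    simp only [← LieModule.toEnd_apply_apply ℂ (so g) V X, map_sum, map_smul, Finset.smul_sum,
      smul_smul] at h ⊢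
    exact h
  have s2 : ∑ i, (-2 * g ⁅X, frame V i⁆ v) • gamma S g (coframe g hg i) =
      (2 : ℂ) • gamma S g ⁅X, v⁆ := by
    conv_rhs => rw [← hw ⁅X, v⁆]
    simp only [map_sum, map_smul, Finset.smul_sum, smul_smul]
    refine Finset.sum_congr rfl fun i _ => ?_
    rw [so_apply]
    have := hs.eq (frame V i) ⁅X, v⁆
    rw [this]; congr 1; ring
  rw [spin, smul_mul_assoc, mul_smul_comm, ← smul_sub, Finset.sum_mul, Finset.mul_sum,
    ← Finset.sum_sub_distrib]
  simp only [h1, Finset.sum_sub_distrib, s1, s2, ← sub_smul, smul_smul]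
  norm_num

theorem spin_lie (hs : g.IsSymm) (hg : g.Nondegenerate) (X Y : so g) :
    spin (S := S) g hg ⁅X, Y⁆ = spin g hg X * spin g hg Y - spin g hg Y * spin g hg X := by
  have h1 : ∀ a b : V, spin (S := S) g hg X * (gamma S g a * gamma S g b) -
      gamma S g a * gamma S g b * spin g hg X =
      gamma S g ⁅X, a⁆ * gamma S g b + gamma S g a * gamma S g ⁅X, b⁆ := by
    intro a b
    rw [← spin_gamma g hs hg X a, ← spin_gamma g hs hg X b]
    noncomm_ring
  have h := contract_skew g hg X
    ((LinearMap.mul ℂ (Module.End ℂ S)).compl₁₂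
      (gamma S g ∘ₗ LieModule.toEnd ℂ (so g) V Y) (gamma S g))
  simp only [LinearMap.compl₁₂_apply, LinearMap.comp_apply, LinearMap.mul_apply'] at h
  have e : spin (S := S) g hg X * spin g hg Y - spin g hg Y * spin g hg X =
      (-(1 / 4) : ℂ) • ∑ i, (gamma S g ⁅X, ⁅Y, frame V i⁆⁆ * gamma S g (coframe g hg i) +
        gamma S g ⁅Y, frame V i⁆ * gamma S g ⁅X, coframe g hg i⁆) := by
    conv_lhs => rw [spin.eq_def g hg Y]
    rw [smul_mul_assoc, mul_smul_comm, ← smul_sub, Finset.sum_mul, Finset.mul_sum,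
      ← Finset.sum_sub_distrib]
    simp only [h1]
  rw [e, spin]
  congr 1
  rw [← sub_zero (∑ i, (gamma S g ⁅X, ⁅Y, frame V i⁆⁆ * gamma S g (coframe g hg i) +
        gamma S g ⁅Y, frame V i⁆ * gamma S g ⁅X, coframe g hg i⁆)), ← h,
    ← Finset.sum_sub_distrib]
  refine Finset.sum_congr rfl fun i _ => ?_
  rw [lie_lie, map_sub, LieModule.toEnd_apply_apply, LieModule.toEnd_apply_apply, sub_mul]
  abel

/-- The parabolic Lie subalgebra `𝔭 ⊂ 𝔤` stabilising the line `⟨ξ⟩`. -/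
def stabilizer (hs : g.IsSymm) (hg : g.Nondegenerate) (ξ : S) : LieSubalgebra ℂ (so g) where
  carrier := {X | ∃ c : ℂ, spin g hg X ξ = c • ξ}
  add_mem' := by
    rintro X Y ⟨c, hc⟩ ⟨d, hd⟩
    refine ⟨c + d, ?_⟩
    have : spin (S := S) g hg (X + Y) = spin g hg X + spin g hg Y := by
      simp [spin, add_lie, add_mul, Finset.sum_add_distrib]
    rw [this, LinearMap.add_apply, hc, hd, add_smul]
  zero_mem' := ⟨0, by simp [spin]⟩
  smul_mem' := by
    rintro t X ⟨c, hc⟩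
    refine ⟨t * c, ?_⟩
    have : spin (S := S) g hg (t • X) = t • spin g hg X := by
      simp only [spin, Finset.smul_sum, smul_comm t]
      simp
    rw [this, LinearMap.smul_apply, hc, smul_smul]
  lie_mem' := by
    rintro X Y ⟨c, hc⟩ ⟨d, hd⟩
    refine ⟨0, ?_⟩
    rw [spin_lie g hs hg, LinearMap.sub_apply, Module.End.mul_apply, Module.End.mul_apply, hc, hd,
      map_smul, map_smul, hc, hd, smul_smul, smul_smul, mul_comm, sub_self, zero_smul]

/-! ### A splitting of `V` and the modules of the Levi factor -/

/-- The reductive part `𝔤₀ ⊂ 𝔭` determined by a complement `N'` (playing the role of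
`𝔙_{-1/2}`) of the null space of `ξ`: the elements that preserve both. -/
def levi (hs : g.IsSymm) (hg : g.Nondegenerate) (ξ : S) (N' : Submodule ℂ V) :
    LieSubalgebra ℂ (stabilizer g hs hg ξ) where
  carrier := {X | (∀ v ∈ nullPlane g ξ, ⁅X, v⁆ ∈ nullPlane g ξ) ∧ ∀ v ∈ N', ⁅X, v⁆ ∈ N'}
  add_mem' := fun {X} {Y} hX hY =>
    ⟨fun v hv => by rw [add_lie]; exact add_mem (hX.1 v hv) (hY.1 v hv),
      fun v hv => by rw [add_lie]; exact add_mem (hX.2 v hv) (hY.2 v hv)⟩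
  zero_mem' := ⟨fun v _ => by rw [zero_lie]; exact zero_mem _,
    fun v _ => by rw [zero_lie]; exact zero_mem _⟩
  smul_mem' := fun t X hX =>
    ⟨fun v hv => by rw [smul_lie]; exact Submodule.smul_mem _ t (hX.1 v hv),
      fun v hv => by rw [smul_lie]; exact Submodule.smul_mem _ t (hX.2 v hv)⟩
  lie_mem' := fun {X} {Y} hX hY =>
    ⟨fun v hv => by rw [lie_lie]; exact sub_mem (hX.1 _ (hY.1 v hv)) (hY.1 _ (hX.1 v hv)),
      fun v hv => by rw [lie_lie]; exact sub_mem (hX.2 _ (hY.2 v hv)) (hY.2 _ (hX.2 v hv))⟩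

variable (hs : g.IsSymm) (hg : g.Nondegenerate) (ξ : S) (N' : Submodule ℂ V)

theorem levi_mem (X : levi g hs hg ξ N') :
    (∀ v ∈ nullPlane g ξ, ⁅X, v⁆ ∈ nullPlane g ξ) ∧ ∀ v ∈ N', ⁅X, v⁆ ∈ N' := X.2

/-- `𝔙_{1/2}` as a `𝔤₀`-module. -/
def vPos : LieSubmodule ℂ (levi g hs hg ξ N') V :=
  { nullPlane g ξ with lie_mem := fun {X} {v} hv => (levi_mem g hs hg ξ N' X).1 v hv }

/-- `𝔙_{-1/2}` as a `𝔤₀`-module. -/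
def vNeg : LieSubmodule ℂ (levi g hs hg ξ N') V :=
  { N' with lie_mem := fun {X} {v} hv => (levi_mem g hs hg ξ N' X).2 v hv }

/-- `𝔤₁` as a `𝔤₀`-module: the elements `φ` of `𝔤` with `ξ^{bA} φ_{ba} = 0`, that is,
annihilating `𝔙_{1/2}`. -/
def gPos : LieSubmodule ℂ (levi g hs hg ξ N') (so g) where
  carrier := {X | ∀ v ∈ nullPlane g ξ, ⁅X, v⁆ = 0}
  add_mem' := fun {X} {Y} hX hY v hv => by
    rw [add_lie, hX v hv, hY v hv, add_zero]
  zero_mem' := fun v _ => zero_lie v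
  smul_mem' := fun t X hX v hv => by
    rw [smul_lie, hX v hv, smul_zero]
  lie_mem := fun {X} {Y} hY v hv => by
    have h : ⁅X, ⁅Y, v⁆⁆ = ⁅⁅X, Y⁆, v⁆ + ⁅Y, ⁅X, v⁆⁆ := leibniz_lie (X : so g) Y v
    rw [hY v hv, lie_zero, hY _ ((levi_mem g hs hg ξ N' X).1 v hv), add_zero] at h
    exact h.symm

/-- `𝔤₋₁` as a `𝔤₀`-module: the elements of `𝔤` annihilating `𝔙_{-1/2}`. -/
def gNeg : LieSubmodule ℂ (levi g hs hg ξ N') (so g) where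
  carrier := {X | ∀ v ∈ N', ⁅X, v⁆ = 0}
  add_mem' := fun {X} {Y} hX hY v hv => by
    rw [add_lie, hX v hv, hY v hv, add_zero]
  zero_mem' := fun v _ => zero_lie v
  smul_mem' := fun t X hX v hv => by
    rw [smul_lie, hX v hv, smul_zero]
  lie_mem := fun {X} {Y} hY v hv => by
    have h : ⁅X, ⁅Y, v⁆⁆ = ⁅⁅X, Y⁆, v⁆ + ⁅Y, ⁅X, v⁆⁆ := leibniz_lie (X : so g) Y v
    rw [hY v hv, lie_zero, hY _ ((levi_mem g hs hg ξ N' X).2 v hv), add_zero] at h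
    exact h.symm

/-- The centre `𝔷₀` of `𝔤₀`, as a `𝔤₀`-module. -/
abbrev zZero : LieIdeal ℂ (levi g hs hg ξ N') := LieAlgebra.center ℂ (levi g hs hg ξ N')

/-- The simple part `𝔰𝔩₀ = [𝔤₀, 𝔤₀]` of `𝔤₀`, as a `𝔤₀`-module. -/
abbrev slZero : LieIdeal ℂ (levi g hs hg ξ N') :=
  LieAlgebra.derivedSeries ℂ (levi g hs hg ξ N') 1

/-- The Borel subalgebra of `𝔤₀ ≅ 𝔤𝔩(𝔙_{1/2})` preserving the complete flag spanned by a basis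
of `𝔙_{1/2}`. -/
def borel {m : ℕ} (e : Basis (Fin m) ℂ (nullPlane g ξ)) : Set (levi g hs hg ξ N') :=
  {X | ∀ k, ⁅X, (e k : V)⁆ ∈ Submodule.span ℂ ((fun j => (e j : V)) '' Set.Iic k)}

end Spinors

/-! ### Cartan products -/

section Cartan

variable {L : Type*} [LieRing L] [LieAlgebra ℂ L]

/-- A highest weight vector with respect to a Borel subalgebra `b`: a non-zero simultaneous
eigenvector of the elements of `b`. -/
def IsHighestWeightVector {P : Type*} [AddCommGroup P] [LieRingModule L P] [Module ℂ P]
    (b : Set L) (v : P) : Prop :=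
  v ≠ 0 ∧ ∀ X ∈ b, ∃ c : ℂ, ⁅X, v⁆ = c • v

/-- The Cartan product `P ⊚ R` of two irreducible representations: the submodule of `P ⊗ R`
generated by the tensor product of the highest weight vectors. -/
def cartanProduct (b : Set L) (P R : Type*)
    [AddCommGroup P] [Module ℂ P] [LieRingModule L P] [LieModule ℂ L P]
    [AddCommGroup R] [Module ℂ R] [LieRingModule L R] [LieModule ℂ L R] :
    LieSubmodule ℂ L (P ⊗[ℂ] R) :=
  LieSubmodule.lieSpan ℂ L
    {t | ∃ v w, IsHighestWeightVector b v ∧ IsHighestWeightVector b w ∧ t = v ⊗ₜ[ℂ] w}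

end Cartan

/-! ### The maps `Π_i^j` on Cotton–York tensors

The free vector indices are arguments, the free spinor indices are tensor factors, and contracted
indices are summed with `frame` and `coframe`. Products of `γ`-matrices with spinor indices are
read from left to right, as in `ξ^{B'} γ_{bB'}^C γ_{cC}^{D'} = e_c · (e_b · ξ)`. -/

section Maps

variable {V : Type*} [AddCommGroup V] [Module ℂ V] [FiniteDimensional ℂ V]
variable {S : Type*} [AddCommGroup S] [Module ℂ S]
variable (g : LinearMap.BilinForm ℂ V) [Module (CliffordAlgebra (cliffordForm g)) S]
  [IsScalarTower ℂ (CliffordAlgebra (cliffordForm g)) S]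
variable (hg : g.Nondegenerate) (ξ : S)

/-- `ξ^{aA}`, as a function of the frame index of `a`. -/
def xi₁ (i : Fin (finrank ℂ V)) : S := gamma S g (coframe g hg i) ξ

/-- `ξ^{bcD'} = ξ^{B'} γ^{bc}_{B'}^{D'}`, as a function of the frame indices of `b`, `c`. -/
def xi₂ (i j : Fin (finrank ℂ V)) : S :=
  (1 / 2 : ℂ) • (gamma S g (coframe g hg j) (gamma S g (coframe g hg i) ξ) -
    gamma S g (coframe g hg i) (gamma S g (coframe g hg j) ξ))

/-- Symmetrisation `T^{(AB)}`. -/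
def symPart (T : S ⊗[ℂ] S) : S ⊗[ℂ] S := (1 / 2 : ℂ) • (T + TensorProduct.comm ℂ S S T)

/-- Skew-symmetrisation `T^{[AB]}`. -/
def altPart (T : S ⊗[ℂ] S) : S ⊗[ℂ] S := (1 / 2 : ℂ) • (T - TensorProduct.comm ℂ S S T)

variable (A : V →ₗ[ℂ] V →ₗ[ℂ] V →ₗ[ℂ] ℂ)

/-- `Π^0_{-3/2}(A) = ξ^{aA} ξ^{bB} ξ^{cC} A_{abc}`. -/
def piM3_0 : S ⊗[ℂ] (S ⊗[ℂ] S) :=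
  ∑ a, ∑ b, ∑ c, A (frame V a) (frame V b) (frame V c) •
    (xi₁ g hg ξ a ⊗ₜ[ℂ] (xi₁ g hg ξ b ⊗ₜ[ℂ] xi₁ g hg ξ c))

/-- `Π^0_{-1/2}(A) = ξ^{aA} A_{abc} ξ^{bcC'}`. -/
def piM1_0 : S ⊗[ℂ] S :=
  ∑ a, ∑ b, ∑ c, A (frame V a) (frame V b) (frame V c) • (xi₁ g hg ξ a ⊗ₜ[ℂ] xi₂ g hg ξ b c)

/-- `Π^1_{-1/2}(A) = ξ^{bB} ξ^{cC} A_{abc} + 1/(n-2) γ_{aD'}^{[B} ξ^{dC]} ξ^{bcD'} A_{dbc}`,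
as a function of `a`. -/
def piM1_1 (a : V) : S ⊗[ℂ] S :=
  (∑ b, ∑ c, A a (frame V b) (frame V c) • (xi₁ g hg ξ b ⊗ₜ[ℂ] xi₁ g hg ξ c)) +
    (1 / ((finrank ℂ V : ℂ) - 2)) • altPart (∑ d, ∑ b, ∑ c,
      A (frame V d) (frame V b) (frame V c) •
        (gamma S g a (xi₂ g hg ξ b c) ⊗ₜ[ℂ] xi₁ g hg ξ d))

/-- `Π^2_{-1/2}(A) = ξ^{a(A} ξ^{bB)} A_{abc} + 3/(2(n+2)) γ_{cD'}^{(A} ξ^{dB)} ξ^{baD'} A_{dba}`,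
as a function of `c`. -/
def piM1_2 (c : V) : S ⊗[ℂ] S :=
  symPart (∑ a, ∑ b, A (frame V a) (frame V b) c • (xi₁ g hg ξ a ⊗ₜ[ℂ] xi₁ g hg ξ b)) +
    (3 / (2 * ((finrank ℂ V : ℂ) + 2))) • symPart (∑ d, ∑ b, ∑ a,
      A (frame V d) (frame V b) (frame V a) •
        (gamma S g c (xi₂ g hg ξ b a) ⊗ₜ[ℂ] xi₁ g hg ξ d))

/-- `Π^0_{1/2}(A) = A_{abc} ξ^{bcA'}`, as a function of `a`. -/
def piP1_0 (a : V) : S :=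
  ∑ b, ∑ c, A a (frame V b) (frame V c) • xi₂ g hg ξ b c

/-- `Π^1_{1/2}(A) = ξ^{cA} A_{cab} - 1/(n-2) γ_{[a|D'}^A A_{|b]cd} ξ^{cdD'}`, as a function
of `a`, `b`. -/
def piP1_1 (a b : V) : S :=
  (∑ c, A (frame V c) a b • xi₁ g hg ξ c) -
    (1 / ((finrank ℂ V : ℂ) - 2)) • ((1 / 2 : ℂ) •
      (gamma S g a (piP1_0 g hg ξ A b) - gamma S g b (piP1_0 g hg ξ A a)))

/-- `Π^2_{1/2}(A) = A_{(ab)c} ξ^{cA} - 3/(2(n+2)) γ_{(a|D'}^A A_{|b)cd} ξ^{cdD'}`, as a function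
of `a`, `b`. -/
def piP1_2 (a b : V) : S :=
  (∑ c, ((1 / 2 : ℂ) * (A a b (frame V c) + A b a (frame V c))) • xi₁ g hg ξ c) -
    (3 / (2 * ((finrank ℂ V : ℂ) + 2))) • ((1 / 2 : ℂ) •
      (gamma S g a (piP1_0 g hg ξ A b) + gamma S g b (piP1_0 g hg ξ A a)))

end Maps

/-! ### The graded pieces -/

/-- The eight labels `(i, j)` of the modules `𝔄_i^j`. -/
inductive Label
  | m3_0 | m1_0 | m1_1 | m1_2 | p1_0 | p1_1 | p1_2 | p3_0
  deriving DecidableEq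

namespace Label

/-- The position of `i` in the list `-3/2, -1/2, 1/2, 3/2`. -/
def pos : Label → Fin 4
  | m3_0 => 0
  | m1_0 => 1
  | m1_1 => 1
  | m1_2 => 1
  | p1_0 => 2
  | p1_1 => 2
  | p1_2 => 2
  | p3_0 => 3

/-- The dimensions of the modules `𝔄_i^j`. -/
def dim (m : ℚ) : Label → ℚ
  | m3_0 => m * (m ^ 2 - 1) / 3
  | m1_0 => m
  | m1_1 => m * (m - 2) * (m + 1) / 2
  | m1_2 => m * (m + 2) * (m - 1) / 2
  | p1_0 => m
  | p1_1 => m * (m - 2) * (m + 1) / 2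
  | p1_2 => m * (m + 2) * (m - 1) / 2
  | p3_0 => m * (m ^ 2 - 1) / 3

/-- The arrows `𝔄_i^j ⟶ 𝔄_{i-1}^k` of the directed graph. -/
inductive Arrow : Label → Label → Prop
  | p3_0_p1_0 : Arrow p3_0 p1_0
  | p3_0_p1_1 : Arrow p3_0 p1_1
  | p3_0_p1_2 : Arrow p3_0 p1_2
  | p1_2_m1_2 : Arrow p1_2 m1_2
  | p1_2_m1_1 : Arrow p1_2 m1_1
  | p1_1_m1_2 : Arrow p1_1 m1_2
  | p1_1_m1_0 : Arrow p1_1 m1_0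
  | p1_0_m1_1 : Arrow p1_0 m1_1
  | p1_0_m1_0 : Arrow p1_0 m1_0
  | m1_2_m3_0 : Arrow m1_2 m3_0
  | m1_1_m3_0 : Arrow m1_1 m3_0
  | m1_0_m3_0 : Arrow m1_0 m3_0

end Label

section Graded

variable {V : Type*} [AddCommGroup V] [Module ℂ V] [FiniteDimensional ℂ V]
variable {S : Type*} [AddCommGroup S] [Module ℂ S]
variable (g : LinearMap.BilinForm ℂ V) [Module (CliffordAlgebra (cliffordForm g)) S]
  [IsScalarTower ℂ (CliffordAlgebra (cliffordForm g)) S]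

/-- The condition `Π_i^j(A) = 0`. There is no map for `i = 3/2`, where the condition is read as
`A = 0`, in accordance with `𝔄^{5/2} = 0`. -/
def PiVanishes (hg : g.Nondegenerate) (ξ : S) (x : Label)
    (A : V →ₗ[ℂ] V →ₗ[ℂ] V →ₗ[ℂ] ℂ) : Prop :=
  match x with
  | .m3_0 => piM3_0 g hg ξ A = 0
  | .m1_0 => piM1_0 g hg ξ A = 0
  | .m1_1 => piM1_1 g hg ξ A = 0
  | .m1_2 => piM1_2 g hg ξ A = 0
  | .p1_0 => piP1_0 g hg ξ A = 0
  | .p1_1 => piP1_1 g hg ξ A = 0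
  | .p1_2 => piP1_2 g hg ξ A = 0
  | .p3_0 => A = 0

variable {L M : Type*} [LieRing L] [LieAlgebra ℂ L] [AddCommGroup M] [Module ℂ M]
  [LieRingModule L M] [LieModule ℂ L M]

/-- The quotient `F k / F (k + 1)` of a descending filtration by submodules. -/
abbrev gr (F : Fin 5 → LieSubmodule ℂ L M) (k : Fin 4) : Type _ :=
  ↥(F k.castSucc) ⧸ (F k.succ).comap (F k.castSucc).incl

/-- The submodule `(K ∩ F k) / F (k + 1)` of `F k / F (k + 1)`. -/
def grPart (F : Fin 5 → LieSubmodule ℂ L M) (k : Fin 4) (K : LieSubmodule ℂ L M) :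
    LieSubmodule ℂ L (gr F k) :=
  (K.comap (F k.castSucc).incl).map
    (LieSubmodule.Quotient.mk' ((F k.succ).comap (F k.castSucc).incl))

end Graded

end PureSpinor

end

set_option linter.unusedSectionVars false
set_option linter.unusedSimpArgs false
set_option linter.unusedVariables false

noncomputable section

namespace PureSpinor

/-! ### Coefficient arrays -/

/-! Choose bases `p` of 𝔙_{1/2} and `q` of 𝔙_{-1/2} that are dual under `g`. The symmetries reduce a
Cotton–York tensor to the four blocks A(p,p,p), A(p,p,q), A(q,q,p), A(q,q,q), and tracelessness
becomes `tr1 = 2 tr2` on the two mixed blocks (`mem_cottonYork_iff`). The grading element gives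
these blocks the weights -3/2, -1/2, 1/2, 3/2. Under 𝔤₀ ≅ 𝔤𝔩_m the pure blocks have hook symmetry
and are irreducible, while each mixed block splits into a trace, a trace-free part skew in its first
two indices and a trace-free part symmetric in them. These eight pieces are the components `cmpL`.

The maps Π. Since p_i·ξ = 0 and p_i·q_j·ξ = -2δ_ij ξ, the spinors q_i·ξ are independent, contraction
with ξ^{aA} reads off values on the null plane, and contraction with ξ^{bcD'} contributes a trace.
The coefficients 1/(n-2) and 3/(2(n+2)) are exactly those that remove the trace from the skew and
symmetric parts. So once the lower components vanish, Π_i^j(A) = 0 says that the component (i, j)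
vanishes (`piVanishes_iff`), and the vanishing of all Π_i^j for one i already forces the lower
components to vanish (`cmpL_eq_zero_of_piVanishes`).

The filtration. An element of 𝔭 preserves the null plane, so on a component below which everything
vanishes it acts through its 𝔤𝔩_m part (`cmpL_lie`). Hence the kernels are 𝔭-submodules and the
graded module can be read off component by component. Dimensions are traces of the projections onto
the four types (`finrank_range_proj`).

Irreducibility (`modForm_le`) uses rank-one elements only. For an incident pair, g(u, v) = 0, a
power of the nilpotent element `hop u v` turns a suitable tensor into a decomposable one; further
rank-one elements carry this to every decomposable tensor of the same shape; and these span. The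
trace modules are copies of a null plane and are handled directly.

The graph. The grading element separates degrees, and dimensions separate the modules of one degree,
so the eight modules are pairwise non-isomorphic. Thus 𝔄 is multiplicity-free over 𝔤₀: the submodule
isomorphic to a given 𝔄_i^j is unique (`eq_modC`), and a 𝔤₀-submodule contains the components of its
elements (`pr_mem`). For an arrow it is then enough to exhibit one tensor and one element of 𝔤₁ with
a non-zero component (`exists_raise`).

Cartan products. Contracting A with a vector gives an equivariant map into the tensor product. By
irreducibility it is an isomorphism onto the Cartan product as soon as one explicit tensor maps to a
non-zero multiple of the product of the highest weight vectors (`nonempty_equiv_cartanProduct`);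
elementary matrices in the Borel subalgebra show that these vectors are unique up to scale. -/

/-- Arrays of coefficients `t_{ijk}` of trilinear forms on an `m`-dimensional space. -/
abbrev Coef (m : ℕ) : Type := Fin m × Fin m × Fin m → ℂ

/-- The four types of irreducible modules of arrays. -/
inductive Kind
  | hook | trace | alt | sym
  deriving DecidableEq

section Coef

variable {m : ℕ}

/-- The contraction `∑ j, t_{ijj}`. -/
def tr1 : Coef m →ₗ[ℂ] (Fin m → ℂ) where
  toFun t i := ∑ j, t (i, j, j)
  map_add' s t := by ext i; simp [Finset.sum_add_distrib]
  map_smul' c t := by ext i; simp [Finset.mul_sum]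

/-- The contraction `∑ j, t_{jij}`. -/
def tr2 : Coef m →ₗ[ℂ] (Fin m → ℂ) where
  toFun t i := ∑ j, t (j, i, j)
  map_add' s t := by ext i; simp [Finset.sum_add_distrib]
  map_smul' c t := by ext i; simp [Finset.mul_sum]

theorem tr1_apply (t : Coef m) (i : Fin m) : tr1 t i = ∑ j, t (i, j, j) := rfl
theorem tr2_apply (t : Coef m) (i : Fin m) : tr2 t i = ∑ j, t (j, i, j) := rfl

/-- The Kronecker symbol. -/
def kron (i j : Fin m) : ℂ := if i = j then 1 else 0

theorem kron_self (i : Fin m) : kron i i = 1 := if_pos rfl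
theorem kron_ne {i j : Fin m} (h : i ≠ j) : kron i j = 0 := if_neg h
theorem kron_comm (i j : Fin m) : kron i j = kron j i := by simp [kron, eq_comm]

theorem sum_kron_mul (i : Fin m) (f : Fin m → ℂ) : ∑ j, kron i j * f j = f i := by simp [kron]
theorem sum_kron_mul' (i : Fin m) (f : Fin m → ℂ) : ∑ j, kron j i * f j = f i := by simp [kron]
theorem sum_mul_kron (i : Fin m) (f : Fin m → ℂ) : ∑ j, f j * kron i j = f i := by simp [kron]
theorem sum_mul_kron' (i : Fin m) (f : Fin m → ℂ) : ∑ j, f j * kron j i = f i := by simp [kron]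
theorem sum_kron_self : ∑ j : Fin m, kron j j = (m : ℂ) := by simp [kron]

/-- The array `a λ_i δ_{jk} + b λ_j δ_{ik}`. -/
def pure (a b : ℂ) : (Fin m → ℂ) →ₗ[ℂ] Coef m where
  toFun l x := a * (l x.1 * kron x.2.1 x.2.2) + b * (l x.2.1 * kron x.1 x.2.2)
  map_add' s t := by ext i; simp; ring
  map_smul' c t := by ext i; simp; ring

theorem pure_apply (a b : ℂ) (l : Fin m → ℂ) (i j k : Fin m) :
    pure a b l (i, j, k) = a * (l i * kron j k) + b * (l j * kron i k) := rfl

theorem tr1_pure (a b : ℂ) (l : Fin m → ℂ) : tr1 (pure a b l) = (a * m + b) • l := by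
  ext i
  simp only [tr1_apply, pure_apply, Finset.sum_add_distrib, ← Finset.mul_sum, sum_kron_self,
    sum_mul_kron]
  simp only [Pi.smul_apply, smul_eq_mul]; ring

theorem tr2_pure (a b : ℂ) (l : Fin m → ℂ) : tr2 (pure a b l) = (a + b * m) • l := by
  ext i
  simp only [tr2_apply, pure_apply, Finset.sum_add_distrib, ← Finset.mul_sum, sum_kron_self,
    sum_mul_kron]
  simp only [Pi.smul_apply, smul_eq_mul]; ring

/-- Permutation of the indices of an array. -/
def perm (f : Fin m × Fin m × Fin m → Fin m × Fin m × Fin m) : Coef m →ₗ[ℂ] Coef m :=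
  LinearMap.funLeft ℂ ℂ f

theorem perm_apply (f : Fin m × Fin m × Fin m → Fin m × Fin m × Fin m) (t : Coef m)
    (x : Fin m × Fin m × Fin m) : perm f t x = t (f x) := rfl

/-- The projections onto the four types of arrays. -/
def proj : Kind → Coef m →ₗ[ℂ] Coef m
  | .hook => (1 / 3 : ℂ) • (LinearMap.id - perm (fun x => (x.1, x.2.2, x.2.1)) +
      perm (fun x => (x.2.2, x.2.1, x.1)) - perm (fun x => (x.2.1, x.2.2, x.1)))
  | .trace => pure ((2 * m - 1) / (2 * (m ^ 2 - 1))) ((m - 2) / (2 * (m ^ 2 - 1))) ∘ₗ tr1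
  | .alt => (1 / 2 : ℂ) • (LinearMap.id - perm (fun x => (x.2.1, x.1, x.2.2))) -
      pure (1 / (2 * (m - 1))) (-(1 / (2 * (m - 1)))) ∘ₗ (tr1 - tr2)
  | .sym => (1 / 2 : ℂ) • (LinearMap.id + perm (fun x => (x.2.1, x.1, x.2.2))) -
      pure (1 / (2 * (m + 1))) (1 / (2 * (m + 1))) ∘ₗ (tr1 + tr2)

theorem proj_hook_apply (t : Coef m) (i j k : Fin m) :
    proj .hook t (i, j, k) =
      (1 / 3) * (t (i, j, k) - t (i, k, j) + t (k, j, i) - t (j, k, i)) := rfl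

theorem proj_trace (t : Coef m) :
    proj .trace t = pure ((2 * m - 1) / (2 * (m ^ 2 - 1))) ((m - 2) / (2 * (m ^ 2 - 1))) (tr1 t) :=
  rfl

theorem proj_alt_apply (t : Coef m) (i j k : Fin m) :
    proj .alt t (i, j, k) = (1 / 2) * (t (i, j, k) - t (j, i, k)) -
      pure (1 / (2 * (m - 1))) (-(1 / (2 * (m - 1)))) (tr1 t - tr2 t) (i, j, k) := rfl

theorem proj_sym_apply (t : Coef m) (i j k : Fin m) :
    proj .sym t (i, j, k) = (1 / 2) * (t (i, j, k) + t (j, i, k)) -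
      pure (1 / (2 * (m + 1))) (1 / (2 * (m + 1))) (tr1 t + tr2 t) (i, j, k) := rfl

theorem proj_hook_anti (t : Coef m) (i j k : Fin m) :
    proj .hook t (i, j, k) = - proj .hook t (i, k, j) := by
  simp only [proj_hook_apply]; ring

theorem proj_hook_cyc (t : Coef m) (i j k : Fin m) :
    proj .hook t (i, j, k) + proj .hook t (j, k, i) + proj .hook t (k, i, j) = 0 := by
  simp only [proj_hook_apply]; ring

theorem proj_hook_eq_self (t : Coef m) (h1 : ∀ i j k, t (i, j, k) = - t (i, k, j))
    (h2 : ∀ i j k, t (i, j, k) + t (j, k, i) + t (k, i, j) = 0) : proj .hook t = t := by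
  ext ⟨i, j, k⟩
  rw [proj_hook_apply]
  linear_combination -(1 / 3) * h1 i j k - (1 / 3) * h2 i j k + (1 / 3) * h1 k j i

variable (hm : 3 ≤ m)
include hm

theorem natCast_sub_one_ne : (m : ℂ) - 1 ≠ 0 := by
  have : (m : ℂ) ≠ (1 : ℕ) := by exact_mod_cast (by omega : m ≠ 1)
  simpa [sub_ne_zero] using this

omit hm in
theorem natCast_add_one_ne : (m : ℂ) + 1 ≠ 0 := by exact_mod_cast Nat.succ_ne_zero m

theorem natCast_sq_sub_one_ne : (m : ℂ) ^ 2 - 1 ≠ 0 := by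
  have := mul_ne_zero (natCast_sub_one_ne hm) (natCast_add_one_ne (m := m))
  intro h; apply this; linear_combination h

/-- The coefficients of the trace projection solve `a m + b = 1` and `a + b m = 1/2`: the result
keeps the first trace of the array and satisfies `tr1 = 2 tr2`. -/
theorem tr1_proj_trace (t : Coef m) : tr1 (proj .trace t) = tr1 t := by
  rw [proj_trace, tr1_pure]
  have := natCast_sq_sub_one_ne hm
  convert one_smul ℂ _ using 2
  field_simp; ring

theorem tr2_proj_trace (t : Coef m) : tr2 (proj .trace t) = (1 / 2 : ℂ) • tr1 t := by
  rw [proj_trace, tr2_pure]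
  have := natCast_sq_sub_one_ne hm
  congr 1
  field_simp; ring

omit hm in
theorem tr1_alt (t : Coef m) (i : Fin m) :
    ∑ j, (1 / 2) * (t (i, j, j) - t (j, i, j)) = (1 / 2) * (tr1 t - tr2 t) i := by
  simp only [← Finset.mul_sum, Finset.sum_sub_distrib, Pi.sub_apply, tr1_apply, tr2_apply]

omit hm in
theorem tr1_sym (t : Coef m) (i : Fin m) :
    ∑ j, (1 / 2) * (t (i, j, j) + t (j, i, j)) = (1 / 2) * (tr1 t + tr2 t) i := by
  simp only [← Finset.mul_sum, Finset.sum_add_distrib, Pi.add_apply, tr1_apply, tr2_apply]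

omit hm in
theorem proj_alt_anti (t : Coef m) (i j k : Fin m) :
    proj .alt t (i, j, k) = - proj .alt t (j, i, k) := by
  simp only [proj_alt_apply, pure_apply]; ring

omit hm in
theorem proj_sym_symm (t : Coef m) (i j k : Fin m) :
    proj .sym t (i, j, k) = proj .sym t (j, i, k) := by
  simp only [proj_sym_apply, pure_apply]; ring

/-- The skew part has first trace `(tr1 - tr2)/2`, and `pure c (-c) l` has first trace `c (m - 1)
l`; this fixes the coefficient `1/(2(m - 1))`. The symmetric case is the same with `m + 1`. -/
theorem tr1_proj_alt (t : Coef m) : tr1 (proj .alt t) = 0 := by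
  ext i
  have h := congrFun (tr1_pure (1 / (2 * ((m : ℂ) - 1))) (-(1 / (2 * (m - 1)))) (tr1 t - tr2 t)) i
  rw [tr1_apply] at h
  simp only [tr1_apply (proj .alt t), proj_alt_apply, Finset.sum_sub_distrib, h]
  have e := tr1_alt t i
  rw [Finset.sum_congr rfl fun j _ => mul_sub _ _ _, Finset.sum_sub_distrib] at e
  simp only [mul_sub, Finset.sum_sub_distrib, e]
  have := natCast_sub_one_ne hm
  simp only [Pi.smul_apply, Pi.sub_apply, Pi.zero_apply, smul_eq_mul]
  field_simp; ring

theorem tr2_proj_alt (t : Coef m) : tr2 (proj .alt t) = 0 := by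
  ext i
  have h := congrFun (tr1_proj_alt hm t) i
  rw [tr1_apply] at h
  rw [tr2_apply, Finset.sum_congr rfl fun j _ => proj_alt_anti t j i j, Finset.sum_neg_distrib, h]
  simp

omit hm in
theorem tr1_proj_sym (t : Coef m) : tr1 (proj .sym t) = 0 := by
  ext i
  have h := congrFun (tr1_pure (1 / (2 * ((m : ℂ) + 1))) (1 / (2 * (m + 1))) (tr1 t + tr2 t)) i
  rw [tr1_apply] at h
  simp only [tr1_apply (proj .sym t), proj_sym_apply, Finset.sum_sub_distrib, h]
  have e := tr1_sym t i
  rw [e]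
  have := natCast_add_one_ne (m := m)
  simp only [Pi.smul_apply, Pi.add_apply, Pi.zero_apply, smul_eq_mul]
  field_simp; ring

omit hm in
theorem tr2_proj_sym (t : Coef m) : tr2 (proj .sym t) = 0 := by
  ext i
  have h := congrFun (tr1_proj_sym t) i
  rw [tr1_apply] at h
  rw [tr2_apply, Finset.sum_congr rfl fun j _ => proj_sym_symm t j i j, h]

omit hm in
theorem proj_alt_eq_self {t : Coef m} (h : ∀ i j k, t (i, j, k) = - t (j, i, k))
    (h1 : tr1 t = 0) : proj .alt t = t := by
  have h2 : tr2 t = 0 := by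
    ext i
    rw [tr2_apply, Finset.sum_congr rfl fun j _ => h j i j, Finset.sum_neg_distrib, ← tr1_apply, h1]
    simp
  ext ⟨i, j, k⟩
  rw [proj_alt_apply, h1, h2, sub_zero, map_zero, Pi.zero_apply, h j i k]; ring

omit hm in
theorem proj_sym_eq_self {t : Coef m} (h : ∀ i j k, t (i, j, k) = t (j, i, k))
    (h1 : tr1 t = 0) : proj .sym t = t := by
  have h2 : tr2 t = 0 := by
    ext i
    rw [tr2_apply, Finset.sum_congr rfl fun j _ => h j i j, ← tr1_apply, h1]
  ext ⟨i, j, k⟩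
  rw [proj_sym_apply, h1, h2, add_zero, map_zero, Pi.zero_apply, h j i k]; ring

/-- Each projection produces the symmetries and traces on which it acts as the identity. -/
theorem proj_idem (κ : Kind) (t : Coef m) : proj κ (proj κ t) = proj κ t := by
  cases κ
  · exact proj_hook_eq_self _ (proj_hook_anti t) (proj_hook_cyc t)
  · rw [proj_trace (proj .trace t), tr1_proj_trace hm, proj_trace]
  · exact proj_alt_eq_self (proj_alt_anti t) (tr1_proj_alt hm t)
  · exact proj_sym_eq_self (proj_sym_symm t) (tr1_proj_sym t)

/-- The type `.hook` is left out because it belongs to a different block, with three indices of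
equal variance; the other three types share the mixed block. -/
theorem proj_proj {κ μ : Kind} (h : κ ≠ μ) (hκ : κ ≠ .hook) (hμ : μ ≠ .hook) (t : Coef m) :
    proj κ (proj μ t) = 0 := by
  have h1 := natCast_sub_one_ne hm
  have h2 := natCast_add_one_ne (m := m)
  have h3 := natCast_sq_sub_one_ne hm
  cases κ <;> cases μ <;> simp only [ne_eq, not_true_eq_false, reduceCtorEq, not_false_eq_true] at h hκ hμ ⊢
  · rw [proj_trace, tr1_proj_alt hm, map_zero]
  · rw [proj_trace, tr1_proj_sym, map_zero]
  · ext ⟨i, j, k⟩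
    rw [proj_alt_apply, tr1_proj_trace hm, tr2_proj_trace hm, proj_trace]
    simp only [pure_apply, Pi.sub_apply, Pi.smul_apply, smul_eq_mul, Pi.zero_apply]
    have e : (m : ℂ) ^ 2 - 1 = (m - 1) * (m + 1) := by ring
    rw [e]; field_simp; ring
  · ext ⟨i, j, k⟩
    rw [proj_alt_apply, tr1_proj_sym, tr2_proj_sym, proj_sym_symm t j i k]; simp
  · ext ⟨i, j, k⟩
    rw [proj_sym_apply, tr1_proj_trace hm, tr2_proj_trace hm, proj_trace]
    simp only [pure_apply, Pi.add_apply, Pi.smul_apply, smul_eq_mul, Pi.zero_apply]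
    have e : (m : ℂ) ^ 2 - 1 = (m - 1) * (m + 1) := by ring
    rw [e]; field_simp; ring
  · ext ⟨i, j, k⟩
    rw [proj_sym_apply, tr1_proj_alt hm, tr2_proj_alt hm, proj_alt_anti t j i k]; simp

/-- The trace corrections made in the skew and symmetric parts add up to the trace part precisely
under the condition `tr1 = 2 tr2`. -/
theorem proj_add (t : Coef m) (h : tr1 t = (2 : ℂ) • tr2 t) :
    proj .trace t + proj .alt t + proj .sym t = t := by
  have h1 := natCast_sub_one_ne hm
  have h2 := natCast_add_one_ne (m := m)
  have h3 := natCast_sq_sub_one_ne hm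
  ext ⟨i, j, k⟩
  simp only [Pi.add_apply, proj_trace, proj_alt_apply, proj_sym_apply, h, pure_apply, Pi.sub_apply,
    Pi.smul_apply, smul_eq_mul]
  have e : (m : ℂ) ^ 2 - 1 = (m - 1) * (m + 1) := by ring
  rw [e]; field_simp; ring

theorem tr_proj {κ : Kind} (hκ : κ ≠ .hook) (t : Coef m) :
    tr1 (proj κ t) = (2 : ℂ) • tr2 (proj κ t) := by
  cases κ
  · exact absurd rfl hκ
  · rw [tr1_proj_trace hm, tr2_proj_trace hm, smul_smul]; norm_num
  · rw [tr1_proj_alt hm, tr2_proj_alt hm, smul_zero]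
  · rw [tr1_proj_sym, tr2_proj_sym, smul_zero]

/-! ### Dimensions as traces of projections -/

/-- The dimensions of the four types of arrays. -/
def Kind.dim (m : ℚ) : Kind → ℚ
  | .hook => m * (m ^ 2 - 1) / 3
  | .trace => m
  | .alt => m * (m - 2) * (m + 1) / 2
  | .sym => m * (m + 2) * (m - 1) / 2

omit hm in
theorem trace_coef (f : Coef m →ₗ[ℂ] Coef m) :
    LinearMap.trace ℂ _ f = ∑ i, ∑ j, ∑ k, f (Pi.single (i, j, k) 1) (i, j, k) := by
  rw [LinearMap.trace_eq_matrix_trace ℂ (Pi.basisFun ℂ _), Matrix.trace, Fintype.sum_prod_type]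
  refine Finset.sum_congr rfl fun i _ => ?_
  rw [Fintype.sum_prod_type]
  simp

omit hm in
theorem trace_perm (f : Fin m × Fin m × Fin m → Fin m × Fin m × Fin m) :
    LinearMap.trace ℂ _ (perm f) = ∑ i, ∑ j, ∑ k, if f (i, j, k) = (i, j, k) then (1 : ℂ) else 0 := by
  simp only [trace_coef, perm_apply, Pi.single_apply]

omit hm in
-- By cyclicity of the trace the composite may be taken in the other order, where it is a scalar on
-- `Fin m → ℂ`.
theorem trace_pure_comp (a b c d : ℂ) :
    LinearMap.trace ℂ _ (pure a b ∘ₗ (c • tr1 + d • tr2) : Coef m →ₗ[ℂ] Coef m) =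
      (c * (a * m + b) + d * (a + b * m)) * m := by
  rw [LinearMap.trace_comp_comm']
  have : ((c • tr1 + d • tr2) ∘ₗ pure a b : (Fin m → ℂ) →ₗ[ℂ] Fin m → ℂ) =
      (c * (a * m + b) + d * (a + b * m)) • LinearMap.id := by
    refine LinearMap.ext fun l => ?_
    simp only [LinearMap.comp_apply, LinearMap.add_apply, LinearMap.smul_apply, tr1_pure, tr2_pure,
      LinearMap.id_apply, smul_smul, ← add_smul]
  rw [this, map_smul, LinearMap.trace_id, finrank_fin_fun, smul_eq_mul]

omit hm in
theorem trace_perm₁₂ : LinearMap.trace ℂ _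
    (perm (fun x => (x.2.1, x.1, x.2.2)) : Coef m →ₗ[ℂ] Coef m) = (m : ℂ) ^ 2 := by
  rw [trace_perm]
  have : ∀ i j k : Fin m, (if (j, i, k) = (i, j, k) then (1 : ℂ) else 0) = if i = j then 1 else 0 := by
    intro i j k; congr 1; simp [eq_comm]
  simp only [this]
  simp; ring

theorem trace_proj (κ : Kind) : LinearMap.trace ℂ _ (proj κ : Coef m →ₗ[ℂ] Coef m) =
    ((κ.dim m : ℚ) : ℂ) := by
  have h1 := natCast_sub_one_ne hm
  have h2 := natCast_add_one_ne (m := m)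
  have h3 := natCast_sq_sub_one_ne hm
  have e : (m : ℂ) ^ 2 - 1 = (m - 1) * (m + 1) := by ring
  have hid : LinearMap.trace ℂ (Coef m) LinearMap.id = (m : ℂ) ^ 3 := by
    rw [LinearMap.trace_id]; simp; ring
  cases κ
  · have e1 : ∀ i j k : Fin m, (if (i, k, j) = (i, j, k) then (1 : ℂ) else 0) =
        if j = k then 1 else 0 := by
      intro i j k; congr 1; simp [eq_comm]
    have e2 : ∀ i j k : Fin m, (if (k, j, i) = (i, j, k) then (1 : ℂ) else 0) =
        if i = k then 1 else 0 := by
      intro i j k; congr 1; simp [eq_comm]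
    have e3 : ∀ i j k : Fin m, (if (j, k, i) = (i, j, k) then (1 : ℂ) else 0) =
        if i = j then (if j = k then 1 else 0) else 0 := by
      intro i j k
      by_cases h : i = j <;> by_cases h' : j = k
      · subst h h'; simp
      · simp [h, h', Ne.symm h']
      · subst h'; simp [h, Ne.symm h]
      · simp [h, h', Ne.symm h]
    simp only [proj, map_smul, map_add, map_sub, hid, trace_perm, e1, e2, e3]
    simp [Kind.dim]; ring
  · have := trace_pure_comp (m := m) ((2 * m - 1) / (2 * (m ^ 2 - 1))) ((m - 2) / (2 * (m ^ 2 - 1))) 1 0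
    simp only [one_smul, zero_smul, add_zero] at this
    rw [proj, this, Kind.dim]
    push_cast; rw [e]; field_simp; ring
  · have := trace_pure_comp (m := m) (1 / (2 * (m - 1))) (-(1 / (2 * (m - 1)))) 1 (-1)
    have h' : (1 : ℂ) • tr1 + (-1 : ℂ) • tr2 = (tr1 - tr2 : Coef m →ₗ[ℂ] Fin m → ℂ) := by module
    rw [h'] at this
    rw [proj, map_sub, this, map_smul, map_sub, hid, trace_perm₁₂, Kind.dim, smul_eq_mul]
    push_cast; field_simp; ring
  · have := trace_pure_comp (m := m) (1 / (2 * (m + 1))) (1 / (2 * (m + 1))) 1 1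
    simp only [one_smul] at this
    rw [proj, map_sub, this, map_smul, map_add, hid, trace_perm₁₂, Kind.dim, smul_eq_mul]
    push_cast; field_simp; ring

/-- The number of independent components of an array of each type. -/
theorem finrank_range_proj (κ : Kind) :
    (finrank ℂ (LinearMap.range (proj κ : Coef m →ₗ[ℂ] Coef m)) : ℚ) = κ.dim m := by
  have hp : LinearMap.IsProj (LinearMap.range (proj κ : Coef m →ₗ[ℂ] Coef m)) (proj κ) :=
    ⟨fun t => ⟨t, rfl⟩, by rintro _ ⟨t, rfl⟩; exact proj_idem hm κ t⟩
  -- The trace of a projection is its rank.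
  have h := hp.trace
  rw [trace_proj hm] at h
  exact_mod_cast h.symm

/-! The action of matrices on arrays -/

omit hm

/-- The action on arrays of the endomorphism with matrix `x`. -/
def rho (x : Fin m → Fin m → ℂ) (κ : Kind) (t : Coef m) : Coef m := fun y =>
  - ∑ l, x l y.1 * t (l, y.2.1, y.2.2) - ∑ l, x l y.2.1 * t (y.1, l, y.2.2) +
    if κ = .hook then - ∑ l, x l y.2.2 * t (y.1, y.2.1, l)
      else ∑ l, x y.2.2 l * t (y.1, y.2.1, l)

/-- The action on covectors of the endomorphism with matrix `x`. -/
def rho₁ (x : Fin m → Fin m → ℂ) (l : Fin m → ℂ) : Fin m → ℂ := fun i => - ∑ j, x j i * l j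

theorem rho_hook (x : Fin m → Fin m → ℂ) (t : Coef m) (i j k : Fin m) :
    rho x .hook t (i, j, k) = - ∑ l, x l i * t (l, j, k) - ∑ l, x l j * t (i, l, k) -
      ∑ l, x l k * t (i, j, l) := by
  simp [rho]; ring

theorem rho_of_ne (x : Fin m → Fin m → ℂ) {κ : Kind} (hκ : κ ≠ .hook) (t : Coef m)
    (i j k : Fin m) :
    rho x κ t (i, j, k) = - ∑ l, x l i * t (l, j, k) - ∑ l, x l j * t (i, l, k) +
      ∑ l, x k l * t (i, j, l) := by
  simp [rho, hκ]

theorem tr1_rho (x : Fin m → Fin m → ℂ) {κ : Kind} (hκ : κ ≠ .hook) (t : Coef m) :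
    tr1 (rho x κ t) = rho₁ x (tr1 t) := by
  ext i
  simp only [tr1_apply, rho_of_ne x hκ, rho₁, Finset.sum_add_distrib, Finset.sum_sub_distrib,
    Finset.sum_neg_distrib, Finset.mul_sum]
  rw [Finset.sum_comm (f := fun j l => x j l * t (i, j, l)), Finset.sum_comm]
  ring

theorem tr2_rho (x : Fin m → Fin m → ℂ) {κ : Kind} (hκ : κ ≠ .hook) (t : Coef m) :
    tr2 (rho x κ t) = rho₁ x (tr2 t) := by
  ext i
  simp only [tr2_apply, rho_of_ne x hκ, rho₁, Finset.sum_add_distrib, Finset.sum_sub_distrib,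
    Finset.sum_neg_distrib, Finset.mul_sum]
  rw [Finset.sum_comm (f := fun j l => x j l * t (j, i, l)),
    Finset.sum_comm (f := fun j l => x l i * t (j, l, j))]
  ring

theorem pure_rho₁ (x : Fin m → Fin m → ℂ) {κ : Kind} (hκ : κ ≠ .hook) (a b : ℂ) (l : Fin m → ℂ) :
    pure a b (rho₁ x l) = rho x κ (pure a b l) := by
  ext ⟨i, j, k⟩
  have e1 : ∀ (y : Fin m → ℂ) (c : ℂ) (k : Fin m), ∑ n, y n * (c * kron n k) = c * y k := by
    intro y c k; rw [← sum_mul_kron' k y, Finset.mul_sum]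
    exact Finset.sum_congr rfl fun _ _ => by ring
  have e2 : ∀ (y : Fin m → ℂ) (c : ℂ) (k : Fin m), ∑ n, y n * (c * kron k n) = c * y k := by
    intro y c k; rw [← sum_mul_kron k y, Finset.mul_sum]
    exact Finset.sum_congr rfl fun _ _ => by ring
  have e3 : ∀ (y z : Fin m → ℂ) (c : ℂ), ∑ n, y n * (z n * c) = (∑ n, y n * z n) * c := by
    intro y z c; rw [Finset.sum_mul]
    exact Finset.sum_congr rfl fun _ _ => by ring
  simp only [rho_of_ne x hκ, pure_apply, rho₁, mul_add, Finset.sum_add_distrib, mul_left_comm _ a,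
    mul_left_comm _ b, ← Finset.mul_sum, e1, e2, e3]
  ring

/-- The projections are made of permutations of indices of equal variance, contractions of indices
of opposite variance and Kronecker symbols, all of which are invariant under matrices. -/
theorem proj_rho (x : Fin m → Fin m → ℂ) (κ : Kind) (t : Coef m) :
    proj κ (rho x κ t) = rho x κ (proj κ t) := by
  have hpa : ∀ (κ : Kind) (t s : Coef m), rho x κ (t - s) = rho x κ t - rho x κ s := by
    intro κ t s; ext ⟨i, j, k⟩
    simp only [rho, Pi.sub_apply, mul_sub, Finset.sum_sub_distrib]
    split_ifs <;> ring
  by_cases hκ : κ = .hook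
  · subst hκ
    ext ⟨i, j, k⟩
    rw [proj_hook_apply]
    simp only [rho_hook, proj_hook_apply, mul_left_comm _ (1 / 3 : ℂ), ← Finset.mul_sum, mul_add,
      mul_sub, Finset.sum_add_distrib, Finset.sum_sub_distrib]
    ring
  have e0 : ∀ (c : ℂ) (s : Coef m), rho x κ (c • s) = c • rho x κ s := by
    intro c s; ext ⟨i, j, k⟩
    simp only [rho_of_ne x hκ, Pi.smul_apply, smul_eq_mul, mul_left_comm _ c, ← Finset.mul_sum]
    ring
  have e1 : perm (fun x => (x.2.1, x.1, x.2.2)) (rho x κ t) =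
      rho x κ (perm (fun x => (x.2.1, x.1, x.2.2)) t) := by
    ext ⟨i, j, k⟩
    simp only [rho_of_ne x hκ, perm_apply]; ring
  have e2 : ∀ l l' : Fin m → ℂ, rho₁ x (l - l') = rho₁ x l - rho₁ x l' := by
    intro l l'; ext i; simp only [rho₁, Pi.sub_apply, mul_sub, Finset.sum_sub_distrib]; ring
  have e3 : ∀ l l' : Fin m → ℂ, rho₁ x (l + l') = rho₁ x l + rho₁ x l' := by
    intro l l'; ext i; simp only [rho₁, Pi.add_apply, mul_add, Finset.sum_add_distrib]; ring
  have e4 : ∀ (t s : Coef m), rho x κ (t + s) = rho x κ t + rho x κ s := by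
    intro t s; ext ⟨i, j, k⟩
    simp only [rho_of_ne x hκ, Pi.add_apply, mul_add, Finset.sum_add_distrib]; ring
  cases κ
  · exact absurd rfl hκ
  · simp only [proj, LinearMap.comp_apply, tr1_rho x hκ, pure_rho₁ x hκ]
  · simp only [proj, LinearMap.comp_apply, LinearMap.sub_apply, LinearMap.smul_apply,
      LinearMap.id_apply, tr1_rho x hκ, tr2_rho x hκ, e1, ← e2, pure_rho₁ x hκ, ← hpa, ← e0]
  · simp only [proj, LinearMap.comp_apply, LinearMap.sub_apply, LinearMap.smul_apply,
      LinearMap.add_apply,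
      LinearMap.id_apply, tr1_rho x hκ, tr2_rho x hκ, e1, ← e3, pure_rho₁ x hκ, ← hpa, ← e0, ← e4]

theorem rho_zero (x : Fin m → Fin m → ℂ) (κ : Kind) : rho x κ 0 = 0 := by
  ext ⟨i, j, k⟩; simp [rho]

end Coef

/-! ### Trilinear forms -/

/-- Trilinear forms on `V`. -/
abbrev Tri (V : Type*) [AddCommGroup V] [Module ℂ V] : Type _ := V →ₗ[ℂ] V →ₗ[ℂ] V →ₗ[ℂ] ℂ

section Tri

variable {V : Type*} [AddCommGroup V] [Module ℂ V] {g : LinearMap.BilinForm ℂ V}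

theorem lie_tri (X : so g) (A : Tri V) (a b c : V) :
    (⁅X, A⁆ : Tri V) a b c = - A ⁅X, a⁆ b c - A a ⁅X, b⁆ c - A a b ⁅X, c⁆ := by
  have : (⁅X, A⁆ : Tri V) a b c = - A a b ⁅X, c⁆ - A a ⁅X, b⁆ c - A ⁅X, a⁆ b c := by
    simp [LieHom.lie_apply]
  rw [this]; ring

variable (g) in
/-- The linear map `w ↦ g(v, w) u - g(u, w) v`, an element of `𝔰𝔬(V, g)`. -/
def hop (hs : g.IsSymm) (u v : V) : so g :=
  ⟨(g v).smulRight u - (g u).smulRight v, by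
    change _ ∈ g.skewAdjointSubmodule
    rw [LinearMap.mem_skewAdjointSubmodule]
    intro x y
    have h1 := hs.eq x u
    have h2 := hs.eq x v
    simp only [LinearMap.sub_apply, LinearMap.smulRight_apply, map_sub, map_smul, smul_eq_mul,
      LinearMap.smul_apply, LinearMap.neg_apply, LinearMap.map_neg, Pi.neg_apply, map_neg, h1, h2]
    ring⟩

theorem hop_lie (hs : g.IsSymm) (u v w : V) : ⁅hop g hs u v, w⁆ = g v w • u - g u w • v := rfl

theorem so_ext {X Y : so g} (h : ∀ v : V, ⁅X, v⁆ = ⁅Y, v⁆) : X = Y :=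
  Subtype.ext (LinearMap.ext h)

theorem so_lie_lie (X Y : so g) (v : V) : ⁅⁅X, Y⁆, v⁆ = ⁅X, ⁅Y, v⁆⁆ - ⁅Y, ⁅X, v⁆⁆ := lie_lie X Y v

variable (g) in
/-- The form `A_{abc} = u_a v_b w_c`. -/
def tri (u v w : V) : Tri V := (g u).smulRight ((g v).smulRight (g w))

theorem tri_apply (u v w x y z : V) : tri g u v w x y z = g u x * (g v y * g w z) := by
  simp [tri]

variable (g) in
/-- The form `u_a v_b w_c - u_a w_b v_c + w_a v_b u_c - w_a u_b v_c`. -/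
def theta : V →ₗ[ℂ] V →ₗ[ℂ] V →ₗ[ℂ] Tri V :=
  LinearMap.mk₂ ℂ (fun u v =>
    { toFun := fun w => tri g u v w - tri g u w v + tri g w v u - tri g w u v
      map_add' := fun x y => by
        ext a b c; simp only [LinearMap.add_apply, LinearMap.sub_apply, tri_apply, map_add]; ring
      map_smul' := fun x y => by
        ext a b c; simp only [LinearMap.add_apply, LinearMap.sub_apply, tri_apply, map_smul,
          LinearMap.smul_apply, smul_eq_mul, RingHom.id_apply]; ring })
    (fun x y z => by
      ext w a b c; simp only [LinearMap.add_apply, LinearMap.sub_apply, tri_apply, map_add,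
        LinearMap.coe_mk, AddHom.coe_mk]; ring)
    (fun r x z => by
      ext w a b c; simp only [LinearMap.add_apply, LinearMap.sub_apply, tri_apply, map_smul,
        LinearMap.coe_mk, AddHom.coe_mk, LinearMap.smul_apply, smul_eq_mul]; ring)
    (fun x y z => by
      ext w a b c; simp only [LinearMap.add_apply, LinearMap.sub_apply, tri_apply, map_add,
        LinearMap.coe_mk, AddHom.coe_mk]; ring)
    (fun r x z => by
      ext w a b c; simp only [LinearMap.add_apply, LinearMap.sub_apply, tri_apply, map_smul,
        LinearMap.coe_mk, AddHom.coe_mk, LinearMap.smul_apply, smul_eq_mul]; ring)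

theorem theta_apply (u v w x y z : V) : theta g u v w x y z =
    g u x * (g v y * g w z) - g u x * (g w y * g v z) + g w x * (g v y * g u z) -
      g w x * (g u y * g v z) := by
  simp only [theta, LinearMap.mk₂_apply, LinearMap.coe_mk, AddHom.coe_mk, LinearMap.add_apply,
    LinearMap.sub_apply, tri_apply]

theorem lie_theta (X : so g) (u v w : V) :
    (⁅X, theta g u v w⁆ : Tri V) =
      theta g ⁅X, u⁆ v w + theta g u ⁅X, v⁆ w + theta g u v ⁅X, w⁆ := by
  ext x y z
  simp only [lie_tri, LinearMap.add_apply, theta_apply, so_apply]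
  ring

variable [FiniteDimensional ℂ V] {hg : g.Nondegenerate}

theorem mem_cottonYork {A : Tri V} : A ∈ cottonYork g hg ↔
    (∀ a b c, A a b c = - A a c b) ∧ (∀ a b c, A a b c + A b c a + A c a b = 0) ∧
    ∀ c, ∑ i, A (frame V i) (coframe g hg i) c = 0 := Iff.rfl

/-! ### Hyperbolic bases -/

variable (g) in
/-- A basis of `V` made of dual bases `p`, `q` of two complementary totally null subspaces. -/
structure Hyp {m : ℕ} (p q : Fin m → V) : Prop where
  pp : ∀ i j, g (p i) (p j) = 0
  qq : ∀ i j, g (q i) (q j) = 0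
  pq : ∀ i j, g (p i) (q j) = kron i j
  qp : ∀ i j, g (q i) (p j) = kron i j
  expand : ∀ v, v = ∑ i, g (q i) v • p i + ∑ i, g (p i) v • q i

variable {m : ℕ} {p q : Fin m → V}

omit [FiniteDimensional ℂ V] in
theorem Hyp.swap (h : Hyp g p q) : Hyp g q p :=
  ⟨h.qq, h.pp, h.qp, h.pq, fun v => by rw [add_comm]; exact h.expand v⟩

omit [FiniteDimensional ℂ V] in
theorem Hyp.mem_span (h : Hyp g p q) {v : V} :
    v ∈ Submodule.span ℂ (Set.range p) ↔ ∀ i, g (p i) v = 0 := by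
  constructor
  · intro hv i
    induction hv using Submodule.span_induction with
    | mem x hx => obtain ⟨j, rfl⟩ := hx; exact h.pp i j
    | zero => simp
    | add x y _ _ hx hy => simp [hx, hy]
    | smul c x _ hx => simp [hx]
  · intro hv
    rw [h.expand v]
    simp only [hv, zero_smul, Finset.sum_const_zero, add_zero]
    exact Submodule.sum_mem _ fun i _ => Submodule.smul_mem _ _ (Submodule.subset_span ⟨i, rfl⟩)

omit [FiniteDimensional ℂ V] in
theorem Hyp.expand_left (h : Hyp g p q) {v : V} (hv : ∀ i, g (p i) v = 0) :
    v = ∑ i, g (q i) v • p i := by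
  conv_lhs => rw [h.expand v]
  simp [hv]

omit [FiniteDimensional ℂ V] in
theorem Hyp.expand_right (h : Hyp g p q) {v : V} (hv : ∀ i, g (q i) v = 0) :
    v = ∑ i, g (p i) v • q i := h.swap.expand_left hv

omit [FiniteDimensional ℂ V] in
theorem Hyp.ext (h : Hyp g p q) {v w : V} (h1 : ∀ i, g (p i) v = g (p i) w)
    (h2 : ∀ i, g (q i) v = g (q i) w) : v = w := by
  rw [h.expand v, h.expand w]; simp [h1, h2]

/-- Both sides contract `B` with the inverse metric. Expanding the coframe in `p`, `q` and resumming
the frame passes from one basis to the other, so every contraction in the maps Π can be computed in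
a hyperbolic basis. -/
theorem sum_frame (hg : g.Nondegenerate) (h : Hyp g p q) {M : Type*} [AddCommGroup M] [Module ℂ M]
    (B : V →ₗ[ℂ] V →ₗ[ℂ] M) :
    ∑ i, B (frame V i) (coframe g hg i) = ∑ i, (B (p i) (q i) + B (q i) (p i)) := by
  have hv : ∀ w : V, ∑ i, g (coframe g hg i) w • frame V i = w := by
    intro w
    conv_rhs => rw [← (frame V).sum_repr w]
    exact Finset.sum_congr rfl fun j _ => by rw [coframe_apply]
  have hc : ∀ i, g (coframe g hg i) = g (coframe g hg i) := fun i => rfl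
  have hs : ∀ (i : Fin (finrank ℂ V)), coframe g hg i = ∑ j, g (coframe g hg i) (q j) • p j +
      ∑ j, g (coframe g hg i) (p j) • q j := by
    intro i
    have e : ∀ v : V, v = ∑ j, g v (q j) • p j + ∑ j, g v (p j) • q j := by
      intro v
      have h1 := h.expand v
      -- Symmetry of `g` is not assumed here; it follows from the values of `g` on the basis.
      have h2 : ∀ j, g v (q j) = g (q j) v := by
        intro j
        conv_lhs => rw [h1]
        conv_rhs => rw [h1]
        simp only [map_add, map_sum, map_smul, LinearMap.add_apply, LinearMap.sum_apply,
          LinearMap.smul_apply, h.pq, h.qp, h.qq, kron_comm]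
      have h3 : ∀ j, g v (p j) = g (p j) v := by
        intro j
        conv_lhs => rw [h1]
        conv_rhs => rw [h1]
        simp only [map_add, map_sum, map_smul, LinearMap.add_apply, LinearMap.sum_apply,
          LinearMap.smul_apply, h.pq, h.qp, h.pp, kron_comm]
      simp only [h2, h3]; exact h1
    exact e _
  have step : ∀ i, B (frame V i) (coframe g hg i) =
      ∑ j, B (g (coframe g hg i) (q j) • frame V i) (p j) +
      ∑ j, B (g (coframe g hg i) (p j) • frame V i) (q j) := by
    intro i
    conv_lhs => rw [hs i]
    simp only [map_add, map_sum, map_smul, LinearMap.smul_apply]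
  simp only [step, Finset.sum_add_distrib]
  rw [Finset.sum_comm, Finset.sum_comm (f := fun i j => B (g (coframe g hg i) (p j) • frame V i) (q j))]
  simp only [← LinearMap.sum_apply, ← map_sum, hv]
  rw [add_comm]

/-! ### Blocks of a trilinear form -/

/-- The components `A_{ijk} = A(p_i, p_j, r_k)`. -/
def comp (p r : Fin m → V) : Tri V →ₗ[ℂ] Coef m where
  toFun A x := A (p x.1) (p x.2.1) (r x.2.2)
  map_add' _ _ := rfl
  map_smul' _ _ := rfl

omit [FiniteDimensional ℂ V] in
theorem comp_apply (p r : Fin m → V) (A : Tri V) (i j k : Fin m) :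
    comp p r A (i, j, k) = A (p i) (p j) (r k) := rfl

/-- The block of components of `A` relevant to a type. -/
def blk (p q : Fin m → V) : Kind → Tri V →ₗ[ℂ] Coef m
  | .hook => comp p p
  | .trace => comp p q
  | .alt => comp p q
  | .sym => comp p q

omit [FiniteDimensional ℂ V] in
theorem blk_of_ne (p q : Fin m → V) {κ : Kind} (hκ : κ ≠ .hook) : blk p q κ = comp p q := by
  cases κ
  · exact absurd rfl hκ
  all_goals rfl

/-- The component of type `κ` of a form, with respect to the null spaces spanned by `p`, `q`. -/
def cmp (p q : Fin m → V) (κ : Kind) : Tri V →ₗ[ℂ] Coef m := proj κ ∘ₗ blk p q κ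

/-- The form with a given component of type `κ`. -/
def build (g : LinearMap.BilinForm ℂ V) (p q : Fin m → V) : Kind → Coef m → Tri V
  | .hook, t => (1 / 3 : ℂ) • ∑ i, ∑ j, ∑ k, t (i, j, k) • theta g (q i) (q j) (q k)
  | _, t => ∑ i, ∑ j, ∑ k, t (i, j, k) • theta g (q i) (q j) (p k)

omit [FiniteDimensional ℂ V] in
theorem build_hook (t : Coef m) : build g p q .hook t =
    (1 / 3 : ℂ) • ∑ i, ∑ j, ∑ k, t (i, j, k) • theta g (q i) (q j) (q k) := rfl

omit [FiniteDimensional ℂ V] in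
theorem build_of_ne {κ : Kind} (hκ : κ ≠ .hook) (t : Coef m) : build g p q κ t =
    ∑ i, ∑ j, ∑ k, t (i, j, k) • theta g (q i) (q j) (p k) := by
  cases κ
  · exact absurd rfl hκ
  all_goals rfl

omit [FiniteDimensional ℂ V] in
theorem sum_theta_apply (t : Coef m) (u v w : Fin m → V) (x y z : V) :
    (∑ i, ∑ j, ∑ k, t (i, j, k) • theta g (u i) (v j) (w k)) x y z =
      ∑ i, ∑ j, ∑ k, t (i, j, k) * theta g (u i) (v j) (w k) x y z := by
  simp only [LinearMap.sum_apply, LinearMap.smul_apply, smul_eq_mul]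

omit [FiniteDimensional ℂ V] in
theorem sum_kron₃ (t : Coef m) (a b c : Fin m) :
    ∑ i, ∑ j, ∑ k, t (i, j, k) * (kron i a * (kron j b * kron k c)) = t (a, b, c) := by
  simp [kron]

/-! ### Components of the forms built from arrays -/

section
omit [FiniteDimensional ℂ V]
variable (h : Hyp g p q)
include h

/-- On (p, p, q) only the first of the four terms of `theta` survives: each of the others pairs
vectors of the same null space. -/
theorem comp_build_of_ne {κ : Kind} (hκ : κ ≠ .hook) (t : Coef m) :
    comp p q (build g p q κ t) = t := by
  ext ⟨a, b, c⟩
  rw [comp_apply, build_of_ne hκ, sum_theta_apply]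
  simp only [theta_apply, h.pq, h.qp, h.pp, h.qq, mul_zero, zero_mul, sub_zero, add_zero]
  exact sum_kron₃ t a b c

/-- All four terms survive and give three times the projection, whence the factor `1/3` in `build`.
-/
theorem comp_build_hook (t : Coef m) : comp p p (build g p q .hook t) = proj .hook t := by
  ext ⟨a, b, c⟩
  rw [comp_apply, build_hook, LinearMap.smul_apply, LinearMap.smul_apply, LinearMap.smul_apply,
    sum_theta_apply, proj_hook_apply, ← sum_kron₃ t a b c, ← sum_kron₃ t a c b, ← sum_kron₃ t c b a,
    ← sum_kron₃ t b c a, smul_eq_mul]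
  simp only [← Finset.sum_sub_distrib, ← Finset.sum_add_distrib, theta_apply, h.qp]
  congr 1
  refine Finset.sum_congr rfl fun i _ => Finset.sum_congr rfl fun j _ =>
    Finset.sum_congr rfl fun k _ => ?_
  ring

theorem comp_build_of_ne_eq_zero {κ : Kind} (hκ : κ ≠ .hook) (t : Coef m) :
    comp p p (build g p q κ t) = 0 ∧ comp q q (build g p q κ t) = 0 ∧
      comp q p (build g p q κ t) = 0 := by
  refine ⟨?_, ?_, ?_⟩ <;>
  · ext ⟨a, b, c⟩
    rw [comp_apply, build_of_ne hκ, sum_theta_apply]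
    simp only [theta_apply, h.pp, h.qq, mul_zero, zero_mul, sub_zero, add_zero,
      Finset.sum_const_zero, Pi.zero_apply]

theorem comp_build_hook_eq_zero (t : Coef m) :
    comp p q (build g p q .hook t) = 0 ∧ comp q q (build g p q .hook t) = 0 ∧
      comp q p (build g p q .hook t) = 0 := by
  refine ⟨?_, ?_, ?_⟩ <;>
  · ext ⟨a, b, c⟩
    rw [comp_apply, build_hook, LinearMap.smul_apply, LinearMap.smul_apply, LinearMap.smul_apply,
      sum_theta_apply]
    simp only [theta_apply, h.qq, mul_zero, zero_mul, sub_zero, add_zero,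
      Finset.sum_const_zero, Pi.zero_apply, smul_zero]

/-- A form with the symmetries of a Cotton–York tensor is determined by four blocks. -/
theorem tri_eq_zero {A : Tri V} (h1 : ∀ a b c, A a b c = - A a c b)
    (h2 : ∀ a b c, A a b c + A b c a + A c a b = 0) (e1 : comp p p A = 0) (e2 : comp p q A = 0)
    (e3 : comp q p A = 0) (e4 : comp q q A = 0) : A = 0 := by
  have f1 : ∀ i j k, A (p i) (p j) (p k) = 0 := fun i j k => congrFun e1 (i, j, k)
  have f2 : ∀ i j k, A (p i) (p j) (q k) = 0 := fun i j k => congrFun e2 (i, j, k)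
  have f3 : ∀ i j k, A (q i) (q j) (p k) = 0 := fun i j k => congrFun e3 (i, j, k)
  have f4 : ∀ i j k, A (q i) (q j) (q k) = 0 := fun i j k => congrFun e4 (i, j, k)
  -- The other four arrangements of the arguments reduce to the four blocks, by skewness in the last
  -- two slots and then by the cyclic identity.
  have f5 : ∀ i j k, A (p i) (q j) (p k) = 0 := fun i j k => by rw [h1, f2, neg_zero]
  have f6 : ∀ i j k, A (q i) (p j) (q k) = 0 := fun i j k => by rw [h1, f3, neg_zero]
  have f7 : ∀ i j k, A (q i) (p j) (p k) = 0 := fun i j k => by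
    have := h2 (q i) (p j) (p k); rwa [f2, f5, add_zero, add_zero] at this
  have f8 : ∀ i j k, A (p i) (q j) (q k) = 0 := fun i j k => by
    have := h2 (p i) (q j) (q k); rwa [f3, f6, add_zero, add_zero] at this
  ext x y z
  rw [h.expand x, h.expand y, h.expand z]
  simp only [map_add, map_sum, map_smul, LinearMap.add_apply, LinearMap.sum_apply,
    LinearMap.smul_apply, f1, f2, f3, f4, f5, f6, f7, f8, smul_zero, Finset.sum_const_zero,
    LinearMap.zero_apply, add_zero]

end

theorem trace_eq (h : Hyp g p q) {A : Tri V} (c : V) :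
    ∑ i, A (frame V i) (coframe g hg i) c = ∑ i, (A (p i) (q i) c + A (q i) (p i) c) := by
  have := sum_frame hg h (A.compr₂ (LinearMap.applyₗ c))
  simpa only [LinearMap.compr₂_apply, LinearMap.applyₗ_apply_apply] using this

omit [FiniteDimensional ℂ V] in
-- Skewness turns A(p_i, q_i, p_k) into -A(p_i, p_k, q_i), and the cyclic identity turns A(q_i, p_i,
-- p_k) into A(p_k, p_i, q_i) - A(p_i, p_k, q_i). This is the origin of the factor 2 in `tr1 = 2
-- tr2`.
theorem trace_left {A : Tri V} (h1 : ∀ a b c, A a b c = - A a c b)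
    (h2 : ∀ a b c, A a b c + A b c a + A c a b = 0) (k : Fin m) :
    ∑ i, (A (p i) (q i) (p k) + A (q i) (p i) (p k)) =
      tr1 (comp p q A) k - 2 * tr2 (comp p q A) k := by
  simp only [tr1_apply, tr2_apply, comp_apply, Finset.mul_sum, ← Finset.sum_sub_distrib]
  refine Finset.sum_congr rfl fun i _ => ?_
  linear_combination h1 (p i) (q i) (p k) + h2 (q i) (p i) (p k) -
    h1 (p k) (q i) (p i) - h1 (p i) (p k) (q i) + h1 (p i) (p k) (q i)

theorem mem_cottonYork_iff (h : Hyp g p q) {A : Tri V} : A ∈ cottonYork g hg ↔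
    (∀ a b c, A a b c = - A a c b) ∧ (∀ a b c, A a b c + A b c a + A c a b = 0) ∧
    tr1 (comp p q A) = (2 : ℂ) • tr2 (comp p q A) ∧
    tr1 (comp q p A) = (2 : ℂ) • tr2 (comp q p A) := by
  rw [mem_cottonYork]
  refine and_congr_right fun h1 => and_congr_right fun h2 => ?_
  have e : ∀ k, ∑ i, (A (p i) (q i) (q k) + A (q i) (p i) (q k)) =
      tr1 (comp q p A) k - 2 * tr2 (comp q p A) k := by
    intro k; rw [← trace_left h1 h2 k]
    exact Finset.sum_congr rfl fun i _ => add_comm _ _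
  simp only [trace_eq h]
  constructor
  · intro h3
    refine ⟨?_, ?_⟩ <;> ext k
    · have := trace_left (p := p) (q := q) h1 h2 k
      rw [h3] at this
      simp only [Pi.smul_apply, smul_eq_mul]; linear_combination -this
    · have := e k
      rw [h3] at this
      simp only [Pi.smul_apply, smul_eq_mul]; linear_combination -this
  · rintro ⟨h3, h4⟩ c
    have e1 : ∀ k, ∑ i, (A (p i) (q i) (p k) + A (q i) (p i) (p k)) = 0 := by
      intro k; rw [trace_left h1 h2, h3]; simp
    have e2 : ∀ k, ∑ i, (A (p i) (q i) (q k) + A (q i) (p i) (q k)) = 0 := by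
      intro k; rw [e, h4]; simp
    let f : V →ₗ[ℂ] ℂ := ∑ i, (A (p i) (q i) + A (q i) (p i))
    have hf : ∀ c, f c = ∑ i, (A (p i) (q i) c + A (q i) (p i) c) := by
      intro c; simp [f]
    have f1 : ∀ k, f (p k) = 0 := fun k => by rw [hf, e1]
    have f2 : ∀ k, f (q k) = 0 := fun k => by rw [hf, e2]
    rw [← hf, h.expand c]
    simp only [map_add, map_sum, map_smul, f1, f2, smul_zero, Finset.sum_const_zero, add_zero]

omit [FiniteDimensional ℂ V] in
theorem theta_anti (u v w a b c : V) : theta g u v w a b c = - theta g u v w a c b := by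
  simp only [theta_apply]; ring

omit [FiniteDimensional ℂ V] in
theorem theta_cyc (u v w a b c : V) :
    theta g u v w a b c + theta g u v w b c a + theta g u v w c a b = 0 := by
  simp only [theta_apply]; ring

omit [FiniteDimensional ℂ V] in
theorem build_anti (κ : Kind) (t : Coef m) (a b c : V) :
    build g p q κ t a b c = - build g p q κ t a c b := by
  by_cases hκ : κ = .hook
  · subst hκ
    rw [build_hook]
    simp only [LinearMap.smul_apply, sum_theta_apply, theta_anti _ _ _ a b c, mul_neg,
      Finset.sum_neg_distrib, smul_neg]
  · rw [build_of_ne hκ]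
    simp only [sum_theta_apply, theta_anti _ _ _ a b c, mul_neg, Finset.sum_neg_distrib]

omit [FiniteDimensional ℂ V] in
theorem build_cyc (κ : Kind) (t : Coef m) (a b c : V) :
    build g p q κ t a b c + build g p q κ t b c a + build g p q κ t c a b = 0 := by
  by_cases hκ : κ = .hook
  · subst hκ
    rw [build_hook]
    simp only [LinearMap.smul_apply, sum_theta_apply, smul_eq_mul, ← mul_add,
      ← Finset.sum_add_distrib, theta_cyc, mul_zero, Finset.sum_const_zero]
  · rw [build_of_ne hκ]
    simp only [sum_theta_apply, ← mul_add,
      ← Finset.sum_add_distrib, theta_cyc, mul_zero, Finset.sum_const_zero]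

/-! ### Components separate Cotton–York tensors -/

section
variable (hm : 3 ≤ m) (h : Hyp g p q)
include hm h

theorem build_mem (κ : Kind) (t : Coef m) : build g p q κ (proj κ t) ∈ cottonYork g hg := by
  rw [mem_cottonYork_iff h]
  refine ⟨build_anti κ _, build_cyc κ _, ?_⟩
  by_cases hκ : κ = .hook
  · subst hκ
    rw [(comp_build_hook_eq_zero h _).1, (comp_build_hook_eq_zero h _).2.2]
    simp
  · rw [comp_build_of_ne h hκ, (comp_build_of_ne_eq_zero h hκ _).2.2]
    exact ⟨tr_proj hm hκ t, by simp⟩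

theorem cmp_build_self (κ : Kind) (t : Coef m) :
    cmp p q κ (build g p q κ (proj κ t)) = proj κ t := by
  by_cases hκ : κ = .hook
  · subst hκ
    rw [cmp, LinearMap.comp_apply, blk, comp_build_hook h, proj_idem hm, proj_idem hm]
  · rw [cmp, LinearMap.comp_apply, blk_of_ne p q hκ, comp_build_of_ne h hκ, proj_idem hm]

theorem cmp_build_ne {κ μ : Kind} (hκμ : μ ≠ κ) (t : Coef m) :
    cmp p q μ (build g p q κ (proj κ t)) = 0 := by
  rw [cmp, LinearMap.comp_apply]
  by_cases hκ : κ = .hook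
  · subst hκ
    rw [blk_of_ne p q hκμ, (comp_build_hook_eq_zero h _).1, map_zero]
  by_cases hμ : μ = .hook
  · subst hμ
    rw [blk, (comp_build_of_ne_eq_zero h hκ _).1, map_zero]
  rw [blk_of_ne p q hμ, comp_build_of_ne h hκ, proj_proj hm hκμ hμ hκ]

omit hm in
theorem cmp_swap_build (κ μ : Kind) (t : Coef m) :
    cmp q p μ (build g p q κ t) = 0 := by
  rw [cmp, LinearMap.comp_apply]
  by_cases hκ : κ = .hook
  · subst hκ
    cases μ <;> simp only [blk, comp_build_hook_eq_zero h, map_zero]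
  cases μ <;> simp only [blk, comp_build_of_ne_eq_zero h hκ, map_zero]

omit hm in
theorem proj_hook_comp {A : Tri V} (hA : A ∈ cottonYork g hg) :
    proj .hook (comp p p A) = comp p p A := by
  rw [mem_cottonYork] at hA
  exact proj_hook_eq_self _ (fun i j k => hA.1 _ _ _) (fun i j k => hA.2.1 _ _ _)

omit hm in
theorem cmp_hook {A : Tri V} (hA : A ∈ cottonYork g hg) : cmp p q .hook A = comp p p A :=
  proj_hook_comp h hA

theorem sum_cmp {A : Tri V} (hA : A ∈ cottonYork g hg) :
    cmp p q .trace A + cmp p q .alt A + cmp p q .sym A = comp p q A := by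
  rw [mem_cottonYork_iff h] at hA
  exact proj_add hm _ hA.2.2.1

theorem eq_zero_of_cmp {A : Tri V} (hA : A ∈ cottonYork g hg) (h1 : ∀ κ, cmp p q κ A = 0)
    (h2 : ∀ κ, cmp q p κ A = 0) : A = 0 := by
  have hA' := mem_cottonYork.1 hA
  refine tri_eq_zero h hA'.1 hA'.2.1 ?_ ?_ ?_ ?_
  · rw [← cmp_hook h hA, h1]
  · rw [← sum_cmp hm h hA, h1, h1, h1, add_zero, add_zero]
  · rw [← sum_cmp hm h.swap hA, h2, h2, h2, add_zero, add_zero]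
  · rw [← cmp_hook h.swap hA, h2]

end

/-! ### The action on components -/

/-- The remainders `d` and `e` measure the failure of `X` to preserve the two null spaces. They are
harmless when `A` vanishes on them, which lets the lemma serve both 𝔤₀, where they are zero, and 𝔭
acting on a lowest component. -/
theorem blk_lie {X : so g} {x : Fin m → Fin m → ℂ} {d e : Fin m → V}
    (hp : ∀ i, ⁅X, p i⁆ = ∑ l, x l i • p l + d i) (hq : ∀ k, ⁅X, q k⁆ = - ∑ l, x k l • q l + e k)
    (κ : Kind) {A : Tri V}
    (h1 : κ = .hook → ∀ i j k, A (d i) (p j) (p k) = 0 ∧ A (p i) (d j) (p k) = 0 ∧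
      A (p i) (p j) (d k) = 0)
    (h2 : κ ≠ .hook → ∀ i j k, A (d i) (p j) (q k) = 0 ∧ A (p i) (d j) (q k) = 0 ∧
      A (p i) (p j) (e k) = 0) :
    blk p q κ ⁅X, A⁆ = rho x κ (blk p q κ A) := by
  by_cases hκ : κ = .hook
  · subst hκ
    ext ⟨i, j, k⟩
    obtain ⟨f1, -, -⟩ := h1 rfl i j k
    obtain ⟨-, f2, -⟩ := h1 rfl i j k
    obtain ⟨-, -, f3⟩ := h1 rfl i j k
    rw [rho_hook]
    simp only [blk, comp_apply, lie_tri, hp, map_add, map_sum, map_smul, LinearMap.add_apply,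
      LinearMap.sum_apply, LinearMap.smul_apply, smul_eq_mul, f1, f2, f3, add_zero]
  · ext ⟨i, j, k⟩
    obtain ⟨f1, f2, f3⟩ := h2 hκ i j k
    rw [rho_of_ne x hκ, blk_of_ne p q hκ]
    simp only [comp_apply, lie_tri, hp, hq, map_add, map_sum, map_smul, LinearMap.add_apply,
      LinearMap.sum_apply, LinearMap.smul_apply, smul_eq_mul, f1, f2, f3, add_zero, map_neg]
    ring

theorem cmp_lie {X : so g} {x : Fin m → Fin m → ℂ} {d e : Fin m → V}
    (hp : ∀ i, ⁅X, p i⁆ = ∑ l, x l i • p l + d i) (hq : ∀ k, ⁅X, q k⁆ = - ∑ l, x k l • q l + e k)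
    (κ : Kind) {A : Tri V}
    (h1 : κ = .hook → ∀ i j k, A (d i) (p j) (p k) = 0 ∧ A (p i) (d j) (p k) = 0 ∧
      A (p i) (p j) (d k) = 0)
    (h2 : κ ≠ .hook → ∀ i j k, A (d i) (p j) (q k) = 0 ∧ A (p i) (d j) (q k) = 0 ∧
      A (p i) (p j) (e k) = 0) :
    cmp p q κ ⁅X, A⁆ = rho x κ (cmp p q κ A) := by
  rw [cmp, LinearMap.comp_apply, blk_lie hp hq κ h1 h2, proj_rho, LinearMap.comp_apply]

end Tri

/-! ### The maps `Π_i^j` in a hyperbolic basis -/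

section PiMaps

variable {V : Type*} [AddCommGroup V] [Module ℂ V] [FiniteDimensional ℂ V]
variable {S : Type*} [AddCommGroup S] [Module ℂ S]
variable {g : LinearMap.BilinForm ℂ V} [Module (CliffordAlgebra (cliffordForm g)) S]
  [IsScalarTower ℂ (CliffordAlgebra (cliffordForm g)) S]
variable (hs : g.IsSymm) (hg : g.Nondegenerate) {ξ : S}
variable {m : ℕ} {p q : Fin m → V} (h : Hyp g p q) (hξ : ξ ≠ 0) (hp : ∀ i, gamma S g (p i) ξ = 0)

theorem gamma_gamma (hs : g.IsSymm) (u v : V) (s : S) :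
    gamma S g u (gamma S g v s) = (-2 * g u v) • s - gamma S g v (gamma S g u s) := by
  have := congrArg (fun f => f s) (gamma_anticomm (S := S) g hs u v)
  simp only [LinearMap.add_apply, Module.End.mul_apply, LinearMap.smul_apply,
    Module.End.one_apply] at this
  rw [← this]; abel

include hs h hp in
theorem gamma_p_q (i j : Fin m) :
    gamma S g (p i) (gamma S g (q j) ξ) = (-2 * kron i j) • ξ := by
  rw [gamma_gamma hs, hp, map_zero, sub_zero, h.pq]

include h hp in
theorem gamma_xi (v : V) : gamma S g v ξ = ∑ i, g (p i) v • gamma S g (q i) ξ := by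
  conv_lhs => rw [h.expand v]
  simp only [map_add, map_sum, map_smul, LinearMap.add_apply, LinearMap.sum_apply,
    LinearMap.smul_apply, hp, smul_zero, Finset.sum_const_zero, zero_add]

include h in
theorem sum_gamma {M : Type*} [AddCommGroup M] [Module ℂ M] (l : V →ₗ[ℂ] ℂ) (s : S)
    (T : S →ₗ[ℂ] M) :
    ∑ a, l (frame V a) • T (gamma S g (coframe g hg a) s) =
      ∑ i, (l (p i) • T (gamma S g (q i) s) + l (q i) • T (gamma S g (p i) s)) := by
  have := sum_frame hg h (l.smulRight (T ∘ₗ (gamma S g).flip s))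
  simpa only [LinearMap.smulRight_apply, LinearMap.smul_apply, LinearMap.comp_apply,
    LinearMap.flip_apply] using this

include h hp in
-- As the vectors `p i` annihilate `ξ`, contraction with ξ^{aA} sees a form only through its values
-- on the null plane.
theorem sum_xi₁ {M : Type*} [AddCommGroup M] [Module ℂ M] (l : V →ₗ[ℂ] ℂ) (T : S →ₗ[ℂ] M) :
    ∑ a, l (frame V a) • T (xi₁ g hg ξ a) = ∑ i, l (p i) • T (gamma S g (q i) ξ) := by
  simp only [xi₁]
  rw [sum_gamma hg h]
  simp only [hp, map_zero, smul_zero, add_zero]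

include hs h hp in
-- The multiple of `ξ` comes from the mixed terms, where p_i·q_j·ξ = -2δ_ij ξ; it is how a trace
-- enters the maps Π.
theorem sum_xi₂ (D : V →ₗ[ℂ] V →ₗ[ℂ] ℂ) (hD : ∀ a b, D a b = - D b a) :
    ∑ b, ∑ c, D (frame V b) (frame V c) • xi₂ g hg ξ b c =
      ∑ j, ∑ k, D (p j) (p k) • gamma S g (q k) (gamma S g (q j) ξ) -
        (2 * ∑ b, D (p b) (q b)) • ξ := by
  have e1 : ∑ b, ∑ c, D (frame V b) (frame V c) •
      gamma S g (coframe g hg c) (gamma S g (coframe g hg b) ξ) =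
      ∑ j, ∑ k, D (p j) (p k) • gamma S g (q k) (gamma S g (q j) ξ) -
        (2 * ∑ b, D (p b) (q b)) • ξ := by
    rw [Finset.sum_comm]
    have e2 : ∀ c, ∑ b, D (frame V b) (frame V c) •
        gamma S g (coframe g hg c) (gamma S g (coframe g hg b) ξ) =
        ∑ j, D (p j) (frame V c) • gamma S g (coframe g hg c) (gamma S g (q j) ξ) := fun c =>
      sum_xi₁ hg h hp (D.flip (frame V c)) (gamma S g (coframe g hg c))
    simp only [e2]
    rw [Finset.sum_comm, sub_eq_add_neg, ← neg_smul, ← mul_neg, ← Finset.sum_neg_distrib,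
      Finset.mul_sum, Finset.sum_smul, ← Finset.sum_add_distrib]
    refine Finset.sum_congr rfl fun j _ => ?_
    have := sum_gamma hg h (D (p j)) (gamma S g (q j) ξ) LinearMap.id
    simp only [LinearMap.id_apply] at this
    rw [this, Finset.sum_add_distrib]
    congr 1
    simp only [gamma_p_q hs h hp, smul_smul]
    rw [← Finset.sum_smul]
    congr 1
    have : ∀ i, D (p j) (q i) * (-2 * kron i j) = -2 * (D (p j) (q i) * kron i j) := by
      intro i; ring
    simp only [this, ← Finset.mul_sum, sum_mul_kron']; ring
  -- By skewness of `D` the two halves of ξ^{bcD'} contribute equally, which absorbs the factor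
  -- `1/2`.
  have e3 : ∑ b, ∑ c, D (frame V b) (frame V c) •
      gamma S g (coframe g hg b) (gamma S g (coframe g hg c) ξ) =
      - ∑ b, ∑ c, D (frame V b) (frame V c) •
      gamma S g (coframe g hg c) (gamma S g (coframe g hg b) ξ) := by
    rw [Finset.sum_comm, ← Finset.sum_neg_distrib]
    refine Finset.sum_congr rfl fun c _ => ?_
    rw [← Finset.sum_neg_distrib]
    refine Finset.sum_congr rfl fun b _ => ?_
    rw [hD, neg_smul]
  rw [← e1]
  simp only [xi₂, smul_comm _ (1 / 2 : ℂ), smul_sub, ← Finset.smul_sum, Finset.sum_sub_distrib]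
  rw [e3]
  rw [smul_neg, sub_neg_eq_add, ← add_smul]; norm_num

include hs h hξ hp in
/-- The spinors `q_i · ξ` are linearly independent. -/
theorem exists_dual : ∃ f : Fin m → S →ₗ[ℂ] ℂ, ∀ i j, f i (gamma S g (q j) ξ) = kron i j := by
  obtain ⟨φ, hφ⟩ : ∃ φ : Module.Dual ℂ S, φ ξ ≠ 0 := by
    by_contra hcon
    push Not at hcon
    exact hξ ((Module.forall_dual_apply_eq_zero_iff ℂ ξ).1 hcon)
  -- Multiplication by `p i` sends `q j · ξ` to `-2 δ_ij ξ`, and the scalar normalises the value of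
  -- `φ` there.
  refine ⟨fun i => (-(1 / 2) * (φ ξ)⁻¹) • (φ ∘ₗ gamma S g (p i)), fun i j => ?_⟩
  rw [LinearMap.smul_apply, LinearMap.comp_apply, gamma_p_q hs h hp, map_smul, smul_eq_mul,
    smul_eq_mul]
  field_simp

include hs h hξ hp in
theorem tmul_independent {M : Type*} [AddCommGroup M] [Module ℂ M] {t : Fin m → M}
    (ht : ∑ i, gamma S g (q i) ξ ⊗ₜ[ℂ] t i = 0) (i : Fin m) : t i = 0 := by
  obtain ⟨f, hf⟩ := exists_dual hs h hξ hp
  have := congrArg (fun x => TensorProduct.lid ℂ M (TensorProduct.map (f i) LinearMap.id x)) ht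
  simpa [hf, kron] using this

include hs h hξ hp in
theorem xi_independent {t : Fin m → ℂ}
    (ht : ∑ i, t i • gamma S g (q i) ξ = 0) (i : Fin m) : t i = 0 := by
  obtain ⟨f, hf⟩ := exists_dual hs h hξ hp
  have := congrArg (f i) ht
  simpa [hf, kron] using this

include hs h hξ hp in
theorem tmul_independent₂ {t : Fin m → Fin m → ℂ}
    (ht : ∑ i, ∑ j, t i j • (gamma S g (q i) ξ ⊗ₜ[ℂ] gamma S g (q j) ξ) = 0) (i j : Fin m) :
    t i j = 0 := by
  have h1 : ∑ i, gamma S g (q i) ξ ⊗ₜ[ℂ] (∑ j, t i j • gamma S g (q j) ξ) = 0 := by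
    rw [← ht]; simp only [TensorProduct.tmul_sum, TensorProduct.tmul_smul]
  exact xi_independent hs h hξ hp (tmul_independent hs h hξ hp h1 i) j

variable {A : Tri V} (hA : A ∈ cottonYork g hg)

include h hp in
theorem piM3_0_eq (A : Tri V) : piM3_0 g hg ξ A = ∑ i, gamma S g (q i) ξ ⊗ₜ[ℂ]
    ∑ j, gamma S g (q j) ξ ⊗ₜ[ℂ] ∑ k, A (p i) (p j) (p k) • gamma S g (q k) ξ := by
  have e1 : ∀ a b, ∑ c, A (frame V a) (frame V b) (frame V c) •
      (xi₁ g hg ξ a ⊗ₜ[ℂ] (xi₁ g hg ξ b ⊗ₜ[ℂ] xi₁ g hg ξ c)) =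
      ∑ k, A (frame V a) (frame V b) (p k) •
      (xi₁ g hg ξ a ⊗ₜ[ℂ] (xi₁ g hg ξ b ⊗ₜ[ℂ] gamma S g (q k) ξ)) := fun a b =>
    sum_xi₁ hg h hp (A (frame V a) (frame V b))
      (TensorProduct.mk ℂ S (S ⊗[ℂ] S) (xi₁ g hg ξ a) ∘ₗ TensorProduct.mk ℂ S S (xi₁ g hg ξ b))
  have e2 : ∀ a k, ∑ b, A (frame V a) (frame V b) (p k) •
      (xi₁ g hg ξ a ⊗ₜ[ℂ] (xi₁ g hg ξ b ⊗ₜ[ℂ] gamma S g (q k) ξ)) =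
      ∑ j, A (frame V a) (p j) (p k) •
      (xi₁ g hg ξ a ⊗ₜ[ℂ] (gamma S g (q j) ξ ⊗ₜ[ℂ] gamma S g (q k) ξ)) := fun a k =>
    sum_xi₁ hg h hp ((A (frame V a)).flip (p k))
      (TensorProduct.mk ℂ S (S ⊗[ℂ] S) (xi₁ g hg ξ a) ∘ₗ
        (TensorProduct.mk ℂ S S).flip (gamma S g (q k) ξ))
  have e3 : ∀ j k, ∑ a, A (frame V a) (p j) (p k) •
      (xi₁ g hg ξ a ⊗ₜ[ℂ] (gamma S g (q j) ξ ⊗ₜ[ℂ] gamma S g (q k) ξ)) =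
      ∑ i, A (p i) (p j) (p k) •
      (gamma S g (q i) ξ ⊗ₜ[ℂ] (gamma S g (q j) ξ ⊗ₜ[ℂ] gamma S g (q k) ξ)) := fun j k =>
    sum_xi₁ hg h hp ((A.flip (p j)).flip (p k))
      ((TensorProduct.mk ℂ S (S ⊗[ℂ] S)).flip (gamma S g (q j) ξ ⊗ₜ[ℂ] gamma S g (q k) ξ))
  have f1 : ∀ a, ∑ b, ∑ c, A (frame V a) (frame V b) (frame V c) •
      (xi₁ g hg ξ a ⊗ₜ[ℂ] (xi₁ g hg ξ b ⊗ₜ[ℂ] xi₁ g hg ξ c)) =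
      ∑ j, ∑ k, A (frame V a) (p j) (p k) •
      (xi₁ g hg ξ a ⊗ₜ[ℂ] (gamma S g (q j) ξ ⊗ₜ[ℂ] gamma S g (q k) ξ)) := by
    intro a
    simp only [e1]
    rw [Finset.sum_comm]
    simp only [e2]
    rw [Finset.sum_comm]
  rw [piM3_0]
  simp only [f1]
  rw [Finset.sum_comm, Finset.sum_congr rfl fun j _ => Finset.sum_comm]
  simp only [e3]
  rw [Finset.sum_congr rfl fun j _ => Finset.sum_comm, Finset.sum_comm]
  simp only [TensorProduct.tmul_sum, TensorProduct.tmul_smul]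

include hs h hξ hp in
theorem piM3_0_eq_zero : piM3_0 g hg ξ A = 0 ↔ comp p p A = 0 := by
  rw [piM3_0_eq hg h hp]
  constructor
  · intro h0
    ext ⟨i, j, k⟩
    exact xi_independent hs h hξ hp
      (tmul_independent hs h hξ hp (tmul_independent hs h hξ hp h0 i) j) k
  · intro h0
    have : ∀ i j k, A (p i) (p j) (p k) = 0 := fun i j k => congrFun h0 (i, j, k)
    simp [this]

/-- The trace `∑ b, A(a, p_b, q_b)`. -/
def tau (p q : Fin m → V) (A : Tri V) (a : V) : ℂ := ∑ b, A a (p b) (q b)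

include hA hs h hp in
theorem piP1_0_eq (a : V) : piP1_0 g hg ξ A a =
    ∑ j, ∑ k, A a (p j) (p k) • gamma S g (q k) (gamma S g (q j) ξ) -
        (2 * tau p q A a) • ξ :=
  sum_xi₂ hs hg h hp (A a) fun b c => (mem_cottonYork.1 hA).1 a b c

include hA hs h hp in
theorem piP1_0_of_vanish {a : V} (h0 : ∀ i j, A a (p i) (p j) = 0) : piP1_0 g hg ξ A a =
    (-2 * tau p q A a) • ξ := by
  rw [piP1_0_eq hs hg h hp hA]
  simp [h0]

include hA hs h hξ hp in
-- The spinor is a combination of the q_k·q_j·ξ plus a multiple of ξ. Multiplying by two vectors of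
-- the null plane isolates the first part; what remains is the trace.
theorem piP1_0_eq_zero {a : V} : piP1_0 g hg ξ A a = 0 ↔
    (∀ i j, A a (p i) (p j) = 0) ∧ tau p q A a = 0 := by
  constructor
  · intro h0
    have key : ∀ i j, A a (p j) (p i) = 0 := by
      intro i j
      have h1 := piP1_0_eq hs hg h hp hA a
      rw [h0] at h1
      -- The product p_j·p_i· annihilates ξ and maps q_c·q_b·ξ to a multiple of ξ, so it extracts
      -- the coefficient A(a, p_j, p_i), with factor 8 after skew-symmetry.
      have h2 := congrArg (fun s => gamma S g (p j) (gamma S g (p i) s)) h1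
      have h3 : ∀ b c, gamma S g (p j) (gamma S g (p i)
          (gamma S g (q c) (gamma S g (q b) ξ))) =
          (4 * (kron i c * kron j b - kron i b * kron j c)) • ξ := by
        intro b c
        rw [gamma_gamma hs (p i), gamma_p_q hs h hp, h.pq, map_smul, map_sub, map_smul, map_smul,
          gamma_p_q hs h hp, gamma_p_q hs h hp, smul_smul, smul_smul, ← sub_smul]
        congr 1; ring
      simp only [map_zero, map_sub, map_sum, map_smul, h3, hp, smul_zero, sub_zero, smul_smul,
        ← Finset.sum_smul] at h2
      have h4 := (smul_eq_zero.1 h2.symm).resolve_right hξ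
      have h5 : ∑ b, ∑ c, A a (p b) (p c) * (4 * (kron i c * kron j b - kron i b * kron j c)) =
          4 * (A a (p j) (p i) - A a (p i) (p j)) := by
        have : ∀ b c, A a (p b) (p c) * (4 * (kron i c * kron j b - kron i b * kron j c)) =
          4 * ((A a (p b) (p c) * kron i c) * kron j b - (A a (p b) (p c) * kron j c) * kron i b) := by
          intro b c; ring
        simp only [this, ← Finset.mul_sum, Finset.sum_sub_distrib, ← Finset.sum_mul, sum_mul_kron]
      rw [h5] at h4
      have h6 := (mem_cottonYork.1 hA).1 a (p j) (p i)
      linear_combination (1 / 8) * h4 + (1 / 2) * h6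
    refine ⟨fun i j => key j i, ?_⟩
    rw [piP1_0_of_vanish hs hg h hp hA fun i j => key j i] at h0
    have := (smul_eq_zero.1 h0).resolve_right hξ
    linear_combination (-1 / 2) * this
  · rintro ⟨h1, h2⟩
    rw [piP1_0_of_vanish hs hg h hp hA h1, h2]; simp

include h hp in
theorem piM1_0_eq (A : Tri V) : piM1_0 g hg ξ A =
    ∑ i, gamma S g (q i) ξ ⊗ₜ[ℂ] piP1_0 g hg ξ A (p i) := by
  have e1 : ∀ b c, ∑ a, A (frame V a) (frame V b) (frame V c) •
      (xi₁ g hg ξ a ⊗ₜ[ℂ] xi₂ g hg ξ b c) =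
      ∑ i, A (p i) (frame V b) (frame V c) • (gamma S g (q i) ξ ⊗ₜ[ℂ] xi₂ g hg ξ b c) := fun b c =>
    sum_xi₁ hg h hp ((A.flip (frame V b)).flip (frame V c))
      ((TensorProduct.mk ℂ S S).flip (xi₂ g hg ξ b c))
  rw [piM1_0, Finset.sum_comm, Finset.sum_congr rfl fun b _ => Finset.sum_comm]
  simp only [e1, piP1_0, TensorProduct.tmul_sum, TensorProduct.tmul_smul]
  rw [Finset.sum_congr rfl fun b _ => Finset.sum_comm, Finset.sum_comm]

include h hp in
theorem sum_gamma_xi₂ (A : Tri V) (v : V) :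
    ∑ d, ∑ b, ∑ c, A (frame V d) (frame V b) (frame V c) •
        (gamma S g v (xi₂ g hg ξ b c) ⊗ₜ[ℂ] xi₁ g hg ξ d) =
    ∑ i, gamma S g v (piP1_0 g hg ξ A (p i)) ⊗ₜ[ℂ] gamma S g (q i) ξ := by
  have e1 : ∀ b c, ∑ d, A (frame V d) (frame V b) (frame V c) •
      (gamma S g v (xi₂ g hg ξ b c) ⊗ₜ[ℂ] xi₁ g hg ξ d) =
      ∑ i, A (p i) (frame V b) (frame V c) •
        (gamma S g v (xi₂ g hg ξ b c) ⊗ₜ[ℂ] gamma S g (q i) ξ) := fun b c =>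
    sum_xi₁ hg h hp ((A.flip (frame V b)).flip (frame V c))
      (TensorProduct.mk ℂ S S (gamma S g v (xi₂ g hg ξ b c)))
  rw [Finset.sum_comm, Finset.sum_congr rfl fun b _ => Finset.sum_comm]
  simp only [e1, piP1_0, TensorProduct.sum_tmul, map_sum, map_smul, ← TensorProduct.smul_tmul']
  rw [Finset.sum_congr rfl fun b _ => Finset.sum_comm, Finset.sum_comm]

include h hp in
theorem sum_xi₁_xi₁ (D : V →ₗ[ℂ] V →ₗ[ℂ] ℂ) :
    ∑ b, ∑ c, D (frame V b) (frame V c) • (xi₁ g hg ξ b ⊗ₜ[ℂ] xi₁ g hg ξ c) =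
      ∑ j, ∑ k, D (p j) (p k) • (gamma S g (q j) ξ ⊗ₜ[ℂ] gamma S g (q k) ξ) := by
  have e1 : ∀ b, ∑ c, D (frame V b) (frame V c) • (xi₁ g hg ξ b ⊗ₜ[ℂ] xi₁ g hg ξ c) =
      ∑ k, D (frame V b) (p k) • (xi₁ g hg ξ b ⊗ₜ[ℂ] gamma S g (q k) ξ) := fun b =>
    sum_xi₁ hg h hp (D (frame V b)) (TensorProduct.mk ℂ S S (xi₁ g hg ξ b))
  have e2 : ∀ k, ∑ b, D (frame V b) (p k) • (xi₁ g hg ξ b ⊗ₜ[ℂ] gamma S g (q k) ξ) =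
      ∑ j, D (p j) (p k) • (gamma S g (q j) ξ ⊗ₜ[ℂ] gamma S g (q k) ξ) := fun k =>
    sum_xi₁ hg h hp (D.flip (p k)) ((TensorProduct.mk ℂ S S).flip (gamma S g (q k) ξ))
  simp only [e1]
  rw [Finset.sum_comm]
  simp only [e2]
  rw [Finset.sum_comm]

theorem comm_sum (t : Fin m → Fin m → ℂ) (s : Fin m → S) :
    TensorProduct.comm ℂ S S (∑ j, ∑ k, t j k • (s j ⊗ₜ[ℂ] s k)) =
      ∑ j, ∑ k, t k j • (s j ⊗ₜ[ℂ] s k) := by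
  simp only [map_sum, map_smul, TensorProduct.comm_tmul]
  rw [Finset.sum_comm]

theorem altPart_sum (t : Fin m → Fin m → ℂ) (s : Fin m → S) :
    altPart (∑ j, ∑ k, t j k • (s j ⊗ₜ[ℂ] s k)) =
      ∑ j, ∑ k, ((1 / 2) * (t j k - t k j)) • (s j ⊗ₜ[ℂ] s k) := by
  rw [altPart, comm_sum]
  simp only [← Finset.sum_sub_distrib, Finset.smul_sum, ← sub_smul, smul_smul]

theorem symPart_sum (t : Fin m → Fin m → ℂ) (s : Fin m → S) :
    symPart (∑ j, ∑ k, t j k • (s j ⊗ₜ[ℂ] s k)) =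
      ∑ j, ∑ k, ((1 / 2) * (t j k + t k j)) • (s j ⊗ₜ[ℂ] s k) := by
  rw [symPart, comm_sum]
  simp only [← Finset.sum_add_distrib, Finset.smul_sum, ← add_smul, smul_smul]

/-! ### The maps Π_{-1/2} on tensors whose lowest block vanishes -/

section Level1

variable (h0 : comp p p A = 0)

theorem comp_vanish {p r : Fin m → V} (h0 : comp p r A = 0) (i j k : Fin m) :
    A (p i) (p j) (r k) = 0 := congrFun h0 (i, j, k)

include h hp hs hA h0 in
theorem sum_gamma_xi₂_of (v : V) :
    ∑ d, ∑ b, ∑ c, A (frame V d) (frame V b) (frame V c) •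
        (gamma S g v (xi₂ g hg ξ b c) ⊗ₜ[ℂ] xi₁ g hg ξ d) =
    ∑ j, ∑ k, (-2 * (g (p j) v * tau p q A (p k))) •
      (gamma S g (q j) ξ ⊗ₜ[ℂ] gamma S g (q k) ξ) := by
  rw [sum_gamma_xi₂ hg h hp, Finset.sum_comm]
  refine Finset.sum_congr rfl fun k _ => ?_
  rw [piP1_0_of_vanish hs hg h hp hA (comp_vanish h0 k), map_smul, gamma_xi h hp, Finset.smul_sum,
    TensorProduct.sum_tmul]
  refine Finset.sum_congr rfl fun j _ => ?_
  rw [smul_smul, ← TensorProduct.smul_tmul']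
  congr 1; ring

include h hp hs hA h0 in
theorem piM1_1_eq (v : V) : piM1_1 g hg ξ A v =
    ∑ j, ∑ k, (A v (p j) (p k) - (1 / ((finrank ℂ V : ℂ) - 2)) *
      (g (p j) v * tau p q A (p k) - g (p k) v * tau p q A (p j))) •
      (gamma S g (q j) ξ ⊗ₜ[ℂ] gamma S g (q k) ξ) := by
  rw [piM1_1, sum_gamma_xi₂_of hs hg h hp hA h0, sum_xi₁_xi₁ hg h hp, altPart_sum]
  simp only [Finset.smul_sum, ← Finset.sum_add_distrib, smul_smul, ← add_smul]
  refine Finset.sum_congr rfl fun j _ => Finset.sum_congr rfl fun k _ => ?_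
  congr 1; ring

include h hp hs hA h0 in
theorem piM1_2_eq (v : V) : piM1_2 g hg ξ A v =
    ∑ j, ∑ k, ((1 / 2) * (A (p j) (p k) v + A (p k) (p j) v) -
      (3 / (2 * ((finrank ℂ V : ℂ) + 2))) *
      (g (p j) v * tau p q A (p k) + g (p k) v * tau p q A (p j))) •
      (gamma S g (q j) ξ ⊗ₜ[ℂ] gamma S g (q k) ξ) := by
  have e := sum_xi₁_xi₁ hg h hp (ξ := ξ) (A.compr₂ (LinearMap.applyₗ v))
  simp only [LinearMap.compr₂_apply, LinearMap.applyₗ_apply_apply] at e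
  rw [piM1_2, sum_gamma_xi₂_of hs hg h hp hA h0, e, symPart_sum, symPart_sum]
  simp only [Finset.smul_sum, ← Finset.sum_add_distrib, smul_smul, ← add_smul]
  refine Finset.sum_congr rfl fun j _ => Finset.sum_congr rfl fun k _ => ?_
  congr 1; ring

end Level1

theorem tau_left (i : Fin m) : tau p q A (p i) = tr1 (comp p q A) i := rfl

include hA in
theorem tau_right (i : Fin m) : tau p q A (q i) = - tr1 (comp q p A) i := by
  rw [tau, tr1_apply, ← Finset.sum_neg_distrib]
  exact Finset.sum_congr rfl fun j _ => (mem_cottonYork.1 hA).1 _ _ _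

include hA h in
-- By the cyclic identity the skew part of A(p_i, p_j, q_k) is half of A(q_k, p_j, p_i). Since `tr1
-- - tr2 = tr1/2`, doubling leaves the coefficient `1/(2(m - 1)) = 1/(n - 2)`.
theorem cmp_alt_apply (i j k : Fin m) : 2 * cmp p q .alt A (i, j, k) =
    A (q k) (p j) (p i) - (1 / (2 * (m - 1))) *
      (tr1 (comp p q A) i * kron j k - tr1 (comp p q A) j * kron i k) := by
  have h1 := (mem_cottonYork.1 hA).1
  have h2 := (mem_cottonYork.1 hA).2.1
  have h3 := ((mem_cottonYork_iff h).1 hA).2.2.1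
  have e := fun i => congrFun h3 i
  simp only [Pi.smul_apply, smul_eq_mul] at e
  rw [cmp, LinearMap.comp_apply, blk, proj_alt_apply, pure_apply, comp_apply, comp_apply]
  simp only [Pi.sub_apply, e]
  linear_combination h1 (p i) (q k) (p j) - h2 (q k) (p j) (p i)

include hA h in
-- Since `tr1 + tr2 = (3/2) tr1`, the coefficient `1/(2(m + 1))` becomes `3/(4(m + 1)) = 3/(2(n +
-- 2))`.
theorem cmp_sym_apply (i j k : Fin m) : cmp p q .sym A (i, j, k) =
    (1 / 2) * (A (p i) (p j) (q k) + A (p j) (p i) (q k)) - (3 / (4 * (m + 1))) *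
      (tr1 (comp p q A) i * kron j k + tr1 (comp p q A) j * kron i k) := by
  have h3 := ((mem_cottonYork_iff h).1 hA).2.2.1
  have e := fun i => congrFun h3 i
  simp only [Pi.smul_apply, smul_eq_mul] at e
  have := natCast_add_one_ne (m := m)
  rw [cmp, LinearMap.comp_apply, blk, proj_sym_apply, pure_apply, comp_apply, comp_apply]
  simp only [Pi.add_apply, e]
  field_simp
  ring

variable (hm : 3 ≤ m) (hV : finrank ℂ V = 2 * m)

include hm in
theorem cmp_trace_eq_zero (A : Tri V) : cmp p q .trace A = 0 ↔ tr1 (comp p q A) = 0 := by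
  rw [cmp, LinearMap.comp_apply, blk, proj_trace]
  constructor
  · intro h0
    have := tr1_proj_trace hm (comp p q A)
    rw [proj_trace, h0, map_zero] at this
    exact this.symm
  · intro h0; rw [h0, map_zero]

include hs hA h hξ hp hm in
-- Here nothing is assumed about the lowest block: this map detects it as well, so its vanishing
-- alone gives the inclusion into the previous step of the filtration.
theorem piM1_0_eq_zero : piM1_0 g hg ξ A = 0 ↔ comp p p A = 0 ∧ cmp p q .trace A = 0 := by
  rw [piM1_0_eq hg h hp, cmp_trace_eq_zero hm]
  constructor
  · intro h0
    have h1 := tmul_independent hs h hξ hp h0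
    simp only [piP1_0_eq_zero hs hg h hξ hp hA] at h1
    exact ⟨funext fun ⟨i, j, k⟩ => (h1 i).1 j k, funext fun i => (h1 i).2⟩
  · rintro ⟨h1, h2⟩
    refine Finset.sum_eq_zero fun i _ => ?_
    rw [(piP1_0_eq_zero hs hg h hξ hp hA).2 ⟨comp_vanish h1 i, congrFun h2 i⟩,
      TensorProduct.tmul_zero]

include h in
-- Reduces a free vector index of Π to the directions `q i`; along `p i` the expressions vanish
-- because the lower blocks do.
theorem forall_iff_left {f : V →ₗ[ℂ] ℂ} (hf : ∀ i, f (p i) = 0) :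
    (∀ v, f v = 0) ↔ ∀ i, f (q i) = 0 := by
  refine ⟨fun h0 i => h0 _, fun h0 v => ?_⟩
  rw [h.expand v]; simp [hf, h0]

include hs hA h hξ hp hV in
theorem piM1_1_eq_zero (h0 : comp p p A = 0) :
    piM1_1 g hg ξ A = 0 ↔ cmp p q .alt A = 0 := by
  have e : piM1_1 g hg ξ A = 0 ↔ ∀ j k v, (A v (p j) (p k) - (1 / ((finrank ℂ V : ℂ) - 2)) *
      (g (p j) v * tau p q A (p k) - g (p k) v * tau p q A (p j))) = 0 := by
    constructor
    · intro h1 j k v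
      have h2 := congrFun h1 v
      rw [piM1_1_eq hs hg h hp hA h0, Pi.zero_apply] at h2
      exact tmul_independent₂ hs h hξ hp h2 j k
    · intro h1
      funext v
      rw [piM1_1_eq hs hg h hp hA h0]
      simp only [h1, zero_smul, Finset.sum_const_zero, Pi.zero_apply]
  have e' : ∀ j k, (∀ v, (A v (p j) (p k) - (1 / ((finrank ℂ V : ℂ) - 2)) *
      (g (p j) v * tau p q A (p k) - g (p k) v * tau p q A (p j))) = 0) ↔
      ∀ i, cmp p q .alt A (k, j, i) = 0 := by
    intro j k
    have := forall_iff_left h (f := (A.flip (p j)).flip (p k) - (1 / ((finrank ℂ V : ℂ) - 2)) •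
      (tau p q A (p k) • g (p j) - tau p q A (p j) • g (p k))) (by
        intro i; simp [comp_vanish h0, h.pp])
    simp only [LinearMap.sub_apply, LinearMap.flip_apply, LinearMap.smul_apply, smul_eq_mul,
      mul_comm (tau p q A _) _] at this
    rw [this]
    refine forall_congr' fun i => ?_
    have h1 := cmp_alt_apply hg h hA k j i
    rw [h.pq, h.pq, tau_left, tau_left, hV]
    -- With `n = 2 m`, the coefficient in Π is the one of the trace-free skew part.
    have h2 : (1 / (((2 * m : ℕ) : ℂ) - 2)) = 1 / (2 * (m - 1)) := by push_cast; congr 1; ring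
    rw [h2]
    constructor
    · intro h3; linear_combination (1 / 2) * h1 + (1 / 2) * h3
    · intro h3; rw [h3] at h1; linear_combination -h1
  rw [e]
  simp only [e']
  constructor
  · intro h1; funext ⟨k, j, i⟩; exact h1 j k i
  · intro h1 j k i; exact congrFun h1 (k, j, i)

include hs hA h hξ hp hV in
theorem piM1_2_eq_zero (h0 : comp p p A = 0) :
    piM1_2 g hg ξ A = 0 ↔ cmp p q .sym A = 0 := by
  have e : piM1_2 g hg ξ A = 0 ↔ ∀ j k v, ((1 / 2) * (A (p j) (p k) v + A (p k) (p j) v) -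
      (3 / (2 * ((finrank ℂ V : ℂ) + 2))) *
      (g (p j) v * tau p q A (p k) + g (p k) v * tau p q A (p j))) = 0 := by
    constructor
    · intro h1 j k v
      have h2 := congrFun h1 v
      rw [piM1_2_eq hs hg h hp hA h0, Pi.zero_apply] at h2
      exact tmul_independent₂ hs h hξ hp h2 j k
    · intro h1
      funext v
      rw [piM1_2_eq hs hg h hp hA h0]
      simp only [h1, zero_smul, Finset.sum_const_zero, Pi.zero_apply]
  have e' : ∀ j k, (∀ v, ((1 / 2) * (A (p j) (p k) v + A (p k) (p j) v) -
      (3 / (2 * ((finrank ℂ V : ℂ) + 2))) *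
      (g (p j) v * tau p q A (p k) + g (p k) v * tau p q A (p j))) = 0) ↔
      ∀ i, cmp p q .sym A (j, k, i) = 0 := by
    intro j k
    have := forall_iff_left h (f := (1 / 2 : ℂ) • (A (p j) (p k) + A (p k) (p j)) -
      (3 / (2 * ((finrank ℂ V : ℂ) + 2))) •
      (tau p q A (p k) • g (p j) + tau p q A (p j) • g (p k))) (by
        intro i; simp [comp_vanish h0, h.pp])
    simp only [LinearMap.sub_apply, LinearMap.add_apply, LinearMap.smul_apply, smul_eq_mul,
      mul_comm (tau p q A _) _] at this
    rw [this]
    refine forall_congr' fun i => ?_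
    have h1 := cmp_sym_apply hg h hA j k i
    rw [h.pq, h.pq, tau_left, tau_left, hV]
    have h2 : (3 / (2 * (((2 * m : ℕ) : ℂ) + 2))) = 3 / (4 * (m + 1)) := by push_cast; congr 1; ring
    rw [h2]
    constructor
    · intro h3; linear_combination h1 + h3
    · intro h3; rw [h3] at h1; linear_combination -h1
  rw [e]
  simp only [e']
  constructor
  · intro h1; funext ⟨k, j, i⟩; exact h1 k j i
  · intro h1 j k i; exact congrFun h1 (j, k, i)

/-! ### The maps Π_{1/2} on tensors whose two lower blocks vanish -/

section Level2

variable (h0 : comp p p A = 0) (h1 : comp p q A = 0)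

include hA h h0 h1 in
-- The two blocks kill A(p_i, p_j, v) for every `v`; skewness and the cyclic identity move `v` to
-- the other slots.
theorem vanish_of_comp (v : V) (i j : Fin m) :
    A (p i) (p j) v = 0 ∧ A (p i) v (p j) = 0 ∧ A v (p i) (p j) = 0 := by
  have a1 := (mem_cottonYork.1 hA).1
  have a2 := (mem_cottonYork.1 hA).2.1
  have e1 : ∀ i j v, A (p i) (p j) v = 0 := by
    intro i j v
    rw [h.expand v]
    simp [comp_vanish h0, comp_vanish h1]
  refine ⟨e1 i j v, by rw [a1, e1, neg_zero], ?_⟩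
  have := a2 v (p i) (p j)
  rwa [e1, a1 (p j), e1, neg_zero, add_zero, add_zero] at this

include hA h h0 h1 hs hp in
theorem piP1_0_of_vanish' (v : V) : piP1_0 g hg ξ A v = (-2 * tau p q A v) • ξ :=
  piP1_0_of_vanish hs hg h hp hA fun i j => (vanish_of_comp hg h hA h0 h1 v i j).2.2

/-- The trace `∑ b, A(a, p_b, q_b)`, as a linear form. -/
def tauₗ (p q : Fin m → V) (A : Tri V) : V →ₗ[ℂ] ℂ := ∑ b, (A.flip (p b)).flip (q b)

theorem tauₗ_apply (v : V) : tauₗ p q A v = tau p q A v := by simp [tauₗ, tau]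

include h1 in
theorem tau_left_eq_zero (i : Fin m) : tau p q A (p i) = 0 := by rw [tau_left, h1]; simp

include hA h h0 h1 hs hp hξ hm in
theorem piP1_0_eq_zero' : piP1_0 g hg ξ A = 0 ↔ cmp q p .trace A = 0 := by
  rw [cmp_trace_eq_zero hm]
  have := forall_iff_left h (f := tauₗ p q A) fun i => by
    rw [tauₗ_apply, tau_left_eq_zero h1]
  simp only [tauₗ_apply, tau_right hg hA, neg_eq_zero] at this
  rw [funext_iff, funext_iff]
  simp only [Pi.zero_apply]
  rw [← this]
  refine forall_congr' fun v => ?_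
  rw [piP1_0_of_vanish' hs hg h hp hA h0 h1, smul_eq_zero, or_iff_left hξ, mul_eq_zero,
    or_iff_right (by norm_num)]

include hA h h0 h1 hs hp in
theorem piP1_1_eq (v w : V) : piP1_1 g hg ξ A v w =
    ∑ i, (A (p i) v w + (1 / ((finrank ℂ V : ℂ) - 2)) *
      (g (p i) v * tau p q A w - g (p i) w * tau p q A v)) • gamma S g (q i) ξ := by
  have e := sum_xi₁ hg h hp (ξ := ξ) ((A.flip v).flip w) LinearMap.id
  simp only [LinearMap.flip_apply, LinearMap.id_apply] at e
  rw [piP1_1, e, piP1_0_of_vanish' hs hg h hp hA h0 h1, piP1_0_of_vanish' hs hg h hp hA h0 h1,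
    map_smul, map_smul, gamma_xi h hp v, gamma_xi h hp w]
  simp only [Finset.smul_sum, ← Finset.sum_sub_distrib, smul_smul, ← sub_smul]
  refine Finset.sum_congr rfl fun i _ => ?_
  congr 1; ring

include hA h h0 h1 hs hp in
theorem piP1_2_eq (v w : V) : piP1_2 g hg ξ A v w =
    ∑ i, ((1 / 2) * (A v w (p i) + A w v (p i)) + (3 / (2 * ((finrank ℂ V : ℂ) + 2))) *
      (g (p i) v * tau p q A w + g (p i) w * tau p q A v)) • gamma S g (q i) ξ := by
  have e := sum_xi₁ hg h hp (ξ := ξ) ((1 / 2 : ℂ) • (A v w + A w v)) LinearMap.id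
  simp only [LinearMap.smul_apply, LinearMap.add_apply, LinearMap.id_apply, smul_eq_mul] at e
  rw [piP1_2, e, piP1_0_of_vanish' hs hg h hp hA h0 h1, piP1_0_of_vanish' hs hg h hp hA h0 h1,
    map_smul, map_smul, gamma_xi h hp v, gamma_xi h hp w]
  simp only [Finset.smul_sum, ← Finset.sum_sub_distrib, ← Finset.sum_add_distrib, smul_smul,
    ← sub_smul, ← add_smul]
  refine Finset.sum_congr rfl fun i _ => ?_
  congr 1; ring

include h in
theorem forall_iff_left₂ {f : V →ₗ[ℂ] V →ₗ[ℂ] ℂ} (hf : ∀ i v, f (p i) v = 0)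
    (hf' : ∀ i v, f v (p i) = 0) :
    (∀ v w, f v w = 0) ↔ ∀ i j, f (q i) (q j) = 0 := by
  refine ⟨fun h0 i j => h0 _ _, fun h0 v w => ?_⟩
  rw [h.expand v, h.expand w]; simp [hf, hf', h0]

include hA h h0 h1 hs hp hξ hV in
-- The comparison made for Π_{-1/2}, with `p` and `q` exchanged. The opposite sign of the correction
-- term matches the sign in `tau_right`.
theorem piP1_1_eq_zero : piP1_1 g hg ξ A = 0 ↔ cmp q p .alt A = 0 := by
  have e : piP1_1 g hg ξ A = 0 ↔ ∀ i v w, A (p i) v w + (1 / ((finrank ℂ V : ℂ) - 2)) *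
      (g (p i) v * tau p q A w - g (p i) w * tau p q A v) = 0 := by
    constructor
    · intro h2 i v w
      have h3 := congrFun (congrFun h2 v) w
      rw [piP1_1_eq hs hg h hp hA h0 h1] at h3
      exact xi_independent hs h hξ hp h3 i
    · intro h2
      funext v w
      rw [piP1_1_eq hs hg h hp hA h0 h1]
      simp only [h2, zero_smul, Finset.sum_const_zero, Pi.zero_apply]
  have e' : ∀ i, (∀ v w, A (p i) v w + (1 / ((finrank ℂ V : ℂ) - 2)) *
      (g (p i) v * tau p q A w - g (p i) w * tau p q A v) = 0) ↔
      ∀ j k, cmp q p .alt A (k, j, i) = 0 := by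
    intro i
    have := forall_iff_left₂ h (f := A (p i) + (1 / ((finrank ℂ V : ℂ) - 2)) •
      ((g (p i)).smulRight (tauₗ p q A) - ((g (p i)).smulRight (tauₗ p q A)).flip))
      (by
        intro j v
        simp [tauₗ_apply, h.pp, tau_left_eq_zero h1, (vanish_of_comp hg h hA h0 h1 v i j).1])
      (by
        intro j v
        simp [tauₗ_apply, h.pp, tau_left_eq_zero h1, (vanish_of_comp hg h hA h0 h1 v i j).2.1])
    simp only [LinearMap.sub_apply, LinearMap.add_apply, LinearMap.flip_apply, LinearMap.smul_apply,
      smul_eq_mul, LinearMap.smulRight_apply, tauₗ_apply] at this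
    rw [this]
    refine forall_congr' fun j => forall_congr' fun k => ?_
    have h2 := cmp_alt_apply hg h.swap hA k j i
    rw [h.pq, h.pq, tau_right hg hA, tau_right hg hA, hV]
    have h3 : (1 / (((2 * m : ℕ) : ℂ) - 2)) = 1 / (2 * (m - 1)) := by push_cast; congr 1; ring
    rw [h3]
    rw [kron_comm j i, kron_comm k i] at h2
    constructor
    · intro h4; linear_combination (1 / 2) * h2 + (1 / 2) * h4
    · intro h4; rw [h4] at h2; linear_combination -h2
  rw [e]
  simp only [e']
  constructor
  · intro h1; funext ⟨k, j, i⟩; exact h1 i j k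
  · intro h1 i j k; exact congrFun h1 (k, j, i)

include hA h h0 h1 hs hp hξ hV in
theorem piP1_2_eq_zero : piP1_2 g hg ξ A = 0 ↔ cmp q p .sym A = 0 := by
  have e : piP1_2 g hg ξ A = 0 ↔ ∀ i v w, (1 / 2) * (A v w (p i) + A w v (p i)) +
      (3 / (2 * ((finrank ℂ V : ℂ) + 2))) *
      (g (p i) v * tau p q A w + g (p i) w * tau p q A v) = 0 := by
    constructor
    · intro h2 i v w
      have h3 := congrFun (congrFun h2 v) w
      rw [piP1_2_eq hs hg h hp hA h0 h1] at h3
      exact xi_independent hs h hξ hp h3 i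
    · intro h2
      funext v w
      rw [piP1_2_eq hs hg h hp hA h0 h1]
      simp only [h2, zero_smul, Finset.sum_const_zero, Pi.zero_apply]
  have e' : ∀ i, (∀ v w, (1 / 2) * (A v w (p i) + A w v (p i)) +
      (3 / (2 * ((finrank ℂ V : ℂ) + 2))) *
      (g (p i) v * tau p q A w + g (p i) w * tau p q A v) = 0) ↔
      ∀ j k, cmp q p .sym A (j, k, i) = 0 := by
    intro i
    have := forall_iff_left₂ h (f := (1 / 2 : ℂ) •
        (A.compr₂ (LinearMap.applyₗ (p i)) + (A.compr₂ (LinearMap.applyₗ (p i))).flip) +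
      (3 / (2 * ((finrank ℂ V : ℂ) + 2))) •
      ((g (p i)).smulRight (tauₗ p q A) + ((g (p i)).smulRight (tauₗ p q A)).flip))
      (by
        intro j v
        simp [tauₗ_apply, h.pp, tau_left_eq_zero h1, (vanish_of_comp hg h hA h0 h1 v j i)])
      (by
        intro j v
        simp [tauₗ_apply, h.pp, tau_left_eq_zero h1, (vanish_of_comp hg h hA h0 h1 v j i)])
    simp only [LinearMap.sub_apply, LinearMap.add_apply, LinearMap.flip_apply, LinearMap.smul_apply,
      smul_eq_mul, LinearMap.smulRight_apply, tauₗ_apply, LinearMap.compr₂_apply,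
      LinearMap.applyₗ_apply_apply] at this
    rw [this]
    refine forall_congr' fun j => forall_congr' fun k => ?_
    have h2 := cmp_sym_apply hg h.swap hA j k i
    rw [h.pq, h.pq, tau_right hg hA, tau_right hg hA, hV]
    have h3 : (3 / (2 * (((2 * m : ℕ) : ℂ) + 2))) = 3 / (4 * (m + 1)) := by push_cast; congr 1; ring
    rw [h3]
    rw [kron_comm j i, kron_comm k i] at h2
    constructor
    · intro h4; linear_combination h2 + h4
    · intro h4; rw [h4] at h2; linear_combination -h2
  rw [e]
  simp only [e']
  constructor
  · intro h1; funext ⟨k, j, i⟩; exact h1 i k j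
  · intro h1 i j k; exact congrFun h1 (j, k, i)

end Level2

/-! ### Kernels of the maps Π in terms of components -/

/-- The component of a form labelled by `(i, j)`. -/
def cmpL (p q : Fin m → V) : Label → Tri V →ₗ[ℂ] Coef m
  | .m3_0 => cmp p q .hook
  | .m1_0 => cmp p q .trace
  | .m1_1 => cmp p q .alt
  | .m1_2 => cmp p q .sym
  | .p1_0 => cmp q p .trace
  | .p1_1 => cmp q p .alt
  | .p1_2 => cmp q p .sym
  | .p3_0 => cmp q p .hook

include hs hA h hξ hp hm hV in
/-- The condition `Π_i^j(A) = 0` only concerns the component of `A` labelled by `(i, j)`, provided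
that the lower components vanish. -/
theorem piVanishes_iff (x : Label) (hlow : ∀ y : Label, y.pos < x.pos → cmpL p q y A = 0) :
    PiVanishes g hg ξ x A ↔ cmpL p q x A = 0 := by
  have f0 : 0 < x.pos → comp p p A = 0 := fun hx => by
    rw [← cmp_hook h hA]; exact hlow .m3_0 hx
  have f1 : 1 < x.pos → comp p q A = 0 := fun hx => by
    have e1 : cmp p q .trace A = 0 := hlow .m1_0 hx
    have e2 : cmp p q .alt A = 0 := hlow .m1_1 hx
    have e3 : cmp p q .sym A = 0 := hlow .m1_2 hx
    rw [← sum_cmp hm h hA, e1, e2, e3, add_zero, add_zero]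
  cases x
  · exact (piM3_0_eq_zero hs hg h hξ hp).trans (by rw [cmpL, cmp_hook h hA])
  · exact (piM1_0_eq_zero hs hg h hξ hp hA hm).trans (and_iff_right (f0 (by decide)))
  · exact piM1_1_eq_zero hs hg h hξ hp hA hV (f0 (by decide))
  · exact piM1_2_eq_zero hs hg h hξ hp hA hV (f0 (by decide))
  · exact piP1_0_eq_zero' hs hg h hξ hp hA hm (f0 (by decide)) (f1 (by decide))
  · exact piP1_1_eq_zero hs hg h hξ hp hA hV (f0 (by decide)) (f1 (by decide))
  · exact piP1_2_eq_zero hs hg h hξ hp hA hV (f0 (by decide)) (f1 (by decide))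
  · constructor
    · intro h0
      have : A = 0 := h0
      rw [this, map_zero]
    · intro h0
      have e1 : cmp q p .trace A = 0 := hlow .p1_0 (by decide)
      have e2 : cmp q p .alt A = 0 := hlow .p1_1 (by decide)
      have e3 : cmp q p .sym A = 0 := hlow .p1_2 (by decide)
      have hA' := mem_cottonYork.1 hA
      refine tri_eq_zero h hA'.1 hA'.2.1 (f0 (by decide)) (f1 (by decide)) ?_ ?_
      · rw [← sum_cmp hm h.swap hA, e1, e2, e3, add_zero, add_zero]
      · rw [← cmp_hook h.swap hA]; exact h0

include hs hA h hξ hp hm hV in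
-- The steps of the filtration are defined by the maps of a single degree, so the components of
-- lower degree have to be shown to vanish as well.
theorem cmpL_eq_zero_of_piVanishes {k : Fin 4}
    (hk : ∀ x : Label, x.pos = k → PiVanishes g hg ξ x A) (y : Label) (hy : y.pos ≤ k) :
    cmpL p q y A = 0 := by
  have low : ∀ y : Label, y.pos < k → cmpL p q y A = 0 := by
    have c : ∀ k : Fin 4, k = 0 ∨ k = 1 ∨ k = 2 ∨ k = 3 := by decide
    rcases c k with rfl | rfl | rfl | rfl
    · intro y hy; exact absurd hy (Fin.not_lt_zero _)
    · have h1 := (piM1_0_eq_zero hs hg h hξ hp hA hm).1 (hk .m1_0 rfl)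
      intro y hy
      cases y <;> first | exact absurd hy (by decide) | skip
      rw [cmpL, cmp_hook h hA, h1.1]
    -- Once Π^0_{1/2} vanishes, Π^1_{1/2} reduces to ξ^{cA} A_{cab}. Its vanishing kills every
    -- A(p_i, ·, ·), hence both lower blocks.
    · have h1 : ∀ a, piP1_0 g hg ξ A a = 0 := fun a => congrFun (hk .p1_0 rfl) a
      have h2 : ∀ i a b, A (p i) a b = 0 := by
        intro i a b
        have h3 := congrFun (congrFun (hk .p1_1 rfl) a) b
        have e := sum_xi₁ hg h hp (ξ := ξ) ((A.flip a).flip b) LinearMap.id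
        simp only [LinearMap.flip_apply, LinearMap.id_apply] at e
        rw [piP1_1, h1, h1, map_zero, map_zero, sub_zero, smul_zero, smul_zero, sub_zero, e] at h3
        exact xi_independent hs h hξ hp h3 i
      have f0 : comp p p A = 0 := funext fun ⟨i, j, k⟩ => h2 _ _ _
      have f1 : comp p q A = 0 := funext fun ⟨i, j, k⟩ => h2 _ _ _
      intro y hy
      cases y <;> first
        | exact absurd hy (by decide)
        | (simp only [cmpL, cmp, LinearMap.comp_apply, blk, f0, f1, map_zero])
    · have : A = 0 := hk .p3_0 rfl
      intro y _
      rw [this, map_zero]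
  rcases lt_or_eq_of_le hy with hy | hy
  · exact low y hy
  · subst hy
    exact (piVanishes_iff hs hg h hξ hp hA hm hV y low).1 (hk y rfl)

end PiMaps

/-! ### Irreducibility of the modules of forms -/

section Irreducible

variable {V : Type*} [AddCommGroup V] [Module ℂ V] [FiniteDimensional ℂ V]
variable {g : LinearMap.BilinForm ℂ V} {hg : g.Nondegenerate} (hs : g.IsSymm)
variable {m : ℕ} {p q : Fin m → V}

instance : AddCommGroup (Tri V) := LinearMap.addCommGroup

theorem tri_lie_add (X : so g) (A B : Tri V) : (⁅X, A + B⁆ : Tri V) = ⁅X, A⁆ + ⁅X, B⁆ := by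
  ext x y z; simp only [lie_tri, LinearMap.add_apply]; ring

theorem tri_lie_sub (X : so g) (A B : Tri V) : (⁅X, A - B⁆ : Tri V) = ⁅X, A⁆ - ⁅X, B⁆ := by
  ext x y z; simp only [lie_tri, LinearMap.sub_apply]; ring

theorem tri_lie_smul (X : so g) (c : ℂ) (A : Tri V) : (⁅X, c • A⁆ : Tri V) = c • ⁅X, A⁆ := by
  ext x y z; simp only [lie_tri, LinearMap.smul_apply, smul_eq_mul]; ring

/-- The forms all of whose components vanish except the one of type `κ`. -/
def modForm (g : LinearMap.BilinForm ℂ V) (hg : g.Nondegenerate) (p q : Fin m → V) (κ : Kind) :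
    Submodule ℂ (Tri V) :=
  (cottonYork g hg).toSubmodule ⊓ (⨅ μ : {μ // μ ≠ κ}, LinearMap.ker (cmp p q μ)) ⊓
    ⨅ μ, LinearMap.ker (cmp q p μ)

theorem mem_modForm {κ : Kind} {A : Tri V} : A ∈ modForm g hg p q κ ↔
    A ∈ cottonYork g hg ∧ (∀ μ, μ ≠ κ → cmp p q μ A = 0) ∧ ∀ μ, cmp q p μ A = 0 := by
  simp [modForm, and_assoc]

theorem build_mem_modForm (hm : 3 ≤ m) (h : Hyp g p q) (κ : Kind) (t : Coef m) :
    build g p q κ (proj κ t) ∈ modForm g hg p q κ :=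
  mem_modForm.2 ⟨build_mem hm h κ t, fun _ hμ => cmp_build_ne hm h hμ t,
    fun μ => cmp_swap_build h κ μ _⟩

theorem eq_of_cmp_eq (hm : 3 ≤ m) (h : Hyp g p q) {κ : Kind} {A B : Tri V}
    (hA : A ∈ modForm g hg p q κ) (hB : B ∈ modForm g hg p q κ) (e : cmp p q κ A = cmp p q κ B) :
    A = B := by
  have hAB := mem_modForm.1 (sub_mem hA hB)
  rw [← sub_eq_zero]
  refine eq_zero_of_cmp hm h hAB.1 (fun μ => ?_) hAB.2.2
  by_cases hμ : μ = κ
  · subst hμ; rw [map_sub, e, sub_self]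
  · exact hAB.2.1 μ hμ

theorem eq_build (hm : 3 ≤ m) (h : Hyp g p q) {κ : Kind} {A : Tri V}
    (hA : A ∈ modForm g hg p q κ) : A = build g p q κ (proj κ (cmp p q κ A)) := by
  refine eq_of_cmp_eq hm h hA (build_mem_modForm hm h κ _) ?_
  rw [cmp_build_self hm h, cmp, LinearMap.comp_apply, proj_idem hm]

/-! ### Arguments on which tensors of one type vanish -/

section Facts

variable (hm : 3 ≤ m) (h : Hyp g p q) {A : Tri V}
include hm h

theorem comp_of_mem_modForm {κ : Kind} (hA : A ∈ modForm g hg p q κ) :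
    comp q q A = 0 ∧ comp q p A = 0 ∧ (κ = .hook → comp p q A = 0) ∧
      (κ ≠ .hook → comp p p A = 0 ∧ comp p q A = cmp p q κ A) := by
  obtain ⟨h1, h2, h3⟩ := mem_modForm.1 hA
  refine ⟨?_, ?_, ?_, fun hκ => ⟨?_, ?_⟩⟩
  · rw [← cmp_hook h.swap h1, h3]
  · rw [← sum_cmp hm h.swap h1, h3, h3, h3, add_zero, add_zero]
  · rintro rfl
    rw [← sum_cmp hm h h1, h2 _ (by decide), h2 _ (by decide), h2 _ (by decide), add_zero, add_zero]
  · rw [← cmp_hook h h1, h2 _ (Ne.symm hκ)]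
  · rw [← sum_cmp hm h h1]
    cases κ
    · exact absurd rfl hκ
    · rw [h2 .alt (by decide), h2 .sym (by decide), add_zero, add_zero]
    · rw [h2 .trace (by decide), h2 .sym (by decide), add_zero, zero_add]
    · rw [h2 .alt (by decide), h2 .trace (by decide), add_zero, zero_add]

/-- A tensor of type `.hook` lives on the `p` block alone, so any argument from the span of `q`
annihilates it. -/
theorem eq_zero_of_mem_hook (hA : A ∈ modForm g hg p q .hook) {v : V}
    (hv : ∀ i, g (q i) v = 0) (x y : V) : A v x y = 0 ∧ A x v y = 0 ∧ A x y v = 0 := by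
  obtain ⟨c1, c2, c3, -⟩ := comp_of_mem_modForm hm h hA
  have hA' := (mem_modForm.1 hA).1
  have a1 := (mem_cottonYork.1 hA').1
  have a2 := (mem_cottonYork.1 hA').2.1
  have k := vanish_of_comp hg h.swap hA' c1 c2
  have e1 : ∀ i j l, A (p i) (p j) (q l) = 0 := fun i j l => congrFun (c3 rfl) (i, j, l)
  have e2 : ∀ i x y, A x y (q i) = 0 := by
    intro i x y
    rw [h.expand x, h.expand y]
    simp [e1, k]
  have e3 : ∀ i x y, A x (q i) y = 0 := fun i x y => by rw [a1, e2, neg_zero]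
  have e4 : ∀ i x y, A (q i) x y = 0 := fun i x y => by
    have := a2 (q i) x y
    rwa [e2, e3, add_zero, add_zero] at this
  rw [h.expand_right hv]
  simp [e2, e3, e4]

/-- The other types need exactly two arguments from the span of `p` and one from the span of `q`. -/
theorem eq_zero_of_mem_ne {κ : Kind} (hκ : κ ≠ .hook) (hA : A ∈ modForm g hg p q κ) :
    (∀ u v w : V, (∀ i, g (p i) u = 0) → (∀ i, g (p i) v = 0) → (∀ i, g (p i) w = 0) →
      A u v w = 0) ∧
    ∀ u v w : V, (∀ i, g (q i) u = 0) → (∀ i, g (q i) v = 0) →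
      A u v w = 0 ∧ A u w v = 0 ∧ A w u v = 0 := by
  obtain ⟨c1, c2, -, c3⟩ := comp_of_mem_modForm hm h hA
  have hA' := (mem_modForm.1 hA).1
  have k := vanish_of_comp hg h.swap hA' c1 c2
  have e1 : ∀ i j l, A (p i) (p j) (p l) = 0 := fun i j l => congrFun (c3 hκ).1 (i, j, l)
  refine ⟨fun u v w hu hv hw => ?_, fun u v w hu hv => ?_⟩
  · rw [h.expand_left hu, h.expand_left hv, h.expand_left hw]; simp [e1]
  · rw [h.expand_right hu, h.expand_right hv]; simp [k]

end Facts

/-! ### Powers of nilpotent rank-one elements -/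

section HopFacts

theorem Hyp.lin_zero (h : Hyp g p q) {f : V →ₗ[ℂ] ℂ} (hf : ∀ i, f (p i) = 0) {x : V}
    (hx : ∀ i, g (p i) x = 0) : f x = 0 := by
  rw [h.expand_left hx]; simp [hf]

theorem Hyp.lin_ext (h : Hyp g p q) {f f' : V →ₗ[ℂ] ℂ} (h1 : ∀ i, f (p i) = f' (p i))
    (h2 : ∀ i, f (q i) = f' (q i)) : f = f' := by
  ext x
  rw [h.expand x]; simp [h1, h2]

variable {u v : V}

theorem g_p_eq_zero (h : Hyp g p q) {u w : V} (hu : ∀ i, g (p i) u = 0) (hw : ∀ i, g (p i) w = 0) :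
    g u w = 0 := by
  rw [h.expand_left hu]; simp [hw]

theorem hop_left (h : Hyp g p q) {a b w : V} (ha : ∀ i, g (p i) a = 0) (hw : ∀ i, g (p i) w = 0) :
    ⁅hop g hs a b, w⁆ = g b w • a := by
  rw [hop_lie, g_p_eq_zero h ha hw, zero_smul, sub_zero]

theorem hop_right (h : Hyp g p q) {a b w : V} (hb : ∀ i, g (q i) b = 0) (hw : ∀ i, g (q i) w = 0) :
    ⁅hop g hs a b, w⁆ = -(g a w • b) := by
  rw [hop_lie, g_p_eq_zero h.swap hb hw, zero_smul, zero_sub]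

/-- The sum `θ(v, w, u) - θ(w, v, u)`. -/
def psi (g : LinearMap.BilinForm ℂ V) (v w u : V) : Tri V := theta g v w u - theta g w v u

theorem lie_psi (X : so g) (v w u : V) : (⁅X, psi g v w u⁆ : Tri V) =
    psi g ⁅X, v⁆ w u + psi g v ⁅X, w⁆ u + psi g v w ⁅X, u⁆ := by
  rw [psi, tri_lie_sub, lie_theta, lie_theta, psi, psi, psi]; abel

theorem psi_swap (v w u : V) : psi g v w u = - psi g w v u := by rw [psi, psi]; abel

theorem psi_smul₁ (c : ℂ) (v w u : V) : psi g (c • v) w u = c • psi g v w u := by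
  simp [psi, smul_sub]
theorem psi_smul₂ (c : ℂ) (v w u : V) : psi g v (c • w) u = c • psi g v w u := by
  simp [psi, smul_sub]
theorem psi_smul₃ (c : ℂ) (v w u : V) : psi g v w (c • u) = c • psi g v w u := by
  simp [psi, smul_sub]

variable (hm : 3 ≤ m) (h : Hyp g p q) {A : Tri V} (hu : ∀ i, g (p i) u = 0)
  (hv : ∀ i, g (q i) v = 0) (huv : g v u = 0)

include hs huv in
theorem symm_zero : g u v = 0 := by rw [← huv]; exact hs.eq u v

include hs h hu hv huv in
-- For an incident pair the element squares to zero on `V`. Its square and cube on trilinear forms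
-- then keep only the terms in which it hits distinct arguments.
theorem hop_hop (x : V) : ⁅hop g hs u v, ⁅hop g hs u v, x⁆⁆ = 0 := by
  have e := symm_zero hs huv
  simp only [hop_lie, map_sub, map_smul, smul_eq_mul, huv, e, g_p_eq_zero h hu hu,
    g_p_eq_zero h.swap hv hv, mul_zero, sub_zero, zero_smul]

include hs h hu hv huv in
theorem lie_lie_hop (A : Tri V) (x y z : V) :
    (⁅hop g hs u v, ⁅hop g hs u v, A⁆⁆ : Tri V) x y z =
      2 * (A ⁅hop g hs u v, x⁆ ⁅hop g hs u v, y⁆ z + A ⁅hop g hs u v, x⁆ y ⁅hop g hs u v, z⁆ +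
        A x ⁅hop g hs u v, y⁆ ⁅hop g hs u v, z⁆) := by
  simp only [lie_tri, hop_hop hs h hu hv huv, map_zero, LinearMap.zero_apply]
  ring

include hs h hu hv huv in
theorem lie_lie_lie_hop (A : Tri V) (x y z : V) :
    (⁅hop g hs u v, ⁅hop g hs u v, ⁅hop g hs u v, A⁆⁆⁆ : Tri V) x y z =
      -6 * A ⁅hop g hs u v, x⁆ ⁅hop g hs u v, y⁆ ⁅hop g hs u v, z⁆ := by
  rw [lie_lie_hop hs h hu hv huv]
  simp only [lie_tri, hop_hop hs h hu hv huv, map_zero, LinearMap.zero_apply]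
  ring

include hm hs h hu hv huv in
-- Produces a decomposable tensor from an arbitrary one of type `.hook`: both copies of `v` come
-- from the two applications, and the last factor represents the form A(u, u, ·).
theorem lie_lie_hook (hA : A ∈ modForm g hg p q .hook) :
    (⁅hop g hs u v, ⁅hop g hs u v, A⁆⁆ : Tri V) =
      (2 : ℂ) • theta g v v (∑ i, A u u (p i) • q i) := by
  have hA' := (mem_modForm.1 hA).1
  have a1 := (mem_cottonYork.1 hA').1
  have z := eq_zero_of_mem_hook hm h hA hv
  have zq := fun i => eq_zero_of_mem_hook hm h hA (h.qq · i)
  have hβ : ∀ x, g (∑ i, A u u (p i) • q i) x = A u u x := by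
    refine fun x => LinearMap.congr_fun (h.lin_ext (f := g (∑ i, A u u (p i) • q i))
      (f' := A u u) (fun i => ?_) fun i => ?_) x
    · simp [h.qp, kron]
    · simp [h.qq, (zq i u u).2.2]
  have a3 : ∀ x, A x u u = 0 := fun x => by
    have := a1 x u u; linear_combination (1 / 2) * this
  ext x y w
  rw [lie_lie_hop hs h hu hv huv]
  simp only [LinearMap.smul_apply, theta_apply, hβ, hop_lie, map_sub, map_smul, LinearMap.sub_apply,
    z, smul_zero, sub_zero, a3, smul_eq_mul, a1 u y u]
  ring

include hm hs h hu hv huv in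
-- The cube replaces every argument by a multiple of `u` or `v`, so only the number A(u, u, v)
-- remains. This serves the symmetric type; for the skew type that number is zero.
theorem lie_lie_lie_ne {κ : Kind} (hκ : κ ≠ .hook) (hA : A ∈ modForm g hg p q κ) :
    (⁅hop g hs u v, ⁅hop g hs u v, ⁅hop g hs u v, A⁆⁆⁆ : Tri V) =
      (6 * A u u v) • theta g v v u := by
  have hA' := (mem_modForm.1 hA).1
  have a1 := (mem_cottonYork.1 hA').1
  obtain ⟨z1, z2⟩ := eq_zero_of_mem_ne hm h hκ hA
  have e1 := z1 u u u hu hu hu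
  have e2 := fun w => z2 v v w hv hv
  have e3 : A v u u = 0 := by
    have := a1 v u u; linear_combination (1 / 2) * this
  ext x y w
  rw [lie_lie_lie_hop hs h hu hv huv]
  simp only [LinearMap.smul_apply, theta_apply, hop_lie, map_sub, map_smul, LinearMap.sub_apply,
    e1, e2, e3, smul_zero, sub_zero, zero_sub, smul_eq_mul, a1 u v u]
  ring

include hm hs h hu hv huv in
-- For the skew type the form A(u, u, ·) is zero, so two applications are used instead of three.
-- What remains is governed by the form A(u, ·, v).
theorem lie_lie_alt (hA : A ∈ modForm g hg p q .alt) :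
    (⁅hop g hs u v, ⁅hop g hs u v, A⁆⁆ : Tri V) =
      (-2 : ℂ) • psi g v (∑ i, A u (p i) v • q i) u := by
  have hA' := (mem_modForm.1 hA).1
  have a1 := (mem_cottonYork.1 hA').1
  have a2 := (mem_cottonYork.1 hA').2.1
  obtain ⟨z1, z2⟩ := eq_zero_of_mem_ne hm h (by decide) hA
  have c := ((comp_of_mem_modForm hm h hA).2.2.2 (by decide)).2
  have ant : ∀ i j k, A (p i) (p j) (q k) + A (p j) (p i) (q k) = 0 := by
    intro i j k
    have h1 := congrFun c (i, j, k)
    have h2 := congrFun c (j, i, k)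
    rw [comp_apply] at h1 h2
    rw [h1, h2, cmp, LinearMap.comp_apply, proj_alt_anti _ i j k, neg_add_cancel]
  -- Skewness of the mixed block on basis vectors, extended by linearity one argument at a time.
  have ant₂ : ∀ x z, (∀ i, g (p i) x = 0) → (∀ i, g (q i) z = 0) → A x u z + A u x z = 0 := by
    intro x z hx hz
    have s1 : ∀ i j, A (p i) (p j) z + A (p j) (p i) z = 0 := fun i j =>
      h.swap.lin_zero (f := A (p i) (p j) + A (p j) (p i)) (fun k => by simpa using ant i j k) hz
    have s2 : ∀ i, A (p i) u z + A u (p i) z = 0 := fun i =>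
      h.lin_zero (f := (A (p i)).flip z + (A.flip (p i)).flip z) (fun j => by simpa using s1 i j) hu
    exact h.lin_zero (f := (A.flip u).flip z + (A u).flip z) (fun j => by simpa using s2 j) hx
  have zq : ∀ i z, (∀ i, g (q i) z = 0) → A u (q i) z = 0 ∧ A (q i) u z = 0 := fun i z hz =>
    ⟨(z2 (q i) z u (h.qq · i) hz).2.2, (z2 (q i) z u (h.qq · i) hz).2.1⟩
  have ant' : ∀ y, A u y v = - A y u v := by
    intro y
    have := h.lin_ext (f := (A u).flip v) (f' := -(A.flip u).flip v)
      (fun i => by simpa [eq_neg_iff_add_eq_zero, add_comm] using ant₂ (p i) v (h.pp · i) hv)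
      (fun i => by simp [zq i v hv])
    exact LinearMap.congr_fun this y
  have uu : ∀ z, A u u z = 0 := by
    intro z
    have := h.lin_ext (f := A u u) (f' := 0) (fun i => by simpa using z1 u u (p i) hu hu (h.pp · i))
      (fun i => by
        have := ant₂ u (q i) hu (h.qq · i)
        rw [LinearMap.zero_apply]; linear_combination (1 / 2) * this)
    exact LinearMap.congr_fun this z
  have hβ : ∀ x, g (∑ i, A u (p i) v • q i) x = A u x v := by
    refine fun x => LinearMap.congr_fun (h.lin_ext (f := g (∑ i, A u (p i) v • q i))
      (f' := (A u).flip v) (fun i => ?_) fun i => ?_) x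
    · simp [h.qp, kron]
    · simp [h.qq, zq i v hv]
  have e1 : ∀ z, A u v z = - A u z v := fun z => a1 _ _ _
  have e2 : ∀ z, A v u z = - 2 * A u z v := fun z => by
    have := a2 v u z
    have := a1 z v u
    have := ant' z
    linear_combination a2 v u z - a1 z v u + ant' z
  have e3 : ∀ x, A x u v = - A u x v := fun x => by rw [ant', neg_neg]
  have e4 : ∀ x, A x v u = A u x v := fun x => by rw [a1, e3, neg_neg]
  have e5 := fun w => z2 v v w hv hv
  have e6 : ∀ x, A x u u = 0 := fun x => by
    have := a1 x u u; linear_combination (1 / 2) * this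
  have e7 : ∀ y, A u y u = 0 := fun y => by rw [a1, uu, neg_zero]
  have e8 : ∀ z, A v z u = 2 * A u z v := fun z => by rw [a1, e2]; ring
  have e9 : ∀ z, A v z v = 0 := fun z => (e5 z).2.1
  have e10 : ∀ z, A z v v = 0 := fun z => (e5 z).2.2
  have e11 : ∀ z, A v v z = 0 := fun z => (e5 z).1
  ext x y w
  rw [lie_lie_hop hs h hu hv huv]
  simp only [LinearMap.smul_apply, psi, theta_apply, hop_lie, map_sub, map_smul,
    LinearMap.sub_apply, hβ, uu, e1 w, e2 w, e3 x, e4 x, e6, e7, e8 y, e9, e10, e11, smul_zero,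
    sub_zero, zero_sub, smul_eq_mul]
  ring

end HopFacts

/-! ### From one decomposable tensor to all those of the same shape -/

section Propagate

/-- There is a non-zero vector of the first null space in the kernel of two given linear forms. -/
theorem exists_ne_zero_ker (hm : 3 ≤ m) (h : Hyp g p q) (f f' : V →ₗ[ℂ] ℂ) :
    ∃ u, (∀ i, g (p i) u = 0) ∧ u ≠ 0 ∧ f u = 0 ∧ f' u = 0 := by
  let s : (Fin m → ℂ) →ₗ[ℂ] V := ∑ i, (LinearMap.proj i).smulRight (p i)
  have hs' : ∀ c, s c = ∑ i, c i • p i := fun c => by simp [s]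
  have hk : LinearMap.ker ((f ∘ₗ s).prod (f' ∘ₗ s)) ≠ ⊥ := by
    -- Two linear conditions on a space of dimension `m ≥ 3`.
    apply LinearMap.ker_ne_bot_of_finrank_lt
    simp; omega
  obtain ⟨c, hc, hc0⟩ := (Submodule.ne_bot_iff _).1 hk
  have hc := LinearMap.mem_ker.1 hc
  refine ⟨s c, fun i => by simp [hs', h.pp], fun h0 => hc0 ?_, congrArg Prod.fst hc,
    congrArg Prod.snd hc⟩
  ext i
  have := congrArg (g (q i)) h0
  simpa [hs', h.qp, kron] using this

/-- A vector of the second null space which is not a multiple of another one is separated from it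
by a vector of the first. -/
theorem exists_sep (h : Hyp g p q) {v w : V} (hv : ∀ i, g (q i) v = 0) (hw : ∀ i, g (q i) w = 0)
    (hvw : ∀ c : ℂ, v ≠ c • w) : ∃ a, (∀ i, g (p i) a = 0) ∧ g a w = 0 ∧ g a v ≠ 0 := by
  have : v ∉ Submodule.span ℂ {w} := fun hmem => by
    obtain ⟨c, hc⟩ := Submodule.mem_span_singleton.1 hmem
    exact hvw c hc.symm
  obtain ⟨f, hf, hk⟩ := Submodule.exists_le_ker_of_notMem this
  have e : ∀ x, (∀ i, g (q i) x = 0) → g (∑ i, f (q i) • p i) x = f x := by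
    intro x hx
    conv_rhs => rw [h.expand_right hx]
    simp [mul_comm]
  refine ⟨∑ i, f (q i) • p i, fun i => by simp [h.pp], ?_, ?_⟩
  · rw [e w hw]; exact hk (Submodule.mem_span_singleton_self w)
  · rw [e v hv]; exact hf

/-- Stability under the endomorphisms of rank one of the first null space. -/
def Stable (hs : g.IsSymm) (p q : Fin m → V) (W : Submodule ℂ (Tri V)) : Prop :=
  ∀ a b, (∀ i, g (p i) a = 0) → (∀ i, g (q i) b = 0) → ∀ A ∈ W, (⁅hop g hs a b, A⁆ : Tri V) ∈ W

variable {W : Submodule ℂ (Tri V)} (hm : 3 ≤ m) (h : Hyp g p q) (hW : Stable hs p q W)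

theorem smul_mem_cancel {W : Submodule ℂ (Tri V)} {c : ℂ} (hc : c ≠ 0) {A : Tri V}
    (hA : c • A ∈ W) : A ∈ W := by
  have := W.smul_mem c⁻¹ hA
  rwa [smul_smul, inv_mul_cancel₀ hc, one_smul] at this

theorem ne_smul_symm {v w : V} (hv : v ≠ 0) (h : ∀ c : ℂ, w ≠ c • v) (c : ℂ) : v ≠ c • w := by
  rintro rfl
  have hc : c ≠ 0 := by rintro rfl; simp at hv
  exact h c⁻¹ (by rw [smul_smul, inv_mul_cancel₀ hc, one_smul])

include h hW in
-- A vector `a` orthogonal to `v` but not to `w` makes `hop a b` kill `v` and send `w` to a multiple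
-- of `b`.
theorem hook_step {v w b : V} (hv : ∀ i, g (q i) v = 0) (hw : ∀ i, g (q i) w = 0)
    (hb : ∀ i, g (q i) b = 0)
    (hvw : ∀ c : ℂ, w ≠ c • v) (hmem : theta g v v w ∈ W) : theta g v v b ∈ W := by
  obtain ⟨a, ha, hav, haw⟩ := exists_sep h hw hv hvw
  have := hW a b ha hb _ hmem
  rw [lie_theta, hop_right hs h hb hv, hop_right hs h hb hw, hav] at this
  simp only [zero_smul, neg_zero, map_zero, LinearMap.zero_apply, zero_add, map_neg, map_smul]
    at this
  rw [← neg_smul] at this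
  exact smul_mem_cancel (neg_ne_zero.2 haw) this

include hm h hW in
theorem hook_all {v w : V} (hv : ∀ i, g (q i) v = 0) (hw : ∀ i, g (q i) w = 0)
    (hv0 : v ≠ 0) (hvw : ∀ c : ℂ, w ≠ c • v) (hmem : theta g v v w ∈ W) {v' w' : V}
    (hv' : ∀ i, g (q i) v' = 0) (hw' : ∀ i, g (q i) w' = 0) : theta g v' v' w' ∈ W := by
  by_cases hc : ∃ c : ℂ, v' = c • v
  · obtain ⟨c, rfl⟩ := hc
    have := hook_step hs h hW hv hw hw' hvw hmem
    simp only [map_smul, LinearMap.smul_apply]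
    exact W.smul_mem _ (W.smul_mem _ this)
  · push Not at hc
    -- To replace `v` by an independent `v'`, put `v'` in the last slot first; the element sending
    -- `v` to `v'` and killing `v'` then gives a multiple of θ(v', v', v), by the symmetries of
    -- `theta`.
    have h1 := hook_step hs h hW hv hw hv' hvw hmem
    obtain ⟨a, ha, hav, haw⟩ := exists_sep h hv hv' (ne_smul_symm hv0 hc)
    have h2 := hW a v' ha hv' _ h1
    rw [lie_theta, hop_right hs h hv' hv, hop_right hs h hv' hv', hav] at h2
    have e : theta g (-(g a v • v')) v v' + theta g v (-(g a v • v')) v' +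
        theta g v v (-((0 : ℂ) • v')) = (g a v) • theta g v' v' v := by
      ext x y z
      simp only [map_neg, map_smul, LinearMap.add_apply, LinearMap.neg_apply,
        LinearMap.smul_apply, smul_eq_mul, theta_apply, zero_mul, zero_smul, map_zero,
        LinearMap.zero_apply]
      ring
    rw [e] at h2
    exact hook_step hs h hW hv' hv hw' (ne_smul_symm hv0 hc) (smul_mem_cancel haw h2)

include hs in
theorem g_comm (u v : V) : g u v = g v u := hs.eq u v

theorem exists_dual_ne {v : V} (h : Hyp g p q) (hv : ∀ i, g (q i) v = 0) (hv0 : v ≠ 0) :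
    ∃ i, g (p i) v ≠ 0 := by
  by_contra hcon
  push Not at hcon
  exact hv0 (by rw [h.expand_right hv]; simp [hcon])

include h hW in
theorem sym_step₁ {v u a : V} (hv : ∀ i, g (q i) v = 0) (hu : ∀ i, g (p i) u = 0)
    (ha : ∀ i, g (p i) a = 0) (hu0 : u ≠ 0) (hav : g a v = 0)
    (hmem : theta g v v u ∈ W) : theta g v v a ∈ W := by
  obtain ⟨i, hi⟩ := exists_dual_ne h.swap hu hu0
  have := hW a (q i) ha (h.qq · i) _ hmem
  rw [lie_theta, hop_right hs h (h.qq · i) hv, hop_left hs h ha hu, hav] at this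
  simp only [zero_smul, neg_zero, map_zero, LinearMap.zero_apply, zero_add, map_smul] at this
  exact smul_mem_cancel hi this

include h hW in
-- Sending `v` to `b` twice yields θ(b, b, u), up to a multiple of the first image, which is
-- subtracted.
theorem sym_step₂ {v u b : V} (hv : ∀ i, g (q i) v = 0) (hu : ∀ i, g (p i) u = 0)
    (hb : ∀ i, g (q i) b = 0) (hv0 : v ≠ 0) (hbu : g b u = 0)
    (hmem : theta g v v u ∈ W) : theta g b b u ∈ W := by
  obtain ⟨i, hi⟩ := exists_dual_ne h hv hv0
  have h1 := hW (p i) b (h.pp · i) hb _ hmem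
  have h2 := hW (p i) b (h.pp · i) hb _ h1
  have e1 : (⁅hop g hs (p i) b, theta g v v u⁆ : Tri V) =
      (-g (p i) v) • (theta g b v u + theta g v b u) := by
    rw [lie_theta, hop_right hs h hb hv, hop_left hs h (h.pp · i) hu, hbu]
    simp only [zero_smul, map_zero, map_neg, map_smul, LinearMap.neg_apply, LinearMap.smul_apply]
    module
  have e2 : (⁅hop g hs (p i) b, ⁅hop g hs (p i) b, theta g v v u⁆⁆ : Tri V) =
      (2 * g (p i) v ^ 2) • theta g b b u +
        (-g (p i) b) • ((-g (p i) v) • (theta g b v u + theta g v b u)) := by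
    rw [e1, tri_lie_smul, tri_lie_add, lie_theta, lie_theta, hop_right hs h hb hv,
      hop_left hs h (h.pp · i) hu, hbu, hop_right hs h hb hb]
    simp only [zero_smul, map_zero, map_neg, map_smul, LinearMap.neg_apply, LinearMap.smul_apply]
    module
  rw [e2, ← e1] at h2
  have h3 := W.add_mem h2 (W.smul_mem (g (p i) b) h1)
  have e3 : (2 * g (p i) v ^ 2) • theta g b b u +
      (-g (p i) b) • (⁅hop g hs (p i) b, theta g v v u⁆ : Tri V) +
      (g (p i) b) • (⁅hop g hs (p i) b, theta g v v u⁆ : Tri V) =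
      (2 * g (p i) v ^ 2) • theta g b b u := by module
  rw [e3] at h3
  exact smul_mem_cancel (mul_ne_zero two_ne_zero (pow_ne_zero 2 hi)) h3

include hm h hW in
theorem sym_all {v u : V} (hv : ∀ i, g (q i) v = 0) (hu : ∀ i, g (p i) u = 0)
    (hv0 : v ≠ 0) (hu0 : u ≠ 0) (hmem : theta g v v u ∈ W) {v' u' : V}
    (hv' : ∀ i, g (q i) v' = 0) (hu' : ∀ i, g (p i) u' = 0) (huv' : g v' u' = 0) :
    theta g v' v' u' ∈ W := by
  by_cases hv'0 : v' = 0
  · subst hv'0; simp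
  -- A vector incident to both `v` and `v'` allows `u` to be replaced by `a`, then `v` by `v'`, then
  -- `a` by `u'`.
  obtain ⟨a, ha, ha0, hav, hav'⟩ := exists_ne_zero_ker hm h (g v) (g v')
  have h1 := sym_step₁ hs h hW hv hu ha hu0 (by rw [g_comm hs]; exact hav) hmem
  have h2 := sym_step₂ hs h hW hv ha hv' hv0 hav' h1
  exact sym_step₁ hs h hW hv' ha hu' ha0 (by rw [g_comm hs]; exact huv') h2

include h hW in
theorem alt_step {v w u b : V} (hv : ∀ i, g (q i) v = 0) (hw : ∀ i, g (q i) w = 0)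
    (hu : ∀ i, g (p i) u = 0) (hb : ∀ i, g (q i) b = 0) (hvw : ∀ c : ℂ, v ≠ c • w)
    (hbu : g b u = 0) (hmem : psi g v w u ∈ W) : psi g b w u ∈ W := by
  obtain ⟨a, ha, haw, hav⟩ := exists_sep h hv hw hvw
  have := hW a b ha hb _ hmem
  rw [lie_psi, hop_right hs h hb hv, hop_right hs h hb hw, hop_left hs h ha hu, hbu, haw,
    ← neg_smul, ← neg_smul, psi_smul₁, psi_smul₂, psi_smul₃] at this
  simp only [neg_zero, zero_smul, add_zero] at this
  exact smul_mem_cancel (neg_ne_zero.2 hav) this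

theorem psi_mem_swap {W : Submodule ℂ (Tri V)} {v w u : V} (hmem : psi g v w u ∈ W) :
    psi g w v u ∈ W := by rw [psi_swap]; exact neg_mem hmem

include h hW in
-- Exchange of factors with `u` fixed: one factor is replaced at a time, keeping the pair
-- independent. If `w` is already a multiple of `b`, a single exchange suffices.
theorem alt_all₁ {v w u b c : V} (hv : ∀ i, g (q i) v = 0) (hw : ∀ i, g (q i) w = 0)
    (hu : ∀ i, g (p i) u = 0) (hb : ∀ i, g (q i) b = 0) (hc : ∀ i, g (q i) c = 0) (hw0 : w ≠ 0)
    (hvw : ∀ c : ℂ, v ≠ c • w) (hbu : g b u = 0) (hcu : g c u = 0) (hmem : psi g v w u ∈ W) :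
    psi g b c u ∈ W := by
  by_cases hwb : ∃ k : ℂ, w = k • b
  · obtain ⟨k, rfl⟩ := hwb
    have hk : k ≠ 0 := by rintro rfl; simp at hw0
    rw [psi_smul₂] at hmem
    have hvb : ∀ c : ℂ, v ≠ c • b := fun c hc' => hvw (c * k⁻¹) (by
      rw [smul_smul, mul_assoc, inv_mul_cancel₀ hk, mul_one, hc'])
    exact psi_mem_swap (alt_step hs h hW hv hb hu hc hvb hcu (smul_mem_cancel hk hmem))
  · push Not at hwb
    have h1 := alt_step hs h hW hv hw hu hb hvw hbu hmem
    exact psi_mem_swap (alt_step hs h hW hw hb hu hc hwb hcu (psi_mem_swap h1))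

include hm h hW in
theorem alt_all {v w u : V} (hv : ∀ i, g (q i) v = 0) (hw : ∀ i, g (q i) w = 0)
    (hu : ∀ i, g (p i) u = 0) (hu0 : u ≠ 0) (hw0 : w ≠ 0) (hvw : ∀ c : ℂ, v ≠ c • w)
    (hmem : psi g v w u ∈ W) {b c u' : V} (hb : ∀ i, g (q i) b = 0) (hc : ∀ i, g (q i) c = 0)
    (hu' : ∀ i, g (p i) u' = 0) (hbu : g b u' = 0) (hcu : g c u' = 0) : psi g b c u' ∈ W := by
  by_cases hk : ∃ k : ℂ, u' = k • u
  · obtain ⟨k, rfl⟩ := hk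
    by_cases hk0 : k = 0
    · subst hk0; simp [psi]
    rw [map_smul, smul_eq_mul, mul_eq_zero, or_iff_right hk0] at hbu hcu
    rw [psi_smul₃]
    exact W.smul_mem _ (alt_all₁ hs h hW hv hw hu hb hc hw0 hvw hbu hcu hmem)
  push Not at hk
  -- The vector `x` is incident to both `u` and `u'`, `y` only to `u`, and `z` only to `u'`.
  obtain ⟨x, hx, hx0, hxu, hxu'⟩ := exists_ne_zero_ker hm h.swap (g u) (g u')
  obtain ⟨y, hy, hyu, hyu'⟩ := exists_sep h.swap hu' hu hk
  obtain ⟨z, hz, hzu', hzu⟩ := exists_sep h.swap hu hu' (ne_smul_symm hu0 hk)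
  have h1 := alt_all₁ hs h hW hv hw hu hy hx hw0 hvw hyu (by rw [g_comm hs]; exact hxu) hmem
  -- The element `hop u' z` sends `y` to a multiple of `z` and `u` to a multiple of `u'`. Applied
  -- twice to ψ(y, x, u), it gives a non-zero multiple of ψ(z, x, u').
  have h2 := hW u' z hu' hz _ (hW u' z hu' hz _ h1)
  have e0 : g u' z = 0 := by rw [g_comm hs]; exact hzu'
  have e1 : (⁅hop g hs u' z, psi g y x u⁆ : Tri V) =
      (-g u' y) • psi g z x u + g z u • psi g y x u' := by
    rw [lie_psi, hop_right hs h hz hy, hop_right hs h hz hx, hop_left hs h hu' hu, hxu',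
      ← neg_smul, ← neg_smul, psi_smul₁, psi_smul₂, psi_smul₃]
    simp only [neg_zero, zero_smul, add_zero]
  have e2 : (⁅hop g hs u' z, psi g z x u⁆ : Tri V) = g z u • psi g z x u' := by
    rw [lie_psi, hop_right hs h hz hz, hop_right hs h hz hx, hop_left hs h hu' hu, hxu', e0,
      ← neg_smul, psi_smul₁, psi_smul₂, psi_smul₃]
    simp only [neg_zero, zero_smul, zero_add]
  have e3 : (⁅hop g hs u' z, psi g y x u'⁆ : Tri V) = (-g u' y) • psi g z x u' := by
    rw [lie_psi, hop_right hs h hz hy, hop_right hs h hz hx, hop_left hs h hu' hu', hxu', hzu',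
      ← neg_smul, ← neg_smul, psi_smul₁, psi_smul₂, psi_smul₃]
    simp only [neg_zero, zero_smul, add_zero]
  rw [e1, tri_lie_add, tri_lie_smul, tri_lie_smul, e2, e3, smul_smul, smul_smul, ← add_smul] at h2
  have hyu'' : g u' y ≠ 0 := by rw [g_comm hs]; exact hyu'
  have h3 : psi g z x u' ∈ W := by
    refine smul_mem_cancel ?_ h2
    have : -g u' y * g z u + g z u * -g u' y = -2 * (g u' y * g z u) := by ring
    rw [this]
    exact mul_ne_zero (by norm_num) (mul_ne_zero hyu'' hzu)
  refine alt_all₁ hs h hW hz hx hu' hb hc hx0 ?_ hbu hcu h3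
  rintro k rfl
  apply hzu
  rw [map_smul, LinearMap.smul_apply, g_comm hs, hxu, smul_zero]

end Propagate

end Irreducible

section Span

variable {V : Type*} [AddCommGroup V] [Module ℂ V] [FiniteDimensional ℂ V]
variable {g : LinearMap.BilinForm ℂ V} {hg : g.Nondegenerate} (hs : g.IsSymm)
variable {m : ℕ} {p q : Fin m → V}

/-! ### Elements preserving both null spaces -/

/-- `x` is the matrix of `X` on the first null space, and `X` preserves both. -/
structure Acts (X : so g) (p q : Fin m → V) (x : Fin m → Fin m → ℂ) : Prop where
  left : ∀ i, ⁅X, p i⁆ = ∑ l, x l i • p l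
  right : ∀ k, ⁅X, q k⁆ = - ∑ l, x k l • q l

theorem Acts.swap {X : so g} {x : Fin m → Fin m → ℂ} (h : Acts X p q x) :
    Acts X q p (fun i j => - x j i) :=
  ⟨fun i => by simp [h.right i], fun k => by simp [h.left k]⟩

theorem Acts.cmp_lie {X : so g} {x : Fin m → Fin m → ℂ} (hX : Acts X p q x) (κ : Kind)
    (A : Tri V) : cmp p q κ ⁅X, A⁆ = rho x κ (cmp p q κ A) :=
  PureSpinor.cmp_lie (d := 0) (e := 0) (fun i => by simpa using hX.left i)
    (fun i => by simpa using hX.right i) κ (by simp) (by simp)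

theorem Acts.lie_mem {X : so g} {x : Fin m → Fin m → ℂ} (hX : Acts X p q x) {κ : Kind} {A : Tri V}
    (hA : A ∈ modForm g hg p q κ) : (⁅X, A⁆ : Tri V) ∈ modForm g hg p q κ := by
  obtain ⟨h1, h2, h3⟩ := mem_modForm.1 hA
  refine mem_modForm.2 ⟨(cottonYork g hg).lie_mem h1, fun μ hμ => ?_, fun μ => ?_⟩
  · rw [hX.cmp_lie, h2 μ hμ, rho_zero]
  · rw [hX.swap.cmp_lie, h3 μ, rho_zero]

theorem acts_of_mem (h : Hyp g p q) {X : so g} (hp : ∀ i j, g (p j) ⁅X, p i⁆ = 0)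
    (hq : ∀ i j, g (q j) ⁅X, q i⁆ = 0) : Acts X p q (fun l i => g (q l) ⁅X, p i⁆) := by
  refine ⟨fun i => h.expand_left (hp i), fun k => ?_⟩
  rw [h.expand_right (hq k), ← Finset.sum_neg_distrib]
  refine Finset.sum_congr rfl fun l _ => ?_
  rw [← neg_smul]
  congr 1
  have e := so_apply g X (p l) (q k)
  rw [h.expand_left (hp l)] at e
  simp only [map_sum, map_smul, LinearMap.sum_apply, LinearMap.smul_apply, h.pq, smul_eq_mul,
    sum_mul_kron'] at e
  rw [e, neg_neg]

theorem acts_hop (h : Hyp g p q) {a b : V} (ha : ∀ i, g (p i) a = 0) (hb : ∀ i, g (q i) b = 0) :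
    Acts (hop g hs a b) p q (fun l i => g (q l) a * g b (p i)) := by
  have := acts_of_mem h (X := hop g hs a b) (fun i j => by simp [hop_left hs h ha (h.pp · i), ha])
    (fun i j => by simp [hop_right hs h hb (h.qq · i), hb])
  simpa only [hop_left hs h ha (h.pp · _), map_smul, smul_eq_mul, mul_comm] using this

/-! ### Forms vanishing on incident pairs -/

/-- A form with s(v, v, u) = 0 on all incident pairs has pure trace as its symmetric part. Dually,
the tensors θ(v, v, u) span the trace-free symmetric type. -/
theorem exists_sym_coord (h : Hyp g p q) (s : Tri V)
    (hs₀ : ∀ v u, (∀ i, g (q i) v = 0) → (∀ i, g (p i) u = 0) → g v u = 0 → s v v u = 0) :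
    ∃ l : Fin m → ℂ, ∀ i j k, s (q i) (q j) (p k) + s (q j) (q i) (p k) =
      pure 1 1 l (i, j, k) := by
  refine ⟨fun i => s (q i) (q i) (p i), fun i j k => ?_⟩
  have d : ∀ i k, i ≠ k → s (q i) (q i) (p k) = 0 := fun i k hik =>
    hs₀ _ _ (h.qq · i) (h.pp · k) (by rw [h.qp, kron_ne hik])
  have key : ∀ i j, i ≠ j → s (q i) (q j) (p j) + s (q j) (q i) (p j) = s (q i) (q i) (p i) := by
    intro i j hij
    -- The incident pairs q_i ± q_j, p_i ∓ p_j relate the entries that basis pairs do not reach.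
    have h1 := hs₀ (q i + q j) (p i - p j) (by simp [h.qq]) (by simp [h.pp])
      (by simp [h.qp, kron_self, kron_ne hij, kron_ne hij.symm])
    have h2 := hs₀ (q i - q j) (p i + p j) (by simp [h.qq]) (by simp [h.pp])
      (by simp [h.qp, kron_self, kron_ne hij, kron_ne hij.symm])
    simp only [map_add, map_sub, LinearMap.add_apply, LinearMap.sub_apply, d i j hij,
      d j i hij.symm] at h1 h2
    linear_combination -(1 / 2) * h1 - (1 / 2) * h2
  rw [pure_apply]
  by_cases hik : i = k
  · subst hik
    by_cases hij : i = j
    · subst hij; simp only [kron_self]; ring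
    · rw [add_comm, key j i (Ne.symm hij), kron_self, kron_ne (Ne.symm hij)]; ring
  · by_cases hjk : j = k
    · subst hjk; rw [key i j hik, kron_self, kron_ne hik]; ring
    · have := hs₀ (q i + q j) (p k) (by simp [h.qq]) (h.pp · k)
        (by simp [h.qp, kron_ne hik, kron_ne hjk])
      simp only [map_add, LinearMap.add_apply, d i k hik, d j k hjk] at this
      rw [kron_ne hik, kron_ne hjk]
      linear_combination this

/-- The entries s(q_i, q_j, p_j) do not depend on `j ≠ i`, as the incident triple q_i, q_j - q_k,
p_j + p_k shows; their common value is the coefficient of the trace. -/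
theorem exists_alt_coord (hm : 3 ≤ m) (h : Hyp g p q) (s : Tri V)
    (ha : ∀ i j k, s (q i) (q j) (p k) = - s (q j) (q i) (p k))
    (hs₀ : ∀ b c u, (∀ i, g (q i) b = 0) → (∀ i, g (q i) c = 0) → (∀ i, g (p i) u = 0) →
      g b u = 0 → g c u = 0 → s b c u = 0) :
    ∃ l : Fin m → ℂ, ∀ i j k, s (q i) (q j) (p k) = pure 1 (-1) l (i, j, k) := by
  have d : ∀ i j k, i ≠ k → j ≠ k → s (q i) (q j) (p k) = 0 := fun i j k hik hjk =>
    hs₀ _ _ _ (h.qq · i) (h.qq · j) (h.pp · k) (by rw [h.qp, kron_ne hik])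
      (by rw [h.qp, kron_ne hjk])
  have key : ∀ i j k, i ≠ j → i ≠ k → s (q i) (q j) (p j) = s (q i) (q k) (p k) := by
    intro i j k hij hik
    by_cases hjk : j = k
    · rw [hjk]
    have h1 := hs₀ (q i) (q j - q k) (p j + p k) (h.qq · i) (by simp [h.qq]) (by simp [h.pp])
      (by simp [h.qp, kron_ne hij, kron_ne hik])
      (by simp [h.qp, kron_self, kron_ne hjk, kron_ne (Ne.symm hjk)])
    simp only [map_add, map_sub, LinearMap.add_apply, LinearMap.sub_apply, d i j k hik hjk,
      d i k j hij (Ne.symm hjk)] at h1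
    linear_combination h1
  have : Nontrivial (Fin m) := Fin.nontrivial_iff_two_le.2 (by omega)
  choose f hf using fun i : Fin m => exists_ne i
  refine ⟨fun i => s (q i) (q (f i)) (p (f i)), fun i j k => ?_⟩
  rw [pure_apply]
  by_cases hij : i = j
  · subst hij
    have := ha i i k
    linear_combination (1 / 2) * this
  by_cases hik : i = k
  · subst hik
    rw [ha, key j i (f j) (Ne.symm hij) (hf j).symm, kron_self, kron_ne (Ne.symm hij)]; ring
  · by_cases hjk : j = k
    · subst hjk; rw [key i j (f i) hik (hf i).symm, kron_self, kron_ne hik]; ring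
    · rw [d i j k hik hjk, kron_ne hik, kron_ne hjk]; ring

theorem sum_mul_pure (T : Coef m) (a b : ℂ) (l : Fin m → ℂ) (h1 : tr1 T = 0) (h2 : tr2 T = 0) :
    ∑ i, ∑ j, ∑ k, T (i, j, k) * pure a b l (i, j, k) = 0 := by
  have e : ∀ i j k, T (i, j, k) * pure a b l (i, j, k) =
      a * l i * (kron j k * T (i, j, k)) + b * l j * (kron i k * T (i, j, k)) := by
    intro i j k; rw [pure_apply]; ring
  have f1 : ∀ i, ∑ j, T (i, j, j) = 0 := fun i => congrFun h1 i
  have f2 : ∀ j, ∑ i, T (i, j, i) = 0 := fun i => congrFun h2 i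
  simp only [e, Finset.sum_add_distrib, ← Finset.mul_sum, sum_kron_mul]
  rw [Finset.sum_comm (f := fun i j => b * l j * T (i, j, i))]
  simp only [← Finset.mul_sum, f1, f2, mul_zero, Finset.sum_const_zero, add_zero]

/-! ### Generators -/

variable {W : Submodule ℂ (Tri V)} (hm : 3 ≤ m) (h : Hyp g p q)

include hm h in
theorem modForm_hook_le (hth : ∀ v w, (∀ i, g (q i) v = 0) → (∀ i, g (q i) w = 0) →
    theta g v v w ∈ W) : modForm g hg p q .hook ≤ W := by
  intro A hA
  have th : ∀ i j k, theta g (q i) (q j) (q k) ∈ W := by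
    -- A functional that kills the θ(v, v, w) is skew in its first two indices by polarisation. But
    -- `theta` is symmetric in its outer indices, and the two symmetries together force zero.
    by_contra hcon
    push Not at hcon
    obtain ⟨i, j, k, hijk⟩ := hcon
    obtain ⟨f, hf, hk⟩ := Submodule.exists_le_ker_of_notMem hijk
    have an : ∀ a b c, f (theta g (q a) (q b) (q c)) = - f (theta g (q b) (q a) (q c)) := by
      intro a b c
      have h0 : ∀ v, (∀ i, g (q i) v = 0) → f (theta g v v (q c)) = 0 :=
        fun v hv => hk (hth v (q c) hv (h.qq · c))
      have := h0 (q a + q b) (by simp [h.qq])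
      simp only [map_add, LinearMap.add_apply, h0 _ (h.qq · a), h0 _ (h.qq · b)] at this
      linear_combination this
    have sy : ∀ a b c, f (theta g (q a) (q b) (q c)) = f (theta g (q c) (q b) (q a)) := by
      intro a b c
      congr 1
      ext x y z; simp only [theta_apply]; ring
    apply hf
    have := an i j k
    have := sy j i k
    have := an k i j
    have := sy i k j
    have := an j k i
    have := sy k j i
    linear_combination (1 / 2) * (an i j k - sy j i k - an k i j + sy i k j + an j k i - sy k j i)
  rw [eq_build hm h hA, build_hook]
  exact W.smul_mem _ (Submodule.sum_mem _ fun i _ => Submodule.sum_mem _ fun j _ =>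
    Submodule.sum_mem _ fun k _ => W.smul_mem _ (th i j k))

include h in
theorem apply_build {κ : Kind} (hκ : κ ≠ .hook) (f : Tri V →ₗ[ℂ] ℂ) (t : Coef m) :
    f (build g p q κ t) = ∑ i, ∑ j, ∑ k, t (i, j, k) * f (theta g (q i) (q j) (p k)) := by
  rw [build_of_ne hκ]; simp only [map_sum, map_smul, smul_eq_mul]

include hm h in
-- A functional vanishing on the generators has pure trace as its symmetric part, which pairs to
-- zero with the trace-free symmetric coefficients of any tensor of this type. The skew case is
-- analogous.
theorem modForm_sym_le (hth : ∀ v u, (∀ i, g (q i) v = 0) → (∀ i, g (p i) u = 0) → g v u = 0 →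
    theta g v v u ∈ W) : modForm g hg p q .sym ≤ W := by
  intro A hA
  by_contra hAW
  obtain ⟨f, hf, hk⟩ := Submodule.exists_le_ker_of_notMem hAW
  obtain ⟨l, hl⟩ := exists_sym_coord h ((theta g).compr₂ (LinearMap.compRight ℂ f))
    (fun v u hv hu hvu => hk (hth v u hv hu hvu))
  apply hf
  rw [eq_build hm h hA, apply_build h (by decide)]
  set T := proj .sym (cmp p q .sym A)
  have sy : ∀ i j k, T (i, j, k) = T (j, i, k) := proj_sym_symm _
  have := sum_mul_pure T 1 1 l (tr1_proj_sym _) (tr2_proj_sym _)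
  simp only [← hl, mul_add, Finset.sum_add_distrib] at this
  have e := Finset.sum_comm (s := Finset.univ) (t := Finset.univ) (f := fun i j => ∑ k,
    T (i, j, k) * ((theta g).compr₂ (LinearMap.compRight ℂ f)) (q j) (q i) (p k))
  simp only [← sy] at e
  rw [e] at this
  change (∑ i, ∑ j, ∑ k,
    T (i, j, k) * ((theta g).compr₂ (LinearMap.compRight ℂ f)) (q i) (q j) (p k)) = 0
  linear_combination (1 / 2) * this

include hm h in
theorem modForm_alt_le (hth : ∀ b c u, (∀ i, g (q i) b = 0) → (∀ i, g (q i) c = 0) →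
    (∀ i, g (p i) u = 0) → g b u = 0 → g c u = 0 → psi g b c u ∈ W) :
    modForm g hg p q .alt ≤ W := by
  intro A hA
  by_contra hAW
  obtain ⟨f, hf, hk⟩ := Submodule.exists_le_ker_of_notMem hAW
  set s := (theta g).compr₂ (LinearMap.compRight ℂ f)
  have hs' : ∀ b c u, (s - s.flip) b c u = f (psi g b c u) := fun b c u => by
    rw [psi, map_sub]; rfl
  obtain ⟨l, hl⟩ := exists_alt_coord hm h (s - s.flip)
    (fun i j k => by rw [hs', hs', psi_swap, map_neg])
    (fun b c u hb hc hu hbu hcu => by rw [hs']; exact hk (hth b c u hb hc hu hbu hcu))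
  apply hf
  rw [eq_build hm h hA, apply_build h (by decide)]
  set T := proj .alt (cmp p q .alt A)
  have sy : ∀ i j k, T (i, j, k) = - T (j, i, k) := proj_alt_anti _
  have := sum_mul_pure T 1 (-1) l (tr1_proj_alt hm _) (tr2_proj_alt hm _)
  simp only [← hl, LinearMap.sub_apply, mul_sub, Finset.sum_sub_distrib] at this
  have e := Finset.sum_comm (s := Finset.univ) (t := Finset.univ) (f := fun i j => ∑ k,
    T (i, j, k) * s.flip (q i) (q j) (p k))
  have e2 : ∀ i j k, T (i, j, k) * s.flip (q i) (q j) (p k) =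
    - (T (j, i, k) * s (q j) (q i) (p k)) := fun i j k => by
      rw [sy, neg_mul]; rfl
  rw [e] at this
  simp only [e2, Finset.sum_neg_distrib] at this
  change (∑ i, ∑ j, ∑ k, T (i, j, k) * s (q i) (q j) (p k)) = 0
  linear_combination (1 / 2) * this

/-! ### Irreducibility -/

variable (hW : Stable hs p q W) {A : Tri V} (hAW : A ∈ W) (hA0 : A ≠ 0)
include hs hm h hW hAW hA0

theorem modForm_le_of_hook (hA : A ∈ modForm g hg p q .hook) : modForm g hg p q .hook ≤ W := by
  have hA' := mem_cottonYork.1 (mem_modForm.1 hA).1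
  -- Otherwise polarisation makes `A` skew in its first two slots, so totally skew, and the cyclic
  -- identity kills it.
  have : ∃ u z, (∀ i, g (p i) u = 0) ∧ (∀ i, g (p i) z = 0) ∧ A u u z ≠ 0 := by
    by_contra hcon
    push Not at hcon
    apply hA0
    refine eq_of_cmp_eq hm h hA (zero_mem _) ?_
    rw [map_zero, cmp_hook h (mem_modForm.1 hA).1]
    ext ⟨i, j, k⟩
    rw [comp_apply, Pi.zero_apply]
    have an : ∀ i j k, A (p i) (p j) (p k) = - A (p j) (p i) (p k) := fun i j k => by
      have := hcon (p i + p j) (p k) (by simp [h.pp]) (h.pp · k)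
      simp only [map_add, LinearMap.add_apply, hcon _ _ (h.pp · _) (h.pp · k)] at this
      linear_combination this
    have a1 := fun i j k => hA'.1 (p i) (p j) (p k)
    linear_combination (1 / 3) * (hA'.2.1 (p i) (p j) (p k) - 2 * an k i j + 2 * a1 i k j -
      an j k i + a1 k j i)
  obtain ⟨u, z, hu, hz, huz⟩ := this
  set β := ∑ i, A u u (p i) • q i with hβ
  have hβq : ∀ i, g (q i) β = 0 := fun i => by simp [hβ, h.qq]
  have hβ0 : β ≠ 0 := fun h0 => by
    have e : g β z = A u u z := by
      conv_rhs => rw [h.expand_left hz]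
      rw [hβ]
      simp [mul_comm]
    apply huz; rw [← e, h0]; simp
  obtain ⟨k, hk⟩ := exists_dual_ne h hβq hβ0
  -- The coordinate of `v` along `q k` is zero while that of `β` is not, so `β` is not a multiple of
  -- `v`.
  obtain ⟨v, hv, hv0, huv, hkv⟩ := exists_ne_zero_ker hm h.swap (g u) (g (p k))
  have hne : ∀ c : ℂ, β ≠ c • v := by
    intro c hc
    apply hk; rw [hc, map_smul, hkv, smul_zero]
  have hmem := hW u v hu hv _ (hW u v hu hv _ hAW)
  rw [lie_lie_hook hs hm h hu hv (by rw [g_comm hs]; exact huv) hA] at hmem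
  have hmem := smul_mem_cancel two_ne_zero hmem
  exact modForm_hook_le hm h fun v' w' hv' hw' =>
    hook_all hs hm h hW hv hβq hv0 hne hmem hv' hw'

theorem modForm_le_of_sym (hA : A ∈ modForm g hg p q .sym) : modForm g hg p q .sym ≤ W := by
  -- Otherwise the block of `A` would be pure trace as well as trace-free, hence zero.
  have : ∃ u v, (∀ i, g (p i) u = 0) ∧ (∀ i, g (q i) v = 0) ∧ g u v = 0 ∧ A u u v ≠ 0 := by
    by_contra hcon
    push Not at hcon
    obtain ⟨l, hl⟩ := exists_sym_coord h.swap A hcon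
    apply hA0
    refine eq_of_cmp_eq hm h hA (zero_mem _) ?_
    rw [map_zero]
    have c := ((comp_of_mem_modForm hm h hA).2.2.2 (by decide)).2
    have e : (2 : ℂ) • cmp p q .sym A = pure 1 1 l := by
      ext ⟨i, j, k⟩
      rw [← hl, Pi.smul_apply, smul_eq_mul, two_mul]
      nth_rw 2 [cmp]
      rw [LinearMap.comp_apply, proj_sym_symm, ← LinearMap.comp_apply, ← cmp, ← c]
      rfl
    have e1 := congrArg tr1 e
    rw [map_smul, cmp, LinearMap.comp_apply, tr1_proj_sym, smul_zero, tr1_pure] at e1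
    have : l = 0 := by
      refine (smul_eq_zero.1 e1.symm).resolve_left ?_
      rw [one_mul]; exact natCast_add_one_ne
    rw [this, map_zero] at e
    exact (smul_eq_zero.1 e).resolve_left two_ne_zero
  obtain ⟨u, v, hu, hv, huv, hne⟩ := this
  have hv0 : v ≠ 0 := by rintro rfl; simp at hne
  have hu0 : u ≠ 0 := by rintro rfl; simp at hne
  have hmem := hW u v hu hv _ (hW u v hu hv _ (hW u v hu hv _ hAW))
  rw [lie_lie_lie_ne hs hm h hu hv (by rw [g_comm hs]; exact huv) (by decide) hA] at hmem
  have hmem := smul_mem_cancel (mul_ne_zero (by norm_num) hne) hmem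
  exact modForm_sym_le hm h fun v' u' hv' hu' huv' =>
    sym_all hs hm h hW hv hu hv0 hu0 hmem hv' hu' huv'

theorem modForm_le_of_alt (hA : A ∈ modForm g hg p q .alt) : modForm g hg p q .alt ≤ W := by
  have c := ((comp_of_mem_modForm hm h hA).2.2.2 (by decide)).2
  have : ∃ u u' v, (∀ i, g (p i) u = 0) ∧ (∀ i, g (p i) u' = 0) ∧ (∀ i, g (q i) v = 0) ∧
      g u v = 0 ∧ g u' v = 0 ∧ A u u' v ≠ 0 := by
    by_contra hcon
    push Not at hcon
    have hc : ∀ i j k, A (p i) (p j) (q k) = cmp p q .alt A (i, j, k) := fun i j k => by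
      rw [← c]; rfl
    obtain ⟨l, hl⟩ := exists_alt_coord hm h.swap A (fun i j k => by
      rw [hc, hc, cmp, LinearMap.comp_apply, proj_alt_anti]) hcon
    apply hA0
    refine eq_of_cmp_eq hm h hA (zero_mem _) ?_
    rw [map_zero]
    have e : cmp p q .alt A = pure 1 (-1) l := by
      ext ⟨i, j, k⟩
      rw [← hl, hc]
    have e1 := congrArg tr1 e
    rw [cmp, LinearMap.comp_apply, tr1_proj_alt hm, tr1_pure] at e1
    have : l = 0 := by
      refine (smul_eq_zero.1 e1.symm).resolve_left ?_
      rw [one_mul]; exact natCast_sub_one_ne hm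
    rw [e, this, map_zero]
  obtain ⟨u, u', v, hu, hu', hv, huv, huv', hne⟩ := this
  have hv0 : v ≠ 0 := by rintro rfl; simp at hne
  have hu0 : u ≠ 0 := by rintro rfl; simp at hne
  have hmem := hW u v hu hv _ (hW u v hu hv _ hAW)
  rw [lie_lie_alt hs hm h hu hv (by rw [g_comm hs]; exact huv) hA] at hmem
  have hmem := smul_mem_cancel (by norm_num) hmem
  set w := ∑ i, A u (p i) v • q i with hw
  have hwq : ∀ i, g (q i) w = 0 := fun i => by simp [hw, h.qq]
  have e : g w u' = A u u' v := by
    conv_rhs => rw [h.expand_left hu']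
    rw [hw]
    simp [mul_comm]
  -- The vector `u'` is orthogonal to `v` but not to `w`, so these are independent.
  have hwv : ∀ c : ℂ, w ≠ c • v := by
    intro c hc
    apply hne
    rw [← e, hc, map_smul, LinearMap.smul_apply, g_comm hs, huv', smul_zero]
  have hw0 : w ≠ 0 := fun h0 => hwv 0 (by rw [h0, zero_smul])
  exact modForm_alt_le hm h fun b c u'' hb hc hu'' hbu hcu =>
    alt_all hs hm h hW hv hwq hu hu0 hw0 (ne_smul_symm hv0 hwv) hmem hb hc hu'' hbu hcu

theorem modForm_le_of_trace (hA : A ∈ modForm g hg p q .trace) :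
    modForm g hg p q .trace ≤ W := by
  intro B hB
  have cc : ∀ {C : Tri V}, cmp p q .trace C = pure ((2 * m - 1) / (2 * (m ^ 2 - 1)))
    ((m - 2) / (2 * (m ^ 2 - 1))) (tr1 (comp p q C)) := fun {C} => proj_trace _
  have : ∃ l, tr1 (comp p q A) l ≠ 0 := by
    by_contra hcon
    push Not at hcon
    apply hA0
    refine eq_of_cmp_eq hm h hA (zero_mem _) ?_
    rw [map_zero, cc, funext hcon]
    exact map_zero _
  obtain ⟨l, hl⟩ := this
  have mem : ∀ j, (⁅hop g hs (p l) (q j), A⁆ : Tri V) ∈ W := fun j =>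
    hW _ _ (h.pp · l) (h.qq · j) _ hAW
  -- The trace vector determines a tensor of this type, and `hop (p l) (q j)` moves its non-zero
  -- `l`-th entry to place `j` with a minus sign; this explains the coefficients.
  have hB' : B = ∑ j, (- tr1 (comp p q B) j / tr1 (comp p q A) l) •
      (⁅hop g hs (p l) (q j), A⁆ : Tri V) := by
    refine eq_of_cmp_eq hm h hB (Submodule.sum_mem _ fun j _ => Submodule.smul_mem _ _
      ((acts_hop hs h (h.pp · l) (h.qq · j)).lie_mem hA)) ?_
    simp only [map_sum, map_smul, (acts_hop hs h (h.pp · l) (h.qq · _)).cmp_lie]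
    simp only [cc, ← pure_rho₁ _ (show Kind.trace ≠ .hook by decide), ← map_smul, ← map_sum]
    congr 1
    ext i
    simp only [Finset.sum_apply, Pi.smul_apply, smul_eq_mul, rho₁, h.qp, mul_assoc, sum_kron_mul',
      mul_neg]
    have e : ∀ j, -(-tr1 (comp p q B) j / tr1 (comp p q A) l *
        (kron j i * tr1 (comp p q A) l)) = kron j i * tr1 (comp p q B) j := fun j => by
      field_simp
    simp only [e, sum_kron_mul']
  rw [hB']
  exact Submodule.sum_mem _ fun j _ => W.smul_mem _ (mem j)

theorem modForm_le {κ : Kind} (hA : A ∈ modForm g hg p q κ) : modForm g hg p q κ ≤ W := by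
  cases κ
  · exact modForm_le_of_hook hs hm h hW hAW hA0 hA
  · exact modForm_le_of_trace hs hm h hW hAW hA0 hA
  · exact modForm_le_of_alt hs hm h hW hAW hA0 hA
  · exact modForm_le_of_sym hs hm h hW hAW hA0 hA

end Span

section Filtration

variable {V : Type*} [AddCommGroup V] [Module ℂ V] [FiniteDimensional ℂ V]
variable {S : Type*} [AddCommGroup S] [Module ℂ S]
variable {g : LinearMap.BilinForm ℂ V} [Module (CliffordAlgebra (cliffordForm g)) S]
  [IsScalarTower ℂ (CliffordAlgebra (cliffordForm g)) S]
variable (hs : g.IsSymm) (hg : g.Nondegenerate) {ξ : S}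
variable {m : ℕ} {p q : Fin m → V}

/-! ### Hyperbolic bases adapted to a pure spinor -/

/-- The Gram matrix shows the `2 m` vectors to be independent, so by dimension they form a basis
with the stated expansion. -/
theorem Hyp.of_finrank (hV : finrank ℂ V = 2 * m) (pp : ∀ i j, g (p i) (p j) = 0)
    (qq : ∀ i j, g (q i) (q j) = 0) (pq : ∀ i j, g (p i) (q j) = kron i j)
    (qp : ∀ i j, g (q i) (p j) = kron i j) : Hyp g p q := by
  let T : V →ₗ[ℂ] (Fin m → ℂ) × (Fin m → ℂ) :=
    (LinearMap.pi fun i => g (q i)).prod (LinearMap.pi fun i => g (p i))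
  have h1 : ∀ a b : Fin m → ℂ, T (∑ i, a i • p i + ∑ i, b i • q i) = (a, b) := by
    intro a b
    ext i <;> simp [T, pp, qq, pq, qp, kron]
  have hs : Function.Surjective T := fun x => ⟨_, h1 x.1 x.2⟩
  have hi : Function.Injective T := (LinearMap.injective_iff_surjective_of_finrank_eq_finrank (by
    rw [hV, Module.finrank_prod, finrank_fin_fun, two_mul])).2 hs
  exact ⟨pp, qq, pq, qp, fun v => hi (h1 _ _).symm⟩

include hs in
theorem nullPlane_isotropic (hξ : ξ ≠ 0) {u v : V} (hu : u ∈ nullPlane g ξ)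
    (hv : v ∈ nullPlane g ξ) : g u v = 0 := by
  have h := LinearMap.congr_fun (gamma_anticomm (S := S) g hs u v) ξ
  have hu' : gamma S g u ξ = 0 := hu
  have hv' : gamma S g v ξ = 0 := hv
  simp only [LinearMap.add_apply, Module.End.mul_apply, hu', hv', map_zero, add_zero,
    LinearMap.smul_apply, Module.End.one_apply] at h
  have := (smul_eq_zero.1 h.symm).resolve_right hξ
  linear_combination -(1 / 2) * this

variable (g ξ) in
/-- A hyperbolic basis one half of which spans the null space of the spinor. -/
structure Adapted (p q : Fin m → V) : Prop extends Hyp g p q where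
  mem_iff : ∀ v, v ∈ nullPlane g ξ ↔ ∀ i, g (p i) v = 0

include hs hg in
theorem exists_adapted (hξ : IsPure g ξ) (hV : finrank ℂ V = 2 * m) :
    ∃ p q : Fin m → V, Adapted g ξ p q := by
  have hd : finrank ℂ (nullPlane g ξ) = m := by have := hξ.2; omega
  let e : Basis (Fin m) ℂ (nullPlane g ξ) := finBasisOfFinrankEq ℂ _ hd
  have iso : ∀ i j, g (e i) (e j) = 0 := fun i j =>
    nullPlane_isotropic hs hξ.1 (e i).2 (e j).2
  have hr : ∀ j, ∃ r : V, ∀ i, g r (e i) = kron j i := by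
    intro j
    obtain ⟨f, hf⟩ := LinearMap.exists_extend (e.coord j)
    refine ⟨(LinearMap.BilinForm.toDual g hg).symm f, fun i => ?_⟩
    rw [← LinearMap.BilinForm.toDual_def hg, LinearEquiv.apply_symm_apply]
    have := LinearMap.congr_fun hf (e i)
    simp only [LinearMap.comp_apply, Submodule.subtype_apply, Basis.coord_apply, Basis.repr_self]
      at this
    rw [this, Finsupp.single_apply, kron]
    simp only [eq_comm]
  choose r hr using hr
  -- Subtracting half of the Gram matrix of the `r j` makes the dual vectors null; duality with the
  -- `e i` is unaffected because the `e i` are null.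
  let q : Fin m → V := fun j => r j - (1 / 2 : ℂ) • ∑ k, g (r j) (r k) • (e k : V)
  have hqp : ∀ i j, g (q i) (e j) = kron i j := fun i j => by
    simp [q, hr, iso]
  have hq : ∀ i j, g (q i) (q j) = 0 := fun i j => by
    have e1 : ∀ i j, g (e i) (r j) = kron i j := fun i j => by
      rw [g_comm hs, hr, kron_comm]
    simp only [q, map_sub, map_smul, map_sum, LinearMap.sub_apply, LinearMap.smul_apply,
      LinearMap.sum_apply, smul_eq_mul, hr, e1, iso, mul_zero, Finset.sum_const_zero, sub_zero]
    rw [sum_mul_kron i (fun x => g (r j) (r x)), sum_mul_kron' j (fun x => g (r i) (r x))]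
    linear_combination -(1 / 2) * g_comm hs (r j) (r i)
  have H := Hyp.of_finrank (p := fun i => (e i : V)) (q := q) hV iso hq
    (fun i j => by rw [g_comm hs, hqp, kron_comm]) hqp
  refine ⟨fun i => e i, q, H, fun v => ⟨fun hv i => nullPlane_isotropic hs hξ.1 (e i).2 hv,
    fun hv => ?_⟩⟩
  rw [H.expand_left hv]
  exact Submodule.sum_mem _ fun i _ => Submodule.smul_mem _ _ (e i).2

include hs hg in
-- The null plane and `N'` are both null and together span `V`, so `g` pairs them perfectly and the
-- basis dual to `e` lies in `N'`.
theorem exists_adapted_compl (hξ : IsPure g ξ) (hV : finrank ℂ V = 2 * m) {N' : Submodule ℂ V}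
    (hc : IsCompl (nullPlane g ξ) N') (hN' : ∀ u ∈ N', ∀ v ∈ N', g u v = 0)
    (e : Basis (Fin m) ℂ (nullPlane g ξ)) :
    ∃ q : Fin m → V, Adapted g ξ (fun i => (e i : V)) q ∧ ∀ v, v ∈ N' ↔ ∀ i, g (q i) v = 0 := by
  have hd : finrank ℂ (nullPlane g ξ) = m := by have := hξ.2; omega
  have hd' : finrank ℂ N' = m := by
    have := Submodule.finrank_add_eq_of_isCompl hc; omega
  have iso : ∀ i j, g (e i) (e j) = 0 := fun i j =>
    nullPlane_isotropic hs hξ.1 (e i).2 (e j).2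
  let T : N' →ₗ[ℂ] (Fin m → ℂ) := LinearMap.pi fun i => (g (e i)) ∘ₗ N'.subtype
  have hi : Function.Injective T := by
    rw [← LinearMap.ker_eq_bot, LinearMap.ker_eq_bot']
    intro w hw
    have hw' : ∀ i, g (e i) w = 0 := fun i => congrFun hw i
    have h0 : (w : V) = 0 := by
      refine hg.2 _ fun v => ?_
      obtain ⟨a, ha, b, hb, rfl⟩ := Submodule.mem_sup.1
        (hc.sup_eq_top ▸ Submodule.mem_top : v ∈ nullPlane g ξ ⊔ N')
      have h1 : (g.flip w) ∘ₗ (nullPlane g ξ).subtype = 0 := e.ext hw'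
      have h2 : g a w = 0 := LinearMap.congr_fun h1 ⟨a, ha⟩
      rw [map_add, LinearMap.add_apply, h2, hN' b hb w w.2, add_zero]
    exact Subtype.ext h0
  have hsurj : Function.Surjective T :=
    (LinearMap.injective_iff_surjective_of_finrank_eq_finrank (by rw [hd', finrank_fin_fun])).1 hi
  choose r hr using fun j : Fin m => hsurj (fun i => kron i j)
  have hpq : ∀ i j, g (e i) (r j) = kron i j := fun i j => congrFun (hr j) i
  have H := Hyp.of_finrank (p := fun i => (e i : V)) (q := fun j => (r j : V)) hV iso
    (fun i j => hN' _ (r i).2 _ (r j).2) hpq (fun i j => by rw [g_comm hs, hpq, kron_comm])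
  refine ⟨fun j => r j, ⟨H, fun v => ⟨fun hv i => nullPlane_isotropic hs hξ.1 (e i).2 hv,
    fun hv => ?_⟩⟩, fun v => ⟨fun hv i => hN' _ (r i).2 _ hv, fun hv => ?_⟩⟩
  · rw [H.expand_left hv]
    exact Submodule.sum_mem _ fun i _ => Submodule.smul_mem _ _ (e i).2
  · rw [H.expand_right hv]
    exact Submodule.sum_mem _ fun i _ => Submodule.smul_mem _ _ (r i).2

theorem Adapted.gamma (h : Adapted g ξ p q) (i : Fin m) : gamma S g (p i) ξ = 0 :=
  (h.mem_iff _).2 (h.pp · i)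

/-! ### The stabilizer -/

include hs in
theorem spin_gamma_apply (X : so g) (v : V) (s : S) : spin g hg X (gamma S g v s) -
    gamma S g v (spin g hg X s) = gamma S g ⁅X, v⁆ s :=
  LinearMap.congr_fun (spin_gamma (S := S) g hs hg X v) s

theorem stabilizer_preserves (X : stabilizer g hs hg ξ) {v : V} (hv : v ∈ nullPlane g ξ) :
    ⁅(X : so g), v⁆ ∈ nullPlane g ξ := by
  obtain ⟨c, hc⟩ := X.2
  have h := spin_gamma_apply hs hg X v ξ
  have hv' : PureSpinor.gamma S g v ξ = 0 := hv
  rw [hc, hv', map_zero, map_smul, hv', smul_zero, sub_zero] at h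
  exact h.symm

/-- Converse of `stabilizer_preserves`: of the Clifford sum only the terms X p_i · q_i · ξ = -2 g(X
p_i, q_i) ξ survive, so the eigenvalue is half the trace of `X` on the null plane. -/
theorem mem_stabilizer (h : Adapted g ξ p q) {X : so g} (hX : ∀ i j, g (p j) ⁅X, p i⁆ = 0) :
    X ∈ stabilizer g hs hg ξ := by
  refine ⟨1 / 2 * ∑ i, g (q i) ⁅X, p i⁆, ?_⟩
  have e := sum_frame hg h.toHyp (M := S)
    (LinearMap.mk₂ ℂ (fun u v => PureSpinor.gamma S g ⁅X, u⁆ (PureSpinor.gamma S g v ξ))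
      (by simp) (by simp) (by simp) (by simp))
  simp only [LinearMap.mk₂_apply, h.gamma, map_zero, add_zero] at e
  rw [spin, LinearMap.smul_apply, LinearMap.sum_apply]
  simp only [Module.End.mul_apply]
  rw [e, Finset.smul_sum, Finset.mul_sum, Finset.sum_smul]
  refine Finset.sum_congr rfl fun i _ => ?_
  have h0 : PureSpinor.gamma S g ⁅X, p i⁆ ξ = 0 := (h.mem_iff _).2 (hX i)
  have h1 := LinearMap.congr_fun (gamma_anticomm (S := S) g hs ⁅X, p i⁆ (q i)) ξ
  simp only [LinearMap.add_apply, Module.End.mul_apply, h0, map_zero, add_zero,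
    LinearMap.smul_apply, Module.End.one_apply] at h1
  rw [h1, smul_smul, g_comm hs (q i)]
  congr 1
  ring

/-! ### The action on components -/

/-- The type of a label. -/
def Label.kind : Label → Kind
  | .m3_0 => .hook
  | .m1_0 => .trace
  | .m1_1 => .alt
  | .m1_2 => .sym
  | .p1_0 => .trace
  | .p1_1 => .alt
  | .p1_2 => .sym
  | .p3_0 => .hook

/-- The action on components of the endomorphism with matrix `x` on the null space. -/
def Label.act (x : Fin m → Fin m → ℂ) (z : Label) : Coef m → Coef m :=
  if z.pos ≤ 1 then rho x z.kind else rho (fun i j => - x j i) z.kind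

theorem cmpL_neg {z : Label} (hz : z.pos ≤ 1) : cmpL p q z = cmp p q z.kind := by
  cases z <;> first | rfl | exact absurd hz (by decide)

theorem cmpL_pos {z : Label} (hz : ¬ z.pos ≤ 1) : cmpL p q z = cmp q p z.kind := by
  cases z <;> first | rfl | exact absurd (by decide) hz

theorem act_zero (x : Fin m → Fin m → ℂ) (z : Label) : z.act x 0 = 0 := by
  rw [Label.act]; split_ifs <;> exact rho_zero _ _

theorem comp_eq_zero_of_low (hm : 3 ≤ m) (h : Hyp g p q) {A : Tri V} (hA : A ∈ cottonYork g hg)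
    {k : Fin 4} (low : ∀ y : Label, y.pos < k → cmpL p q y A = 0) :
    (0 < k → comp p p A = 0) ∧ (1 < k → comp p q A = 0) ∧ (2 < k → comp q p A = 0) := by
  refine ⟨fun hk => ?_, fun hk => ?_, fun hk => ?_⟩
  · rw [← cmp_hook h hA]; exact low .m3_0 hk
  · rw [← sum_cmp hm h hA]
    have e1 : cmp p q .trace A = 0 := low .m1_0 hk
    have e2 : cmp p q .alt A = 0 := low .m1_1 hk
    have e3 : cmp p q .sym A = 0 := low .m1_2 hk
    rw [e1, e2, e3, add_zero, add_zero]
  · rw [← sum_cmp hm h.swap hA]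
    have e1 : cmp q p .trace A = 0 := low .p1_0 hk
    have e2 : cmp q p .alt A = 0 := low .p1_1 hk
    have e3 : cmp q p .sym A = 0 := low .p1_2 hk
    rw [e1, e2, e3, add_zero, add_zero]

/-- An element of 𝔭 preserves the span of `p`, and its remainder on `q` lies in that span. The
remainder couples a component only to components of lower position, so it drops out when these
vanish and the 𝔤₀ part alone acts. -/
theorem cmpL_lie (hm : 3 ≤ m) (h : Hyp g p q) {X : so g} (hX : ∀ i j, g (p j) ⁅X, p i⁆ = 0)
    {A : Tri V} (hA : A ∈ cottonYork g hg) (z : Label)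
    (low : ∀ y : Label, y.pos < z.pos → cmpL p q y A = 0) :
    cmpL p q z ⁅X, A⁆ = z.act (fun l i => g (q l) ⁅X, p i⁆) (cmpL p q z A) := by
  set x : Fin m → Fin m → ℂ := fun l i => g (q l) ⁅X, p i⁆ with hx
  set d : Fin m → V := fun k => ⁅X, q k⁆ + ∑ l, x k l • q l with hd
  have hp : ∀ i, ⁅X, p i⁆ = ∑ l, x l i • p l := fun i => h.expand_left (hX i)
  have hq : ∀ k, ⁅X, q k⁆ = - ∑ l, x k l • q l + d k := fun k => by
    rw [hd]; simp only; abel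
  -- By skew-adjointness the `q` part of X q_k is minus the transpose of the matrix on `p`; the
  -- remainder is in the null plane.
  have hdp : ∀ k l, g (p l) (d k) = 0 := fun k l => by
    have e := so_apply g X (p l) (q k)
    rw [hp] at e
    simp only [map_sum, map_smul, LinearMap.sum_apply, LinearMap.smul_apply, h.pq, smul_eq_mul,
      sum_mul_kron'] at e
    simp only [hd, map_add, map_sum, map_smul, h.pq, smul_eq_mul, sum_mul_kron]
    linear_combination e
  obtain ⟨l1, l2, l3⟩ := comp_eq_zero_of_low hg hm h hA low
  by_cases hz : z.pos ≤ 1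
  · rw [cmpL_neg hz, Label.act, if_pos hz]
    refine cmp_lie (d := 0) (e := d) (fun i => by simpa using hp i) hq _ (by simp) fun hk i j k => ?_
    have hz' : 0 < z.pos := by
      cases z <;> first | decide | exact absurd rfl hk
    have z1 := l1 hz'
    refine ⟨by simp, by simp, ?_⟩
    rw [h.expand_left (hdp k)]
    simp [comp_vanish z1]
  · have hz1 : 1 < z.pos := not_le.1 hz
    have k1 := vanish_of_comp hg h hA (l1 (lt_trans (by decide) hz1)) (l2 hz1)
    have k2 : ∀ u v w : V, (∀ i, g (p i) u = 0) → (∀ i, g (p i) v = 0) →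
        A u v w = 0 ∧ A u w v = 0 ∧ A w u v = 0 := fun u v w hu hv => by
      rw [h.expand_left hu, h.expand_left hv]
      simp [k1]
    rw [cmpL_pos hz, Label.act, if_neg hz]
    refine cmp_lie (d := d) (e := 0) (fun i => by simp [hq i]) (fun i => by simp [hp i]) _
      (fun hk i j k => ?_) fun hk i j k => ?_
    · have hz' : 2 < z.pos := by
        cases z <;> first | decide | exact absurd hk (by decide) | exact absurd hz1 (by decide)
      have a1 := (mem_cottonYork.1 hA).1
      have a2 := (mem_cottonYork.1 hA).2.1
      have z3 := comp_vanish (l3 hz')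
      have e1 : ∀ i j k, A (q i) (q j) (d k) = 0 := fun i j k => by
        rw [h.expand_left (hdp k)]; simp [z3]
      have e2 : ∀ i j k, A (q i) (d j) (q k) = 0 := fun i j k => by rw [a1, e1, neg_zero]
      exact ⟨by have := a2 (d i) (q j) (q k); rwa [e1, e2, add_zero, add_zero] at this, e2 _ _ _,
        e1 _ _ _⟩
    · exact ⟨(k2 _ _ _ (hdp i) (h.pp · k)).2.1, (k2 _ _ _ (hdp j) (h.pp · k)).2.2, by simp⟩

end Filtration

section Components

variable {V : Type*} [AddCommGroup V] [Module ℂ V] [FiniteDimensional ℂ V]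
variable {g : LinearMap.BilinForm ℂ V} {hg : g.Nondegenerate}
variable {m : ℕ} {p q : Fin m → V}

/-! ### The module of forms with a given label -/

theorem CottonYork.form_mem (A : CottonYork g hg) : A.form ∈ cottonYork g hg :=
  (show ↥(cottonYork g hg) from A).2

variable (g hg) in
/-- The underlying form, as a linear map. -/
def formₗ : CottonYork g hg →ₗ[ℂ] Tri V := (cottonYork g hg).toSubmodule.subtype

theorem formₗ_apply (A : CottonYork g hg) : formₗ g hg A = A.form := rfl

theorem CottonYork.ext {A B : CottonYork g hg} (h : A.form = B.form) : A = B := Subtype.ext h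

/-- A form with Cotton–York symmetries, as an element of `𝔄`. -/
def CottonYork.mk (A : Tri V) (hA : A ∈ cottonYork g hg) : CottonYork g hg := ⟨A, hA⟩

theorem CottonYork.form_mk (A : Tri V) (hA : A ∈ cottonYork g hg) :
    (CottonYork.mk A hA).form = A := rfl

/-- The label in the lower half with a given type. -/
def Kind.neg : Kind → Label
  | .hook => .m3_0
  | .trace => .m1_0
  | .alt => .m1_1
  | .sym => .m1_2

/-- The label in the upper half with a given type. -/
def Kind.pos : Kind → Label
  | .hook => .p3_0
  | .trace => .p1_0
  | .alt => .p1_1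
  | .sym => .p1_2

theorem cmpL_kind_neg (κ : Kind) : cmpL p q κ.neg = cmp p q κ := by cases κ <;> rfl
theorem cmpL_kind_pos (κ : Kind) : cmpL p q κ.pos = cmp q p κ := by cases κ <;> rfl

theorem Label.eq_neg_or_pos (x : Label) : (x.pos ≤ 1 ∧ x = x.kind.neg) ∨
    (¬ x.pos ≤ 1 ∧ x = x.kind.pos) := by
  cases x <;> decide

theorem Kind.kind_neg (κ : Kind) : κ.neg.kind = κ := by cases κ <;> rfl
theorem Kind.kind_pos (κ : Kind) : κ.pos.kind = κ := by cases κ <;> rfl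
theorem Kind.neg_ne_pos (κ μ : Kind) : κ.neg ≠ μ.pos := by cases κ <;> cases μ <;> decide

variable (g hg p q) in
/-- The tensors whose components vanish except the one labelled by `x`. -/
def modL (x : Label) : Submodule ℂ (Tri V) :=
  (cottonYork g hg).toSubmodule ⊓ ⨅ y : {y // y ≠ x}, LinearMap.ker (cmpL p q y)

theorem mem_modL {x : Label} {A : Tri V} : A ∈ modL g hg p q x ↔
    A ∈ cottonYork g hg ∧ ∀ y, y ≠ x → cmpL p q y A = 0 := by
  simp [modL]

theorem modL_neg (κ : Kind) : modL g hg p q κ.neg = modForm g hg p q κ := by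
  ext A
  rw [mem_modL, mem_modForm]
  refine and_congr_right fun _ => ⟨fun H => ⟨fun μ hμ => ?_, fun μ => ?_⟩, fun H y hy => ?_⟩
  · rw [← cmpL_kind_neg]
    exact H _ fun e => hμ (by rw [← μ.kind_neg, e, κ.kind_neg])
  · rw [← cmpL_kind_pos]; exact H _ (κ.neg_ne_pos μ).symm
  · rcases y.eq_neg_or_pos with ⟨-, e⟩ | ⟨-, e⟩
    · rw [e, cmpL_kind_neg]
      exact H.1 _ fun e' => hy (by rw [e, e'])
    · rw [e, cmpL_kind_pos]; exact H.2 _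

theorem modL_pos (κ : Kind) : modL g hg p q κ.pos = modForm g hg q p κ := by
  ext A
  rw [mem_modL, mem_modForm]
  refine and_congr_right fun _ => ⟨fun H => ⟨fun μ hμ => ?_, fun μ => ?_⟩, fun H y hy => ?_⟩
  · rw [← cmpL_kind_pos]
    exact H _ fun e => hμ (by rw [← μ.kind_pos, e, κ.kind_pos])
  · rw [← cmpL_kind_neg]; exact H _ (μ.neg_ne_pos κ)
  · rcases y.eq_neg_or_pos with ⟨-, e⟩ | ⟨-, e⟩
    · rw [e, cmpL_kind_neg]; exact H.2 _
    · rw [e, cmpL_kind_pos]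
      exact H.1 _ fun e' => hy (by rw [e, e'])

variable (g p q) in
/-- The form with a given component. -/
def buildL (x : Label) (t : Coef m) : Tri V :=
  if x.pos ≤ 1 then build g p q x.kind (proj x.kind t) else build g q p x.kind (proj x.kind t)

section
variable (hm : 3 ≤ m) (h : Hyp g p q)
include hm h

theorem buildL_mem (x : Label) (t : Coef m) : buildL g p q x t ∈ modL g hg p q x := by
  rcases x.eq_neg_or_pos with ⟨h1, e⟩ | ⟨h1, e⟩
  · rw [buildL, if_pos h1, e, modL_neg, Kind.kind_neg]; exact build_mem_modForm hm h _ _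
  · rw [buildL, if_neg h1, e, modL_pos, Kind.kind_pos]; exact build_mem_modForm hm h.swap _ _

theorem cmpL_buildL (x : Label) (t : Coef m) : cmpL p q x (buildL g p q x t) = proj x.kind t := by
  by_cases hx : x.pos ≤ 1
  · rw [buildL, if_pos hx, cmpL_neg hx]; exact cmp_build_self hm h _ _
  · rw [buildL, if_neg hx, cmpL_pos hx]; exact cmp_build_self hm h.swap _ _

omit h in
theorem proj_cmpL (x : Label) (A : Tri V) : proj x.kind (cmpL p q x A) = cmpL p q x A := by
  by_cases hx : x.pos ≤ 1
  · rw [cmpL_neg hx, cmp, LinearMap.comp_apply, proj_idem hm]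
  · rw [cmpL_pos hx, cmp, LinearMap.comp_apply, proj_idem hm]

theorem eq_zero_of_cmpL {A : Tri V} (hA : A ∈ cottonYork g hg)
    (hc : ∀ x, cmpL p q x A = 0) : A = 0 :=
  eq_zero_of_cmp hm h hA (fun κ => by rw [← cmpL_kind_neg, hc])
    fun κ => by rw [← cmpL_kind_pos, hc]

theorem modL_ext {x : Label} {A B : Tri V} (hA : A ∈ modL g hg p q x) (hB : B ∈ modL g hg p q x)
    (e : cmpL p q x A = cmpL p q x B) : A = B := by
  have hAB := mem_modL.1 (sub_mem hA hB)
  rw [← sub_eq_zero]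
  refine eq_zero_of_cmpL hm h hAB.1 fun y => ?_
  by_cases hy : y = x
  · subst hy; rw [map_sub, e, sub_self]
  · exact hAB.2 y hy

/-- The projection of `𝔄` onto the forms labelled by `x`. -/
def pr (x : Label) : CottonYork g hg →ₗ[ℂ] CottonYork g hg where
  toFun A := .mk (buildL g p q x (cmpL p q x A.form)) (mem_modL.1 (buildL_mem hm h x _)).1
  map_add' A B := CottonYork.ext <| modL_ext (hg := hg) hm h (buildL_mem hm h x _)
    (add_mem (buildL_mem hm h x _) (buildL_mem hm h x _)) (by
      change cmpL p q x (buildL g p q x (cmpL p q x (A.form + B.form))) =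
        cmpL p q x (buildL g p q x _ + buildL g p q x _)
      rw [map_add, map_add, cmpL_buildL hm h, cmpL_buildL hm h, cmpL_buildL hm h, map_add])
  map_smul' c A := CottonYork.ext <| modL_ext (hg := hg) hm h (buildL_mem hm h x _)
    (Submodule.smul_mem _ _ (buildL_mem hm h x _)) (by
      change cmpL p q x (buildL g p q x (cmpL p q x (c • A.form))) =
        cmpL p q x (c • buildL g p q x _)
      rw [map_smul, map_smul, cmpL_buildL hm h, cmpL_buildL hm h, map_smul])

theorem form_pr_mem (x : Label) (A : CottonYork g hg) :
    (pr hm h x A).form ∈ modL g hg p q x := buildL_mem hm h x _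

theorem cmpL_pr_self (x : Label) (A : CottonYork g hg) :
    cmpL p q x (pr hm h x A).form = cmpL p q x A.form :=
  (cmpL_buildL hm h x _).trans (proj_cmpL hm x _)

theorem cmpL_pr_ne {x y : Label} (hxy : y ≠ x) (A : CottonYork g hg) :
    cmpL p q y (pr hm h x A).form = 0 := (mem_modL.1 (form_pr_mem hm h x A)).2 y hxy

theorem pr_eq_self {x : Label} {A : CottonYork g hg} (hA : A.form ∈ modL g hg p q x) :
    pr hm h x A = A :=
  CottonYork.ext (modL_ext (hg := hg) hm h (form_pr_mem hm h x A) hA (cmpL_pr_self hm h x A))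

instance : Fintype Label :=
  ⟨{.m3_0, .m1_0, .m1_1, .m1_2, .p1_0, .p1_1, .p1_2, .p3_0}, fun x => by cases x <;> decide⟩

theorem sum_pr (A : CottonYork g hg) : ∑ x, pr hm h x A = A := by
  refine CottonYork.ext (sub_eq_zero.1 (eq_zero_of_cmpL (hg := hg) hm h
    (sub_mem (CottonYork.form_mem _) A.form_mem) fun y => ?_))
  rw [map_sub, ← formₗ_apply, map_sum, map_sum, Finset.sum_eq_single y, formₗ_apply,
    cmpL_pr_self, sub_self]
  · exact fun x _ hxy => cmpL_pr_ne hm h hxy.symm A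
  · simp

omit h in
-- All four dimensions are positive for `m ≥ 3`; this makes the filtration strict and the modules
-- non-zero.
theorem exists_proj_ne_zero (κ : Kind) : ∃ t : Coef m, proj κ t ≠ 0 := by
  by_contra hcon
  push Not at hcon
  have h0 : (proj κ : Coef m →ₗ[ℂ] Coef m) = 0 := LinearMap.ext hcon
  have := finrank_range_proj hm κ
  rw [h0, LinearMap.range_zero, finrank_bot] at this
  have hm' : (3 : ℚ) ≤ m := by exact_mod_cast hm
  have m0 : (0 : ℚ) < m := by linarith
  have m1 : (0 : ℚ) < m - 1 := by linarith
  have m2 : (0 : ℚ) < m - 2 := by linarith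
  have h1 := mul_pos m0 (mul_pos m1 (add_pos m0 one_pos))
  have h2 := mul_pos m0 (mul_pos m2 (add_pos m0 one_pos))
  have h3 := mul_pos m0 (mul_pos (add_pos m0 two_pos) m1)
  cases κ <;> simp only [Kind.dim] at this <;> push_cast at this <;> linarith

theorem exists_mem_modL (x : Label) : ∃ A ∈ modL g hg p q x, cmpL p q x A ≠ 0 := by
  obtain ⟨t, ht⟩ := exists_proj_ne_zero hm x.kind
  exact ⟨_, buildL_mem hm h x t, by rwa [cmpL_buildL hm h]⟩

end

end Components

section Filtration

variable {V : Type*} [AddCommGroup V] [Module ℂ V] [FiniteDimensional ℂ V]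
variable {S : Type*} [AddCommGroup S] [Module ℂ S]
variable {g : LinearMap.BilinForm ℂ V} [Module (CliffordAlgebra (cliffordForm g)) S]
  [IsScalarTower ℂ (CliffordAlgebra (cliffordForm g)) S]
variable {hs : g.IsSymm} {hg : g.Nondegenerate} {ξ : S}
variable {m : ℕ} {p q : Fin m → V}

/-! ### The filtration -/

theorem Adapted.lie_left (h : Adapted g ξ p q) (X : stabilizer g hs hg ξ) (i j : Fin m) :
    g (p j) ⁅(X : so g), p i⁆ = 0 :=
  (h.mem_iff _).1 (stabilizer_preserves hs hg X ((h.mem_iff _).2 (h.pp · i))) j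

/-- The tensors whose components with label in a lower set vanish. -/
def cut (hs : g.IsSymm) (hg : g.Nondegenerate) (hm : 3 ≤ m) (h : Adapted g ξ p q) (T : Label → Prop)
    (hT : ∀ x y : Label, T x → y.pos < x.pos → T y) :
    LieSubmodule ℂ (stabilizer g hs hg ξ) (CottonYork g hg) where
  carrier := {A | ∀ y, T y → cmpL p q y A.form = 0}
  add_mem' {A B} hA hB y hy := by
    change cmpL p q y (A.form + B.form) = 0
    rw [map_add, hA y hy, hB y hy, add_zero]
  zero_mem' y _ := map_zero (cmpL p q y)
  smul_mem' c A hA y hy := by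
    change cmpL p q y (c • A.form) = 0
    rw [map_smul, hA y hy, smul_zero]
  lie_mem {X A} hA y hy := by
    change cmpL p q y ⁅(X : so g), A.form⁆ = 0
    rw [cmpL_lie hg hm h.toHyp (h.lie_left X) A.form_mem y fun z hz => hA z (hT y z hy hz),
      hA y hy, act_zero]

theorem mem_cut (hm : 3 ≤ m) (h : Adapted g ξ p q) {T : Label → Prop}
    (hT : ∀ x y : Label, T x → y.pos < x.pos → T y) {A : CottonYork g hg} :
    A ∈ cut hs hg hm h T hT ↔ ∀ y, T y → cmpL p q y A.form = 0 := Iff.rfl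

/-- The characterisation of the filtration and of the submodules defining `𝔄_i^j`. -/
structure IsFiltration (F : Fin 5 → LieSubmodule ℂ (stabilizer g hs hg ξ) (CottonYork g hg))
    (K : Label → LieSubmodule ℂ (stabilizer g hs hg ξ) (CottonYork g hg)) : Prop where
  zero : F 0 = ⊤
  mem_succ : ∀ (k : Fin 4) (A : CottonYork g hg),
    A ∈ F k.succ ↔ ∀ x : Label, x.pos = k → PiVanishes g hg ξ x A.form
  mem_K : ∀ (x : Label) (A : CottonYork g hg), A ∈ K x ↔ A ∈ F x.pos.castSucc ∧
    ∀ y : Label, y.pos = x.pos → y ≠ x → PiVanishes g hg ξ y A.form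

section

variable (hm : 3 ≤ m) (hV : finrank ℂ V = 2 * m) (hξ : ξ ≠ 0) (h : Adapted g ξ p q)
include hm hV hξ h hs

theorem piVanishes_pos_iff (k : Fin 4) (A : CottonYork g hg) :
    (∀ x : Label, x.pos = k → PiVanishes g hg ξ x A.form) ↔
      ∀ y : Label, y.pos ≤ k → cmpL p q y A.form = 0 :=
  ⟨fun H y hy => cmpL_eq_zero_of_piVanishes hs hg h.toHyp hξ h.gamma A.form_mem hm hV H y hy,
    fun H x hx => (piVanishes_iff hs hg h.toHyp hξ h.gamma A.form_mem hm hV x fun y hy =>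
      H y (hx ▸ hy.le)).2 (H x hx.le)⟩

theorem mem_K_iff (x : Label) (A : CottonYork g hg) :
    ((∀ y : Label, y.pos < x.pos → cmpL p q y A.form = 0) ∧
      ∀ y : Label, y.pos = x.pos → y ≠ x → PiVanishes g hg ξ y A.form) ↔
      ∀ y : Label, y.pos ≤ x.pos ∧ y ≠ x → cmpL p q y A.form = 0 := by
  have e : (∀ y : Label, y.pos < x.pos → cmpL p q y A.form = 0) → ∀ y : Label, y.pos = x.pos →
      (PiVanishes g hg ξ y A.form ↔ cmpL p q y A.form = 0) := fun H y hy =>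
    piVanishes_iff hs hg h.toHyp hξ h.gamma A.form_mem hm hV y fun z hz => H z (hy ▸ hz)
  constructor
  · rintro ⟨h1, h2⟩ y ⟨hy, hyx⟩
    rcases hy.lt_or_eq with hy | hy
    · exact h1 y hy
    · exact (e h1 y hy).1 (h2 y hy hyx)
  · intro H
    have h1 : ∀ y : Label, y.pos < x.pos → cmpL p q y A.form = 0 := fun y hy =>
      H y ⟨hy.le, fun e => by subst e; exact lt_irrefl _ hy⟩
    exact ⟨h1, fun y hy hyx => (e h1 y hy).2 (H y ⟨hy.le, hyx⟩)⟩

theorem exists_isFiltration : ∃ F K, IsFiltration (hs := hs) (hg := hg) (ξ := ξ) F K := by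
  -- `F k` kills the components at positions strictly below `k`, so `F 0` imposes nothing and `F 4`
  -- kills all eight.
  refine ⟨fun k => cut hs hg hm h (fun y => (y.pos : ℕ) < k) fun x y hx hy => lt_trans hy hx,
    fun x => cut hs hg hm h (fun y => y.pos ≤ x.pos ∧ y ≠ x) fun y z hy hz =>
      ⟨hz.le.trans hy.1, fun e => by subst e; exact absurd (lt_of_lt_of_le hz hy.1) (lt_irrefl _)⟩,
    ?_, fun k A => ?_, fun x A => ?_⟩
  · rw [eq_top_iff]
    intro A _ y hy
    exact absurd hy (Nat.not_lt_zero _)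
  · rw [piVanishes_pos_iff (hs := hs) hm hV hξ h, mem_cut]
    simp only [Fin.val_succ, Nat.lt_succ_iff, Fin.val_fin_le]
  · rw [mem_cut, mem_cut, ← mem_K_iff (hs := hs) hm hV hξ h x A]
    simp only [Fin.val_castSucc, Fin.val_fin_lt]

variable {F : Fin 5 → LieSubmodule ℂ (stabilizer g hs hg ξ) (CottonYork g hg)}
  {K : Label → LieSubmodule ℂ (stabilizer g hs hg ξ) (CottonYork g hg)} (hF : IsFiltration F K)
include hF

/-- `IsFiltration` mentions no basis, so this description is available in every adapted basis, in
particular in those coming from arbitrary splittings. -/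
theorem IsFiltration.mem_F_iff (k : Fin 5) (A : CottonYork g hg) :
    A ∈ F k ↔ ∀ y : Label, (y.pos : ℕ) < k → cmpL p q y A.form = 0 := by
  cases k using Fin.cases with
  | zero => simp [hF.zero]
  | succ k =>
    rw [hF.mem_succ, piVanishes_pos_iff (hs := hs) hm hV hξ h]
    simp only [Fin.val_succ, Nat.lt_succ_iff, Fin.val_fin_le]

theorem IsFiltration.mem_K_iff (x : Label) (A : CottonYork g hg) :
    A ∈ K x ↔ ∀ y : Label, y.pos ≤ x.pos → y ≠ x → cmpL p q y A.form = 0 := by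
  rw [hF.mem_K, hF.mem_F_iff hm hV hξ h]
  simp only [Fin.val_castSucc, Fin.val_fin_lt]
  rw [PureSpinor.mem_K_iff (hs := hs) hm hV hξ h x A]
  simp only [and_imp]

theorem IsFiltration.last : F 4 = ⊥ := by
  rw [eq_bot_iff]
  intro A hA
  rw [hF.mem_F_iff hm hV hξ h] at hA
  exact CottonYork.ext (eq_zero_of_cmpL (hg := hg) hm h.toHyp A.form_mem fun x => hA x x.pos.2)

theorem IsFiltration.strictAnti : StrictAnti F := by
  rw [Fin.strictAnti_iff_succ_lt]
  intro k
  have hl : ∃ x : Label, x.pos = k := by revert k; decide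
  refine lt_of_le_not_ge (fun A hA => ?_) fun hle => ?_
  · rw [hF.mem_F_iff hm hV hξ h] at hA ⊢
    exact fun y hy => hA y (hy.trans (by simp))
  · obtain ⟨x, rfl⟩ := hl
    obtain ⟨A, hA, hne⟩ := exists_mem_modL (hg := hg) hm h.toHyp x
    have h1 : CottonYork.mk A (mem_modL.1 hA).1 ∈ F x.pos.castSucc := by
      rw [hF.mem_F_iff hm hV hξ h]
      exact fun y hy => (mem_modL.1 hA).2 y fun e => by subst e; simp at hy
    have h2 := hle h1
    rw [hF.mem_F_iff hm hV hξ h] at h2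
    exact hne (h2 x (by simp))

end
end Filtration

section Levi

variable {V : Type*} [AddCommGroup V] [Module ℂ V] [FiniteDimensional ℂ V]
variable {S : Type*} [AddCommGroup S] [Module ℂ S]
variable {g : LinearMap.BilinForm ℂ V} [Module (CliffordAlgebra (cliffordForm g)) S]
  [IsScalarTower ℂ (CliffordAlgebra (cliffordForm g)) S]
variable {hs : g.IsSymm} {hg : g.Nondegenerate} {ξ : S} {N' : Submodule ℂ V}
variable {m : ℕ} {p q : Fin m → V}

/-! ### The Levi factor -/

/-- The underlying element of `𝔰𝔬(V, g)`. -/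
def toSo (X : levi g hs hg ξ N') : so g := X.1.1

theorem toSo_injective : Function.Injective (toSo : levi g hs hg ξ N' → so g) :=
  fun _ _ h => Subtype.ext (Subtype.ext h)

theorem levi_lie_vec (X : levi g hs hg ξ N') (v : V) : ⁅X, v⁆ = ⁅toSo X, v⁆ := rfl

theorem form_levi_lie (X : levi g hs hg ξ N') (A : CottonYork g hg) :
    (⁅X, A⁆ : CottonYork g hg).form = ⁅toSo X, A.form⁆ := rfl

theorem toSo_lie (X Y : levi g hs hg ξ N') : toSo ⁅X, Y⁆ = ⁅toSo X, toSo Y⁆ := rfl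

variable (hs hg ξ N') in
/-- A hyperbolic basis adapted to the Levi factor: its halves are bases of the two null spaces, in
either order. -/
structure LeviFrame (p q : Fin m → V) : Prop where
  hyp : Hyp g p q
  acts : ∀ X : levi g hs hg ξ N', Acts (toSo X) p q (fun l i => g (q l) ⁅toSo X, p i⁆)
  exists_levi : ∀ X : so g, (∀ i j, g (p j) ⁅X, p i⁆ = 0) → (∀ i j, g (q j) ⁅X, q i⁆ = 0) →
    ∃ Y : levi g hs hg ξ N', toSo Y = X

theorem LeviFrame.exists_hop (h : LeviFrame hs hg ξ N' p q) {a b : V} (ha : ∀ i, g (p i) a = 0)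
    (hb : ∀ i, g (q i) b = 0) : ∃ Y : levi g hs hg ξ N', toSo Y = hop g hs a b :=
  h.exists_levi _ (fun i j => by simp [hop_left hs h.hyp ha (h.hyp.pp · i), ha])
    fun i j => by simp [hop_right hs h.hyp hb (h.hyp.qq · i), hb]

theorem LeviFrame.swap (h : LeviFrame hs hg ξ N' p q) : LeviFrame hs hg ξ N' q p := by
  refine ⟨h.hyp.swap, fun X => ?_, fun X hq hp => h.exists_levi X hp hq⟩
  convert (h.acts X).swap using 1
  ext l i
  rw [g_comm hs, so_apply]

variable (g ξ N') in
/-- A hyperbolic basis whose halves span the two summands of `V`. -/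
structure Split (p q : Fin m → V) : Prop extends Adapted g ξ p q where
  right : ∀ v, v ∈ N' ↔ ∀ i, g (q i) v = 0

theorem Split.exists_levi (h : Split g ξ N' p q) {X : so g} (hp : ∀ i j, g (p j) ⁅X, p i⁆ = 0)
    (hq : ∀ i j, g (q j) ⁅X, q i⁆ = 0) : ∃ Y : levi g hs hg ξ N', toSo Y = X := by
  refine ⟨⟨⟨X, mem_stabilizer hs hg h.toAdapted hp⟩, fun v hv => ?_, fun v hv => ?_⟩, rfl⟩
  · change ⁅X, v⁆ ∈ _
    rw [h.mem_iff] at hv ⊢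
    intro j
    rw [h.expand_left hv, ← LieModule.toEnd_apply_apply ℂ (so g) V X, map_sum]
    simp [hp]
  · change ⁅X, v⁆ ∈ _
    rw [h.right] at hv ⊢
    intro j
    rw [h.expand_right hv, ← LieModule.toEnd_apply_apply ℂ (so g) V X, map_sum]
    simp [hq]

theorem Split.frame (h : Split g ξ N' p q) : LeviFrame hs hg ξ N' p q := by
  refine ⟨h.toHyp, fun X => acts_of_mem h.toHyp (fun i j => ?_) fun i j => ?_,
    fun X hp hq => h.exists_levi hp hq⟩
  · exact (h.mem_iff _).1 ((levi_mem g hs hg ξ N' X).1 _ ((h.mem_iff _).2 (h.pp · i))) j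
  · exact (h.right _).1 ((levi_mem g hs hg ξ N' X).2 _ ((h.right _).2 (h.qq · i))) j

theorem Acts.cmpL_lie {X : so g} {x : Fin m → Fin m → ℂ} (hX : Acts X p q x) (z : Label)
    (A : Tri V) : cmpL p q z ⁅X, A⁆ = z.act x (cmpL p q z A) := by
  rw [Label.act]
  split_ifs with hz
  · rw [cmpL_neg hz, hX.cmp_lie]
  · rw [cmpL_pos hz, hX.swap.cmp_lie]

/-- The tensors labelled by `x`, as a module over the Levi factor. -/
def modC (h : LeviFrame hs hg ξ N' p q) (x : Label) :
    LieSubmodule ℂ (levi g hs hg ξ N') (CottonYork g hg) :=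
  { (modL g hg p q x).comap (formₗ g hg) with
    lie_mem := fun {X A} hA => by
      change (⁅toSo X, A.form⁆ : Tri V) ∈ modL g hg p q x
      have hA' : A.form ∈ modL g hg p q x := hA
      rw [mem_modL] at hA' ⊢
      exact ⟨(cottonYork g hg).lie_mem hA'.1, fun y hy => by
        rw [(h.acts X).cmpL_lie, hA'.2 y hy, act_zero]⟩ }

theorem mem_modC {h : LeviFrame hs hg ξ N' p q} {x : Label} {A : CottonYork g hg} :
    A ∈ modC h x ↔ A.form ∈ modL g hg p q x := Iff.rfl

theorem stable_of_frame (h : LeviFrame hs hg ξ N' p q)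
    (G : LieSubmodule ℂ (levi g hs hg ξ N') (CottonYork g hg)) :
    Stable hs p q (G.toSubmodule.map (formₗ g hg)) := by
  rintro a b ha hb _ ⟨A, hA, rfl⟩
  obtain ⟨Y, hY⟩ := h.exists_hop ha hb
  rw [← hY]
  exact ⟨⁅Y, A⁆, G.lie_mem hA, rfl⟩

/-- The modules of tensors with a given label are irreducible. -/
theorem modC_le (hm : 3 ≤ m) (h : LeviFrame hs hg ξ N' p q)
    {G : LieSubmodule ℂ (levi g hs hg ξ N') (CottonYork g hg)} {x : Label} {A : CottonYork g hg}
    (hA : A ∈ modC h x) (hAG : A ∈ G) (hA0 : A ≠ 0) : modC h x ≤ G := by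
  have hA0' : A.form ≠ 0 := fun e => hA0 (CottonYork.ext e)
  have key : modL g hg p q x ≤ G.toSubmodule.map (formₗ g hg) := by
    rw [mem_modC] at hA
    rcases x.eq_neg_or_pos with ⟨-, e⟩ | ⟨-, e⟩
    · rw [e, modL_neg] at hA ⊢
      exact modForm_le hs hm h.hyp (stable_of_frame h G) ⟨A, hAG, rfl⟩ hA0' hA
    · rw [e, modL_pos] at hA ⊢
      exact modForm_le hs hm h.hyp.swap (stable_of_frame h.swap G) ⟨A, hAG, rfl⟩ hA0' hA
  intro B hB
  obtain ⟨C, hC, e⟩ := key hB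
  rwa [← CottonYork.ext (A := C) (B := B) e]

theorem pr_lie (hm : 3 ≤ m) (h : LeviFrame hs hg ξ N' p q) (x : Label) (X : levi g hs hg ξ N')
    (A : CottonYork g hg) : pr hm h.hyp x ⁅X, A⁆ = ⁅X, pr hm h.hyp x A⁆ := by
  refine CottonYork.ext (modL_ext (hg := hg) hm h.hyp (form_pr_mem hm h.hyp x _)
    ((modC h x).lie_mem (x := X) (m := pr hm h.hyp x A) (form_pr_mem hm h.hyp x A)) ?_)
  rw [cmpL_pr_self, form_levi_lie, form_levi_lie, (h.acts X).cmpL_lie, (h.acts X).cmpL_lie,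
    cmpL_pr_self]

/-! ### The graded pieces -/

variable (hm : 3 ≤ m) (hV : finrank ℂ V = 2 * m) (hξ : ξ ≠ 0) (h : Split g ξ N' p q)
variable {F : Fin 5 → LieSubmodule ℂ (stabilizer g hs hg ξ) (CottonYork g hg)}
  {K : Label → LieSubmodule ℂ (stabilizer g hs hg ξ) (CottonYork g hg)} (hF : IsFiltration F K)

include hm hV hξ hF h in
theorem modC_le_F {x : Label} {A : CottonYork g hg} (hA : A.form ∈ modL g hg p q x) :
    A ∈ F x.pos.castSucc := by
  rw [hF.mem_F_iff hm hV hξ h.toAdapted]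
  intro y hy
  refine (mem_modL.1 hA).2 y fun e => ?_
  subst e
  simp at hy

include hm hV hξ hF h in
theorem modC_le_K {x : Label} {A : CottonYork g hg} (hA : A.form ∈ modL g hg p q x) :
    A ∈ K x := by
  rw [hF.mem_K_iff hm hV hξ h.toAdapted]
  exact fun y _ hy => (mem_modL.1 hA).2 y hy

/-- The class in the graded module of a tensor with a given label. -/
def toGr (x : Label) : modC h.frame x →ₗ⁅ℂ, levi g hs hg ξ N'⁆ grPart F x.pos (K x) where
  toFun A := ⟨LieSubmodule.Quotient.mk ⟨A.1, modC_le_F hm hV hξ h hF A.2⟩,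
    LieSubmodule.mem_map _ |>.2 ⟨_, modC_le_K hm hV hξ h hF (A := A.1) A.2, rfl⟩⟩
  map_add' _ _ := rfl
  map_smul' _ _ := rfl
  map_lie' := rfl

/-- A tensor of label `x` lying in the next step has zero component, hence is zero. Conversely, a
class in 𝔄_i^j is represented by the projection of any of its members in `K x`. -/
theorem toGr_bijective (x : Label) : Function.Bijective (toGr hm hV hξ h hF x) := by
  constructor
  · rw [← LieModuleHom.coe_toLinearMap, ← LinearMap.ker_eq_bot, LinearMap.ker_eq_bot']
    intro A hA
    have h0 : (LieSubmodule.Quotient.mk ⟨A.1, modC_le_F hm hV hξ h hF A.2⟩ : gr F x.pos) = 0 :=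
      congrArg Subtype.val hA
    have h1 : (A : CottonYork g hg) ∈ F x.pos.succ := (LieSubmodule.Quotient.mk_eq_zero'
      (N := (F x.pos.succ).comap (F x.pos.castSucc).incl)).1 h0
    rw [hF.mem_F_iff hm hV hξ h.toAdapted] at h1
    refine Subtype.ext (CottonYork.ext (modL_ext (hg := hg) hm h.toHyp A.2 (zero_mem _) ?_))
    exact (h1 x (by simp)).trans (map_zero (cmpL p q x)).symm
  · rintro ⟨z, hz⟩
    obtain ⟨A, hA, rfl⟩ := (LieSubmodule.mem_map _).1 hz
    have hA' : (A : CottonYork g hg) ∈ K x := hA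
    rw [hF.mem_K_iff hm hV hξ h.toAdapted] at hA'
    refine ⟨⟨pr hm h.toHyp x A, form_pr_mem hm h.toHyp x A⟩, Subtype.ext ?_⟩
    refine (Submodule.Quotient.eq _).2 ?_
    change pr hm h.toHyp x A - (A : CottonYork g hg) ∈ F x.pos.succ
    rw [hF.mem_F_iff hm hV hξ h.toAdapted]
    intro y hy
    change cmpL p q y ((pr hm h.toHyp x A).form - (A : CottonYork g hg).form) = 0
    rw [map_sub]
    by_cases hyx : y = x
    · subst hyx; rw [cmpL_pr_self, sub_self]
    · rw [cmpL_pr_ne hm h.toHyp hyx, hA' y (Fin.le_def.2 (Nat.lt_succ_iff.1 hy)) hyx, sub_zero]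

/-- The module `𝔄_i^j` is isomorphic to a submodule of `𝔄`. -/
def grEquiv (x : Label) : modC h.frame x ≃ₗ⁅ℂ, levi g hs hg ξ N'⁆ grPart F x.pos (K x) :=
  { toGr hm hV hξ h hF x with
    invFun := (Equiv.ofBijective _ (toGr_bijective hm hV hξ h hF x)).symm
    left_inv := (Equiv.ofBijective _ (toGr_bijective hm hV hξ h hF x)).left_inv
    right_inv := (Equiv.ofBijective _ (toGr_bijective hm hV hξ h hF x)).right_inv }

theorem modC_irreducible (hm : 3 ≤ m) (h : LeviFrame hs hg ξ N' p q) (x : Label) :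
    LieModule.IsIrreducible ℂ (levi g hs hg ξ N') (modC h x) := by
  have : Nontrivial (modC h x) := by
    obtain ⟨A, hA, hne⟩ := exists_mem_modL (hg := hg) hm h.hyp x
    refine ⟨⟨⟨.mk A (mem_modL.1 hA).1, hA⟩, 0, fun e => hne ?_⟩⟩
    have : A = 0 := congrArg (fun B : modC h x => B.1.form) e
    rw [this, map_zero]
  refine LieModule.IsIrreducible.mk fun G hG => ?_
  obtain ⟨A, hA, hA0⟩ : ∃ A ∈ G, A ≠ 0 := by
    by_contra hcon
    push Not at hcon
    exact hG ((LieSubmodule.eq_bot_iff G).2 hcon)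
  have := modC_le hm h A.2 (G := G.map (modC h x).incl)
    ((LieSubmodule.mem_map _).2 ⟨A, hA, rfl⟩) fun e => hA0 (Subtype.ext e)
  rw [eq_top_iff]
  intro B _
  obtain ⟨C, hC, e⟩ := (LieSubmodule.mem_map _).1 (this B.2)
  rwa [← Subtype.ext (a1 := C) (a2 := B) e]

theorem irreducible_of_equiv {L M M' : Type*} [LieRing L] [LieAlgebra ℂ L] [AddCommGroup M]
    [Module ℂ M] [LieRingModule L M] [LieModule ℂ L M] [AddCommGroup M'] [Module ℂ M']
    [LieRingModule L M'] [LieModule ℂ L M'] (e : M ≃ₗ⁅ℂ, L⁆ M')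
    (hM : LieModule.IsIrreducible ℂ L M) : LieModule.IsIrreducible ℂ L M' := by
  have : Nontrivial M' := by
    have := LieModule.nontrivial_of_isIrreducible ℂ L M
    exact e.toLinearEquiv.symm.toEquiv.nontrivial
  refine LieModule.IsIrreducible.mk fun G hG => ?_
  have h1 : G.comap e.toLieModuleHom = ⊤ := by
    refine (eq_bot_or_eq_top _).resolve_left fun h0 => hG ?_
    rw [LieSubmodule.eq_bot_iff] at h0 ⊢
    intro y hy
    have := h0 (e.symm y) (by
      rw [LieSubmodule.mem_comap]
      change e (e.symm y) ∈ G
      rwa [e.apply_symm_apply])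
    rw [← e.apply_symm_apply y, this]
    exact map_zero e.toLieModuleHom
  rw [eq_top_iff]
  intro y _
  have := (h1 ▸ LieSubmodule.mem_top (e.symm y) : e.symm y ∈ G.comap e.toLieModuleHom)
  rw [LieSubmodule.mem_comap] at this
  change e (e.symm y) ∈ G at this
  rwa [e.apply_symm_apply] at this

include h hm hV hξ hF in
theorem grPart_irreducible (x : Label) :
    LieModule.IsIrreducible ℂ (levi g hs hg ξ N') (grPart F x.pos (K x)) :=
  irreducible_of_equiv (grEquiv hm hV hξ h hF x) (modC_irreducible hm h.frame x)

include h hm hV hξ hF in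
-- A 𝔭-submodule is in particular a 𝔤₀-submodule.
theorem grPart_irreducible' (x : Label) :
    LieModule.IsIrreducible ℂ (stabilizer g hs hg ξ) (grPart F x.pos (K x)) := by
  have hi := grPart_irreducible hm hV hξ h hF x
  have := LieModule.nontrivial_of_isIrreducible ℂ (levi g hs hg ξ N') (grPart F x.pos (K x))
  refine LieModule.IsIrreducible.mk fun G hG => ?_
  let G' : LieSubmodule ℂ (levi g hs hg ξ N') (grPart F x.pos (K x)) :=
    { G with lie_mem := fun {X A} hA => G.lie_mem (x := X.1) hA }
  have : G' = ⊤ := by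
    refine (eq_bot_or_eq_top G').resolve_left fun e => hG ?_
    rw [LieSubmodule.eq_bot_iff] at e ⊢
    exact e
  rw [eq_top_iff]
  intro B _
  exact (this ▸ LieSubmodule.mem_top B : B ∈ G')

theorem finrank_modC (hm : 3 ≤ m) (h : LeviFrame hs hg ξ N' p q) (x : Label) :
    finrank ℂ (modC h x) = finrank ℂ (LinearMap.range (proj x.kind : Coef m →ₗ[ℂ] Coef m)) := by
  let f : modC h x →ₗ[ℂ] LinearMap.range (proj x.kind : Coef m →ₗ[ℂ] Coef m) :=
    LinearMap.codRestrict _ (cmpL p q x ∘ₗ formₗ g hg ∘ₗ (modC h x).toSubmodule.subtype) fun A =>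
      ⟨_, proj_cmpL hm x _⟩
  refine LinearEquiv.finrank_eq (LinearEquiv.ofBijective f ⟨?_, ?_⟩)
  · intro A B hAB
    exact Subtype.ext (CottonYork.ext (modL_ext (hg := hg) hm h.hyp A.2 B.2
      (congrArg Subtype.val hAB)))
  · rintro ⟨_, t, rfl⟩
    exact ⟨⟨.mk (buildL g p q x t) (mem_modL.1 (buildL_mem hm h.hyp x t)).1,
      buildL_mem hm h.hyp x t⟩, Subtype.ext (cmpL_buildL hm h.hyp x t)⟩

theorem dim_eq (x : Label) (r : ℚ) : x.dim r = x.kind.dim r := by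
  cases x <;> simp only [Label.dim, Kind.dim, Label.kind]

include h hm hV hξ hF in
theorem finrank_grPart (x : Label) : (finrank ℂ (grPart F x.pos (K x)) : ℚ) = x.dim m := by
  rw [dim_eq, ← finrank_range_proj hm x.kind,
    ← LinearEquiv.finrank_eq (grEquiv hm hV hξ h hF x).toLinearEquiv, finrank_modC hm]

end Levi

section Graded

variable {V : Type*} [AddCommGroup V] [Module ℂ V] [FiniteDimensional ℂ V]
variable {S : Type*} [AddCommGroup S] [Module ℂ S]
variable {g : LinearMap.BilinForm ℂ V} [Module (CliffordAlgebra (cliffordForm g)) S]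
  [IsScalarTower ℂ (CliffordAlgebra (cliffordForm g)) S]
variable {hs : g.IsSymm} {hg : g.Nondegenerate} {ξ : S} {N' : Submodule ℂ V}
variable {m : ℕ} {p q : Fin m → V}
variable (hm : 3 ≤ m) (hV : finrank ℂ V = 2 * m) (hξ : ξ ≠ 0)
variable {F : Fin 5 → LieSubmodule ℂ (stabilizer g hs hg ξ) (CottonYork g hg)}
  {K : Label → LieSubmodule ℂ (stabilizer g hs hg ξ) (CottonYork g hg)}

/-! ### The direct sum decompositions of the graded pieces -/

section Decomposition

variable (h : Adapted g ξ p q) (hF : IsFiltration F K)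

/-- A component of the elements of a graded piece. -/
def grCmp {k : Fin 4} {y : Label} (hy : y.pos = k) : gr F k →ₗ[ℂ] Coef m :=
  Submodule.liftQ _ (cmpL p q y ∘ₗ formₗ g hg ∘ₗ (F k.castSucc).toSubmodule.subtype) fun A hA =>
    (hF.mem_F_iff hm hV hξ h _ _).1 (show (A : CottonYork g hg) ∈ F k.succ from hA) y (by simp [hy])

theorem grCmp_mk {k : Fin 4} {y : Label} (hy : y.pos = k) (A : F k.castSucc) :
    grCmp hm hV hξ h hF hy (LieSubmodule.Quotient.mk A) = cmpL p q y (A : CottonYork g hg).form :=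
  rfl

theorem eq_zero_of_grCmp {k : Fin 4} {z : gr F k}
    (hz : ∀ (y : Label) (hy : y.pos = k), grCmp hm hV hξ h hF hy z = 0) : z = 0 := by
  obtain ⟨A, rfl⟩ := Submodule.Quotient.mk_surjective _ z
  refine (LieSubmodule.Quotient.mk_eq_zero' (N := (F k.succ).comap (F k.castSucc).incl)).2 ?_
  change (A : CottonYork g hg) ∈ F k.succ
  rw [hF.mem_F_iff hm hV hξ h]
  intro y hy
  rcases (Nat.lt_succ_iff.1 hy).lt_or_eq with hy | hy
  · exact (hF.mem_F_iff hm hV hξ h _ _).1 A.2 y hy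
  · exact hz y (Fin.ext hy)

theorem grCmp_eq_zero {k : Fin 4} {x y : Label} (hx : x.pos = k) (hy : y.pos = k) (hyx : y ≠ x)
    {z : gr F k} (hz : z ∈ grPart F k (K x)) : grCmp hm hV hξ h hF hy z = 0 := by
  obtain ⟨A, hA, rfl⟩ := (LieSubmodule.mem_map _).1 hz
  exact (hF.mem_K_iff hm hV hξ h _ _).1 (show (A : CottonYork g hg) ∈ K x from hA) y
    (hy.trans hx.symm).le hyx

include hm hV hξ h hF

theorem iSupIndep_grPart (k : Fin 4) :
    iSupIndep (fun x : {x : Label // x.pos = k} => grPart F k (K x)) := by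
  rw [← LieSubmodule.iSupIndep_toSubmodule]
  intro x
  rw [Submodule.disjoint_def]
  intro z hz hz'
  refine eq_zero_of_grCmp hm hV hξ h hF fun y hy => ?_
  by_cases hyx : y = x
  · have : ⨆ j, ⨆ (_ : j ≠ x), (grPart F k (K j)).toSubmodule ≤
        LinearMap.ker (grCmp hm hV hξ h hF hy) := by
      refine iSup₂_le fun j hj w hw => ?_
      exact grCmp_eq_zero hm hV hξ h hF j.2 hy (fun e => hj (Subtype.ext (e.symm.trans hyx))) hw
    exact this hz'
  · exact grCmp_eq_zero hm hV hξ h hF x.2 hy hyx hz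

theorem iSup_grPart (k : Fin 4) :
    ⨆ x : {x : Label // x.pos = k}, grPart F k (K x) = ⊤ := by
  rw [eq_top_iff]
  intro z _
  obtain ⟨A, rfl⟩ := Submodule.Quotient.mk_surjective _ z
  have hFx : ∀ x : {x : Label // x.pos = k}, pr hm h.toHyp x A ∈ F k.castSucc := by
    rintro ⟨x, rfl⟩
    rw [hF.mem_F_iff hm hV hξ h]
    intro y hy
    refine cmpL_pr_ne hm h.toHyp (fun e => ?_) _
    subst e
    simp at hy
  have e : (LieSubmodule.Quotient.mk A : gr F k) = ∑ x : {x : Label // x.pos = k},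
      (LieSubmodule.Quotient.mk ⟨_, hFx x⟩ : gr F k) := by
    refine sub_eq_zero.1 (eq_zero_of_grCmp hm hV hξ h hF fun y hy => ?_)
    rw [map_sub, map_sum, Finset.sum_eq_single ⟨y, hy⟩, grCmp_mk, grCmp_mk, sub_eq_zero]
    · exact (cmpL_pr_self hm h.toHyp y _).symm
    · intro x _ hx
      exact cmpL_pr_ne hm h.toHyp (fun e => hx (Subtype.ext e.symm)) _
    · simp
  change (LieSubmodule.Quotient.mk A : gr F k) ∈ _
  rw [e]
  refine sum_mem fun x _ => LieSubmodule.mem_iSup_of_mem x ?_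
  refine (LieSubmodule.mem_map _).2 ⟨⟨_, hFx x⟩, ?_, rfl⟩
  change pr hm h.toHyp x (A : CottonYork g hg) ∈ K x
  rw [hF.mem_K_iff hm hV hξ h]
  exact fun y _ hy => cmpL_pr_ne hm h.toHyp hy _

end Decomposition

/-! ### The grading element -/

theorem rho_scalar (c : ℂ) (κ : Kind) {x : Fin m → Fin m → ℂ} (hx : ∀ i j, x i j = c * kron i j)
    (t : Coef m) : rho x κ t = (if κ = .hook then -3 * c else -c) • t := by
  have s1 : ∀ (k : Fin m) (f : Fin m → ℂ), ∑ l, c * kron l k * f l = c * f k :=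
    fun k f => by simp [kron]
  have s2 : ∀ (k : Fin m) (f : Fin m → ℂ), ∑ l, c * kron k l * f l = c * f k :=
    fun k f => by simp [kron]
  ext ⟨i, j, k⟩
  split_ifs with hκ
  · subst hκ
    simp only [rho_hook, hx, s1 _ fun l => t (l, j, k), s1 _ fun l => t (i, l, k),
      s1 _ fun l => t (i, j, l), Pi.smul_apply, smul_eq_mul]
    ring
  · simp only [rho_of_ne x hκ, hx, s1 _ fun l => t (l, j, k), s1 _ fun l => t (i, l, k),
      s2 _ fun l => t (i, j, l), Pi.smul_apply, smul_eq_mul]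
    ring

/-- The scalar is half the number of arguments from 𝔙_{-1/2} minus half the number from 𝔙_{1/2} in
the block carrying the label. -/
theorem act_half (z : Label) {x : Fin m → Fin m → ℂ} (hx : ∀ i j, x i j = (1 / 2 : ℂ) * kron i j)
    (t : Coef m) : z.act x t = (((z.pos : ℕ) : ℂ) - 3 / 2) • t := by
  have hx' : ∀ i j, -x j i = (-(1 / 2) : ℂ) * kron i j := fun i j => by
    rw [hx, kron_comm, neg_mul]
  by_cases hz : z.pos ≤ 1
  · rw [Label.act, if_pos hz, rho_scalar _ _ hx]
    congr 1
    cases z <;> first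
      | exact absurd hz (by decide)
      | (simp [Label.kind, Label.pos]; try norm_num)
  · rw [Label.act, if_neg hz, rho_scalar _ _ hx']
    congr 1
    cases z <;> first
      | exact absurd (by decide) hz
      | (simp [Label.kind, Label.pos]; try norm_num)

variable (h : Split g ξ N' p q) (hF : IsFiltration F K)
include h

variable (hs hg) in
theorem exists_grading : ∃ E : levi g hs hg ξ N',
    (∀ v ∈ nullPlane g ξ, ⁅E, v⁆ = (1 / 2 : ℂ) • v) ∧
      ∀ v ∈ N', ⁅E, v⁆ = (-(1 / 2) : ℂ) • v := by
  have act : ∀ v, ⁅((1 / 2 : ℂ) • ∑ i, hop g hs (p i) (q i)), v⁆ =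
      (1 / 2 : ℂ) • (∑ i, g (q i) v • p i - ∑ i, g (p i) v • q i) := by
    intro v
    rw [smul_lie, sum_lie, ← Finset.sum_sub_distrib]
    rfl
  have hp : ∀ v, (∀ i, g (p i) v = 0) → ⁅((1 / 2 : ℂ) • ∑ i, hop g hs (p i) (q i)), v⁆ =
      (1 / 2 : ℂ) • v := by
    intro v hv
    rw [act, ← h.expand_left hv]; simp [hv]
  have hq : ∀ v, (∀ i, g (q i) v = 0) → ⁅((1 / 2 : ℂ) • ∑ i, hop g hs (p i) (q i)), v⁆ =
      (-(1 / 2) : ℂ) • v := by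
    intro v hv
    rw [act, ← h.expand_right hv]; simp [hv]
  obtain ⟨E, hE⟩ := h.exists_levi (hs := hs) (hg := hg)
    (X := (1 / 2 : ℂ) • ∑ i, hop g hs (p i) (q i))
    (fun i j => by rw [hp _ (h.pp · i), map_smul, h.pp, smul_zero])
    (fun i j => by rw [hq _ (h.qq · i), map_smul, h.qq, smul_zero])
  refine ⟨E, fun v hv => ?_, fun v hv => ?_⟩
  · rw [levi_lie_vec, hE, hp _ ((h.mem_iff v).1 hv)]
  · rw [levi_lie_vec, hE, hq _ ((h.right v).1 hv)]

theorem cmpL_grading {E : levi g hs hg ξ N'} (hE : ∀ v ∈ nullPlane g ξ, ⁅E, v⁆ = (1 / 2 : ℂ) • v)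
    (z : Label) (A : CottonYork g hg) :
    cmpL p q z ⁅E, A⁆.form = (((z.pos : ℕ) : ℂ) - 3 / 2) • cmpL p q z A.form := by
  rw [form_levi_lie, (h.frame.acts E).cmpL_lie, act_half]
  intro i j
  rw [← levi_lie_vec, hE _ ((h.mem_iff _).2 (h.pp · j)), map_smul, h.qp, smul_eq_mul]

include hm hV hξ hF in
theorem gr_grading {E : levi g hs hg ξ N'} (hE : ∀ v ∈ nullPlane g ξ, ⁅E, v⁆ = (1 / 2 : ℂ) • v)
    (k : Fin 4) (y : gr F k) : ⁅E, y⁆ = (((k : ℕ) : ℂ) - 3 / 2) • y := by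
  refine sub_eq_zero.1 (eq_zero_of_grCmp hm hV hξ h.toAdapted hF fun z hz => ?_)
  obtain ⟨A, rfl⟩ := Submodule.Quotient.mk_surjective _ y
  rw [map_sub, map_smul]
  have := cmpL_grading h hE z (A : CottonYork g hg)
  rw [hz] at this
  exact sub_eq_zero.2 this

end Graded

section Schur

variable {V : Type*} [AddCommGroup V] [Module ℂ V] [FiniteDimensional ℂ V]
variable {S : Type*} [AddCommGroup S] [Module ℂ S]
variable {g : LinearMap.BilinForm ℂ V} [Module (CliffordAlgebra (cliffordForm g)) S]
  [IsScalarTower ℂ (CliffordAlgebra (cliffordForm g)) S]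
variable {hs : g.IsSymm} {hg : g.Nondegenerate} {ξ : S} {N' : Submodule ℂ V}
variable {m : ℕ} {p q : Fin m → V}
variable (hm : 3 ≤ m) (h : Split g ξ N' p q)

/-! ### Submodules over the Levi factor -/

theorem kind_dim_injective (hm : 3 ≤ m) {x z : Label} (hpos : x.pos = z.pos)
    (e : x.kind.dim m = z.kind.dim m) : x = z := by
  have hm' : (3 : ℚ) ≤ m := by exact_mod_cast hm
  have m0 : (m : ℚ) ≠ 0 := by positivity
  have h1 : (m : ℚ) ≠ m * (m - 2) * (m + 1) / 2 := fun e => by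
    have : (m : ℚ) * (m ^ 2 - m - 4) = 0 := by linear_combination -2 * e
    have := (mul_eq_zero.1 this).resolve_left m0
    nlinarith
  have h2 : (m : ℚ) ≠ m * (m + 2) * (m - 1) / 2 := fun e => by
    have : (m : ℚ) * (m ^ 2 + m - 4) = 0 := by linear_combination -2 * e
    have := (mul_eq_zero.1 this).resolve_left m0
    nlinarith
  have h3 : (m : ℚ) * (m - 2) * (m + 1) / 2 ≠ m * (m + 2) * (m - 1) / 2 := fun e => by
    have : (m : ℚ) * m = 0 := by linear_combination -e
    exact m0 (mul_self_eq_zero.1 this)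
  cases x <;> cases z <;> first
    | rfl
    | exact absurd hpos (by decide)
    | exact absurd e h1
    | exact absurd e h2
    | exact absurd e h3
    | exact absurd e.symm h1
    | exact absurd e.symm h2
    | exact absurd e.symm h3

include hm h in
-- Schur's lemma: a non-zero map between irreducibles of the same position would equate their
-- dimensions, and in different positions the grading element acts by different scalars.
theorem hom_eq_zero {x z : Label} (hxz : x ≠ z)
    (f : modC (hs := hs) (hg := hg) h.frame x →ₗ⁅ℂ, levi g hs hg ξ N'⁆ modC h.frame z) (A) : f A = 0 := by
  by_contra hA
  have ix := modC_irreducible (hs := hs) (hg := hg) hm h.frame x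
  have iz := modC_irreducible (hs := hs) (hg := hg) hm h.frame z
  by_cases hpos : x.pos = z.pos
  · have hk : f.ker = ⊥ := (eq_bot_or_eq_top _).resolve_right fun e => hA
      (LieModuleHom.mem_ker.1 (e ▸ LieSubmodule.mem_top A : A ∈ f.ker))
    have hr : f.range = ⊤ := (eq_bot_or_eq_top _).resolve_left fun e => hA
      ((LieSubmodule.eq_bot_iff _).1 e _ ((LieModuleHom.mem_range f _).2 ⟨A, rfl⟩))
    have hd := LinearEquiv.finrank_eq (LinearEquiv.ofBijective f.toLinearMap
      ⟨(LieModuleHom.ker_eq_bot _).1 hk, (LieModuleHom.range_eq_top _).1 hr⟩)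
    rw [finrank_modC hm, finrank_modC hm] at hd
    refine hxz (kind_dim_injective hm hpos ?_)
    rw [← finrank_range_proj hm, ← finrank_range_proj hm, hd]
  · obtain ⟨E, hE, -⟩ := exists_grading hs hg h
    have key : ∀ (y : Label) (B : modC (hs := hs) (hg := hg) h.frame y),
        ⁅E, B⁆ = (((y.pos : ℕ) : ℂ) - 3 / 2) • B := fun y B =>
      Subtype.ext (CottonYork.ext (modL_ext (hg := hg) hm h.toHyp (⁅E, B⁆).2
        ((((y.pos : ℕ) : ℂ) - 3 / 2) • B).2 ((cmpL_grading h hE y B).trans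
          (map_smul (cmpL p q y) _ _).symm)))
    have e1 := f.map_lie E A
    rw [key, key, map_smul, ← sub_eq_zero, ← sub_smul] at e1
    have e2 := (smul_eq_zero.1 e1).resolve_right hA
    have e3 : ((x.pos : ℕ) : ℂ) = (z.pos : ℕ) := by linear_combination e2
    exact hpos (Fin.ext (by exact_mod_cast e3))

/-- The projection onto the tensors with a given label. -/
def prHom (x : Label) :
    CottonYork g hg →ₗ⁅ℂ, levi g hs hg ξ N'⁆ modC (hs := hs) (hg := hg) h.frame x :=
  { LinearMap.codRestrict (modC (hs := hs) (hg := hg) h.frame x).toSubmodule (pr hm h.toHyp x)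
      fun A => form_pr_mem hm h.toHyp x A with
    map_lie' := fun {X A} => Subtype.ext (pr_lie hm h.frame x X A) }

include hm h in
theorem map_mem_modC {x : Label}
    (e : modC (hs := hs) (hg := hg) h.frame x →ₗ⁅ℂ, levi g hs hg ξ N'⁆ CottonYork g hg) (A) :
    e A ∈ modC (hs := hs) (hg := hg) h.frame x := by
  have : e A = pr hm h.toHyp x (e A) := by
    conv_lhs => rw [← sum_pr hm h.toHyp (e A)]
    refine Finset.sum_eq_single x (fun z _ hz => ?_) (by simp)
    exact congrArg Subtype.val (hom_eq_zero hm h hz.symm ((prHom hm h z).comp e) A)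
  rw [this]
  exact form_pr_mem hm h.toHyp x _

include hm h in
-- Multiplicity one: all projections of `M` to other labels vanish, so `M` lies in the irreducible
-- `modC` and fills it. This is what allows arbitrary representatives in the statement about arrows.
theorem eq_modC {x : Label} {M : LieSubmodule ℂ (levi g hs hg ξ N') (CottonYork g hg)}
    (e : M ≃ₗ⁅ℂ, levi g hs hg ξ N'⁆ modC (hs := hs) (hg := hg) h.frame x) :
    M = modC h.frame x := by
  have hle : M ≤ modC h.frame x := fun A hA => by
    have := map_mem_modC hm h (M.incl.comp e.symm.toLieModuleHom) (e ⟨A, hA⟩)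
    change ((e.symm (e ⟨A, hA⟩) : M) : CottonYork g hg) ∈ _ at this
    rwa [e.symm_apply_apply] at this
  refine le_antisymm hle ?_
  have := modC_irreducible (hs := hs) (hg := hg) hm h.frame x
  have := LieModule.nontrivial_of_isIrreducible ℂ (levi g hs hg ξ N')
    (modC (hs := hs) (hg := hg) h.frame x)
  have := e.toLinearEquiv.toEquiv.nontrivial
  obtain ⟨A, hA⟩ := exists_ne (0 : M)
  exact modC_le hm h.frame (hle A.2) A.2 fun e => hA (Subtype.ext e)

include hm h in
theorem isAtom_modC (x : Label) : IsAtom (modC (hs := hs) (hg := hg) h.frame x) := by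
  have := modC_irreducible (hs := hs) (hg := hg) hm h.frame x
  have := LieModule.nontrivial_of_isIrreducible ℂ (levi g hs hg ξ N')
    (modC (hs := hs) (hg := hg) h.frame x)
  refine ⟨fun e => ?_, fun G hG => ?_⟩
  · obtain ⟨A, hA⟩ := exists_ne (0 : modC (hs := hs) (hg := hg) h.frame x)
    exact hA (Subtype.ext ((LieSubmodule.eq_bot_iff _).1 e A A.2))
  · rw [LieSubmodule.eq_bot_iff]
    intro A hA
    by_contra hA0
    exact not_le_of_gt hG (modC_le hm h.frame (hG.le hA) hA hA0)

include hm h in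
theorem complementedLattice_levi :
    ComplementedLattice (LieSubmodule ℂ (levi g hs hg ξ N') (CottonYork g hg)) := by
  refine complementedLattice_of_sSup_atoms_eq_top ?_
  rw [eq_top_iff]
  intro A _
  rw [← sum_pr hm h.toHyp A]
  exact sum_mem fun x _ => (le_sSup (isAtom_modC hm h x) : modC h.frame x ≤ _)
    (form_pr_mem hm h.toHyp x A)

/-- By complete reducibility there is an equivariant projection onto `G`. It preserves each labelled
module by multiplicity one, hence commutes with taking components. -/
theorem pr_mem {G : LieSubmodule ℂ (levi g hs hg ξ N') (CottonYork g hg)} {A : CottonYork g hg}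
    (hA : A ∈ G) (x : Label) : pr hm h.toHyp x A ∈ G := by
  have := complementedLattice_levi (hs := hs) (hg := hg) hm h
  obtain ⟨G', hG'⟩ := exists_isCompl G
  have hc : IsCompl G.toSubmodule G'.toSubmodule := LieSubmodule.isCompl_toSubmodule.2 hG'
  let e₀ := Submodule.projectionOnto _ _ hc
  let e : CottonYork g hg →ₗ⁅ℂ, levi g hs hg ξ N'⁆ CottonYork g hg :=
    { G.toSubmodule.subtype ∘ₗ e₀ with
      map_lie' := fun {X B} => by
        obtain ⟨a, ha, b, hb, rfl⟩ := Submodule.mem_sup.1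
          (hc.sup_eq_top ▸ Submodule.mem_top : B ∈ G.toSubmodule ⊔ G'.toSubmodule)
        change (e₀ ⁅X, a + b⁆ : CottonYork g hg) = ⁅X, (e₀ (a + b) : CottonYork g hg)⁆
        have e1 : ∀ a (ha : a ∈ G), e₀ a = ⟨a, ha⟩ := fun a ha =>
          Submodule.projectionOnto_apply_left hc ⟨a, ha⟩
        have e2 : ∀ b (hb : b ∈ G'), e₀ b = 0 := fun b hb =>
          Submodule.projectionOnto_apply_right hc ⟨b, hb⟩
        rw [lie_add, map_add, map_add, e1 a ha, e2 b hb, e1 _ (G.lie_mem ha),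
          e2 _ (G'.lie_mem hb), add_zero, add_zero] }
  have he : e A = A := congrArg Subtype.val (Submodule.projectionOnto_apply_left hc ⟨A, hA⟩)
  have h1 : ∀ z, e (pr hm h.toHyp z A) ∈ modC (hs := hs) (hg := hg) h.frame z := fun z =>
    map_mem_modC hm h (e.comp (modC h.frame z).incl) ⟨_, form_pr_mem hm h.toHyp z A⟩
  have h2 : pr hm h.toHyp x A = e (pr hm h.toHyp x A) := by
    conv_lhs => rw [← he, ← sum_pr hm h.toHyp A, map_sum, map_sum]
    rw [Finset.sum_eq_single x]
    · exact pr_eq_self hm h.toHyp (h1 x)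
    · intro z _ hz
      refine CottonYork.ext (eq_zero_of_cmpL (hg := hg) hm h.toHyp (CottonYork.form_mem _)
        fun y => ?_)
      by_cases hy : y = x
      · subst hy; rw [cmpL_pr_self]; exact (mem_modL.1 (h1 z)).2 y hz.symm
      · exact cmpL_pr_ne hm h.toHyp hy _
    · simp
  rw [h2]
  exact (e₀ _).2

/-- The submodule spanned by the action of `𝔤₁` on a submodule. -/
def gPosSpan (M : LieSubmodule ℂ (levi g hs hg ξ N') (CottonYork g hg)) :
    LieSubmodule ℂ (levi g hs hg ξ N') (CottonYork g hg) :=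
  { Submodule.span ℂ {C | ∃ X ∈ gPos g hs hg ξ N', ∃ A ∈ M, C = ⁅X, A⁆} with
    lie_mem := fun {Z C} hC => by
      change C ∈ Submodule.span ℂ _ at hC
      change ⁅Z, C⁆ ∈ Submodule.span ℂ _
      induction hC using Submodule.span_induction with
      | mem C hC =>
        obtain ⟨X, hX, A, hA, rfl⟩ := hC
        have e : ⁅Z, ⁅X, A⁆⁆ = ⁅⁅Z, X⁆, A⁆ + ⁅X, ⁅Z, A⁆⁆ := leibniz_lie (toSo Z) X A
        rw [e]
        exact add_mem (Submodule.subset_span ⟨_, (gPos g hs hg ξ N').lie_mem hX, A, hA, rfl⟩)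
          (Submodule.subset_span ⟨X, hX, _, M.lie_mem hA, rfl⟩)
      | zero => rw [lie_zero]; exact zero_mem _
      | add C D _ _ hC hD => rw [lie_add]; exact add_mem hC hD
      | smul c C _ hC => rw [lie_smul]; exact Submodule.smul_mem _ _ hC }

include hm h in
-- 𝔤₁ · M is a 𝔤₀-submodule, so it contains the component of ⁅X, A⁆ and with it the whole
-- irreducible module.
theorem le_gPosSpan {x : Label} {M : LieSubmodule ℂ (levi g hs hg ξ N') (CottonYork g hg)}
    {X : so g} (hX : X ∈ gPos g hs hg ξ N') {A : CottonYork g hg} (hA : A ∈ M)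
    (hne : cmpL p q x ⁅X, A.form⁆ ≠ 0) : modC h.frame x ≤ gPosSpan M := by
  refine modC_le hm h.frame (form_pr_mem hm h.toHyp x ⁅X, A⁆)
    (pr_mem hm h (G := gPosSpan M) (A := ⁅X, A⁆)
      (Submodule.subset_span ⟨X, hX, A, hA, rfl⟩) x) fun e => hne ?_
  have := cmpL_pr_self hm h.toHyp x (⁅X, A⁆ : CottonYork g hg)
  rw [e] at this
  exact this.symm.trans (map_zero (cmpL p q x))

end Schur

section Witness

variable {V : Type*} [AddCommGroup V] [Module ℂ V] [FiniteDimensional ℂ V]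
variable {g : LinearMap.BilinForm ℂ V} {hg : g.Nondegenerate} (hs : g.IsSymm)
variable {m : ℕ} {p q : Fin m → V}

/-! ### Test arrays -/

/-- An array of each type. -/
def testArray (a b c : Fin m) : Kind → Coef m
  | .hook => fun x => kron a x.1 * (kron a x.2.1 * kron b x.2.2 - kron b x.2.1 * kron a x.2.2)
  | .trace => pure (2 * m - 1) (m - 2) (kron a)
  | .alt => fun x => (kron a x.1 * kron b x.2.1 - kron b x.1 * kron a x.2.1) * kron c x.2.2
  | .sym => fun x => kron a x.1 * kron a x.2.1 * kron b x.2.2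

theorem proj_testArray (hm : 3 ≤ m) {a b c : Fin m} (hab : a ≠ b) (hac : a ≠ c) (hbc : b ≠ c)
    (κ : Kind) : proj κ (testArray a b c κ) = testArray a b c κ := by
  cases κ
  · refine proj_hook_eq_self _ (fun i j k => ?_) fun i j k => ?_ <;> simp only [testArray] <;> ring
  · rw [proj_trace, testArray, tr1_pure, map_smul]
    have h0 := natCast_sq_sub_one_ne hm
    ext ⟨i, j, k⟩
    simp only [Pi.smul_apply, smul_eq_mul, pure_apply]
    field_simp
    ring
  · refine proj_alt_eq_self (fun i j k => ?_) ?_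
    · simp only [testArray]; ring
    · ext i
      simp [tr1_apply, testArray, kron, Finset.sum_ite_eq, hac, hbc, hac.symm, hbc.symm, sub_mul]
  · refine proj_sym_eq_self (fun i j k => ?_) ?_
    · simp only [testArray]; ring
    · ext i
      simp [tr1_apply, testArray, kron, hab, hab.symm]

theorem exists_testForm (hm : 3 ≤ m) (h : Hyp g p q) {a b c : Fin m} (hab : a ≠ b) (hac : a ≠ c)
    (hbc : b ≠ c) (κ : Kind) :
    ∃ A ∈ modForm g hg p q κ, blk p q κ A = testArray a b c κ := by
  refine ⟨_, build_mem_modForm hm h κ (testArray a b c κ), ?_⟩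
  rw [proj_testArray hm hab hac hbc]
  by_cases hκ : κ = .hook
  · subst hκ
    exact (comp_build_hook h _).trans (proj_testArray hm hab hac hbc _)
  · rw [blk_of_ne p q hκ, comp_build_of_ne h hκ]

/-! ### Non-vanishing of components -/

/-- At an entry whose last index differs from the first two, the trace correction is absent; the
skew case is tested in the same way. -/
theorem proj_sym_ne_zero {t : Coef m} {i k : Fin m} (hik : i ≠ k) (h : t (i, i, k) ≠ 0) :
    proj .sym t ≠ 0 := fun e => h (by
  have := congrFun e (i, i, k)
  rw [proj_sym_apply, pure_apply, kron_ne hik, Pi.zero_apply] at this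
  linear_combination this)

theorem proj_alt_ne_zero {t : Coef m} {i j k : Fin m} (hik : i ≠ k) (hjk : j ≠ k)
    (h : t (i, j, k) ≠ t (j, i, k)) : proj .alt t ≠ 0 := fun e => h (by
  have := congrFun e (i, j, k)
  rw [proj_alt_apply, pure_apply, kron_ne hik, kron_ne hjk, Pi.zero_apply] at this
  linear_combination 2 * this)

theorem proj_trace_ne_zero (hm : 3 ≤ m) {t : Coef m} {i : Fin m} (h : tr1 t i ≠ 0) :
    proj .trace t ≠ 0 := fun e => h (by
  rw [← tr1_proj_trace hm, e, map_zero, Pi.zero_apply])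

/-! ### The action of `𝔤₁` on components -/

section Raise

variable (h : Hyp g p q) {A : Tri V} (a b : Fin m)
include h hs

theorem hop_pp_p (i : Fin m) : ⁅hop g hs (p a) (p b), p i⁆ = 0 := by
  rw [hop_lie, h.pp, h.pp, zero_smul, zero_smul, sub_zero]

theorem hop_pp_q (i : Fin m) :
    ⁅hop g hs (p a) (p b), q i⁆ = kron b i • p a - kron a i • p b := by
  rw [hop_lie, h.pq, h.pq]

/-- Elements of 𝔤₁ kill `p` and send `q` into the span of `p`, so each block of the image is fed
only by the block one degree lower. -/
theorem comp_pq_raise (i j k : Fin m) : comp p q ⁅hop g hs (p a) (p b), A⁆ (i, j, k) =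
    kron a k * comp p p A (i, j, b) - kron b k * comp p p A (i, j, a) := by
  simp only [comp_apply, lie_tri, hop_pp_p hs h, hop_pp_q hs h, map_sub, map_smul, map_zero,
    LinearMap.zero_apply, smul_eq_mul]
  ring

variable (hA : A ∈ cottonYork g hg)
include hA

theorem comp_qp_raise (i j k : Fin m) : comp q p ⁅hop g hs (p a) (p b), A⁆ (i, j, k) =
    kron b i * comp p q A (a, k, j) - kron a i * comp p q A (b, k, j) -
      kron b j * (comp p q A (k, a, i) - comp p q A (a, k, i)) +
      kron a j * (comp p q A (k, b, i) - comp p q A (b, k, i)) := by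
  have a1 := (mem_cottonYork.1 hA).1
  have a2 := (mem_cottonYork.1 hA).2.1
  simp only [comp_apply, lie_tri, hop_pp_p hs h, hop_pp_q hs h, map_sub, map_smul, map_zero,
    LinearMap.zero_apply, smul_eq_mul, LinearMap.sub_apply, LinearMap.smul_apply]
  linear_combination - kron b i * a1 (p a) (q j) (p k) + kron a i * a1 (p b) (q j) (p k) -
    kron b j * (a2 (q i) (p a) (p k) - a1 (p k) (q i) (p a)) +
    kron a j * (a2 (q i) (p b) (p k) - a1 (p k) (q i) (p b))

theorem comp_qq_raise (i j k : Fin m) : comp q q ⁅hop g hs (p a) (p b), A⁆ (i, j, k) =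
    kron b i * (comp q p A (j, k, a) - comp q p A (k, j, a)) -
      kron a i * (comp q p A (j, k, b) - comp q p A (k, j, b)) +
      kron b j * comp q p A (i, k, a) - kron a j * comp q p A (i, k, b) -
      kron b k * comp q p A (i, j, a) + kron a k * comp q p A (i, j, b) := by
  have a1 := (mem_cottonYork.1 hA).1
  have a2 := (mem_cottonYork.1 hA).2.1
  simp only [comp_apply, lie_tri, hop_pp_p hs h, hop_pp_q hs h, map_sub, map_smul, map_zero,
    LinearMap.zero_apply, smul_eq_mul, LinearMap.sub_apply, LinearMap.smul_apply]
  linear_combination - kron b i * (a2 (p a) (q j) (q k) - a1 (q k) (p a) (q j)) +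
    kron a i * (a2 (p b) (q j) (q k) - a1 (q k) (p b) (q j)) -
    kron b j * a1 (q i) (p a) (q k) + kron a j * a1 (q i) (p b) (q k)

end Raise

end Witness

section Arrows

variable {V : Type*} [AddCommGroup V] [Module ℂ V] [FiniteDimensional ℂ V]
variable {g : LinearMap.BilinForm ℂ V} {hg : g.Nondegenerate} (hs : g.IsSymm)
variable {m : ℕ} {p q : Fin m → V}

/-! ### The arrows of the graph -/

/-- One test tensor and one element p_a ∧ p_b of 𝔤₁ for each arrow. Skew and symmetric targets are
tested at an entry without trace correction, trace targets at one entry of `tr1`, and the top target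
at an entry of its block. -/
theorem exists_raise (hm : 3 ≤ m) (h : Hyp g p q) {x y : Label} (hxy : Label.Arrow x y) :
    ∃ a b, ∃ A ∈ modL g hg p q y, cmpL p q x ⁅hop g hs (p a) (p b), A⁆ ≠ 0 := by
  let z : Fin m := ⟨0, by omega⟩
  let o : Fin m := ⟨1, by omega⟩
  let t : Fin m := ⟨2, by omega⟩
  have zo : z ≠ o := by simp [z, o]
  have zt : z ≠ t := by simp [z, t]
  have ot : o ≠ t := by simp [o, t]
  have zo' := zo.symm
  have zt' := zt.symm
  have ot' := ot.symm
  -- This number appears, up to a factor, in the arrows `𝔄^1_{1/2} → 𝔄^0_{-1/2}` and `𝔄^0_{3/2} →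
  -- 𝔄^0_{1/2}`, whose test tensor is of trace type.
  have hα : (2 * m - 1 : ℂ) ≠ 0 := by
    have : ((2 * m - 1 : ℤ) : ℂ) ≠ 0 := Int.cast_ne_zero.2 (by omega)
    push_cast at this
    exact this
  have lower : ∀ κ : Kind, ∃ A ∈ modL g hg p q κ.neg, A ∈ cottonYork g hg ∧
      blk p q κ A = testArray z o t κ := fun κ => by
    obtain ⟨A, hA, e⟩ := exists_testForm (hg := hg) hm h zo zt ot κ
    exact ⟨A, by rwa [modL_neg], (mem_modForm.1 hA).1, e⟩
  have upper : ∀ κ : Kind, ∃ A ∈ modL g hg p q κ.pos, A ∈ cottonYork g hg ∧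
      blk q p κ A = testArray z o t κ := fun κ => by
    obtain ⟨A, hA, e⟩ := exists_testForm (hg := hg) hm h.swap zo zt ot κ
    exact ⟨A, by rwa [modL_pos], (mem_modForm.1 hA).1, e⟩
  have top : ∀ {A : Tri V} {a b i j k : Fin m}, A ∈ cottonYork g hg →
      comp q q ⁅hop g hs (p a) (p b), A⁆ (i, j, k) ≠ 0 →
        cmpL p q .p3_0 ⁅hop g hs (p a) (p b), A⁆ ≠ 0 := by
    intro A a b i j k hA hne e
    have e' : cmp q p .hook ⁅hop g hs (p a) (p b), A⁆ = 0 := e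
    rw [cmp_hook h.swap ((cottonYork g hg).lie_mem hA)] at e'
    exact hne (congrFun e' _)
  cases hxy with
  | m1_2_m3_0 =>
    obtain ⟨A, hA, -, e⟩ := lower .hook
    replace e : comp p p A = _ := e
    refine ⟨o, t, A, hA, proj_sym_ne_zero (i := z) (k := t) zt ?_⟩
    simp [blk, comp_pq_raise hs h, e, testArray, kron, *]
  | m1_1_m3_0 =>
    obtain ⟨A, hA, -, e⟩ := lower .hook
    replace e : comp p p A = _ := e
    refine ⟨z, t, A, hA, proj_alt_ne_zero (i := z) (j := o) (k := t) zt ot ?_⟩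
    simp [blk, comp_pq_raise hs h, e, testArray, kron, *]
  | m1_0_m3_0 =>
    obtain ⟨A, hA, -, e⟩ := lower .hook
    replace e : comp p p A = _ := e
    refine ⟨z, o, A, hA, proj_trace_ne_zero hm (i := z) ?_⟩
    simp [blk, tr1_apply, comp_pq_raise hs h, e, testArray, kron, *, Finset.sum_add_distrib]
  | p1_2_m1_2 =>
    obtain ⟨A, hA, hA', e⟩ := lower .sym
    replace e : comp p q A = _ := e
    refine ⟨z, o, A, hA, proj_sym_ne_zero (i := o) (k := z) zo' ?_⟩
    simp [blk, comp_qp_raise hs h _ _ hA', e, testArray, kron, *]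
  | p1_1_m1_2 =>
    obtain ⟨A, hA, hA', e⟩ := lower .sym
    replace e : comp p q A = _ := e
    refine ⟨z, t, A, hA, proj_alt_ne_zero (i := t) (j := o) (k := z) zt' zo' ?_⟩
    simp [blk, comp_qp_raise hs h _ _ hA', e, testArray, kron, *]
  | p1_2_m1_1 =>
    obtain ⟨A, hA, hA', e⟩ := lower .alt
    replace e : comp p q A = _ := e
    refine ⟨z, t, A, hA, proj_sym_ne_zero (i := t) (k := o) ot' ?_⟩
    simp [blk, comp_qp_raise hs h _ _ hA', e, testArray, kron, *]
    norm_num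
  | p1_0_m1_1 =>
    obtain ⟨A, hA, hA', e⟩ := lower .alt
    replace e : comp p q A = _ := e
    refine ⟨z, o, A, hA, proj_trace_ne_zero hm (i := t) ?_⟩
    simp [blk, tr1_apply, comp_qp_raise hs h _ _ hA', e, testArray, kron, *, sub_mul,
      Finset.sum_add_distrib]
  | p1_1_m1_0 =>
    obtain ⟨A, hA, hA', e⟩ := lower .trace
    replace e : comp p q A = _ := e
    refine ⟨o, t, A, hA, proj_alt_ne_zero (i := o) (j := t) (k := z) zo' zt' ?_⟩
    simp [blk, comp_qp_raise hs h _ _ hA', e, testArray, pure_apply, kron, *]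
    exact fun H => hα (by linear_combination (-1 / 2 : ℂ) * H)
  | p1_0_m1_0 =>
    obtain ⟨A, hA, hA', e⟩ := lower .trace
    replace e : comp p q A = _ := e
    refine ⟨z, o, A, hA, proj_trace_ne_zero hm (i := o) ?_⟩
    simp [blk, tr1_apply, comp_qp_raise hs h _ _ hA', e, testArray, pure_apply, kron, *,
      Finset.sum_add_distrib]
    intro H
    have : (((2 * m * (m + 1) : ℕ)) : ℂ) = 0 := by push_cast; linear_combination H
    exact absurd (Nat.cast_eq_zero.1 this) (by positivity)
  | p3_0_p1_2 =>
    obtain ⟨A, hA, hA', e⟩ := upper .sym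
    replace e : comp q p A = _ := e
    refine ⟨o, t, A, hA, top hA' (i := z) (j := z) (k := t) ?_⟩
    simp [comp_qq_raise hs h _ _ hA', e, testArray, kron, *]
  | p3_0_p1_1 =>
    obtain ⟨A, hA, hA', e⟩ := upper .alt
    replace e : comp q p A = _ := e
    refine ⟨t, z, A, hA, top hA' (i := z) (j := o) (k := z) ?_⟩
    simp [comp_qq_raise hs h _ _ hA', e, testArray, kron, *]
    norm_num
  | p3_0_p1_0 =>
    obtain ⟨A, hA, hA', e⟩ := upper .trace
    replace e : comp q p A = _ := e
    refine ⟨o, t, A, hA, top hA' (i := z) (j := o) (k := t) ?_⟩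
    simp [comp_qq_raise hs h _ _ hA', e, testArray, pure_apply, kron, *]
    exact fun H => hα (by linear_combination (-1 / 2 : ℂ) * H)

end Arrows


/-! ### Recognising Cartan products -/

section Recognise

variable {L : Type*} [LieRing L] [LieAlgebra ℂ L] {M P R : Type*}
  [AddCommGroup M] [Module ℂ M] [LieRingModule L M] [LieModule ℂ L M]
  [AddCommGroup P] [Module ℂ P] [LieRingModule L P] [LieModule ℂ L P]
  [AddCommGroup R] [Module ℂ R] [LieRingModule L R] [LieModule ℂ L R]

theorem tmul_ne_zero {v : P} {w : R} (hv : v ≠ 0) (hw : w ≠ 0) : v ⊗ₜ[ℂ] w ≠ 0 := by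
  intro e
  obtain ⟨f, hf⟩ := not_forall.1 (mt (Module.forall_dual_apply_eq_zero_iff ℂ v).1 hv)
  obtain ⟨f', hf'⟩ := not_forall.1 (mt (Module.forall_dual_apply_eq_zero_iff ℂ w).1 hw)
  have := congrArg (fun t => TensorProduct.lid ℂ ℂ (TensorProduct.map f f' t)) e
  simp [hf, hf'] at this

/-- A vector spanning the highest weight vectors. -/
structure IsHighest (b : Set L) (v : P) : Prop where
  isHW : IsHighestWeightVector b v
  unique : ∀ w, IsHighestWeightVector b w → ∃ c : ℂ, w = c • v

theorem IsHighest.of_map {b : Set L} {f : P →ₗ⁅ℂ, L⁆ R} (hf : Function.Injective f) {v : P}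
    (h0 : f v ≠ 0) (h1 : ∀ X ∈ b, ∃ c : ℂ, ⁅X, f v⁆ = c • f v)
    (h2 : ∀ w : P, f w ≠ 0 → (∀ X ∈ b, ∃ c : ℂ, ⁅X, f w⁆ = c • f w) → ∃ c : ℂ, f w = c • f v) :
    IsHighest b v := by
  refine ⟨⟨fun e => h0 (by rw [e, map_zero]), fun X hX => ?_⟩, fun w hw => ?_⟩
  · obtain ⟨c, hc⟩ := h1 X hX
    exact ⟨c, hf (by rw [LieModuleHom.map_lie, map_smul, hc])⟩
  · obtain ⟨c, hc⟩ := h2 w (fun e => hw.1 (hf (by rw [e, map_zero]))) fun X hX => by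
      obtain ⟨c, hc⟩ := hw.2 X hX
      exact ⟨c, by rw [← LieModuleHom.map_lie, hc, map_smul]⟩
    exact ⟨c, hf (by rw [hc, map_smul])⟩

/-- Uniqueness of the highest weight vectors makes the Cartan product the submodule generated by one
vector, and that vector is in the range of `Φ`. Irreducibility of `M` gives injectivity and forces
the range to be no larger. -/
theorem nonempty_equiv_cartanProduct {b : Set L} (hM : LieModule.IsIrreducible ℂ L M)
    (Φ : M →ₗ⁅ℂ, L⁆ P ⊗[ℂ] R) {v : P} {w : R} (hv : IsHighest b v) (hw : IsHighest b w) {A : M}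
    {c : ℂ} (hc : c ≠ 0) (hA : Φ A = c • v ⊗ₜ[ℂ] w) :
    Nonempty (M ≃ₗ⁅ℂ, L⁆ cartanProduct b P R) := by
  have hvw : Φ A ≠ 0 := by
    rw [hA]; exact smul_ne_zero hc (tmul_ne_zero hv.isHW.1 hw.isHW.1)
  have hA0 : A ≠ 0 := fun e => hvw (by rw [e, map_zero])
  have hle : cartanProduct b P R ≤ Φ.range := by
    refine LieSubmodule.lieSpan_le.2 ?_
    rintro _ ⟨v', w', hv', hw', rfl⟩
    obtain ⟨a, rfl⟩ := hv.unique v' hv'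
    obtain ⟨d, rfl⟩ := hw.unique w' hw'
    refine (LieModuleHom.mem_range _ _).2 ⟨(a * d * c⁻¹) • A, ?_⟩
    rw [map_smul, hA, smul_smul, mul_assoc, inv_mul_cancel₀ hc, mul_one,
      TensorProduct.smul_tmul_smul]
  have htop : ∀ B, Φ B ∈ cartanProduct b P R := by
    have : (cartanProduct b P R).comap Φ = ⊤ := by
      refine (eq_bot_or_eq_top _).resolve_left fun h0 => hA0 ?_
      rw [LieSubmodule.eq_bot_iff] at h0
      refine h0 A ?_
      rw [LieSubmodule.mem_comap, hA]
      exact (cartanProduct b P R).smul_mem c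
        (LieSubmodule.subset_lieSpan ⟨v, w, hv.isHW, hw.isHW, rfl⟩)
    exact fun B => LieSubmodule.mem_comap.1 (this ▸ LieSubmodule.mem_top B)
  have hker : Φ.ker = ⊥ := (eq_bot_or_eq_top _).resolve_right fun h0 =>
    hvw ((LieModuleHom.mem_ker).1 (h0 ▸ LieSubmodule.mem_top A))
  let Ψ : M →ₗ⁅ℂ, L⁆ cartanProduct b P R := LieModuleHom.codRestrict _ Φ htop
  have hΨ : Function.Bijective Ψ := by
    refine ⟨fun B C e => (LieModuleHom.ker_eq_bot Φ).1 hker (congrArg Subtype.val e), fun y => ?_⟩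
    obtain ⟨B, hB⟩ := (LieModuleHom.mem_range _ _).1 (hle y.2)
    exact ⟨B, Subtype.ext hB⟩
  exact ⟨{ Ψ with
    invFun := (Equiv.ofBijective Ψ hΨ).symm
    left_inv := (Equiv.ofBijective Ψ hΨ).left_inv
    right_inv := (Equiv.ofBijective Ψ hΨ).right_inv }⟩

/-- Equivariance of `A ↦ ∑ i, r i ⊗ f i A` for dual families `r`, `f`. -/
theorem exists_sum_tmul {n : Type*} [Fintype n] (r : n → P) (f : n → M →ₗ[ℂ] R)
    (H : ∀ X : L, ∃ y : n → n → ℂ, (∀ i, ⁅X, r i⁆ = - ∑ l, y i l • r l) ∧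
      ∀ A i, ⁅X, f i A⁆ = f i ⁅X, A⁆ + ∑ l, y l i • f l A) :
    ∃ Φ : M →ₗ⁅ℂ, L⁆ P ⊗[ℂ] R, ∀ A, Φ A = ∑ i, r i ⊗ₜ[ℂ] f i A := by
  refine ⟨{ (∑ i, (TensorProduct.mk ℂ P R (r i)) ∘ₗ f i : M →ₗ[ℂ] P ⊗[ℂ] R) with
    map_lie' := fun {X A} => ?_ }, fun A => ?_⟩
  · obtain ⟨y, hr, hf⟩ := H X
    change (∑ i, (TensorProduct.mk ℂ P R (r i)) ∘ₗ f i : M →ₗ[ℂ] P ⊗[ℂ] R) ⁅X, A⁆ =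
      ⁅X, (∑ i, (TensorProduct.mk ℂ P R (r i)) ∘ₗ f i : M →ₗ[ℂ] P ⊗[ℂ] R) A⁆
    simp only [LinearMap.sum_apply, LinearMap.comp_apply, TensorProduct.mk_apply, lie_sum,
      TensorProduct.LieModule.lie_tmul_right, hr, hf, TensorProduct.neg_tmul,
      TensorProduct.sum_tmul, TensorProduct.tmul_add, TensorProduct.tmul_sum,
      TensorProduct.tmul_smul, TensorProduct.smul_tmul', Finset.sum_add_distrib,
      Finset.sum_neg_distrib]
    rw [Finset.sum_comm]
    abel
  · change (∑ i, (TensorProduct.mk ℂ P R (r i)) ∘ₗ f i : M →ₗ[ℂ] P ⊗[ℂ] R) A = _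
    simp

/-- A linear map into the range of an injective one factors through it. -/
theorem exists_lift {Q : Type*} [AddCommGroup Q] [Module ℂ Q] {ι : R →ₗ[ℂ] Q}
    (hι : Function.Injective ι) (f : M →ₗ[ℂ] Q) (hf : ∀ A, ∃ r, ι r = f A) :
    ∃ f' : M →ₗ[ℂ] R, ∀ A, ι (f' A) = f A :=
  ⟨(LinearEquiv.ofInjective ι hι).symm.toLinearMap ∘ₗ f.codRestrict (LinearMap.range ι) hf,
    fun A => congrArg Subtype.val ((LinearEquiv.ofInjective ι hι).apply_symm_apply
      (f.codRestrict (LinearMap.range ι) hf A))⟩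

end Recognise


section HighestWeight

variable {V : Type*} [AddCommGroup V] [Module ℂ V] [FiniteDimensional ℂ V]
variable {S : Type*} [AddCommGroup S] [Module ℂ S]
variable {g : LinearMap.BilinForm ℂ V} [Module (CliffordAlgebra (cliffordForm g)) S]
  [IsScalarTower ℂ (CliffordAlgebra (cliffordForm g)) S]
variable {hs : g.IsSymm} {hg : g.Nondegenerate} {ξ : S} {N' : Submodule ℂ V}
variable {m : ℕ} {p q : Fin m → V}

/-! ### Elements of the orthogonal algebra in a hyperbolic basis -/

variable (hs) in
include hs in
theorem so_skew (X : so g) (u v : V) : g u ⁅X, v⁆ = - g v ⁅X, u⁆ := by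
  rw [g_comm hs, so_apply]

variable (hs) in
include hs in
theorem Hyp.so_ext (h : Hyp g p q) {X Y : so g}
    (h1 : ∀ l i, g (p l) ⁅X, q i⁆ = g (p l) ⁅Y, q i⁆)
    (h2 : ∀ l i, g (p l) ⁅X, p i⁆ = g (p l) ⁅Y, p i⁆)
    (h3 : ∀ l i, g (q l) ⁅X, q i⁆ = g (q l) ⁅Y, q i⁆) : X = Y := by
  refine PureSpinor.so_ext fun v => h.ext (fun i => ?_) fun i => ?_
  · exact LinearMap.congr_fun (h.lin_ext (f := g (p i) ∘ₗ LieModule.toEnd ℂ (so g) V X)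
      (f' := g (p i) ∘ₗ LieModule.toEnd ℂ (so g) V Y) (h2 i) (h1 i)) v
  · refine LinearMap.congr_fun (h.lin_ext (f := g (q i) ∘ₗ LieModule.toEnd ℂ (so g) V X)
      (f' := g (q i) ∘ₗ LieModule.toEnd ℂ (so g) V Y) (fun j => ?_) (h3 i)) v
    change g (q i) ⁅X, p j⁆ = g (q i) ⁅Y, p j⁆
    rw [so_skew hs, h1, ← so_skew hs]

theorem lie_hop (X : so g) (a b : V) :
    ⁅X, hop g hs a b⁆ = hop g hs ⁅X, a⁆ b + hop g hs a ⁅X, b⁆ :=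
  so_ext fun v => by
    rw [so_lie_lie, add_lie, hop_lie, hop_lie, hop_lie, hop_lie, lie_sub, lie_smul, lie_smul,
      so_apply, so_apply]
    module

theorem hop_smul_left (c : ℂ) (a b : V) : hop g hs (c • a) b = c • hop g hs a b :=
  so_ext fun v => by
    rw [smul_lie, hop_lie, hop_lie, map_smul, LinearMap.smul_apply, smul_eq_mul]; module

theorem hop_smul_right (c : ℂ) (a b : V) : hop g hs a (c • b) = c • hop g hs a b :=
  so_ext fun v => by
    rw [smul_lie, hop_lie, hop_lie, map_smul, LinearMap.smul_apply, smul_eq_mul]; module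

theorem hop_add_right (a b c : V) : hop g hs a (b + c) = hop g hs a b + hop g hs a c :=
  so_ext fun v => by
    rw [add_lie, hop_lie, hop_lie, hop_lie, map_add, LinearMap.add_apply]; module

theorem hop_self (a : V) : hop g hs a a = 0 :=
  so_ext fun v => by rw [hop_lie, sub_self, zero_lie]

namespace LeviFrame

variable (h : LeviFrame hs hg ξ N' p q)
include h

theorem lie_right (X : levi g hs hg ξ N') (i j : Fin m) : g (q i) ⁅toSo X, q j⁆ = 0 := by
  rw [(h.acts X).right]; simp [h.hyp.qq]

theorem lie_left (X : levi g hs hg ξ N') (i j : Fin m) : g (p i) ⁅toSo X, p j⁆ = 0 := by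
  rw [(h.acts X).left]; simp [h.hyp.pp]

theorem levi_ext {X Y : levi g hs hg ξ N'}
    (e : ∀ l i, g (p l) ⁅toSo X, q i⁆ = g (p l) ⁅toSo Y, q i⁆) : X = Y :=
  toSo_injective (h.hyp.so_ext hs e (fun l i => by rw [h.lie_left, h.lie_left]) fun l i => by
    rw [h.lie_right, h.lie_right])

theorem entry_lie (X Y : levi g hs hg ξ N') (l i : Fin m) : g (p l) ⁅toSo ⁅X, Y⁆, q i⁆ =
    ∑ k, (g (p l) ⁅toSo X, q k⁆ * g (p k) ⁅toSo Y, q i⁆ -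
      g (p l) ⁅toSo Y, q k⁆ * g (p k) ⁅toSo X, q i⁆) := by
  have e : ∀ X Y : levi g hs hg ξ N', g (p l) ⁅toSo X, ⁅toSo Y, q i⁆⁆ =
      ∑ k, g (p l) ⁅toSo X, q k⁆ * g (p k) ⁅toSo Y, q i⁆ := fun X Y => by
    conv_lhs => rw [h.hyp.expand_right (h.lie_right Y · i), lie_sum, map_sum]
    simp only [lie_smul, map_smul, smul_eq_mul, mul_comm]
  rw [toSo_lie, so_lie_lie, map_sub, e, e, Finset.sum_sub_distrib]

theorem hop_qp_q (a c i : Fin m) : ⁅hop g hs (q a) (p c), q i⁆ = kron c i • q a := by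
  rw [hop_left hs h.hyp.swap (h.hyp.qq · a) (h.hyp.qq · i), h.hyp.pq]

theorem hop_qp_p (a c i : Fin m) : ⁅hop g hs (q a) (p c), p i⁆ = - (kron a i • p c) := by
  rw [hop_right hs h.hyp.swap (h.hyp.pp · c) (h.hyp.pp · i), h.hyp.qp]

theorem entry_hop_lie {X : levi g hs hg ξ N'} {a c : Fin m} (hX : toSo X = hop g hs (q a) (p c))
    (Y : levi g hs hg ξ N') (l i : Fin m) : g (p l) ⁅toSo ⁅X, Y⁆, q i⁆ =
      kron l a * g (p c) ⁅toSo Y, q i⁆ - g (p l) ⁅toSo Y, q a⁆ * kron c i := by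
  rw [toSo_lie, so_lie_lie, hX, h.hop_qp_q,
    hop_left hs h.hyp.swap (h.hyp.qq · a) (h.lie_right Y · i)]
  simp only [map_sub, lie_smul, map_smul, smul_eq_mul, h.hyp.pq]
  ring

end LeviFrame

/-! ### Highest weight vectors -/

/-- If elements of the Borel subalgebra carry an eigenvector `w` to a non-zero multiple of `v`, that
multiple is also a multiple of `w`. This replaces weight theory in the uniqueness proofs. -/
theorem eq_smul_of_lie_lie {L P : Type*} [LieRing L] [LieAlgebra ℂ L] [AddCommGroup P] [Module ℂ P]
    [LieRingModule L P] [LieModule ℂ L P] {b : Set L} {v w : P}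
    (hw : ∀ X ∈ b, ∃ c : ℂ, ⁅X, w⁆ = c • w) {X Y : L} (hX : X ∈ b) (hY : Y ∈ b) (hv : v ≠ 0) {d : ℂ}
    (hd : d ≠ 0) (e : ⁅Y, ⁅X, w⁆⁆ = d • v) : ∃ c : ℂ, w = c • v := by
  obtain ⟨α, hα⟩ := hw X hX
  obtain ⟨β, hβ⟩ := hw Y hY
  rw [hα, lie_smul, hβ, smul_smul] at e
  have h0 : α * β ≠ 0 := fun h0 => smul_ne_zero hd hv (by rw [← e, h0, zero_smul])
  exact ⟨(α * β)⁻¹ * d, by rw [mul_smul, ← e, smul_smul, inv_mul_cancel₀ h0, one_smul]⟩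

theorem eq_smul_of_lie {L P : Type*} [LieRing L] [LieAlgebra ℂ L] [AddCommGroup P] [Module ℂ P]
    [LieRingModule L P] [LieModule ℂ L P] {b : Set L} {v w : P}
    (hw : ∀ X ∈ b, ∃ c : ℂ, ⁅X, w⁆ = c • w) {X : L} (hX : X ∈ b) (hv : v ≠ 0) {d : ℂ}
    (hd : d ≠ 0) (e : ⁅X, w⁆ = d • v) : ∃ c : ℂ, w = c • v := by
  obtain ⟨α, hα⟩ := hw X hX
  rw [hα] at e
  have h0 : α ≠ 0 := fun h0 => smul_ne_zero hd hv (by rw [← e, h0, zero_smul])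
  exact ⟨α⁻¹ * d, by rw [mul_smul, ← e, smul_smul, inv_mul_cancel₀ h0, one_smul]⟩

/-- Compatibility of a hyperbolic basis with a Borel subalgebra. -/
structure BorelFrame (b : Set (levi g hs hg ξ N')) (p q : Fin m → V) : Prop extends
    LeviFrame hs hg ξ N' p q where
  lower : ∀ X ∈ b, ∀ i k, k < i → g (p i) ⁅toSo X, q k⁆ = 0
  raise : ∀ a c, a ≤ c → ∃ Y ∈ b, toSo Y = hop g hs (q a) (p c)

namespace BorelFrame

variable {b : Set (levi g hs hg ξ N')} (h : BorelFrame b p q) {z o t : Fin m} (hz : (z : ℕ) = 0)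
  (ho : (o : ℕ) = 1) (ht : (t : ℕ) = m - 1)

include h hz in
theorem lie_q {X : levi g hs hg ξ N'} (hX : X ∈ b) :
    ⁅toSo X, q z⁆ = g (p z) ⁅toSo X, q z⁆ • q z := by
  conv_lhs => rw [h.hyp.expand_right (h.lie_right X · z)]
  refine Finset.sum_eq_single z (fun i _ hi => ?_) (by simp)
  have : (i : ℕ) ≠ z := fun e => hi (Fin.ext e)
  rw [h.lower X hX i z (Fin.lt_def.2 (by omega)), zero_smul]

include h hz ho in
theorem lie_q' {X : levi g hs hg ξ N'} (hX : X ∈ b) :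
    ⁅toSo X, q o⁆ = g (p z) ⁅toSo X, q o⁆ • q z + g (p o) ⁅toSo X, q o⁆ • q o := by
  have hzo : z ≠ o := fun e => by rw [e] at hz; omega
  conv_lhs => rw [h.hyp.expand_right (h.lie_right X · o)]
  rw [← Finset.sum_pair hzo (f := fun i => g (p i) ⁅toSo X, q o⁆ • q i)]
  refine (Finset.sum_subset (Finset.subset_univ _) fun i _ hi => ?_).symm
  simp only [Finset.mem_insert, Finset.mem_singleton, not_or] at hi
  have h1 : (i : ℕ) ≠ z := fun e => hi.1 (Fin.ext e)
  have h2 : (i : ℕ) ≠ o := fun e => hi.2 (Fin.ext e)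
  rw [h.lower X hX i o (Fin.lt_def.2 (by omega)), zero_smul]

include h ht in
theorem lie_p {X : levi g hs hg ξ N'} (hX : X ∈ b) :
    ⁅toSo X, p t⁆ = g (q t) ⁅toSo X, p t⁆ • p t := by
  conv_lhs => rw [h.hyp.expand_left (h.lie_left X · t)]
  refine Finset.sum_eq_single t (fun i _ hi => ?_) (by simp)
  have : (i : ℕ) ≠ t := fun e => hi (Fin.ext e)
  rw [so_skew hs, h.lower X hX t i (Fin.lt_def.2 (by omega)), neg_zero, zero_smul]

include h in
theorem q_ne_zero (i : Fin m) : q i ≠ 0 := fun e => by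
  have := h.hyp.pq i i
  rw [e, map_zero, kron_self] at this
  exact zero_ne_one this

include h in
theorem p_ne_zero (i : Fin m) : p i ≠ 0 := fun e => by
  have := h.hyp.qp i i
  rw [e, map_zero, kron_self] at this
  exact zero_ne_one this

include h hz in
-- An eigenvector with a non-zero `i`-th coordinate is sent to a multiple of `q z` by the elementary
-- matrix in position (z, i), which lies in the Borel subalgebra.
theorem isHighest_q {P : LieSubmodule ℂ (levi g hs hg ξ N') V}
    (hP : ∀ v, v ∈ P ↔ ∀ i, g (q i) v = 0) {v : P} (hv : (v : V) = q z) : IsHighest b v := by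
  refine IsHighest.of_map (f := P.incl) P.injective_incl (by
    rw [LieSubmodule.incl_apply, hv]; exact h.q_ne_zero z) (fun X hX => ?_) fun w hw0 hw => ?_
  · rw [LieSubmodule.incl_apply, hv]
    exact ⟨_, h.lie_q hz hX⟩
  · rw [LieSubmodule.incl_apply, LieSubmodule.incl_apply, hv] at *
    obtain ⟨i, hi⟩ := exists_dual_ne h.hyp ((hP w).1 w.2) hw0
    obtain ⟨Y, hY, e⟩ := h.raise z i (Fin.le_def.2 (by omega))
    refine eq_smul_of_lie hw hY (h.q_ne_zero z) hi ?_
    rw [levi_lie_vec, e, hop_left hs h.hyp.swap (h.hyp.qq · z) ((hP w).1 w.2)]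

include h ht in
theorem isHighest_p {P : LieSubmodule ℂ (levi g hs hg ξ N') V}
    (hP : ∀ v, v ∈ P ↔ ∀ i, g (p i) v = 0) {v : P} (hv : (v : V) = p t) : IsHighest b v := by
  refine IsHighest.of_map (f := P.incl) P.injective_incl (by
    rw [LieSubmodule.incl_apply, hv]; exact h.p_ne_zero t) (fun X hX => ?_) fun w hw0 hw => ?_
  · rw [LieSubmodule.incl_apply, hv]
    exact ⟨_, h.lie_p ht hX⟩
  · rw [LieSubmodule.incl_apply, LieSubmodule.incl_apply, hv] at *
    obtain ⟨i, hi⟩ := exists_dual_ne h.hyp.swap ((hP w).1 w.2) hw0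
    obtain ⟨Y, hY, e⟩ := h.raise i t (Fin.le_def.2 (by omega))
    refine eq_smul_of_lie hw hY (h.p_ne_zero t) (neg_ne_zero.2 hi) ?_
    rw [levi_lie_vec, e, hop_right hs h.hyp.swap (h.hyp.pp · t) ((hP w).1 w.2), neg_smul]

include h in
theorem entry_hop_lie_p {X : levi g hs hg ξ N'} {a c : Fin m} (hX : toSo X = hop g hs (q a) (p c))
    {Y : so g} (hY : ∀ i, ⁅Y, q i⁆ = 0) (l i : Fin m) : g (p l) ⁅⁅toSo X, Y⁆, p i⁆ =
      kron l a * g (p c) ⁅Y, p i⁆ + kron a i * g (p l) ⁅Y, p c⁆ := by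
  rw [so_lie_lie, hX, h.hop_qp_p, hop_left hs h.hyp.swap (h.hyp.qq · a) fun j => by
    rw [so_skew hs, hY, map_zero, neg_zero]]
  simp only [map_sub, lie_smul, lie_neg, map_neg, map_smul, smul_eq_mul, h.hyp.pq]
  ring

include h hz ho in
theorem isHighest_hop {R : LieSubmodule ℂ (levi g hs hg ξ N') (so g)}
    (hR : ∀ X, X ∈ R ↔ ∀ i, ⁅X, q i⁆ = 0) {w : R} (hw : (w : so g) = hop g hs (q z) (q o)) :
    IsHighest b w := by
  have hzo : z ≠ o := fun e => by rw [e] at hz; omega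
  have hent : ∀ l i, g (p l) ⁅hop g hs (q z) (q o), p i⁆ =
      kron l z * kron o i - kron l o * kron z i := fun l i => by
    rw [hop_lie, h.hyp.qp, h.hyp.qp]
    simp only [map_sub, map_smul, smul_eq_mul, h.hyp.pq]
    ring
  have h0 : hop g hs (q z) (q o) ≠ 0 := fun e => by
    have := hent z o
    rw [e, zero_lie, map_zero, kron_self, kron_self, kron_ne hzo] at this
    simp at this
  refine IsHighest.of_map (f := R.incl) R.injective_incl (by
    rw [LieSubmodule.incl_apply, hw]; exact h0) (fun X hX => ?_) fun y hy0 hy => ?_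
  · rw [LieSubmodule.incl_apply, hw]
    obtain ⟨α, hα⟩ : ∃ α : ℂ, ⁅toSo X, q z⁆ = α • q z := ⟨_, h.lie_q hz hX⟩
    obtain ⟨β, γ, hβ⟩ : ∃ β γ : ℂ, ⁅toSo X, q o⁆ = β • q z + γ • q o := ⟨_, _, h.lie_q' hz ho hX⟩
    refine ⟨α + γ, ?_⟩
    change ⁅toSo X, hop g hs (q z) (q o)⁆ = _
    rw [lie_hop, hα, hβ, hop_add_right, hop_smul_left, hop_smul_right,
      hop_smul_right, hop_self]
    module
  · rw [LieSubmodule.incl_apply, LieSubmodule.incl_apply, hw] at *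
    have hyq : ∀ i, ⁅(y : so g), q i⁆ = 0 := (hR y).1 y.2
    obtain ⟨a, c, hac⟩ : ∃ a c, g (p a) ⁅(y : so g), p c⁆ ≠ 0 := by
      by_contra hcon
      push Not at hcon
      exact hy0 (h.hyp.so_ext hs (by simp [hyq]) (by simp [hcon]) (by simp [hyq]))
    -- With `a < c`, the elementary matrices in positions (z, a) and (o, c) are both upper
    -- triangular and move the chosen entry to q_z ∧ q_o.
    wlog hlt : a < c generalizing a c
    · refine this c a (by rw [so_skew hs]; exact neg_ne_zero.2 hac) ((not_lt.1 hlt).lt_of_ne ?_)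
      rintro rfl
      have := so_skew hs (y : so g) (p c) (p c)
      exact hac (by linear_combination (1 / 2 : ℂ) * this)
    have hlt' := Fin.lt_def.1 hlt
    obtain ⟨Y, hY, e⟩ := h.raise z a (Fin.le_def.2 (by omega))
    obtain ⟨Y', hY', e'⟩ := h.raise o c (Fin.le_def.2 (by omega))
    have hcz : c ≠ z := fun e => by rw [e] at hlt'; omega
    refine eq_smul_of_lie_lie hy hY hY' h0 hac ?_
    have hyq' : ∀ i, ⁅⁅toSo Y, (y : so g)⁆, q i⁆ = 0 := (hR _).1 (R.lie_mem y.2)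
    have hyq'' : ∀ i, ⁅⁅toSo Y', ⁅toSo Y, (y : so g)⁆⁆, q i⁆ = 0 :=
      (hR _).1 (R.lie_mem (x := Y') (R.lie_mem (x := Y) y.2))
    change ⁅toSo Y', ⁅toSo Y, (y : so g)⁆⁆ = _
    have hq0 : ∀ i, ⁅hop g hs (q z) (q o), q i⁆ = 0 := fun i => by
      rw [hop_lie, h.hyp.qq, h.hyp.qq, zero_smul, zero_smul, sub_zero]
    refine h.hyp.so_ext hs (by simp [hyq'', hq0]) (fun l i => ?_) (by simp [hyq'', hq0])
    rw [h.entry_hop_lie_p e' hyq', h.entry_hop_lie_p e hyq, h.entry_hop_lie_p e hyq, smul_lie,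
      map_smul, hent, smul_eq_mul, kron_ne hcz, kron_comm z c, kron_ne hcz, so_skew hs (y : so g) (p c)]
    ring

end BorelFrame

end HighestWeight


section Levi

variable {V : Type*} [AddCommGroup V] [Module ℂ V] [FiniteDimensional ℂ V]
variable {S : Type*} [AddCommGroup S] [Module ℂ S]
variable {g : LinearMap.BilinForm ℂ V} [Module (CliffordAlgebra (cliffordForm g)) S]
  [IsScalarTower ℂ (CliffordAlgebra (cliffordForm g)) S]
variable {hs : g.IsSymm} {hg : g.Nondegenerate} {ξ : S} {N' : Submodule ℂ V}
variable {m : ℕ} {p q : Fin m → V}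

/-! ### The derived algebra and the centre of the Levi factor -/

variable (hs hg ξ N') in
/-- The inclusion into `𝔰𝔬(V, g)` as a homomorphism of modules. -/
def toSoHom : levi g hs hg ξ N' →ₗ⁅ℂ, levi g hs hg ξ N'⁆ so g where
  toFun := toSo
  map_add' _ _ := rfl
  map_smul' _ _ := rfl
  map_lie' := rfl

theorem toSoHom_apply (X : levi g hs hg ξ N') : toSoHom hs hg ξ N' X = toSo X := rfl

namespace LeviFrame

variable (h : LeviFrame hs hg ξ N' p q)
include h

theorem trace_of_mem_slZero {Y : levi g hs hg ξ N'} (hY : Y ∈ slZero g hs hg ξ N') :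
    ∑ i, g (p i) ⁅toSo Y, q i⁆ = 0 := by
  have hY' : Y ∈ (⁅(⊤ : LieIdeal ℂ (levi g hs hg ξ N')), (⊤ : LieIdeal ℂ (levi g hs hg ξ N'))⁆ :
    LieIdeal ℂ (levi g hs hg ξ N')) := hY
  rw [← LieSubmodule.mem_toSubmodule, LieSubmodule.lieIdeal_oper_eq_linear_span'] at hY'
  clear hY
  induction hY' using Submodule.span_induction with
  | mem Y hY =>
    obtain ⟨X, -, Z, -, rfl⟩ := hY
    simp only [h.entry_lie, Finset.sum_sub_distrib]
    rw [sub_eq_zero, Finset.sum_comm]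
    exact Finset.sum_congr rfl fun i _ => Finset.sum_congr rfl fun k _ => mul_comm _ _
  | zero =>
    exact Finset.sum_eq_zero fun i _ => by rw [← toSoHom_apply, map_zero, zero_lie, map_zero]
  | add X Z _ _ hX hZ =>
    simp only [← toSoHom_apply, map_add, add_lie, Finset.sum_add_distrib] at *
    rw [hX, hZ, add_zero]
  | smul c X _ hX =>
    simp only [← toSoHom_apply, map_smul, smul_lie, smul_eq_mul, ← Finset.mul_sum] at *
    rw [hX, mul_zero]

theorem entry_hop (a c l i : Fin m) :
    g (p l) ⁅hop g hs (q a) (p c), q i⁆ = kron c i * kron l a := by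
  rw [h.hop_qp_q, map_smul, h.hyp.pq, smul_eq_mul]

/-- For elementary matrices, [E_{lz}, E_{zj}] = E_{lj} - δ_{lj} E_{zz}. In the sum weighted by the
entries of `Y` the terms E_{zz} add up to the trace, which is zero. -/
theorem mem_slZero_of_trace (z : Fin m) {Y : levi g hs hg ξ N'}
    (hY : ∑ i, g (p i) ⁅toSo Y, q i⁆ = 0) : Y ∈ slZero g hs hg ξ N' := by
  choose H hH using fun a c => h.swap.exists_hop (h.hyp.qq · a) (h.hyp.pp · c)
  have e : Y = ∑ l, ∑ j, g (p l) ⁅toSo Y, q j⁆ • ⁅H l z, H z j⁆ := by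
    refine h.levi_ext fun a i => ?_
    have : ∀ l j, g (p a) ⁅toSo ⁅H l z, H z j⁆, q i⁆ =
        kron a l * kron j i - kron j l * kron a z * kron z i := fun l j => by
      rw [h.entry_hop_lie (hH l z), hH, h.entry_hop, h.entry_hop, kron_self, mul_one]
    simp only [← toSoHom_apply, map_sum, map_smul, sum_lie, smul_lie,
      smul_eq_mul]
    simp only [toSoHom_apply, this, mul_sub, Finset.sum_sub_distrib]
    have e1 : ∀ l, ∑ j, g (p l) ⁅toSo Y, q j⁆ * (kron a l * kron j i) =
        kron a l * g (p l) ⁅toSo Y, q i⁆ := fun l => by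
      simp only [kron, mul_ite, mul_one, mul_zero, Finset.sum_ite_eq', Finset.mem_univ, if_true]
      split_ifs <;> simp
    have e2 : ∀ l, ∑ j, g (p l) ⁅toSo Y, q j⁆ * (kron j l * kron a z * kron z i) =
        g (p l) ⁅toSo Y, q l⁆ * (kron a z * kron z i) := fun l => by
      rw [Finset.sum_eq_single l (fun j _ hj => by rw [kron_ne hj]; ring) (by simp), kron_self]
      ring
    simp only [e1, e2]
    rw [sum_kron_mul, ← Finset.sum_mul, hY, zero_mul, sub_zero]
  rw [e]
  exact sum_mem fun l _ => sum_mem fun j _ => (slZero g hs hg ξ N').smul_mem _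
    (LieSubmodule.lie_mem_lie (LieSubmodule.mem_top (H l z)) (LieSubmodule.mem_top (H z j)))

theorem mem_zZero_iff {Y : levi g hs hg ξ N'} :
    Y ∈ zZero g hs hg ξ N' ↔ ∃ c : ℂ, ∀ l i, g (p l) ⁅toSo Y, q i⁆ = c * kron l i := by
  choose H hH using fun a c => h.swap.exists_hop (h.hyp.qq · a) (h.hyp.pp · c)
  constructor
  · intro hY
    rcases isEmpty_or_nonempty (Fin m) with hE | ⟨⟨z⟩⟩
    · exact ⟨0, fun l => hE.elim l⟩
    refine ⟨g (p z) ⁅toSo Y, q z⁆, fun l i => ?_⟩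
    have := h.entry_hop_lie (hH z l) Y z i
    rw [(LieModule.mem_maxTrivSubmodule (R := ℂ) (L := levi g hs hg ξ N') (M := levi g hs hg ξ N')
      Y).1 hY (H z l), ← toSoHom_apply, map_zero, zero_lie, map_zero, kron_self] at this
    linear_combination -this
  · rintro ⟨c, hc⟩
    refine (LieModule.mem_maxTrivSubmodule (R := ℂ) (L := levi g hs hg ξ N')
      (M := levi g hs hg ξ N') Y).2 fun X => h.levi_ext fun l i => ?_
    rw [h.entry_lie, ← toSoHom_apply 0, map_zero, zero_lie, map_zero]
    simp only [hc, Finset.sum_sub_distrib]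
    rw [sub_eq_zero]
    simp only [kron, mul_ite, mul_one, mul_zero, ite_mul, zero_mul, Finset.sum_ite_eq,
      Finset.sum_ite_eq', Finset.mem_univ, if_true]
    exact mul_comm _ _

end LeviFrame

namespace BorelFrame

variable {b : Set (levi g hs hg ξ N')} (h : BorelFrame b p q) {z o t : Fin m} (hz : (z : ℕ) = 0)
  (ho : (o : ℕ) = 1) (ht : (t : ℕ) = m - 1)

include h hz ht in
theorem isHighest_slZero (hzt : z ≠ t) {w : slZero g hs hg ξ N'}
    (hw : toSo (w : levi g hs hg ξ N') = hop g hs (q z) (p t)) : IsHighest b w := by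
  have h0 : (w : levi g hs hg ξ N') ≠ 0 := fun e => by
    have := h.entry_hop z t z t
    rw [← hw, e, ← toSoHom_apply, map_zero, zero_lie, map_zero, kron_self, kron_self] at this
    simp at this
  refine IsHighest.of_map (f := LieSubmodule.incl (slZero g hs hg ξ N')) (LieSubmodule.injective_incl _) h0
    (fun X hX => ?_) fun y hy0 hy => ?_
  · obtain ⟨α, hα⟩ : ∃ α : ℂ, ⁅toSo X, q z⁆ = α • q z := ⟨_, h.lie_q hz hX⟩
    obtain ⟨β, hβ⟩ : ∃ β : ℂ, ⁅toSo X, p t⁆ = β • p t := ⟨_, h.lie_p ht hX⟩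
    refine ⟨α + β, toSo_injective ?_⟩
    rw [LieSubmodule.incl_apply, toSo_lie, ← toSoHom_apply ((α + β) • _), map_smul, toSoHom_apply,
      hw, lie_hop, hα, hβ, hop_smul_left, hop_smul_right, ← add_smul]
  · rw [LieSubmodule.incl_apply] at *
    rw [LieSubmodule.incl_apply]
    have htr := h.trace_of_mem_slZero y.2
    generalize (y : levi g hs hg ξ N') = Y at *
    -- The hypothesis says that bracketing `Y` with the elementary matrices in positions (a, c) and
    -- then (a', c') gives `d` times the one in position (z, t).
    have fin : ∀ {a c a' c' : Fin m}, a ≤ c → a' ≤ c' → ∀ d : ℂ, d ≠ 0 →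
        (∀ l i, kron l a' * (kron c' a * g (p c) ⁅toSo Y, q i⁆ - g (p c') ⁅toSo Y, q a⁆ * kron c i) -
          (kron l a * g (p c) ⁅toSo Y, q a'⁆ - g (p l) ⁅toSo Y, q a⁆ * kron c a') * kron c' i =
          d * (kron t i * kron l z)) → ∃ c : ℂ, Y = c • (w : levi g hs hg ξ N') := by
      intro a c a' c' hac hac' d hd e
      obtain ⟨X, hX, eX⟩ := h.raise a c hac
      obtain ⟨X', hX', eX'⟩ := h.raise a' c' hac'
      refine eq_smul_of_lie_lie hy hX hX' h0 hd (h.levi_ext fun l i => ?_)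
      rw [h.entry_hop_lie eX', h.entry_hop_lie eX, h.entry_hop_lie eX, e,
        ← toSoHom_apply (d • _), map_smul, toSoHom_apply, hw, smul_lie, map_smul, h.entry_hop,
        smul_eq_mul]
    have hz' : ∀ i, z ≤ i := fun i => Fin.le_def.2 (by omega)
    have ht' : ∀ i, i ≤ t := fun i => Fin.le_def.2 (by omega)
    by_cases htz : g (p t) ⁅toSo Y, q z⁆ = 0
    · have hzt' : kron t z = (0 : ℂ) := kron_ne hzt.symm
      by_cases hoff : ∃ c a, c ≠ a ∧ g (p c) ⁅toSo Y, q a⁆ ≠ 0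
      · obtain ⟨c, a, hca, hne⟩ := hoff
        -- E_{zc} and then E_{at} move the off-diagonal entry at (c, a) to (z, t).
        refine fin (hz' c) (ht' a) _ (neg_ne_zero.2 hne) fun l i => ?_
        rw [hzt', htz, kron_ne hca]
        ring
      · push Not at hoff
        by_cases hdiag : ∃ a, g (p a) ⁅toSo Y, q a⁆ ≠ g (p z) ⁅toSo Y, q z⁆
        · obtain ⟨a, ha⟩ := hdiag
          -- For a diagonal `Y`, bracketing with E_{za} and E_{at} extracts the difference of two
          -- diagonal entries; if there is none, `Y` is scalar and trace-free, hence zero.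
          refine fin (hz' a) (ht' a) _ (neg_ne_zero.2 (sub_ne_zero.2 ha)) fun l i => ?_
          have : g (p l) ⁅toSo Y, q z⁆ = kron l z * g (p z) ⁅toSo Y, q z⁆ := by
            by_cases hl : l = z
            · rw [hl, kron_self, one_mul]
            · rw [hoff l z hl, kron_ne hl, zero_mul]
          rw [hzt', htz, this, kron_self]
          ring
        · push Not at hdiag
          refine absurd (h.levi_ext fun l i => ?_) hy0
          have hm : (m : ℂ) ≠ 0 := Nat.cast_ne_zero.2 (by have := z.2; omega)
          simp only [hdiag, Finset.sum_const, Finset.card_univ, Fintype.card_fin, nsmul_eq_mul,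
            mul_eq_zero, hm, false_or] at htr
          rw [← toSoHom_apply 0, map_zero, zero_lie, map_zero]
          by_cases hli : l = i
          · rw [hli, hdiag, htr]
          · exact hoff l i hli
    -- When the lowest entry is non-zero, bracketing twice with E_{zt} suffices.
    · refine fin (hz' t) (hz' t) (-2 * g (p t) ⁅toSo Y, q z⁆) (mul_ne_zero (by norm_num) htz)
        fun l i => ?_
      rw [kron_ne hzt.symm]
      ring

include h in
theorem isHighest_zZero (z : Fin m) {E : zZero g hs hg ξ N'} (hE : E ≠ 0) : IsHighest b E := by
  refine IsHighest.of_map (f := LieSubmodule.incl (zZero g hs hg ξ N')) (LieSubmodule.injective_incl _)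
    (fun e => hE (Subtype.ext e)) (fun X hX => ⟨0, ?_⟩) fun y hy0 hy => ?_
  · rw [zero_smul]
    exact (LieModule.mem_maxTrivSubmodule (R := ℂ) (L := levi g hs hg ξ N')
      (M := levi g hs hg ξ N') _).1 E.2 X
  · obtain ⟨c, hc⟩ := h.mem_zZero_iff.1 E.2
    obtain ⟨d, hd⟩ := h.mem_zZero_iff.1 y.2
    have hc0 : c ≠ 0 := fun e => hE (Subtype.ext (h.levi_ext fun l i => by
      rw [hc, e, zero_mul]
      change 0 = g (p l) ⁅toSoHom hs hg ξ N' 0, q i⁆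
      rw [map_zero, zero_lie, map_zero]))
    refine ⟨d / c, h.levi_ext fun l i => ?_⟩
    rw [LieSubmodule.incl_apply, LieSubmodule.incl_apply, ← toSoHom_apply ((d / c) • _), map_smul,
      toSoHom_apply, smul_lie, map_smul, hc, hd, smul_eq_mul]
    field_simp

end BorelFrame

end Levi


section CartanForm

variable {V : Type*} [AddCommGroup V] [Module ℂ V] [FiniteDimensional ℂ V]
variable {S : Type*} [AddCommGroup S] [Module ℂ S]
variable {g : LinearMap.BilinForm ℂ V} [Module (CliffordAlgebra (cliffordForm g)) S]
  [IsScalarTower ℂ (CliffordAlgebra (cliffordForm g)) S]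
variable {hs : g.IsSymm} {hg : g.Nondegenerate} {ξ : S} {N' : Submodule ℂ V}
variable {m : ℕ} {p q : Fin m → V}

/-! ### Contracting a Cotton–York tensor with a vector -/

include hg in
theorem so_ext_form {X Y : so g} (e : ∀ y z, g ⁅X, y⁆ z = g ⁅Y, y⁆ z) : X = Y :=
  so_ext fun y => sub_eq_zero.1 (hg.1 _ fun z => by
    rw [map_sub, LinearMap.sub_apply, e, sub_self])

variable (hs) in
include hs in
theorem toDual_symm_skew (A : CottonYork g hg) (v : V) :
    (LinearMap.BilinForm.toDual g hg).symm.toLinearMap ∘ₗ A.form v ∈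
      skewAdjointLieSubalgebra g := by
  change _ ∈ g.skewAdjointSubmodule
  rw [LinearMap.mem_skewAdjointSubmodule]
  intro x y
  change g ((LinearMap.BilinForm.toDual g hg).symm (A.form v x)) y =
    g x (-(LinearMap.BilinForm.toDual g hg).symm (A.form v y))
  rw [map_neg, g_comm hs x, LinearMap.BilinForm.apply_toDual_symm_apply,
    LinearMap.BilinForm.apply_toDual_symm_apply]
  exact (mem_cottonYork.1 A.form_mem).1 v x y

variable (hs hg) in
/-- The skew-adjoint endomorphism `A_{abc} v^a`. -/
def lam (v : V) : CottonYork g hg →ₗ[ℂ] so g where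
  toFun A := ⟨_, toDual_symm_skew hs A v⟩
  map_add' A B := so_ext fun y =>
    map_add (LinearMap.BilinForm.toDual g hg).symm (A.form v y) (B.form v y)
  map_smul' c A := so_ext fun y =>
    map_smul (LinearMap.BilinForm.toDual g hg).symm c (A.form v y)

theorem lam_apply (v : V) (A : CottonYork g hg) (y z : V) :
    g ⁅lam hs hg v A, y⁆ z = A.form v y z :=
  LinearMap.BilinForm.apply_toDual_symm_apply (hB := hg) (f := A.form v y) z

theorem lam_apply' (v : V) (A : CottonYork g hg) (y z : V) :
    g z ⁅lam hs hg v A, y⁆ = A.form v y z := by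
  rw [g_comm hs, lam_apply]

/-- Equivariance of (v, A) ↦ A(v, ·, ·), written so that the second term cancels the action on the
dual factor in `exists_sum_tmul`. -/
theorem lie_lam {s r : Fin m → V} {X : levi g hs hg ξ N'} {x : Fin m → Fin m → ℂ}
    (hX : Acts (toSo X) s r x) (A : CottonYork g hg) (i : Fin m) :
    ⁅toSo X, lam hs hg (s i) A⁆ = lam hs hg (s i) ⁅X, A⁆ + ∑ l, x l i • lam hs hg (s l) A := by
  refine so_ext_form (hg := hg) fun y z => ?_
  rw [so_lie_lie, add_lie, map_sub, LinearMap.sub_apply, map_add, LinearMap.add_apply, so_apply,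
    lam_apply, lam_apply, lam_apply, form_levi_lie, lie_tri, hX.left]
  simp only [sum_lie, smul_lie, map_sum, map_smul, LinearMap.sum_apply, LinearMap.smul_apply,
    lam_apply]
  ring

theorem Acts.tr1_comp_lie {X : so g} {x : Fin m → Fin m → ℂ} (hX : Acts X p q x) (A : Tri V)
    (i : Fin m) :
    tr1 (comp p q ⁅X, A⁆) i = - ∑ l, x l i * tr1 (comp p q A) l := by
  simp only [tr1_apply, comp_apply, lie_tri, hX.left, hX.right, map_sum, map_neg, map_smul,
    LinearMap.sum_apply, LinearMap.smul_apply, smul_eq_mul, Finset.sum_sub_distrib,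
    Finset.sum_neg_distrib, Finset.mul_sum]
  rw [Finset.sum_comm (f := fun j l => x l i * A (p l) (p j) (q j)),
    Finset.sum_comm (f := fun j l => x l j * A (p i) (p l) (q j))]
  ring

/-! ### Cartan products -/

variable {b : Set (levi g hs hg ξ N')}

/-- The common part of the four identifications: the map is A ↦ Σ r_i ⊗ f_i(A). It remains to find
where the f_i(A) lie and one tensor whose image is a multiple of the product of highest weight
vectors. -/
theorem nonempty_equiv_of_contraction (hm : 3 ≤ m) (h : LeviFrame hs hg ξ N' p q) {κ : Kind}
    {P : LieSubmodule ℂ (levi g hs hg ξ N') V} {R : Type*} [AddCommGroup R] [Module ℂ R]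
    [LieRingModule (levi g hs hg ξ N') R] [LieModule ℂ (levi g hs hg ξ N') R]
    {ι : R →ₗ⁅ℂ, levi g hs hg ξ N'⁆ so g} (hι : Function.Injective ι) (r : Fin m → P)
    (f : Fin m → CottonYork g hg →ₗ[ℂ] so g)
    (hf : ∀ A : CottonYork g hg, A.form ∈ modForm g hg p q κ → ∀ i, ∃ y, ι y = f i A)
    (H : ∀ X : levi g hs hg ξ N', ∃ x : Fin m → Fin m → ℂ,
      (∀ i, ⁅toSo X, (r i : V)⁆ = - ∑ l, x i l • (r l : V)) ∧
      ∀ A : CottonYork g hg, ∀ i, ⁅toSo X, f i A⁆ = f i ⁅X, A⁆ + ∑ l, x l i • f l A)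
    {w : R} {i : Fin m} (hv : IsHighest b (r i)) (hw : IsHighest b w) {A : CottonYork g hg}
    (hA : A.form ∈ modForm g hg p q κ) {c : ℂ} (hc : c ≠ 0)
    (e : ∀ k, f k A = (kron k i * c) • ι w) :
    Nonempty (modC h κ.neg ≃ₗ⁅ℂ, levi g hs hg ξ N'⁆ cartanProduct b P R) := by
  have hmem : ∀ A : modC h κ.neg, A.1.form ∈ modForm g hg p q κ := fun A => by
    rw [← modL_neg]; exact A.2
  choose f' hf' using fun i => exists_lift (M := modC h κ.neg)
    (ι := (ι : R →ₗ[ℂ] so g)) hι (f i ∘ₗ (modC h κ.neg).toSubmodule.subtype) fun A => hf A.1 (hmem A) i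
  obtain ⟨Φ, hΦ⟩ := exists_sum_tmul (L := levi g hs hg ξ N') (M := modC h κ.neg) r f' fun X => by
    obtain ⟨x, h1, h2⟩ := H X
    refine ⟨x, fun i => Subtype.ext ?_, fun A i => hι ?_⟩
    · have : ⁅X, (r i : V)⁆ = _ := h1 i
      simpa using this
    · have e1 : ∀ A i, ι (f' i A) = f i A.1 := fun A i => hf' i A
      rw [LieModuleHom.map_lie, map_add, map_sum]
      simp only [map_smul, e1]
      exact h2 A.1 i
  refine nonempty_equiv_cartanProduct (modC_irreducible hm h κ.neg) Φ hv hw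
    (A := ⟨A, by rw [mem_modC, modL_neg]; exact hA⟩) hc ?_
  have e2 : ∀ k, f' k ⟨A, by rw [mem_modC, modL_neg]; exact hA⟩ = (kron k i * c) • w := fun k =>
    hι (by rw [map_smul, ← e k]; exact hf' k _)
  rw [hΦ]
  simp only [e2, TensorProduct.tmul_smul, mul_smul]
  rw [Finset.sum_eq_single i (fun k _ hk => by rw [kron_ne hk, zero_smul]) (by simp), kron_self,
    one_smul]

namespace BorelFrame

variable (hm : 3 ≤ m) (h : BorelFrame b p q)
include hm h

/-- The endomorphism A(p_i, ·, ·) kills every `q j`, since `A` vanishes on any argument from their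
span. The test tensor maps to -q_z ⊗ (q_z ∧ q_o). -/
theorem nonempty_equiv_hook {P : LieSubmodule ℂ (levi g hs hg ξ N') V}
    (hP : ∀ v, v ∈ P ↔ ∀ i, g (q i) v = 0) {R : LieSubmodule ℂ (levi g hs hg ξ N') (so g)}
    (hR : ∀ X, X ∈ R ↔ ∀ i, ⁅X, q i⁆ = 0) :
    Nonempty (modC h.toLeviFrame Kind.hook.neg ≃ₗ⁅ℂ, levi g hs hg ξ N'⁆ cartanProduct b P R) := by
  let z : Fin m := ⟨0, by omega⟩
  let o : Fin m := ⟨1, by omega⟩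
  let t : Fin m := ⟨2, by omega⟩
  obtain ⟨A, hA, e⟩ := exists_testForm (hg := hg) hm h.hyp (show z ≠ o by simp [z, o])
    (show z ≠ t by simp [z, t]) (show o ≠ t by simp [o, t]) .hook
  have hw : hop g hs (q z) (q o) ∈ R := (hR _).2 fun i => by
    rw [hop_lie, h.hyp.qq, h.hyp.qq, zero_smul, zero_smul, sub_zero]
  refine nonempty_equiv_of_contraction hm h.toLeviFrame (ι := R.incl) R.injective_incl
    (fun i => ⟨q i, (hP _).2 (h.hyp.qq · i)⟩) (fun i => lam hs hg (p i)) (fun A hA i => ?_)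
    (fun X => ⟨_, (h.acts X).right, fun A i => lie_lam (h.acts X) A i⟩)
    (h.isHighest_q (z := z) rfl hP rfl) (h.isHighest_hop (z := z) (o := o) rfl rfl hR (w := ⟨_, hw⟩)
      rfl) (A := .mk A (mem_modForm.1 hA).1) hA (c := -1) (by norm_num) fun k => ?_
  · refine ⟨⟨lam hs hg (p i) A, (hR _).2 fun j => hg.1 _ fun y => ?_⟩, rfl⟩
    rw [lam_apply, (eq_zero_of_mem_hook hm h.hyp hA (h.hyp.qq · j) _ _).2.1]
  · have e' : ∀ i j k, A (p i) (p j) (p k) = _ := fun i j k => congrFun e (i, j, k)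
    have e0 : ∀ i x y, A x (q i) y = 0 := fun i x y =>
      (eq_zero_of_mem_hook hm h.hyp hA (h.hyp.qq · i) x y).2.1
    refine h.hyp.so_ext hs (fun l i => ?_) (fun l i => ?_) fun l i => ?_
    all_goals
      rw [lam_apply', CottonYork.form_mk, LieSubmodule.incl_apply, smul_lie, map_smul, hop_lie]
      simp only [e', e0, map_sub, map_smul, h.hyp.qq, h.hyp.qp, h.hyp.pq, smul_eq_mul]
      simp only [testArray, kron_comm k, kron_comm l]
      ring

/-- Here the argument `q i` is contracted, so the vector factor is the span of `p`, whose highest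
weight vector has the last index. The factor 2 comes from the cyclic identity applied to a skew
block. -/
theorem nonempty_equiv_alt {P : LieSubmodule ℂ (levi g hs hg ξ N') V}
    (hP : ∀ v, v ∈ P ↔ ∀ i, g (p i) v = 0) {R : LieSubmodule ℂ (levi g hs hg ξ N') (so g)}
    (hR : ∀ X, X ∈ R ↔ ∀ i, ⁅X, q i⁆ = 0) :
    Nonempty (modC h.toLeviFrame Kind.alt.neg ≃ₗ⁅ℂ, levi g hs hg ξ N'⁆ cartanProduct b P R) := by
  let z : Fin m := ⟨0, by omega⟩
  let o : Fin m := ⟨1, by omega⟩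
  let t : Fin m := ⟨m - 1, by omega⟩
  have zt : z ≠ t := fun e => by have := congrArg Fin.val e; simp only [z, t] at this; omega
  have ot : o ≠ t := fun e => by have := congrArg Fin.val e; simp only [o, t] at this; omega
  obtain ⟨A, hA, e⟩ := exists_testForm (hg := hg) hm h.hyp (show z ≠ o by simp [z, o]) zt ot .alt
  have hw : hop g hs (q z) (q o) ∈ R := (hR _).2 fun i => by
    rw [hop_lie, h.hyp.qq, h.hyp.qq, zero_smul, zero_smul, sub_zero]
  refine nonempty_equiv_of_contraction hm h.toLeviFrame (ι := R.incl) R.injective_incl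
    (fun i => ⟨p i, (hP _).2 (h.hyp.pp · i)⟩) (fun i => lam hs hg (q i)) (fun A hA i => ?_)
    (fun X => ⟨_, (h.acts X).swap.right, fun A i => lie_lam (h.acts X).swap A i⟩)
    (h.isHighest_p (t := t) rfl hP rfl) (h.isHighest_hop (z := z) (o := o) rfl rfl hR (w := ⟨_, hw⟩)
      rfl) (A := .mk A (mem_modForm.1 hA).1) hA (c := 2) (by norm_num) fun k => ?_
  · refine ⟨⟨lam hs hg (q i) A, (hR _).2 fun j => hg.1 _ fun y => ?_⟩, rfl⟩
    rw [lam_apply, ((eq_zero_of_mem_ne hm h.hyp (by decide) hA).2 _ _ _ (h.hyp.qq · i)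
      (h.hyp.qq · j)).1]
  · have e' : ∀ i j k, A (p i) (p j) (q k) = _ := fun i j k => congrFun e (i, j, k)
    have e0 : ∀ i j x, A (q i) (q j) x = 0 := fun i j x =>
      ((eq_zero_of_mem_ne hm h.hyp (by decide) hA).2 _ _ _ (h.hyp.qq · i) (h.hyp.qq · j)).1
    have e1 : ∀ i j x, A (q i) x (q j) = 0 := fun i j x =>
      ((eq_zero_of_mem_ne hm h.hyp (by decide) hA).2 _ _ _ (h.hyp.qq · i) (h.hyp.qq · j)).2.1
    have e2 : ∀ i j k, A (q k) (p i) (p j) = - A (p i) (p j) (q k) + A (p j) (p i) (q k) :=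
      fun i j k => by
        obtain ⟨a1, a2, -⟩ := mem_cottonYork.1 (mem_modForm.1 hA).1
        linear_combination a2 (q k) (p i) (p j) - a1 (p j) (q k) (p i)
    refine h.hyp.so_ext hs (fun l i => ?_) (fun l i => ?_) fun l i => ?_
    all_goals
      rw [lam_apply', CottonYork.form_mk, LieSubmodule.incl_apply, smul_lie, map_smul, hop_lie]
      simp only [e2, e', e0, e1, map_sub, map_smul, h.hyp.qq, h.hyp.qp, h.hyp.pq, smul_eq_mul]
      simp only [testArray, kron_comm k, kron_comm l]
      ring

/-- The endomorphism A(p_i, ·, ·) preserves both null spaces, and its trace is, up to sign, the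
first trace of the block, which is zero; so it belongs to 𝔰𝔩₀. -/
theorem nonempty_equiv_sym {P : LieSubmodule ℂ (levi g hs hg ξ N') V}
    (hP : ∀ v, v ∈ P ↔ ∀ i, g (q i) v = 0) :
    Nonempty (modC h.toLeviFrame Kind.sym.neg ≃ₗ⁅ℂ, levi g hs hg ξ N'⁆
      cartanProduct b P (slZero g hs hg ξ N')) := by
  let z : Fin m := ⟨0, by omega⟩
  let o : Fin m := ⟨1, by omega⟩
  let t : Fin m := ⟨m - 1, by omega⟩
  have zt : z ≠ t := fun e => by have := congrArg Fin.val e; simp only [z, t] at this; omega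
  have ot : o ≠ t := fun e => by have := congrArg Fin.val e; simp only [o, t] at this; omega
  obtain ⟨A, hA, e⟩ := exists_testForm (hg := hg) hm h.hyp zt (show z ≠ o by simp [z, o]) ot.symm
    .sym
  obtain ⟨W, -, hW⟩ := h.raise z t (Fin.le_def.2 (by simp [z]))
  have hW' : W ∈ slZero g hs hg ξ N' := h.mem_slZero_of_trace z (by
    simp only [hW, h.entry_hop]
    refine Finset.sum_eq_zero fun i _ => ?_
    by_cases hi : t = i
    · rw [← hi, kron_ne zt.symm, mul_zero]
    · rw [kron_ne hi, zero_mul])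
  refine nonempty_equiv_of_contraction hm h.toLeviFrame
    (ι := (toSoHom hs hg ξ N').comp (LieSubmodule.incl (slZero g hs hg ξ N')))
    (toSo_injective.comp Subtype.val_injective)
    (fun i => ⟨q i, (hP _).2 (h.hyp.qq · i)⟩) (fun i => lam hs hg (p i)) (fun A hA i => ?_)
    (fun X => ⟨_, (h.acts X).right, fun A i => lie_lam (h.acts X) A i⟩)
    (h.isHighest_q (z := z) rfl hP rfl) (h.isHighest_slZero (z := z) (t := t) rfl rfl zt
      (w := ⟨W, hW'⟩) hW) (A := .mk A (mem_modForm.1 hA).1) hA (c := -1) (by norm_num) fun k => ?_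
  · obtain ⟨k1, k2⟩ := eq_zero_of_mem_ne hm h.hyp (by decide) hA
    obtain ⟨Y, hY⟩ := h.exists_levi (lam hs hg (p i) A)
      (fun j k => by rw [lam_apply', k1 _ _ _ (h.hyp.pp · i) (h.hyp.pp · j) (h.hyp.pp · k)])
      (fun j k => by rw [lam_apply', (k2 _ _ _ (h.hyp.qq · j) (h.hyp.qq · k)).2.2])
    refine ⟨⟨Y, h.mem_slZero_of_trace z ?_⟩, hY⟩
    have h0 : tr1 (comp p q A.form) i = 0 := by
      rw [((comp_of_mem_modForm hm h.hyp hA).2.2.2 (by decide)).2, cmp, LinearMap.comp_apply,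
        tr1_proj_sym, Pi.zero_apply]
    rw [tr1_apply] at h0
    simp only [hY, lam_apply']
    rw [← neg_eq_zero, ← h0, ← Finset.sum_neg_distrib]
    exact Finset.sum_congr rfl fun k _ => ((mem_cottonYork.1 A.form_mem).1 _ _ _).symm
  · have e' : ∀ i j k, A (p i) (p j) (q k) = _ := fun i j k => congrFun e (i, j, k)
    obtain ⟨k1, k2⟩ := eq_zero_of_mem_ne hm h.hyp (by decide) hA
    have a1 := (mem_cottonYork.1 (mem_modForm.1 hA).1).1
    have k1' : ∀ i j k, A (p i) (p j) (p k) = 0 := fun i j k =>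
      k1 _ _ _ (h.hyp.pp · i) (h.hyp.pp · j) (h.hyp.pp · k)
    have k2' : ∀ i j x, A x (q i) (q j) = 0 := fun i j x =>
      (k2 _ _ _ (h.hyp.qq · i) (h.hyp.qq · j)).2.2
    refine h.hyp.so_ext hs (fun l i => ?_) (fun l i => ?_) fun l i => ?_
    all_goals
      rw [lam_apply', CottonYork.form_mk, LieModuleHom.comp_apply, LieSubmodule.incl_apply,
        toSoHom_apply, hW, smul_lie, map_smul, hop_lie]
    on_goal 1 => rw [a1]
    all_goals
      simp only [e', k1', k2', map_sub, map_smul, h.hyp.qq, h.hyp.pp, h.hyp.qp, h.hyp.pq,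
        smul_eq_mul]
    all_goals simp only [testArray, kron_comm k, kron_comm l]
    all_goals ring

/-- Only the trace vector matters, so its entries multiply a fixed central element. The constant
`2(m² - 1) = (2m - 1) m + (m - 2)` is the trace of the test array. -/
theorem nonempty_equiv_trace {P : LieSubmodule ℂ (levi g hs hg ξ N') V}
    (hP : ∀ v, v ∈ P ↔ ∀ i, g (q i) v = 0) :
    Nonempty (modC h.toLeviFrame Kind.trace.neg ≃ₗ⁅ℂ, levi g hs hg ξ N'⁆
      cartanProduct b P (zZero g hs hg ξ N')) := by
  let z : Fin m := ⟨0, by omega⟩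
  let o : Fin m := ⟨1, by omega⟩
  let t : Fin m := ⟨2, by omega⟩
  obtain ⟨A, hA, e⟩ := exists_testForm (hg := hg) hm h.hyp (show z ≠ o by simp [z, o])
    (show z ≠ t by simp [z, t]) (show o ≠ t by simp [o, t]) .trace
  choose T hT using fun a => h.swap.exists_hop (h.hyp.qq · a) (h.hyp.pp · a)
  have hE : ∀ l i, g (p l) ⁅toSo (∑ a, T a), q i⁆ = kron l i := fun l i => by
    simp only [← toSoHom_apply, map_sum, sum_lie]
    simp only [toSoHom_apply, hT, h.entry_hop]
    exact sum_kron_mul' i (fun a => kron l a)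
  have hEz : ∑ a, T a ∈ zZero g hs hg ξ N' := h.mem_zZero_iff.2 ⟨1, fun l i => by rw [hE, one_mul]⟩
  have hE0 : (⟨_, hEz⟩ : zZero g hs hg ξ N') ≠ 0 := fun e0 => by
    have := hE z z
    rw [show ∑ a, T a = 0 from congrArg Subtype.val e0, kron_self] at this
    change g (p z) ⁅toSoHom hs hg ξ N' 0, q z⁆ = 1 at this
    rw [map_zero, zero_lie, map_zero] at this
    exact zero_ne_one this
  have hc : (2 * ((m : ℂ) ^ 2 - 1)) ≠ 0 := mul_ne_zero two_ne_zero (natCast_sq_sub_one_ne hm)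
  refine nonempty_equiv_of_contraction hm h.toLeviFrame
    (ι := (toSoHom hs hg ξ N').comp (LieSubmodule.incl (zZero g hs hg ξ N')))
    (toSo_injective.comp Subtype.val_injective)
    (fun i => ⟨q i, (hP _).2 (h.hyp.qq · i)⟩)
    (fun i => (LinearMap.proj i ∘ₗ tr1 ∘ₗ comp p q ∘ₗ formₗ g hg).smulRight (toSo (∑ a, T a)))
    (fun A hA i => ⟨tr1 (comp p q A.form) i • ⟨_, hEz⟩, rfl⟩) (fun X => ⟨_, (h.acts X).right, fun A i => ?_⟩)
    (h.isHighest_q (z := z) rfl hP rfl) (h.isHighest_zZero z hE0)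
    (A := .mk A (mem_modForm.1 hA).1) hA hc fun k => ?_
  · have hX0 : ⁅toSo X, toSo (∑ a, T a)⁆ = 0 := by
      rw [← toSo_lie, (LieModule.mem_maxTrivSubmodule (R := ℂ) (L := levi g hs hg ξ N')
        (M := levi g hs hg ξ N') _).1 hEz X]
      exact map_zero (toSoHom hs hg ξ N')
    simp only [LinearMap.smulRight_apply, LinearMap.comp_apply, LinearMap.proj_apply, formₗ_apply,
      lie_smul, hX0, smul_zero, smul_smul]
    rw [← Finset.sum_smul, ← add_smul]
    refine (smul_eq_zero.2 (Or.inl ?_)).symm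
    rw [form_levi_lie, (h.acts X).tr1_comp_lie, neg_add_cancel]
  · have e' : tr1 (comp p q A) = tr1 (testArray z o t .trace) := congrArg tr1 e
    rw [LinearMap.smulRight_apply, LieModuleHom.comp_apply, LieSubmodule.incl_apply, toSoHom_apply]
    congr 1
    change tr1 (comp p q A) k = _
    rw [e', testArray, tr1_pure, Pi.smul_apply, smul_eq_mul, kron_comm k]
    ring

end BorelFrame

end CartanForm


section Identification

variable {V : Type*} [AddCommGroup V] [Module ℂ V] [FiniteDimensional ℂ V]
variable {S : Type*} [AddCommGroup S] [Module ℂ S]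
variable {g : LinearMap.BilinForm ℂ V} [Module (CliffordAlgebra (cliffordForm g)) S]
  [IsScalarTower ℂ (CliffordAlgebra (cliffordForm g)) S]
variable {hs : g.IsSymm} {hg : g.Nondegenerate} {ξ : S} {N' : Submodule ℂ V}
variable {m : ℕ} {p q : Fin m → V}

/-! ### The Borel subalgebra in a hyperbolic basis -/

theorem kron_rev (i j : Fin m) : kron i.rev j.rev = kron i j := by simp [kron]

theorem Hyp.rev (h : Hyp g p q) : Hyp g (fun i => p i.rev) fun i => q i.rev :=
  ⟨fun i j => h.pp _ _, fun i j => h.qq _ _, fun i j => by rw [h.pq, kron_rev],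
    fun i j => by rw [h.qp, kron_rev], fun v => by
      conv_lhs => rw [h.expand v]
      congr 1
      · exact (Equiv.sum_comp Fin.revPerm fun i => g (q i) v • p i).symm
      · exact (Equiv.sum_comp Fin.revPerm fun i => g (p i) v • q i).symm⟩

theorem forall_rev {P : Fin m → Prop} : (∀ i : Fin m, P i.rev) ↔ ∀ i, P i :=
  Fin.revPerm.forall_congr_left.symm.trans (by simp)

theorem Split.rev (h : Split g ξ N' p q) :
    Split g ξ N' (fun i => p i.rev) fun i => q i.rev :=
  { h.toHyp.rev with
    mem_iff := fun v => (h.mem_iff v).trans (forall_rev (P := fun i => g (p i) v = 0)).symm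
    right := fun v => (h.right v).trans (forall_rev (P := fun i => g (q i) v = 0)).symm }

variable {e : Basis (Fin m) ℂ (nullPlane g ξ)} (h : Split g ξ N' (fun i => (e i : V)) q)

include h in
theorem entry_of_mem_borel {X : levi g hs hg ξ N'} (hX : X ∈ borel g hs hg ξ N' e) {i k : Fin m}
    (hik : k < i) : g (q i) ⁅toSo X, (e k : V)⁆ = 0 := by
  have hX' : ⁅toSo X, (e k : V)⁆ ∈ Submodule.span ℂ ((fun j => (e j : V)) '' Set.Iic k) := hX k
  generalize ⁅toSo X, (e k : V)⁆ = v at hX' ⊢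
  induction hX' using Submodule.span_induction with
  | mem x hx =>
    obtain ⟨j, hj, rfl⟩ := hx
    rw [h.qp, kron_ne (lt_of_le_of_lt hj hik).ne']
  | zero => rw [map_zero]
  | add x y _ _ hx hy => rw [map_add, hx, hy, add_zero]
  | smul c x _ hx => rw [map_smul, hx, smul_zero]

include h in
theorem Split.borelFrame_pos :
    BorelFrame (borel g hs hg ξ N' e) q (fun i => (e i : V)) := by
  refine ⟨h.frame.swap, fun X hX i k hik => entry_of_mem_borel h hX hik, fun a c hac => ?_⟩
  obtain ⟨Y, hY⟩ := h.frame (hs := hs) (hg := hg) |>.exists_hop (h.pp · a) (h.qq · c)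
  refine ⟨Y, fun k => ?_, hY⟩
  change ⁅toSo Y, (e k : V)⁆ ∈ _
  rw [hY, hop_left hs h.toHyp (h.pp · a) (h.pp · k), h.qp]
  by_cases hck : c = k
  · exact Submodule.smul_mem _ _ (Submodule.subset_span ⟨a, hck ▸ hac, rfl⟩)
  · rw [kron_ne hck, zero_smul]; exact zero_mem _

include h in
-- On 𝔙_{-1/2} the Borel subalgebra acts by minus the transpose, that is by lower triangular
-- matrices; reversing the order of the basis makes them upper triangular.
theorem Split.borelFrame_neg : BorelFrame (borel g hs hg ξ N' e) (fun i => (e i.rev : V))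
    (fun i => q i.rev) := by
  refine ⟨h.rev.frame, fun X hX i k hik => ?_, fun a c hac => ?_⟩
  · rw [so_skew hs, entry_of_mem_borel h hX (Fin.rev_lt_rev.2 hik), neg_zero]
  obtain ⟨Y, hY⟩ := (h.frame (hs := hs) (hg := hg)).swap.exists_hop (h.qq · a.rev) (h.pp · c.rev)
  refine ⟨Y, fun k => ?_, hY⟩
  change ⁅toSo Y, (e k : V)⁆ ∈ _
  rw [hY, hop_right hs h.toHyp.swap (h.pp · c.rev) (h.pp · k), h.qp]
  by_cases hak : a.rev = k
  · exact neg_mem (Submodule.smul_mem _ _ (Submodule.subset_span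
      ⟨c.rev, hak ▸ Fin.rev_le_rev.2 hac, rfl⟩))
  · rw [kron_ne hak, zero_smul, neg_zero]; exact zero_mem _

/-! ### The graded pieces as Cartan products -/

omit [FiniteDimensional ℂ V] in
theorem Hyp.annihilates_iff (h : Hyp g p q) {P : V → Prop} (hP : ∀ v, P v ↔ ∀ i, g (p i) v = 0)
    (X : so g) : (∀ v, P v → ⁅X, v⁆ = 0) ↔ ∀ i, ⁅X, p i⁆ = 0 := by
  refine ⟨fun H i => H _ ((hP _).2 (h.pp · i)), fun H v hv => ?_⟩
  rw [h.expand_left ((hP v).1 hv), lie_sum]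
  simp [H]

/-- Exchanging the null spaces exchanges the two halves of the labels, so the statements proved for
the lower half also give the upper half. -/
theorem modC_swap (h : LeviFrame hs hg ξ N' p q) (h' : LeviFrame hs hg ξ N' q p) (κ : Kind) :
    modC h κ.neg = modC h' κ.pos := by
  ext A
  rw [mem_modC, mem_modC, modL_neg, modL_pos]

variable (hm : 3 ≤ m) (hV : finrank ℂ V = 2 * m) (hξ : ξ ≠ 0)
variable {F : Fin 5 → LieSubmodule ℂ (stabilizer g hs hg ξ) (CottonYork g hg)}
  {K : Label → LieSubmodule ℂ (stabilizer g hs hg ξ) (CottonYork g hg)} (hF : IsFiltration F K)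
include hm hV hξ hF h

theorem nonempty_grPart_pos_equiv {C : Type*} [AddCommGroup C] [Module ℂ C]
    [LieRingModule (levi g hs hg ξ N') C] [LieModule ℂ (levi g hs hg ξ N') C] {κ : Kind}
    (H : Nonempty (modC (h.borelFrame_pos (hs := hs) (hg := hg)).toLeviFrame κ.neg
      ≃ₗ⁅ℂ, levi g hs hg ξ N'⁆ C)) :
    Nonempty (grPart F κ.pos.pos (K κ.pos) ≃ₗ⁅ℂ, levi g hs hg ξ N'⁆ C) := by
  rw [modC_swap _ h.frame] at H
  exact H.map fun f => (grEquiv hm hV hξ h hF κ.pos).symm.trans f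

theorem nonempty_grPart_neg_equiv {C : Type*} [AddCommGroup C] [Module ℂ C]
    [LieRingModule (levi g hs hg ξ N') C] [LieModule ℂ (levi g hs hg ξ N') C] {κ : Kind}
    (H : Nonempty (modC (h.borelFrame_neg (hs := hs) (hg := hg)).toLeviFrame κ.neg
      ≃ₗ⁅ℂ, levi g hs hg ξ N'⁆ C)) :
    Nonempty (grPart F κ.neg.pos (K κ.neg) ≃ₗ⁅ℂ, levi g hs hg ξ N'⁆ C) :=
  H.map fun f => (grEquiv hm hV hξ h.rev hF κ.neg).symm.trans f

theorem grPart_equiv_cartanProduct :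
    Nonempty (grPart F 3 (K .p3_0) ≃ₗ⁅ℂ, levi g hs hg ξ N'⁆
      cartanProduct (borel g hs hg ξ N' e) (vPos g hs hg ξ N') (gPos g hs hg ξ N')) ∧
    Nonempty (grPart F 0 (K .m3_0) ≃ₗ⁅ℂ, levi g hs hg ξ N'⁆
      cartanProduct (borel g hs hg ξ N' e) (vNeg g hs hg ξ N') (gNeg g hs hg ξ N')) ∧
    Nonempty (grPart F 2 (K .p1_0) ≃ₗ⁅ℂ, levi g hs hg ξ N'⁆
      cartanProduct (borel g hs hg ξ N' e) (vPos g hs hg ξ N') (zZero g hs hg ξ N')) ∧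
    Nonempty (grPart F 1 (K .m1_0) ≃ₗ⁅ℂ, levi g hs hg ξ N'⁆
      cartanProduct (borel g hs hg ξ N' e) (vNeg g hs hg ξ N') (zZero g hs hg ξ N')) ∧
    Nonempty (grPart F 2 (K .p1_1) ≃ₗ⁅ℂ, levi g hs hg ξ N'⁆
      cartanProduct (borel g hs hg ξ N' e) (vNeg g hs hg ξ N') (gPos g hs hg ξ N')) ∧
    Nonempty (grPart F 1 (K .m1_1) ≃ₗ⁅ℂ, levi g hs hg ξ N'⁆
      cartanProduct (borel g hs hg ξ N' e) (vPos g hs hg ξ N') (gNeg g hs hg ξ N')) ∧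
    Nonempty (grPart F 2 (K .p1_2) ≃ₗ⁅ℂ, levi g hs hg ξ N'⁆
      cartanProduct (borel g hs hg ξ N' e) (vPos g hs hg ξ N') (slZero g hs hg ξ N')) ∧
    Nonempty (grPart F 1 (K .m1_2) ≃ₗ⁅ℂ, levi g hs hg ξ N'⁆
      cartanProduct (borel g hs hg ξ N' e) (vNeg g hs hg ξ N') (slZero g hs hg ξ N')) := by
  have pos := h.borelFrame_pos (hs := hs) (hg := hg)
  have neg := h.borelFrame_neg (hs := hs) (hg := hg)
  have vp : ∀ v, v ∈ vPos g hs hg ξ N' ↔ ∀ i, g (e i) v = 0 := h.mem_iff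
  have vn : ∀ v, v ∈ vNeg g hs hg ξ N' ↔ ∀ i, g (q i) v = 0 := h.right
  have vp' : ∀ v, v ∈ vPos g hs hg ξ N' ↔ ∀ i : Fin m, g (e i.rev) v = 0 := h.rev.mem_iff
  have vn' : ∀ v, v ∈ vNeg g hs hg ξ N' ↔ ∀ i : Fin m, g (q i.rev) v = 0 := h.rev.right
  have gp : ∀ X, X ∈ gPos g hs hg ξ N' ↔ ∀ i, ⁅X, (e i : V)⁆ = 0 :=
    h.toHyp.annihilates_iff h.mem_iff
  have gn : ∀ X, X ∈ gNeg g hs hg ξ N' ↔ ∀ i : Fin m, ⁅X, q i.rev⁆ = 0 :=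
    h.rev.toHyp.swap.annihilates_iff h.rev.right
  exact ⟨nonempty_grPart_pos_equiv h hm hV hξ hF (κ := .hook) (pos.nonempty_equiv_hook hm vp gp),
    nonempty_grPart_neg_equiv h hm hV hξ hF (κ := .hook) (neg.nonempty_equiv_hook hm vn' gn),
    nonempty_grPart_pos_equiv h hm hV hξ hF (κ := .trace) (pos.nonempty_equiv_trace hm vp),
    nonempty_grPart_neg_equiv h hm hV hξ hF (κ := .trace) (neg.nonempty_equiv_trace hm vn'),
    nonempty_grPart_pos_equiv h hm hV hξ hF (κ := .alt) (pos.nonempty_equiv_alt hm vn gp),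
    nonempty_grPart_neg_equiv h hm hV hξ hF (κ := .alt) (neg.nonempty_equiv_alt hm vp' gn),
    nonempty_grPart_pos_equiv h hm hV hξ hF (κ := .sym) (pos.nonempty_equiv_sym hm vp),
    nonempty_grPart_neg_equiv h hm hV hξ hF (κ := .sym) (neg.nonempty_equiv_sym hm vn')⟩

end Identification

end PureSpinor

end

/-! ### Assembly of the theorem -/

set_option maxHeartbeats 2000000 in
open PureSpinor in
theorem mainTheorem2
    {V : Type*} [AddCommGroup V] [Module ℂ V] [FiniteDimensional ℂ V]
    (g : LinearMap.BilinForm ℂ V) (hs : g.IsSymm) (hg : g.Nondegenerate)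
    {S : Type*} [AddCommGroup S] [Module ℂ S] [Module (CliffordAlgebra (cliffordForm g)) S]
    [IsScalarTower ℂ (CliffordAlgebra (cliffordForm g)) S]
    (m : ℕ) (hm : 3 ≤ m) (hV : Module.finrank ℂ V = 2 * m) (hS : Module.finrank ℂ S = 2 ^ m)
    (ξ : S) (hξ : IsPure g ξ) :
    ∃ (F : Fin 5 → LieSubmodule ℂ (stabilizer g hs hg ξ) (CottonYork g hg))
      (K : Label → LieSubmodule ℂ (stabilizer g hs hg ξ) (CottonYork g hg)),
      -- the filtration by kernels; `F 0, …, F 4` are `𝔄^{-3/2}, …, 𝔄^{5/2}`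
      F 0 = ⊤ ∧ F 4 = ⊥ ∧ StrictAnti F ∧
      (∀ (k : Fin 4) (A : CottonYork g hg),
        A ∈ F k.succ ↔ ∀ x : Label, x.pos = k → PiVanishes g hg ξ x A.form) ∧
      -- the modules `𝔄_i^j` are `K (i, j) / 𝔄^{i+1}`
      (∀ (x : Label) (A : CottonYork g hg),
        A ∈ K x ↔ A ∈ F x.pos.castSucc ∧
          ∀ y : Label, y.pos = x.pos → y ≠ x → PiVanishes g hg ξ y A.form) ∧
      -- each graded piece is the direct sum of the `𝔄_i^j`
      (∀ k : Fin 4,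
        iSupIndep (fun x : {x : Label // x.pos = k} => grPart F k (K x)) ∧
          ⨆ x : {x : Label // x.pos = k}, grPart F k (K x) = ⊤) ∧
      -- the `𝔄_i^j` are irreducible, of the stated dimensions
      (∀ x : Label,
        LieModule.IsIrreducible ℂ (stabilizer g hs hg ξ) (grPart F x.pos (K x)) ∧
          (Module.finrank ℂ (grPart F x.pos (K x)) : ℚ) = x.dim m) ∧
      -- for every splitting of `V` by a totally null complement of `𝔙_{1/2}`
      ∀ N' : Submodule ℂ V, IsCompl (nullPlane g ξ) N' → (∀ u ∈ N', ∀ v ∈ N', g u v = 0) →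
        -- the grading element acts on the graded pieces by `-3/2, -1/2, 1/2, 3/2`
        (∃ E : levi g hs hg ξ N',
          (∀ v ∈ nullPlane g ξ, ⁅E, v⁆ = (1 / 2 : ℂ) • v) ∧
          (∀ v ∈ N', ⁅E, v⁆ = (-(1 / 2) : ℂ) • v) ∧
          ∀ (k : Fin 4) (y : gr F k), ⁅E, y⁆ = (((k : ℕ) : ℂ) - 3 / 2) • y) ∧
        -- the `𝔄_i^j` are irreducible over `𝔤₀` and identified with Cartan products
        (∀ x : Label, LieModule.IsIrreducible ℂ (levi g hs hg ξ N') (grPart F x.pos (K x))) ∧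
        (∀ e : Module.Basis (Fin m) ℂ (nullPlane g ξ),
          Nonempty (grPart F 3 (K .p3_0) ≃ₗ⁅ℂ, levi g hs hg ξ N'⁆
            cartanProduct (borel g hs hg ξ N' e) (vPos g hs hg ξ N') (gPos g hs hg ξ N')) ∧
          Nonempty (grPart F 0 (K .m3_0) ≃ₗ⁅ℂ, levi g hs hg ξ N'⁆
            cartanProduct (borel g hs hg ξ N' e) (vNeg g hs hg ξ N') (gNeg g hs hg ξ N')) ∧
          Nonempty (grPart F 2 (K .p1_0) ≃ₗ⁅ℂ, levi g hs hg ξ N'⁆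
            cartanProduct (borel g hs hg ξ N' e) (vPos g hs hg ξ N') (zZero g hs hg ξ N')) ∧
          Nonempty (grPart F 1 (K .m1_0) ≃ₗ⁅ℂ, levi g hs hg ξ N'⁆
            cartanProduct (borel g hs hg ξ N' e) (vNeg g hs hg ξ N') (zZero g hs hg ξ N')) ∧
          Nonempty (grPart F 2 (K .p1_1) ≃ₗ⁅ℂ, levi g hs hg ξ N'⁆
            cartanProduct (borel g hs hg ξ N' e) (vNeg g hs hg ξ N') (gPos g hs hg ξ N')) ∧
          Nonempty (grPart F 1 (K .m1_1) ≃ₗ⁅ℂ, levi g hs hg ξ N'⁆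
            cartanProduct (borel g hs hg ξ N' e) (vPos g hs hg ξ N') (gNeg g hs hg ξ N')) ∧
          Nonempty (grPart F 2 (K .p1_2) ≃ₗ⁅ℂ, levi g hs hg ξ N'⁆
            cartanProduct (borel g hs hg ξ N' e) (vPos g hs hg ξ N') (slZero g hs hg ξ N')) ∧
          Nonempty (grPart F 1 (K .m1_2) ≃ₗ⁅ℂ, levi g hs hg ξ N'⁆
            cartanProduct (borel g hs hg ξ N' e) (vNeg g hs hg ξ N') (slZero g hs hg ξ N'))) ∧
        -- representatives of the `𝔄_i^j` inside `𝔄` exist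
        (∀ x : Label, ∃ M : LieSubmodule ℂ (levi g hs hg ξ N') (CottonYork g hg),
          Nonempty (M ≃ₗ⁅ℂ, levi g hs hg ξ N'⁆ grPart F x.pos (K x))) ∧
        -- and an arrow from `x` to `y` says that the representative of `x` lies in `𝔤₁ · ` that
        -- of `y`
        (∀ x y : Label, Label.Arrow x y →
          ∀ M M' : LieSubmodule ℂ (levi g hs hg ξ N') (CottonYork g hg),
            Nonempty (M ≃ₗ⁅ℂ, levi g hs hg ξ N'⁆ grPart F x.pos (K x)) →
            Nonempty (M' ≃ₗ⁅ℂ, levi g hs hg ξ N'⁆ grPart F y.pos (K y)) →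
            ∀ B ∈ M, B ∈ Submodule.span ℂ
              {C | ∃ X ∈ gPos g hs hg ξ N', ∃ A ∈ M', C = ⁅X, A⁆}) := by
  obtain ⟨p, q, h⟩ := exists_adapted hs hg hξ hV
  obtain ⟨F, K, hF⟩ := exists_isFiltration (hs := hs) (hg := hg) hm hV hξ.1 h
  -- Irreducibility over 𝔭 and the dimensions do not involve a splitting, but their proofs use one;
  -- the span of `q` serves as an auxiliary complement.
  have h₀ : Split g ξ (Submodule.span ℂ (Set.range q)) p q :=
    { h with right := fun v => h.toHyp.swap.mem_span }
  refine ⟨F, K, hF.zero, hF.last hm hV hξ.1 h, hF.strictAnti hm hV hξ.1 h, hF.mem_succ, hF.mem_K,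
    fun k => ⟨iSupIndep_grPart hm hV hξ.1 h hF k, iSup_grPart hm hV hξ.1 h hF k⟩,
    fun x => ⟨grPart_irreducible' hm hV hξ.1 h₀ hF x, finrank_grPart hm hV hξ.1 h₀ hF x⟩,
    fun N' hc hN' => ?_⟩
  -- The given basis of the null plane must be kept, since it determines the Borel subalgebra.
  have split : ∀ e : Module.Basis (Fin m) ℂ (nullPlane g ξ),
      ∃ r, Split g ξ N' (fun i => (e i : V)) r := fun e => by
    obtain ⟨r, h1, h2⟩ := exists_adapted_compl hs hg hξ hV hc hN' e
    exact ⟨r, { h1 with right := h2 }⟩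
  obtain ⟨r, h'⟩ := split (Module.finBasisOfFinrankEq ℂ _ (by have := hξ.2; omega))
  obtain ⟨E, hE, hE'⟩ := exists_grading hs hg h'
  refine ⟨⟨E, hE, hE', fun k y => gr_grading hm hV hξ.1 h' hF hE k y⟩,
    fun x => grPart_irreducible hm hV hξ.1 h' hF x, fun e => ?_,
    fun x => ⟨modC h'.frame x, ⟨grEquiv hm hV hξ.1 h' hF x⟩⟩, fun x y hxy M M' hM hM' B hB => ?_⟩
  · obtain ⟨r, hr⟩ := split e
    exact grPart_equiv_cartanProduct hr hm hV hξ.1 hF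
  · obtain ⟨e⟩ := hM
    obtain ⟨e'⟩ := hM'
    -- By multiplicity one, `M` and `M'` are the standard submodules, to which the test tensors
    -- belong.
    rw [eq_modC hm h' (e.trans (grEquiv hm hV hξ.1 h' hF x).symm)] at hB
    have hM' := eq_modC hm h' (e'.trans (grEquiv hm hV hξ.1 h' hF y).symm)
    obtain ⟨a, c, A, hA, hne⟩ := exists_raise (hg := hg) hs hm h'.toHyp hxy
    refine le_gPosSpan hm h' (M := M') (X := hop g hs _ _) ?_
      (A := .mk A (mem_modL.1 hA).1) (hM' ▸ hA) hne hB
    intro v hv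
    rw [hop_lie, (h'.mem_iff v).1 hv, (h'.mem_iff v).1 hv, zero_smul, zero_smul, sub_zero]
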